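/- Let $\mathcal X$ be a unitary fusion category with its canonical unitary spherical structure, $\mathcal A$ a unitary braided fusion category, and $\Phi^Z:\mathcal A\to Z(\mathcal X)$ a fully faithful unitary braided functor; write $\Phi:\mathcal A\to\mathcal X$ for its composite with the forgetful functor. Let $d$ denote quantum dimension and $D_{\mathcal X}=\sum_{x\in\operatorname{Irr}(\mathcal X)}d_x^2$. Consider the string net model on a finite box of the cubic lattice with bulk vertices carrying $\mathcal A$ and one boundary layer (a rectangular grid) carrying $\mathcal X$. A bulk vertex carries the Hilbert space $\bigoplus \mathcal A(a_1b_1c_1\to c_2b_2a_2)$, and a boundary vertex carries $\bigoplus\mathcal X(\Phi(a)\,x_1y_1\to y_2x_2)$ (sums over simple labels), with inner product $\langle f|g\rangle=w^{-1/2}\operatorname{tr}(f^\dagger g)$ on each summand, where $w$ is the product of the quantum dimensions of the labels; here $a$ is the label of the edge into the bulk, $x_1,y_1$ those of the left and lower edges, and $y_2,x_2$ those of the upper and right edges. The total Hilbert space $\mathcal H_{\rm tot}$ is the tensor product over all vertices, and $P_A\mathcal H_{\rm tot}$ is the common range of the projectors $A_\ell$ requiring the labels on the two halves of the edge $\ell$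 to agree. For a plaquette $p$ of the boundary layer, $B_p=\frac1{D_{\mathcal X}}\sum_{r\in\operatorname{Irr}(\mathcal X)}d_r\cdot(\text{insert a loop labelled } r \text{ in } p)$, where the loop runs over the $\mathcal A$-strings and is fused into the four edges of $p$: if their labels change from $g,h,i,j$ (bottom, right, top, left) to $k,\ell,m,n$, the corresponding term is $$\frac{1}{D_{\mathcal X}}\,\frac{\sqrt{d_kd_\ell d_md_n}}{d_r\sqrt{d_gd_hd_id_j}}$$ times the sum over pairs of dual trivalent vertices (an orthonormal basis of the trivalent skein module and its dagger) on each edge. Fix orthonormal bases of all the summands. Let $\xi$ and $\eta$ range over the resulting simple tensors of basis vectors whose edge labels match, so that they form a basis of $P_A\mathcal H_{\rm tot}$. Then $B_p\,\xi=\sum_\eta C(\xi,\eta)\,\eta$, with coefficients as follows. Write $\xi_{1,1},\xi_{2,1},\xi_{1,2},\xi_{2,2}$ for the vectors at the lower left, lower right, upper left and upper right corner of $p$. (1) Suppose that $\xi$ and $\eta$ agree at all vertices other than the corners of $p$, and that all external labels of $p$ match: the labels $a,b,c,d\in\operatorname{Irr}(\mathcal A)$ of the edges from the corners $(1,1),(2,1),(2,2),(1,2)$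 into the bulk, and the labels $s,t,u,v,w,x,y,z\in\operatorname{Irr}(\mathcal X)$ of the eight remaining external edges. Then $$C(\xi,\eta)=\frac{1}{D_{\mathcal X}\sqrt{d_ad_bd_cd_d\,d_sd_td_ud_vd_wd_xd_yd_z}}\cdot\operatorname{tr}\bigl(\operatorname{eval}(\eta)^\dagger\circ\operatorname{eval}(\xi)\bigr),$$ where $\operatorname{eval}(\xi)$ is the element of the enriched disk skein module with $4$ $\mathcal A$-boundary points and $8$ $\mathcal X$-boundary points obtained by gluing the four corners of $\xi$ along the edges $g,h,i,j$, with the $\mathcal A$-strings running behind the $\mathcal X$-strings. The trace also equals the value of the closed planar diagram that consists of the inner square with corners $\xi_{1,1},\xi_{2,1},\xi_{2,2},\xi_{1,2}$ and edges $g,h,i,j$, the outer square with corners $\eta_{1,1}^\dagger,\eta_{2,1}^\dagger,\eta_{2,2}^\dagger,\eta_{1,2}^\dagger$ and edges $k,\ell,m,n$, and the strings $a,b,c,d,s,\dots,z$ joining corresponding corners, in which the string $b$ passes under $g$ and $k$ and there are no other crossings. (2) Otherwise, $C(\xi,\eta)=0$. In particular, every boundary plaquette operator $B_p$ preserves $P_A\mathcal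 H_{\rm tot}$ and restricts there to a self-adjoint (orthogonal) projection, and the operators $B_p$, $B_q$ for any two boundary plaquettes commute on $P_A\mathcal H_{\rm tot}$. -/

import Mathlib

open CategoryTheory MonoidalCategory
open scoped TensorProduct ComplexConjugate

set_option linter.unusedSectionVars false

universe v u v₁ u₁ v₂ u₂ w₁ w₂

noncomputable section

namespace EnrichedStringNet

/-! ### Unitary fusion categories -/

section UFC

/-- The set `Irr(C)` of isomorphism classes of simple objects. -/
def Irr (C : Type u) [Category.{v} C] [Limits.HasZeroMorphisms C] : Type u :=
  Quotient ((isIsomorphicSetoid C).comap (fun x : {x : C // Simple x} => x.1))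

/-- A chosen simple object in the given isomorphism class. -/
def Irr.obj {C : Type u} [Category.{v} C] [Limits.HasZeroMorphisms C] (i : Irr C) : C :=
  (Quotient.out i).1

/-- A unitary fusion category equipped with its canonical unitary spherical structure.
The underlying category is a `ℂ`-linear abelian monoidal category with a chosen dual `xᘁ` of
every object; `dag` is the dagger. The axioms say that `dag` is a conjugate-linear involution
compatible with the tensor product, that the category is a C*-category
(`dag_definite`, `dag_positive`), that the hom spaces are finite dimensional, that the unit is
simple, that there are finitely many simple objects, and that the chosen duals are unitary and
spherical, i.e. left and right traces of each endomorphism agree when cups are daggers of caps.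
(Semisimplicity follows from the C*-axioms.) -/
class UnitaryFusionCategory (C : Type u) [Category.{v} C] [Abelian C] [Linear ℂ C]
    [MonoidalCategory C] [MonoidalPreadditive C] [MonoidalLinear ℂ C] [RightRigidCategory C] where
  dag : ∀ {x y : C}, (x ⟶ y) → (y ⟶ x)
  dag_id : ∀ x : C, dag (𝟙 x) = 𝟙 x
  dag_comp : ∀ {x y z : C} (f : x ⟶ y) (g : y ⟶ z), dag (f ≫ g) = dag g ≫ dag f
  dag_dag : ∀ {x y : C} (f : x ⟶ y), dag (dag f) = f
  dag_add : ∀ {x y : C} (f g : x ⟶ y), dag (f + g) = dag f + dag g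
  dag_smul : ∀ {x y : C} (c : ℂ) (f : x ⟶ y), dag (c • f) = conj c • dag f
  dag_whiskerLeft : ∀ (z : C) {x y : C} (f : x ⟶ y), dag (z ◁ f) = z ◁ dag f
  dag_whiskerRight : ∀ {x y : C} (f : x ⟶ y) (z : C), dag (f ▷ z) = dag f ▷ z
  dag_associator : ∀ x y z : C, dag (α_ x y z).hom = (α_ x y z).inv
  dag_leftUnitor : ∀ x : C, dag (λ_ x).hom = (λ_ x).inv
  dag_rightUnitor : ∀ x : C, dag (ρ_ x).hom = (ρ_ x).inv
  dag_definite : ∀ {x y : C} (f : x ⟶ y), f ≫ dag f = 0 → f = 0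
  dag_positive : ∀ {x y : C} (f : x ⟶ y), ∃ g : x ⟶ x, f ≫ dag f = g ≫ dag g
  finiteDimensional_hom : ∀ x y : C, FiniteDimensional ℂ (x ⟶ y)
  simple_unit : Simple (𝟙_ C)
  finite_irr : Finite (Irr C)
  spherical : ∀ {x : C} (f : x ⟶ x),
    η_ x xᘁ ≫ f ▷ xᘁ ≫ dag (η_ x xᘁ) = dag (ε_ x xᘁ) ≫ xᘁ ◁ f ≫ ε_ x xᘁ

open UnitaryFusionCategory

variable {C : Type u} [Category.{v} C] [Abelian C] [Linear ℂ C] [MonoidalCategory C]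
  [MonoidalPreadditive C] [MonoidalLinear ℂ C] [RightRigidCategory C] [UnitaryFusionCategory C]

attribute [instance] UnitaryFusionCategory.finiteDimensional_hom
  UnitaryFusionCategory.simple_unit UnitaryFusionCategory.finite_irr

instance : Fintype (Irr C) := Fintype.ofFinite _
instance : DecidableEq (Irr C) := Classical.decEq _

/-- The number `c` with `f = c • 𝟙`, for an endomorphism `f` of the unit. -/
def scalar (f : 𝟙_ C ⟶ 𝟙_ C) : ℂ := (endomorphism_simple_eq_smul_id ℂ f).choose

/-- The categorical trace of an endomorphism. -/
def tr {x : C} (f : x ⟶ x) : ℂ := scalar (η_ x xᘁ ≫ f ▷ xᘁ ≫ dag (η_ x xᘁ))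

/-- The quantum dimension of an object. -/
def qdim (x : C) : ℝ := (tr (𝟙 x)).re

lemma scalar_spec (f : 𝟙_ C ⟶ 𝟙_ C) : scalar f • 𝟙 (𝟙_ C) = f :=
  (endomorphism_simple_eq_smul_id ℂ f).choose_spec

lemma scalar_unique {f : 𝟙_ C ⟶ 𝟙_ C} {c : ℂ} (h : f = c • 𝟙 (𝟙_ C)) : scalar f = c := by
  have h1 := scalar_spec f
  have h2 : (scalar f - c) • 𝟙 (𝟙_ C) = 0 := by
    rw [sub_smul, h1, ← h, sub_self]
  rcases smul_eq_zero.1 h2 with h3 | h3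
  · exact sub_eq_zero.1 h3
  · exact absurd h3 (id_nonzero _)

lemma scalar_add (f g : 𝟙_ C ⟶ 𝟙_ C) : scalar (f + g) = scalar f + scalar g :=
  scalar_unique (by rw [add_smul, scalar_spec, scalar_spec])

lemma scalar_smul (c : ℂ) (f : 𝟙_ C ⟶ 𝟙_ C) : scalar (c • f) = c * scalar f :=
  scalar_unique (by rw [mul_smul, scalar_spec])

lemma scalar_dag (f : 𝟙_ C ⟶ 𝟙_ C) : scalar (dag f) = conj (scalar f) :=
  scalar_unique (by
    conv_lhs => rw [← scalar_spec f]
    rw [dag_smul, dag_id])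

lemma exists_scalar_comp_dag {y : C} (h : 𝟙_ C ⟶ y) :
    ∃ c : ℂ, scalar (h ≫ dag h) = c * conj c := by
  obtain ⟨g, hg⟩ := dag_positive h
  refine ⟨scalar g, scalar_unique ?_⟩
  rw [hg]
  conv_lhs => rw [← scalar_spec g]
  rw [dag_smul, dag_id, Linear.smul_comp, Linear.comp_smul, Category.comp_id, smul_smul]

lemma tr_add {x : C} (f g : x ⟶ x) : tr (f + g) = tr f + tr g := by
  simp only [tr, MonoidalPreadditive.add_whiskerRight, Preadditive.add_comp,
    Preadditive.comp_add, scalar_add]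

lemma tr_smul {x : C} (c : ℂ) (f : x ⟶ x) : tr (c • f) = c * tr f := by
  simp only [tr, MonoidalLinear.smul_whiskerRight, Linear.smul_comp, Linear.comp_smul,
    scalar_smul]

lemma tr_dag {x : C} (f : x ⟶ x) : tr (dag f) = conj (tr f) := by
  rw [tr, tr, ← scalar_dag]
  simp only [dag_comp, dag_dag, dag_whiskerRight, Category.assoc]

lemma tr_comp_dag_eq {x y : C} (f : x ⟶ y) :
    tr (f ≫ dag f) = scalar ((η_ x xᘁ ≫ f ▷ xᘁ) ≫ dag (η_ x xᘁ ≫ f ▷ xᘁ)) := by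
  simp only [tr, dag_comp, dag_whiskerRight, Category.assoc, comp_whiskerRight]

lemma exists_tr_comp_dag {x y : C} (f : x ⟶ y) : ∃ c : ℂ, tr (f ≫ dag f) = c * conj c := by
  rw [tr_comp_dag_eq]
  exact exists_scalar_comp_dag _

lemma tr_comp_dag_re_nonneg {x y : C} (f : x ⟶ y) : 0 ≤ (tr (f ≫ dag f)).re := by
  obtain ⟨c, hc⟩ := exists_tr_comp_dag f
  rw [hc, Complex.mul_conj, Complex.ofReal_re]
  exact Complex.normSq_nonneg c

lemma eq_zero_of_coev {x y : C} (f : x ⟶ y) (h : η_ x xᘁ ≫ f ▷ xᘁ = 0) : f = 0 := by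
  have h1 : (η_ x xᘁ ▷ x ≫ (α_ _ _ _).hom ≫ x ◁ ε_ x xᘁ) ≫ f ▷ 𝟙_ C = 0 := by
    have h2 : x ◁ ε_ x xᘁ ≫ f ▷ 𝟙_ C = f ▷ (xᘁ ⊗ x) ≫ y ◁ ε_ x xᘁ := whisker_exchange _ _
    have h3 : (α_ x xᘁ x).hom ≫ f ▷ (xᘁ ⊗ x) = f ▷ xᘁ ▷ x ≫ (α_ y xᘁ x).hom := by simp
    rw [Category.assoc, Category.assoc, h2, reassoc_of% h3, ← comp_whiskerRight_assoc, h,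
      MonoidalPreadditive.zero_whiskerRight, Limits.zero_comp]
  rw [ExactPairing.evaluation_coevaluation] at h1
  have h4 : (ρ_ x).inv ≫ f ▷ 𝟙_ C = f ≫ (ρ_ y).inv := by simp
  rw [Category.assoc, h4] at h1
  simpa using h1

lemma tr_comp_dag_definite {x y : C} (f : x ⟶ y) (h : tr (f ≫ dag f) = 0) : f = 0 := by
  rw [tr_comp_dag_eq] at h
  refine eq_zero_of_coev f (dag_definite _ ?_)
  rw [← scalar_spec (_ ≫ dag _), h, zero_smul]

instance (i : Irr C) : Simple i.obj := (Quotient.out i).2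

lemma qdim_pos (i : Irr C) : 0 < qdim i.obj := by
  have h1 : 𝟙 i.obj = 𝟙 i.obj ≫ dag (𝟙 i.obj) := by rw [dag_id, Category.comp_id]
  obtain ⟨c, hc⟩ := exists_tr_comp_dag (𝟙 i.obj)
  have h2 : c ≠ 0 := by
    rintro rfl
    exact id_nonzero i.obj (tr_comp_dag_definite _ (by simpa using hc))
  rw [qdim, h1, hc, Complex.mul_conj, Complex.ofReal_re]
  exact Complex.normSq_pos.2 h2

/-- The quantum dimension `d_i` of a simple object, as a positive real number. -/
def Irr.d (i : Irr C) : {r : ℝ // 0 < r} := ⟨qdim i.obj, qdim_pos i⟩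

/-- The global dimension `D_C = ∑ d_x²`. -/
def globalDim (C : Type u) [Category.{v} C] [Abelian C] [Linear ℂ C] [MonoidalCategory C]
    [MonoidalPreadditive C] [MonoidalLinear ℂ C] [RightRigidCategory C]
    [UnitaryFusionCategory C] : ℝ := ∑ i : Irr C, (i.d : ℝ) ^ 2

/-- The morphism `i ⟶ j` between simple objects that is the identity if `i = j` and `0` if
`i ≠ j`. -/
def Irr.δ (i j : Irr C) : i.obj ⟶ j.obj :=
  if h : i = j then eqToHom (congrArg Irr.obj h) else 0

/-- The hom space `C(x → y)` with the inner product
`⟨f | g⟩ = w^{-1/2} tr (f† ∘ g)`; in applications `w` is the product of the quantum dimensions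
of the simple objects on the boundary. -/
def SkeinHom (_w : {r : ℝ // 0 < r}) (x y : C) : Type v := x ⟶ y

namespace SkeinHom

variable (w : {r : ℝ // 0 < r}) (x y : C)

instance : AddCommGroup (SkeinHom w x y) := inferInstanceAs (AddCommGroup (x ⟶ y))
instance : Module ℂ (SkeinHom w x y) := inferInstanceAs (Module ℂ (x ⟶ y))
instance : FiniteDimensional ℂ (SkeinHom w x y) :=
  inferInstanceAs (FiniteDimensional ℂ (x ⟶ y))

variable {w x y}

/-- The underlying morphism. -/
def hom (f : SkeinHom w x y) : x ⟶ y := f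

lemma hom_add (f g : SkeinHom w x y) : (f + g).hom = f.hom + g.hom := rfl
lemma hom_smul (c : ℂ) (f : SkeinHom w x y) : (c • f).hom = c • f.hom := rfl

variable (w x y)

/-- The skein module inner product. -/
abbrev core : InnerProductSpace.Core ℂ (SkeinHom w x y) where
  inner f g := ((1 / √(w : ℝ) : ℝ) : ℂ) * tr (g.hom ≫ dag f.hom)
  conj_inner_symm f g := by
    rw [map_mul, Complex.conj_ofReal, ← tr_dag, dag_comp, dag_dag]
  re_inner_nonneg f := by
    simp only [RCLike.re_to_complex, Complex.re_ofReal_mul]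
    exact mul_nonneg (by positivity) (tr_comp_dag_re_nonneg _)
  add_left f g h := by
    simp only [hom_add, dag_add, Preadditive.comp_add, tr_add, mul_add]
  smul_left f g c := by
    simp only [hom_smul, dag_smul, Linear.comp_smul, tr_smul]
    ring
  definite f h := by
    have hw : ((1 / √(w : ℝ) : ℝ) : ℂ) ≠ 0 :=
      Complex.ofReal_ne_zero.2 (one_div_pos.2 (Real.sqrt_pos.2 w.2)).ne'
    exact tr_comp_dag_definite f.hom ((mul_eq_zero.1 h).resolve_left hw)

instance : NormedAddCommGroup (SkeinHom w x y) :=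
  @InnerProductSpace.Core.toNormedAddCommGroup ℂ _ _ _ _ (core w x y)

instance : InnerProductSpace ℂ (SkeinHom w x y) := InnerProductSpace.ofCore (core w x y).toCore

lemma inner_def (f g : SkeinHom w x y) :
    inner ℂ f g = ((1 / √(w : ℝ) : ℝ) : ℂ) * tr (g.hom ≫ dag f.hom) := rfl

end SkeinHom

end UFC

/-- A unitary braided fusion category: the braiding of a unitary fusion category is unitary. -/
class UnitaryBraided (A : Type u) [Category.{v} A] [Abelian A] [Linear ℂ A]
    [MonoidalCategory A] [MonoidalPreadditive A] [MonoidalLinear ℂ A] [RightRigidCategory A]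
    [UnitaryFusionCategory A] [BraidedCategory A] : Prop where
  dag_braiding : ∀ x y : A,
    UnitaryFusionCategory.dag (β_ x y).hom = (β_ x y).inv

open UnitaryFusionCategory

section Enriched

variable (A : Type u₁) [Category.{v₁} A] [Abelian A] [Linear ℂ A] [MonoidalCategory A]
  [MonoidalPreadditive A] [MonoidalLinear ℂ A] [RightRigidCategory A] [UnitaryFusionCategory A]
  (X : Type u₂) [Category.{v₂} X] [Abelian X] [Linear ℂ X] [MonoidalCategory X]
  [MonoidalPreadditive X] [MonoidalLinear ℂ X] [RightRigidCategory X] [UnitaryFusionCategory X]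

/-- An `A`-enrichment of `X`: a fully faithful unitary braided functor `Φ^Z` from `A` to the
Drinfeld center of `X` (taking values in the unitary Drinfeld center, i.e. with unitary
half-braidings). -/
structure Enrichment [BraidedCategory A] where
  toCenter : A ⥤ Center X
  [braided : toCenter.Braided]
  [full : toCenter.Full]
  [faithful : toCenter.Faithful]
  map_add : ∀ {a b : A} (f g : a ⟶ b),
    (toCenter.map (f + g)).f = (toCenter.map f).f + (toCenter.map g).f
  map_smul : ∀ {a b : A} (c : ℂ) (f : a ⟶ b),
    (toCenter.map (c • f)).f = c • (toCenter.map f).f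
  map_dag : ∀ {a b : A} (f : a ⟶ b), (toCenter.map (dag f)).f = dag (toCenter.map f).f
  dag_halfBraiding : ∀ (a : A) (x : X),
    dag ((toCenter.obj a).2.β x).hom = ((toCenter.obj a).2.β x).inv
  dag_μ : ∀ a b : A, dag (Functor.LaxMonoidal.μ toCenter a b).f =
    (Functor.OplaxMonoidal.δ toCenter a b).f
  dag_ε : dag (Functor.LaxMonoidal.ε toCenter).f = (Functor.OplaxMonoidal.η toCenter).f

variable {A X} [BraidedCategory A]

namespace Enrichment

variable (Φ : Enrichment A X)

/-- The composite `Φ = F ∘ Φ^Z : A → X` on simple objects. -/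
def obj (a : Irr A) : X := (Φ.toCenter.obj a.obj).1

/-- The half-braiding `Φ(a) ⊗ x ≅ x ⊗ Φ(a)`: the `A`-string passes under the `X`-string. -/
def half (a : Irr A) (x : X) : Φ.obj a ⊗ x ≅ x ⊗ Φ.obj a := (Φ.toCenter.obj a.obj).2.β x

/-- The image under `Φ` of `Irr.δ`. -/
def δ (a b : Irr A) : Φ.obj a ⟶ Φ.obj b := (Φ.toCenter.map (Irr.δ a b)).f

end Enrichment

/-! ### Local Hilbert spaces -/

variable (A X)

/-- Labels of the five edges at a boundary vertex: the edge `a` to the bulk, the incoming edges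
`x₁` (from the left) and `y₁` (from below), and the outgoing edges `y₂` (up) and `x₂` (to the
right). -/
@[ext] structure XLabel where
  a : Irr A
  x₁ : Irr X
  y₁ : Irr X
  y₂ : Irr X
  x₂ : Irr X

/-- Labels of the six edges at a bulk vertex. -/
@[ext] structure ALabel where
  a₁ : Irr A
  b₁ : Irr A
  c₁ : Irr A
  c₂ : Irr A
  b₂ : Irr A
  a₂ : Irr A

instance : Fintype (XLabel A X) :=
  have : Finite (XLabel A X) := Finite.of_injective
    (fun L : XLabel A X => (L.a, L.x₁, L.y₁, L.y₂, L.x₂)) (by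
      intro L L' h; simp only [Prod.mk.injEq] at h; ext <;> tauto)
  Fintype.ofFinite _

instance : DecidableEq (XLabel A X) := Classical.decEq _

instance : Fintype (ALabel A) :=
  have : Finite (ALabel A) := Finite.of_injective
    (fun L : ALabel A => (L.a₁, L.b₁, L.c₁, L.c₂, L.b₂, L.a₂)) (by
      intro L L' h; simp only [Prod.mk.injEq] at h; ext <;> tauto)
  Fintype.ofFinite _

instance : DecidableEq (ALabel A) := Classical.decEq _

variable {A X}

/-- `X(Φ(a) x₁ y₁ → y₂ x₂)` with its skein module inner product. -/
abbrev XHom (Φ : Enrichment A X) (L : XLabel A X) : Type v₂ :=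
  SkeinHom (L.a.d * L.x₁.d * L.y₁.d * L.y₂.d * L.x₂.d)
    (Φ.obj L.a ⊗ (L.x₁.obj ⊗ L.y₁.obj)) (L.y₂.obj ⊗ L.x₂.obj)

/-- `A(a₁ b₁ c₁ → c₂ b₂ a₂)` with its skein module inner product. -/
abbrev AHom (L : ALabel A) : Type v₁ :=
  SkeinHom (L.a₁.d * L.b₁.d * L.c₁.d * L.c₂.d * L.b₂.d * L.a₂.d)
    (L.a₁.obj ⊗ (L.b₁.obj ⊗ L.c₁.obj)) (L.c₂.obj ⊗ (L.b₂.obj ⊗ L.a₂.obj))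

/-- The Hilbert space of a boundary vertex. -/
abbrev HX (Φ : Enrichment A X) : Type _ := PiLp 2 (fun L : XLabel A X => XHom Φ L)

variable (A) in
/-- The Hilbert space of a bulk vertex. -/
abbrev HA : Type _ := PiLp 2 (fun L : ALabel A => AHom L)

end Enriched

/-! ### Finite tensor powers of Hilbert spaces -/

section PiHilbert

variable (S : Type) [Fintype S] [DecidableEq S] (H : Type u) [NormedAddCommGroup H]
  [InnerProductSpace ℂ H]

/-- The tensor product of copies of the Hilbert space `H` indexed by the finite set `S`. -/
def PiHilbert : Type _ := ⨂[ℂ] _ : S, H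

instance : AddCommGroup (PiHilbert S H) := inferInstanceAs (AddCommGroup (⨂[ℂ] _ : S, H))
instance : Module ℂ (PiHilbert S H) := inferInstanceAs (Module ℂ (⨂[ℂ] _ : S, H))

variable {S H}

/-- The simple tensor `⨂ f s`. -/
def PiHilbert.tprod (f : S → H) : PiHilbert S H := PiTensorProduct.tprod ℂ f

/-- The operator `⨂ T s`. -/
def PiHilbert.map (T : S → H →ₗ[ℂ] H) : PiHilbert S H →ₗ[ℂ] PiHilbert S H :=
  PiTensorProduct.map T

variable (S H) [FiniteDimensional ℂ H]

/-- An auxiliary basis of the tensor product, from an orthonormal basis of `H`. -/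
def PiHilbert.basis : Module.Basis (S → Fin (Module.finrank ℂ H)) ℂ (PiHilbert S H) :=
  Basis.piTensorProduct (fun _ : S => (stdOrthonormalBasis ℂ H).toBasis)

/-- The inner product on the tensor product; see `PiHilbert.inner_tprod`. -/
abbrev PiHilbert.core : InnerProductSpace.Core ℂ (PiHilbert S H) where
  inner ψ φ := ∑ p, conj ((PiHilbert.basis S H).repr ψ p) * (PiHilbert.basis S H).repr φ p
  conj_inner_symm ψ φ := by
    simp only [map_sum, map_mul, Complex.conj_conj]
    exact Finset.sum_congr rfl fun p _ => mul_comm _ _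
  re_inner_nonneg ψ := by
    rw [map_sum]
    refine Finset.sum_nonneg fun p _ => ?_
    rw [mul_comm, Complex.mul_conj]
    simp only [RCLike.re_to_complex, Complex.ofReal_re]
    exact Complex.normSq_nonneg _
  add_left ψ φ χ := by
    simp only [map_add, Finsupp.add_apply, add_mul, Finset.sum_add_distrib]
  smul_left ψ φ c := by
    simp only [map_smul, Finsupp.smul_apply, smul_eq_mul, map_mul, mul_assoc, Finset.mul_sum]
  definite ψ h := by
    have h1 : ∀ p, conj ((PiHilbert.basis S H).repr ψ p) * (PiHilbert.basis S H).repr ψ p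
        = ((‖(PiHilbert.basis S H).repr ψ p‖ ^ 2 : ℝ) : ℂ) := fun p => by
      rw [mul_comm, Complex.mul_conj, Complex.normSq_eq_norm_sq]
    rw [Finset.sum_congr rfl fun p _ => h1 p, ← Complex.ofReal_sum, Complex.ofReal_eq_zero,
      Finset.sum_eq_zero_iff_of_nonneg fun p _ => by positivity] at h
    refine (PiHilbert.basis S H).ext_elem fun p => ?_
    have := h p (Finset.mem_univ p)
    simpa using this

instance : NormedAddCommGroup (PiHilbert S H) :=
  @InnerProductSpace.Core.toNormedAddCommGroup ℂ _ _ _ _ (PiHilbert.core S H)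

instance : InnerProductSpace ℂ (PiHilbert S H) :=
  InnerProductSpace.ofCore (PiHilbert.core S H).toCore

lemma PiHilbert.inner_tprod (f g : S → H) :
    inner ℂ (PiHilbert.tprod f) (PiHilbert.tprod g) = ∏ s, inner ℂ (f s) (g s) := by
  have h1 : ∀ (f : S → H) p, (PiHilbert.basis S H).repr (PiHilbert.tprod f) p =
      ∏ s, (stdOrthonormalBasis ℂ H).repr (f s) (p s) := fun f p => by
    exact (Basis.piTensorProduct_repr_tprod_apply _ f p)
  have h2 : ∀ s, inner ℂ (f s) (g s) = ∑ i, conj ((stdOrthonormalBasis ℂ H).repr (f s) i) *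
      (stdOrthonormalBasis ℂ H).repr (g s) i := fun s => by
    rw [← (stdOrthonormalBasis ℂ H).sum_inner_mul_inner (f s) (g s)]
    refine Finset.sum_congr rfl fun i _ => ?_
    rw [OrthonormalBasis.repr_apply_apply, OrthonormalBasis.repr_apply_apply, inner_conj_symm]
  change ∑ p, _ = _
  simp only [h1, h2, map_prod, ← Finset.prod_mul_distrib]
  rw [Finset.prod_univ_sum, Fintype.piFinset_univ]

end PiHilbert

/-! ### The lattice

The boundary layer is the grid `Fin (P + 1) × Fin (Q + 1)` (horizontal and vertical coordinate,
seen from outside) carrying `X`; behind it there are `N` bulk layers carrying `A`, of which the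
last one, with index `N - 1`, is adjacent to the boundary layer. -/

/-- Vertices of the boundary layer. -/
abbrev BSite (P Q : ℕ) : Type := Fin (P + 1) × Fin (Q + 1)

/-- Vertices of the bulk. -/
abbrev ASite (N P Q : ℕ) : Type := Fin N × BSite P Q

/-- Plaquettes of the boundary layer. -/
abbrev Plaq (P Q : ℕ) : Type := Fin P × Fin Q

namespace Plaq

variable {P Q : ℕ} (p : Plaq P Q)

/-- The lower left corner. -/
def c₁₁ : BSite P Q := (p.1.castSucc, p.2.castSucc)
/-- The lower right corner. -/
def c₂₁ : BSite P Q := (p.1.succ, p.2.castSucc)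
/-- The upper left corner. -/
def c₁₂ : BSite P Q := (p.1.castSucc, p.2.succ)
/-- The upper right corner. -/
def c₂₂ : BSite P Q := (p.1.succ, p.2.succ)

/-- The vertex `v` is a corner of the plaquette. -/
def IsCorner (v : BSite P Q) : Prop := v = p.c₁₁ ∨ v = p.c₂₁ ∨ v = p.c₁₂ ∨ v = p.c₂₂

end Plaq

/-- The edges joining two vertices: bulk edges in the three directions, edges from the last bulk
layer to the boundary layer, and horizontal and vertical edges of the boundary layer. -/
inductive Link (N P Q : ℕ) : Type
  | bulkA (l l' : Fin N) (h : l.val + 1 = l'.val) (v : BSite P Q)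
  | bulkB (l : Fin N) (i : Fin P) (j : Fin (Q + 1))
  | bulkC (l : Fin N) (i : Fin (P + 1)) (j : Fin Q)
  | mixed (l : Fin N) (h : l.val + 1 = N) (v : BSite P Q)
  | horizontal (i : Fin P) (j : Fin (Q + 1))
  | vertical (i : Fin (P + 1)) (j : Fin Q)

section Model

variable {A : Type u₁} [Category.{v₁} A] [Abelian A] [Linear ℂ A] [MonoidalCategory A]
  [MonoidalPreadditive A] [MonoidalLinear ℂ A] [RightRigidCategory A] [UnitaryFusionCategory A]
  [BraidedCategory A]
  {X : Type u₂} [Category.{v₂} X] [Abelian X] [Linear ℂ X] [MonoidalCategory X]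
  [MonoidalPreadditive X] [MonoidalLinear ℂ X] [RightRigidCategory X] [UnitaryFusionCategory X]

/-- The total Hilbert space: the tensor product of the Hilbert spaces of all vertices. -/
abbrev Htot (Φ : Enrichment A X) (N P Q : ℕ) : Type _ :=
  PiHilbert (ASite N P Q) (HA A) ⊗[ℂ] PiHilbert (BSite P Q) (HX Φ)

/-! ### Edge terms -/

/-- The operator on `HX` keeping the summands whose label satisfies `q`. -/
def projX (Φ : Enrichment A X) (q : XLabel A X → Prop) [DecidablePred q] : HX Φ →ₗ[ℂ] HX Φ where
  toFun ψ := WithLp.toLp 2 fun L => if q L then ψ L else 0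
  map_add' ψ φ := by ext L; by_cases h : q L <;> simp [h]
  map_smul' c ψ := by ext L; by_cases h : q L <;> simp [h]

variable (A) in
/-- The operator on `HA` keeping the summands whose label satisfies `q`. -/
def projA (q : ALabel A → Prop) [DecidablePred q] : HA A →ₗ[ℂ] HA A where
  toFun ψ := WithLp.toLp 2 fun L => if q L then ψ L else 0
  map_add' ψ φ := by ext L; by_cases h : q L <;> simp [h]
  map_smul' c ψ := by ext L; by_cases h : q L <;> simp [h]

/-- The operator applying `S` at the vertex `v`. -/
def atX {Φ : Enrichment A X} {P Q : ℕ} (v : BSite P Q) (S : HX Φ →ₗ[ℂ] HX Φ) :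
    PiHilbert (BSite P Q) (HX Φ) →ₗ[ℂ] PiHilbert (BSite P Q) (HX Φ) :=
  PiHilbert.map (Function.update (fun _ => LinearMap.id) v S)

/-- The operator applying `S` at the vertex `v`. -/
def atA {N P Q : ℕ} (v : ASite N P Q) (S : HA A →ₗ[ℂ] HA A) :
    PiHilbert (ASite N P Q) (HA A) →ₗ[ℂ] PiHilbert (ASite N P Q) (HA A) :=
  PiHilbert.map (Function.update (fun _ => LinearMap.id) v S)

/-- The edge term `A_ℓ`: the projector onto the states for which the labels of the two halves
of the edge `ℓ` match. -/
def edgeTerm (Φ : Enrichment A X) {N P Q : ℕ} : Link N P Q → (Htot Φ N P Q →ₗ[ℂ] Htot Φ N P Q)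
  | .bulkA l l' _ v => ∑ a : Irr A, TensorProduct.map
      (atA (l, v) (projA A fun L => L.a₂ = a) ∘ₗ atA (l', v) (projA A fun L => L.a₁ = a))
      LinearMap.id
  | .bulkB l i j => ∑ b : Irr A, TensorProduct.map
      (atA (l, (i.castSucc, j)) (projA A fun L => L.b₂ = b) ∘ₗ
        atA (l, (i.succ, j)) (projA A fun L => L.b₁ = b))
      LinearMap.id
  | .bulkC l i j => ∑ c : Irr A, TensorProduct.map
      (atA (l, (i, j.castSucc)) (projA A fun L => L.c₂ = c) ∘ₗ
        atA (l, (i, j.succ)) (projA A fun L => L.c₁ = c))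
      LinearMap.id
  | .mixed l _ v => ∑ a : Irr A, TensorProduct.map
      (atA (l, v) (projA A fun L => L.a₂ = a)) (atX v (projX Φ fun L => L.a = a))
  | .horizontal i j => ∑ x : Irr X, TensorProduct.map LinearMap.id
      (atX (i.castSucc, j) (projX Φ fun L => L.x₂ = x) ∘ₗ
        atX (i.succ, j) (projX Φ fun L => L.x₁ = x))
  | .vertical i j => ∑ y : Irr X, TensorProduct.map LinearMap.id
      (atX (i, j.castSucc) (projX Φ fun L => L.y₂ = y) ∘ₗ
        atX (i, j.succ) (projX Φ fun L => L.y₁ = y))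

/-- The ground state space `P_A H_tot` of `-∑ A_ℓ`: the states fixed by all edge terms. -/
def edgeGroundSpace (Φ : Enrichment A X) (N P Q : ℕ) : Submodule ℂ (Htot Φ N P Q) :=
  ⨅ ℓ : Link N P Q, LinearMap.ker (edgeTerm Φ ℓ - LinearMap.id)

/-! ### Plaquette terms -/

/-- `X(r ⊗ g → k)` as a summand of the trivalent skein module. -/
abbrev TriL (r g k : Irr X) : Type v₂ :=
  SkeinHom (r.d * g.d * k.d) (r.obj ⊗ g.obj) k.obj

/-- `X(j ⊗ r̄ → n)` as a summand of the trivalent skein module. -/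
abbrev TriR (j r n : Irr X) : Type v₂ :=
  SkeinHom (j.d * r.d * n.d) (j.obj ⊗ (r.obj)ᘁ) n.obj

/-- The index set of an orthonormal basis of `TriL r g k`. -/
abbrev IdxL (r g k : Irr X) : Type := Fin (Module.finrank ℂ (TriL r g k))
/-- The index set of an orthonormal basis of `TriR j r n`. -/
abbrev IdxR (j r n : Irr X) : Type := Fin (Module.finrank ℂ (TriR j r n))

/-- The trivalent node `r ⊗ g → k` given by a vector of an orthonormal basis. -/
def nodeL {r g k : Irr X} (e : IdxL r g k) : r.obj ⊗ g.obj ⟶ k.obj :=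
  (stdOrthonormalBasis ℂ (TriL r g k) e).hom
/-- The trivalent node `j ⊗ r̄ → n` given by a vector of an orthonormal basis. -/
def nodeR {j r n : Irr X} (e : IdxR j r n) : j.obj ⊗ (r.obj)ᘁ ⟶ n.obj :=
  (stdOrthonormalBasis ℂ (TriR j r n) e).hom

/-- The operator on `HX` whose component at the label `L` is `F L` applied to the component at
the label `s L`. -/
def localOp (Φ : Enrichment A X) (s : XLabel A X → XLabel A X)
    (F : ∀ L, XHom Φ (s L) →ₗ[ℂ] XHom Φ L) : HX Φ →ₗ[ℂ] HX Φ where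
  toFun ψ := WithLp.toLp 2 fun L => F L (ψ (s L))
  map_add' ψ φ := by ext L; simp
  map_smul' c ψ := by ext L; simp

variable (Φ : Enrichment A X)

/-- The part at the lower left corner `Φ(a) s t → j g` of the loop `r` fused into the four edges
of the plaquette: the loop turns the outgoing labels `j`, `g` into `n`, `k`. -/
def corner₁₁ {j g n k r : Irr X} (o : IdxR j r n) (e : IdxL r g k) : HX Φ →ₗ[ℂ] HX Φ :=
  localOp Φ (fun L => { L with y₂ := j, x₂ := g }) fun L =>
    { toFun := fun ψ =>
        (ψ.hom ⊗≫ j.obj ◁ dag (ε_ r.obj (r.obj)ᘁ) ▷ g.obj ⊗≫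
          ((nodeR o ≫ Irr.δ n L.y₂) ⊗ₘ (nodeL e ≫ Irr.δ k L.x₂)) :
          Φ.obj L.a ⊗ (L.x₁.obj ⊗ L.y₁.obj) ⟶ L.y₂.obj ⊗ L.x₂.obj)
      map_add' := fun ψ φ => by
        simp only [SkeinHom.hom_add, monoidalComp, Preadditive.add_comp]; rfl
      map_smul' := fun c ψ => by
        simp only [SkeinHom.hom_smul, monoidalComp, Linear.smul_comp]; rfl }

/-- The part at the lower right corner `Φ(b) g u → h v`: the loop turns the labels `g`, `h` into
`k`, `l`, passing over the string `Φ(b)`. -/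
def corner₂₁ {g h k l r : Irr X} (e : IdxL r g k) (q : IdxL r h l) : HX Φ →ₗ[ℂ] HX Φ :=
  localOp Φ (fun L => { L with x₁ := g, y₂ := h }) fun L =>
    { toFun := fun ψ =>
        (Φ.obj L.a ◁ ((Irr.δ L.x₁ k ≫ dag (nodeL e)) ▷ L.y₁.obj) ⊗≫
          (Φ.half L.a r.obj).hom ▷ (g.obj ⊗ L.y₁.obj) ⊗≫
          r.obj ◁ ψ.hom ⊗≫ (nodeL q ≫ Irr.δ l L.y₂) ▷ L.x₂.obj :
          Φ.obj L.a ⊗ (L.x₁.obj ⊗ L.y₁.obj) ⟶ L.y₂.obj ⊗ L.x₂.obj)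
      map_add' := fun ψ φ => by
        simp only [SkeinHom.hom_add, monoidalComp, Preadditive.add_comp, Preadditive.comp_add,
          MonoidalPreadditive.whiskerLeft_add]; rfl
      map_smul' := fun c ψ => by
        simp only [SkeinHom.hom_smul, monoidalComp, Linear.smul_comp, Linear.comp_smul,
          MonoidalLinear.whiskerLeft_smul]; rfl }

/-- The part at the upper left corner `Φ(d) z j → y i`: the loop turns the labels `j`, `i` into
`n`, `m`. -/
def corner₁₂ {j i n m r : Irr X} (o : IdxR j r n) (f : IdxR i r m) : HX Φ →ₗ[ℂ] HX Φ :=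
  localOp Φ (fun L => { L with y₁ := j, x₂ := i }) fun L =>
    { toFun := fun ψ =>
        (Φ.obj L.a ◁ (L.x₁.obj ◁ (Irr.δ L.y₁ n ≫ dag (nodeR o))) ⊗≫
          ψ.hom ▷ (r.obj)ᘁ ⊗≫ L.y₂.obj ◁ (nodeR f ≫ Irr.δ m L.x₂) :
          Φ.obj L.a ⊗ (L.x₁.obj ⊗ L.y₁.obj) ⟶ L.y₂.obj ⊗ L.x₂.obj)
      map_add' := fun ψ φ => by
        simp only [SkeinHom.hom_add, monoidalComp, Preadditive.add_comp, Preadditive.comp_add,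
          MonoidalPreadditive.add_whiskerRight]; rfl
      map_smul' := fun c ψ => by
        simp only [SkeinHom.hom_smul, monoidalComp, Linear.smul_comp, Linear.comp_smul,
          MonoidalLinear.smul_whiskerRight]; rfl }

/-- The part at the upper right corner `Φ(c) i h → x w`: the loop turns the incoming labels `i`,
`h` into `m`, `l`. -/
def corner₂₂ {i h m l r : Irr X} (f : IdxR i r m) (q : IdxL r h l) : HX Φ →ₗ[ℂ] HX Φ :=
  localOp Φ (fun L => { L with x₁ := i, y₁ := h }) fun L =>
    { toFun := fun ψ =>
        (Φ.obj L.a ◁ ((Irr.δ L.x₁ m ≫ dag (nodeR f)) ⊗ₘ (Irr.δ L.y₁ l ≫ dag (nodeL q))) ⊗≫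
          Φ.obj L.a ◁ (i.obj ◁ (ε_ r.obj (r.obj)ᘁ ▷ h.obj)) ⊗≫ ψ.hom :
          Φ.obj L.a ⊗ (L.x₁.obj ⊗ L.y₁.obj) ⟶ L.y₂.obj ⊗ L.x₂.obj)
      map_add' := fun ψ φ => by
        simp only [SkeinHom.hom_add, monoidalComp, Preadditive.comp_add]; rfl
      map_smul' := fun c ψ => by
        simp only [SkeinHom.hom_smul, monoidalComp, Linear.comp_smul]; rfl }

/-- The operator applying the four given operators at the corners of `p`. -/
def Plaq.atCorners {P Q : ℕ} (p : Plaq P Q) (S₁₁ S₂₁ S₁₂ S₂₂ : HX Φ →ₗ[ℂ] HX Φ) :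
    PiHilbert (BSite P Q) (HX Φ) →ₗ[ℂ] PiHilbert (BSite P Q) (HX Φ) :=
  PiHilbert.map fun v => if v = p.c₁₁ then S₁₁ else if v = p.c₂₁ then S₂₁ else
    if v = p.c₁₂ then S₁₂ else if v = p.c₂₂ then S₂₂ else LinearMap.id

/-- The boundary plaquette operator `B_p`: the sum over `r` of `d_r / D_X` times the insertion
of a loop labelled `r` in the plaquette, resolved by the fusion relation on the four edges of the
plaquette, whose labels change from `g, h, i, j` (bottom, right, top, left) to `k, l, m, n`. -/
def plaquetteOp (N : ℕ) {P Q : ℕ} (p : Plaq P Q) : Htot Φ N P Q →ₗ[ℂ] Htot Φ N P Q :=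
  TensorProduct.map LinearMap.id
    (((1 / globalDim X : ℝ) : ℂ) •
      ∑ r : Irr X, ∑ g : Irr X, ∑ h : Irr X, ∑ i : Irr X, ∑ j : Irr X,
      ∑ k : Irr X, ∑ l : Irr X, ∑ m : Irr X, ∑ n : Irr X,
      ((√(k.d * l.d * m.d * n.d : ℝ) / (r.d * √(g.d * h.d * i.d * j.d : ℝ)) : ℝ) : ℂ) •
      ∑ e : IdxL r g k, ∑ q : IdxL r h l, ∑ f : IdxR i r m, ∑ o : IdxR j r n,
        p.atCorners Φ (corner₁₁ Φ o e) (corner₂₁ Φ e q) (corner₁₂ Φ o f) (corner₂₂ Φ f q))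

/-! ### Closed diagrams -/

section Diagrams

variable {Φ} {L₁₁ L₂₁ L₁₂ L₂₂ : XLabel A X}

/-- The boundary object `Φ(c) Φ(d) Φ(b) Φ(a) z s t u` of the glued plaquette. -/
def skeinDom (Φ : Enrichment A X) (L₁₁ L₂₁ L₁₂ L₂₂ : XLabel A X) : X :=
  Φ.obj L₂₂.a ⊗ (Φ.obj L₁₂.a ⊗ (Φ.obj L₂₁.a ⊗ (Φ.obj L₁₁.a ⊗
    (L₁₂.x₁.obj ⊗ (L₁₁.x₁.obj ⊗ (L₁₁.y₁.obj ⊗ L₂₁.y₁.obj))))))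

/-- The boundary object `y x w v` of the glued plaquette. -/
def skeinCod (L₂₁ L₁₂ L₂₂ : XLabel A X) : X :=
  L₁₂.y₂.obj ⊗ (L₂₂.y₂.obj ⊗ (L₂₂.x₂.obj ⊗ L₂₁.x₂.obj))

/-- The evaluation of a plaquette in the enriched skein module with four `A`-boundary points and
eight `X`-boundary points: the four vertices are glued along the edges `g, h, i, j`, and the four
`A`-strings run to the left behind the `X`-strings. -/
def skeinEval (ξ₁₁ : XHom Φ L₁₁) (ξ₂₁ : XHom Φ L₂₁) (ξ₁₂ : XHom Φ L₁₂) (ξ₂₂ : XHom Φ L₂₂) :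
    skeinDom Φ L₁₁ L₂₁ L₁₂ L₂₂ ⟶ skeinCod L₂₁ L₁₂ L₂₂ :=
  𝟙 (Φ.obj L₂₂.a ⊗ (Φ.obj L₁₂.a ⊗ (Φ.obj L₂₁.a ⊗ (Φ.obj L₁₁.a ⊗
    (L₁₂.x₁.obj ⊗ (L₁₁.x₁.obj ⊗ (L₁₁.y₁.obj ⊗ L₂₁.y₁.obj))))))) ⊗≫
  Φ.obj L₂₂.a ◁ Φ.obj L₁₂.a ◁ Φ.obj L₂₁.a ◁
    (Φ.half L₁₁.a L₁₂.x₁.obj).hom ▷ (L₁₁.x₁.obj ⊗ (L₁₁.y₁.obj ⊗ L₂₁.y₁.obj)) ⊗≫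
  Φ.obj L₂₂.a ◁ Φ.obj L₁₂.a ◁ Φ.obj L₂₁.a ◁ L₁₂.x₁.obj ◁ ξ₁₁.hom ▷ L₂₁.y₁.obj ⊗≫
  Φ.obj L₂₂.a ◁ Φ.obj L₁₂.a ◁
    (Φ.half L₂₁.a (L₁₂.x₁.obj ⊗ L₁₁.y₂.obj)).hom ▷ (L₁₁.x₂.obj ⊗ L₂₁.y₁.obj) ⊗≫
  Φ.obj L₂₂.a ◁
    (((Φ.obj L₁₂.a ◁ L₁₂.x₁.obj ◁ Irr.δ L₁₁.y₂ L₁₂.y₁) ≫ ξ₁₂.hom) ⊗ₘ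
     ((Φ.obj L₂₁.a ◁ Irr.δ L₁₁.x₂ L₂₁.x₁ ▷ L₂₁.y₁.obj) ≫ ξ₂₁.hom)) ⊗≫
  (Φ.half L₂₂.a L₁₂.y₂.obj).hom ▷ (L₁₂.x₂.obj ⊗ (L₂₁.y₂.obj ⊗ L₂₁.x₂.obj)) ⊗≫
  L₁₂.y₂.obj ◁
    ((Φ.obj L₂₂.a ◁ (Irr.δ L₁₂.x₂ L₂₂.x₁ ⊗ₘ Irr.δ L₂₁.y₂ L₂₂.y₁)) ≫ ξ₂₂.hom) ▷ L₂₁.x₂.obj ⊗≫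
  𝟙 (L₁₂.y₂.obj ⊗ (L₂₂.y₂.obj ⊗ (L₂₂.x₂.obj ⊗ L₂₁.x₂.obj)))

/-- The boundary object `Φ(d) z Φ(a) s t Φ(b) u`. -/
def planarDom (Φ : Enrichment A X) (L₁₁ L₂₁ L₁₂ : XLabel A X) : X :=
  Φ.obj L₁₂.a ⊗ (L₁₂.x₁.obj ⊗ (Φ.obj L₁₁.a ⊗
    (L₁₁.x₁.obj ⊗ (L₁₁.y₁.obj ⊗ (Φ.obj L₂₁.a ⊗ L₂₁.y₁.obj)))))

/-- The boundary object `y Φ(c)‾ x w v`. -/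
def planarCod (Φ : Enrichment A X) (L₂₁ L₁₂ L₂₂ : XLabel A X) : X :=
  L₁₂.y₂.obj ⊗ ((Φ.obj L₂₂.a)ᘁ ⊗ (L₂₂.y₂.obj ⊗ (L₂₂.x₂.obj ⊗ L₂₁.x₂.obj)))

/-- The plaquette with its `A`-strings drawn in the plane: the string `a` ends between `z` and
`s`, the string `b` passes under the edge `g` and ends between `t` and `u`, the string `c` ends
between `y` and `x`, and the string `d` ends between `y` and `z`. -/
def planarEval (ξ₁₁ : XHom Φ L₁₁) (ξ₂₁ : XHom Φ L₂₁) (ξ₁₂ : XHom Φ L₁₂) (ξ₂₂ : XHom Φ L₂₂) :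
    planarDom Φ L₁₁ L₂₁ L₁₂ ⟶ planarCod Φ L₂₁ L₁₂ L₂₂ :=
  𝟙 (Φ.obj L₁₂.a ⊗ (L₁₂.x₁.obj ⊗ (Φ.obj L₁₁.a ⊗
    (L₁₁.x₁.obj ⊗ (L₁₁.y₁.obj ⊗ (Φ.obj L₂₁.a ⊗ L₂₁.y₁.obj)))))) ⊗≫
  Φ.obj L₁₂.a ◁ L₁₂.x₁.obj ◁ ξ₁₁.hom ▷ (Φ.obj L₂₁.a ⊗ L₂₁.y₁.obj) ⊗≫
  Φ.obj L₁₂.a ◁ L₁₂.x₁.obj ◁ L₁₁.y₂.obj ◁ (Φ.half L₂₁.a L₁₁.x₂.obj).inv ▷ L₂₁.y₁.obj ⊗≫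
  (((Φ.obj L₁₂.a ◁ L₁₂.x₁.obj ◁ Irr.δ L₁₁.y₂ L₁₂.y₁) ≫ ξ₁₂.hom) ⊗ₘ
   ((Φ.obj L₂₁.a ◁ Irr.δ L₁₁.x₂ L₂₁.x₁ ▷ L₂₁.y₁.obj) ≫ ξ₂₁.hom)) ⊗≫
  L₁₂.y₂.obj ◁ dag (ε_ (Φ.obj L₂₂.a) (Φ.obj L₂₂.a)ᘁ) ▷
    (L₁₂.x₂.obj ⊗ (L₂₁.y₂.obj ⊗ L₂₁.x₂.obj)) ⊗≫
  L₁₂.y₂.obj ◁ (Φ.obj L₂₂.a)ᘁ ◁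
    ((Φ.obj L₂₂.a ◁ (Irr.δ L₁₂.x₂ L₂₂.x₁ ⊗ₘ Irr.δ L₂₁.y₂ L₂₂.y₁)) ≫ ξ₂₂.hom) ▷ L₂₁.x₂.obj ⊗≫
  𝟙 (L₁₂.y₂.obj ⊗ ((Φ.obj L₂₂.a)ᘁ ⊗ (L₂₂.y₂.obj ⊗ (L₂₂.x₂.obj ⊗ L₂₁.x₂.obj))))

/-! The following morphisms between boundary objects are the canonical identifications when the
external labels agree. -/

/-- The identification of `skeinDom` for equal external labels. -/
def skeinDomδ (Φ : Enrichment A X) (L₁₁ L₂₁ L₁₂ L₂₂ M₁₁ M₂₁ M₁₂ M₂₂ : XLabel A X) :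
    skeinDom Φ L₁₁ L₂₁ L₁₂ L₂₂ ⟶ skeinDom Φ M₁₁ M₂₁ M₁₂ M₂₂ :=
  Φ.δ L₂₂.a M₂₂.a ⊗ₘ (Φ.δ L₁₂.a M₁₂.a ⊗ₘ (Φ.δ L₂₁.a M₂₁.a ⊗ₘ (Φ.δ L₁₁.a M₁₁.a ⊗ₘ
    (Irr.δ L₁₂.x₁ M₁₂.x₁ ⊗ₘ (Irr.δ L₁₁.x₁ M₁₁.x₁ ⊗ₘ (Irr.δ L₁₁.y₁ M₁₁.y₁ ⊗ₘ
      Irr.δ L₂₁.y₁ M₂₁.y₁))))))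

/-- The identification of `skeinCod` for equal external labels. -/
def skeinCodδ (L₂₁ L₁₂ L₂₂ M₂₁ M₁₂ M₂₂ : XLabel A X) :
    skeinCod L₂₁ L₁₂ L₂₂ ⟶ skeinCod M₂₁ M₁₂ M₂₂ :=
  Irr.δ L₁₂.y₂ M₁₂.y₂ ⊗ₘ (Irr.δ L₂₂.y₂ M₂₂.y₂ ⊗ₘ (Irr.δ L₂₂.x₂ M₂₂.x₂ ⊗ₘ Irr.δ L₂₁.x₂ M₂₁.x₂))

/-- The identification of `planarDom` for equal external labels. -/
def planarDomδ (Φ : Enrichment A X) (L₁₁ L₂₁ L₁₂ M₁₁ M₂₁ M₁₂ : XLabel A X) :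
    planarDom Φ L₁₁ L₂₁ L₁₂ ⟶ planarDom Φ M₁₁ M₂₁ M₁₂ :=
  Φ.δ L₁₂.a M₁₂.a ⊗ₘ (Irr.δ L₁₂.x₁ M₁₂.x₁ ⊗ₘ (Φ.δ L₁₁.a M₁₁.a ⊗ₘ
    (Irr.δ L₁₁.x₁ M₁₁.x₁ ⊗ₘ (Irr.δ L₁₁.y₁ M₁₁.y₁ ⊗ₘ (Φ.δ L₂₁.a M₂₁.a ⊗ₘ
      Irr.δ L₂₁.y₁ M₂₁.y₁)))))

/-- The identification of `planarCod` for equal external labels. -/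
def planarCodδ (Φ : Enrichment A X) (L₂₁ L₁₂ L₂₂ M₂₁ M₁₂ M₂₂ : XLabel A X) :
    planarCod Φ L₂₁ L₁₂ L₂₂ ⟶ planarCod Φ M₂₁ M₁₂ M₂₂ :=
  Irr.δ L₁₂.y₂ M₁₂.y₂ ⊗ₘ ((Φ.δ M₂₂.a L₂₂.a)ᘁ ⊗ₘ (Irr.δ L₂₂.y₂ M₂₂.y₂ ⊗ₘ
    (Irr.δ L₂₂.x₂ M₂₂.x₂ ⊗ₘ Irr.δ L₂₁.x₂ M₂₁.x₂)))

end Diagrams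

/-! ### Simple tensors -/

/-- A choice, for every vertex of the lattice, of a vector of an orthonormal basis consisting of
homogeneous vectors; `ιA L` and `ιX L` index orthonormal bases of the summands. -/
abbrev State (ιA : ALabel A → Type w₁) (ιX : XLabel A X → Type w₂) (N P Q : ℕ) : Type _ :=
  (ASite N P Q → Σ L, ιA L) × (BSite P Q → Σ L, ιX L)

section States

variable {Φ}
variable {ιA : ALabel A → Type w₁} {ιX : XLabel A X → Type w₂} {N P Q : ℕ}

/-- The two halves of the edge have the same label. -/
def Link.Matches (ξ : State ιA ιX N P Q) : Link N P Q → Prop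
  | .bulkA l l' _ v => (ξ.1 (l, v)).1.a₂ = (ξ.1 (l', v)).1.a₁
  | .bulkB l i j => (ξ.1 (l, (i.castSucc, j))).1.b₂ = (ξ.1 (l, (i.succ, j))).1.b₁
  | .bulkC l i j => (ξ.1 (l, (i, j.castSucc))).1.c₂ = (ξ.1 (l, (i, j.succ))).1.c₁
  | .mixed l _ v => (ξ.1 (l, v)).1.a₂ = (ξ.2 v).1.a
  | .horizontal i j => (ξ.2 (i.castSucc, j)).1.x₂ = (ξ.2 (i.succ, j)).1.x₁
  | .vertical i j => (ξ.2 (i, j.castSucc)).1.y₂ = (ξ.2 (i, j.succ)).1.y₁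

/-- All edge labels of the simple tensor match. -/
def State.Matched (ξ : State ιA ιX N P Q) : Prop := ∀ ℓ : Link N P Q, ℓ.Matches ξ

/-- The two simple tensors agree away from the corners of `p`. -/
def State.AgreeOff (p : Plaq P Q) (ξ η : State ιA ιX N P Q) : Prop :=
  ξ.1 = η.1 ∧ ∀ v, ¬ p.IsCorner v → ξ.2 v = η.2 v

/-- The labels of the twelve external edges of the plaquette
(`a, b, c, d` in `A` and `s, t, u, v, w, x, y, z` in `X`) agree. -/
def State.ExternalMatch (p : Plaq P Q) (ξ η : State ιA ιX N P Q) : Prop :=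
  (ξ.2 p.c₁₁).1.a = (η.2 p.c₁₁).1.a ∧ (ξ.2 p.c₂₁).1.a = (η.2 p.c₂₁).1.a ∧
  (ξ.2 p.c₂₂).1.a = (η.2 p.c₂₂).1.a ∧ (ξ.2 p.c₁₂).1.a = (η.2 p.c₁₂).1.a ∧
  (ξ.2 p.c₁₁).1.x₁ = (η.2 p.c₁₁).1.x₁ ∧ (ξ.2 p.c₁₁).1.y₁ = (η.2 p.c₁₁).1.y₁ ∧
  (ξ.2 p.c₂₁).1.y₁ = (η.2 p.c₂₁).1.y₁ ∧ (ξ.2 p.c₂₁).1.x₂ = (η.2 p.c₂₁).1.x₂ ∧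
  (ξ.2 p.c₂₂).1.x₂ = (η.2 p.c₂₂).1.x₂ ∧ (ξ.2 p.c₂₂).1.y₂ = (η.2 p.c₂₂).1.y₂ ∧
  (ξ.2 p.c₁₂).1.y₂ = (η.2 p.c₁₂).1.y₂ ∧ (ξ.2 p.c₁₂).1.x₁ = (η.2 p.c₁₂).1.x₁

instance : DecidablePred (State.Matched (ιA := ιA) (ιX := ιX) (N := N) (P := P) (Q := Q)) :=
  Classical.decPred _

variable [∀ L, Fintype (ιA L)] [∀ L, Fintype (ιX L)]
  (bA : ∀ L : ALabel A, OrthonormalBasis (ιA L) ℂ (AHom L))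
  (bX : ∀ L : XLabel A X, OrthonormalBasis (ιX L) ℂ (XHom Φ L))

/-- The simple tensor in the total Hilbert space. -/
def ket (ξ : State ιA ιX N P Q) : Htot Φ N P Q :=
  PiHilbert.tprod (fun v => (PiLp.single 2 (ξ.1 v).1 (bA (ξ.1 v).1 (ξ.1 v).2) : HA A)) ⊗ₜ[ℂ]
  PiHilbert.tprod (fun v => (PiLp.single 2 (ξ.2 v).1 (bX (ξ.2 v).1 (ξ.2 v).2) : HX Φ))

/-- The matrix coefficient `C(ξ, η)` of `B_p`: the coefficient of `η` in `B_p ξ`. -/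
def matrixCoeff (p : Plaq P Q) (ξ η : State ιA ιX N P Q) : ℂ :=
  inner ℂ (ket bA bX η) (plaquetteOp Φ N p (ket bA bX ξ))

/-- The constant `1 / (D_X √(d_a d_b d_c d_d d_s d_t d_u d_v d_w d_x d_y d_z))`. -/
def coeffConst (p : Plaq P Q) (ξ : State ιA ιX N P Q) : ℝ :=
  let L₁₁ := (ξ.2 p.c₁₁).1
  let L₂₁ := (ξ.2 p.c₂₁).1
  let L₁₂ := (ξ.2 p.c₁₂).1
  let L₂₂ := (ξ.2 p.c₂₂).1
  1 / (globalDim X * √(L₁₁.a.d * L₂₁.a.d * L₂₂.a.d * L₁₂.a.d *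
    L₁₁.x₁.d * L₁₁.y₁.d * L₂₁.y₁.d * L₂₁.x₂.d * L₂₂.x₂.d * L₂₂.y₂.d * L₁₂.y₂.d * L₁₂.x₁.d : ℝ))

/-- The closed diagram `tr(eval(η)† ∘ eval(ξ))`: the inner product, without its normalization, of
the elements given by the four corners of `p` in the enriched skein module with four `A`-boundary
points and eight `X`-boundary points. -/
def skeinPairing (p : Plaq P Q) (ξ η : State ιA ιX N P Q) : ℂ :=
  tr (skeinEval (bX _ (ξ.2 p.c₁₁).2) (bX _ (ξ.2 p.c₂₁).2)
        (bX _ (ξ.2 p.c₁₂).2) (bX _ (ξ.2 p.c₂₂).2) ≫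
      skeinCodδ (ξ.2 p.c₂₁).1 (ξ.2 p.c₁₂).1 (ξ.2 p.c₂₂).1
        (η.2 p.c₂₁).1 (η.2 p.c₁₂).1 (η.2 p.c₂₂).1 ≫
      dag (skeinEval (bX _ (η.2 p.c₁₁).2) (bX _ (η.2 p.c₂₁).2)
        (bX _ (η.2 p.c₁₂).2) (bX _ (η.2 p.c₂₂).2)) ≫
      skeinDomδ Φ (η.2 p.c₁₁).1 (η.2 p.c₂₁).1 (η.2 p.c₁₂).1 (η.2 p.c₂₂).1
        (ξ.2 p.c₁₁).1 (ξ.2 p.c₂₁).1 (ξ.2 p.c₁₂).1 (ξ.2 p.c₂₂).1)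

/-- The closed diagram drawn in the plane: the square with corners `ξ` and edges `g, h, i, j`,
surrounded by the square with corners `η†` and edges `k, l, m, n`, corresponding corners being
joined by the external strings, with the string `b` passing under `g` and `k`. -/
def planarDiagram (p : Plaq P Q) (ξ η : State ιA ιX N P Q) : ℂ :=
  tr (planarEval (bX _ (ξ.2 p.c₁₁).2) (bX _ (ξ.2 p.c₂₁).2)
        (bX _ (ξ.2 p.c₁₂).2) (bX _ (ξ.2 p.c₂₂).2) ≫
      planarCodδ Φ (ξ.2 p.c₂₁).1 (ξ.2 p.c₁₂).1 (ξ.2 p.c₂₂).1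
        (η.2 p.c₂₁).1 (η.2 p.c₁₂).1 (η.2 p.c₂₂).1 ≫
      dag (planarEval (bX _ (η.2 p.c₁₁).2) (bX _ (η.2 p.c₂₁).2)
        (bX _ (η.2 p.c₁₂).2) (bX _ (η.2 p.c₂₂).2)) ≫
      planarDomδ Φ (η.2 p.c₁₁).1 (η.2 p.c₂₁).1 (η.2 p.c₁₂).1
        (ξ.2 p.c₁₁).1 (ξ.2 p.c₂₁).1 (ξ.2 p.c₁₂).1)

end States

end Model

end EnrichedStringNet

end

open EnrichedStringNet

noncomputable section

namespace EnrichedStringNet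

open UnitaryFusionCategory

/-! ### Traces with respect to spherical duals -/

section Trace

variable {C : Type u} [Category.{v} C] [Abelian C] [Linear ℂ C] [MonoidalCategory C]
  [MonoidalPreadditive C] [MonoidalLinear ℂ C] [RightRigidCategory C] [UnitaryFusionCategory C]

attribute [simp] dag_id dag_comp dag_dag dag_add dag_smul dag_whiskerLeft dag_whiskerRight
  dag_associator dag_leftUnitor dag_rightUnitor

/-! By definition a matrix coefficient of `B_p` is a sum, over a loop label `r` and trivalent nodes
on the four edges of `p`, of products of four inner products, one for each corner. The main point is
that this sum is the value of one closed diagram: the square `ξ` surrounded by the square `η†`.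

To see this, cut the closed diagram open. By cyclicity of the trace it is an annulus whose upper
right piece is a morphism `i ⊗ h ⟶ m ⊗ l`, obtained from `ξ₂₂` and `η₂₂†` by closing the string `c`.
Such morphisms have a basis consisting of exchanges of a simple string `r` between the two strands
(`eq_sum_exch`). In each term `r` is the only link between the left and the right half of the
annulus. Closing the outer strings therefore turns the halves into morphisms `j ⊗ r̄ ⟶ n` and `r ⊗ g
⟶ k`, which are expanded in nodes (`tr_annulusMid_eq_sum`). What is left is a product of four closed
diagrams, and they are the four corner inner products (`tr_planarGlue_eq_sum`); the crossing of `b`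
becomes the crossing under `r` by naturality of the half-braiding (`tr_cor₂₁`). Comparing square
roots of dimensions gives `localCoeff_hvec`. The diagram with `A`-strings running behind has the
same value, because unitary half-braidings cancel under the trace and the closed string `c` can be
pulled through `y` (`tr_skeinGlue`).

The simple tensors are an orthonormal basis in which the edge terms are diagonal, so `P_A H_tot` is
the span of the matched ones. Selection rules at the corners (`matrixCoeff_ne_zero`) give the
vanishing in case (2) and the invariance of this space. Self-adjointness is the conjugation symmetry
of `tr (eval η† ∘ eval ξ)`.

For idempotence, slide each node along its edge until it meets its adjoint. Summing over nodes
resolves the identity on each pair of parallel strings, so the loop becomes a free circle. It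
contributes `d_r` on top of the `d_r` in the coefficient, and `∑ d_r² = D_X`. Fusing a loop thus
leaves the evaluation unchanged (`sum_planarGlue_fused`), and the coefficients depend on `ξ` only
through the evaluation.

Two plaquettes that are distinct and share no edge commute vertex by vertex. On a shared edge one
loop is fused from the left (or from below) and the other from the opposite side. The two orders
give two tree bases of one hom space, each appearing together with its dagger, so both sums are the
canonical element of that space (`sum_nodeL_nodeR_eq_sum_nodeR_nodeL`).

Two foundations come from the dagger axioms: the trace is cyclic and independent of the spherical
dual (`SphericalDual.trace_comp`), and the identity of every object is a sum of morphisms through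
simple objects (`id_mem_simpleSpan`). -/

@[simp] lemma dag_associator_inv (x y z : C) : dag (α_ x y z).inv = (α_ x y z).hom := by
  rw [← dag_associator, dag_dag]

@[simp] lemma dag_leftUnitor_inv (x : C) : dag (λ_ x).inv = (λ_ x).hom := by
  rw [← dag_leftUnitor, dag_dag]

@[simp] lemma dag_rightUnitor_inv (x : C) : dag (ρ_ x).inv = (ρ_ x).hom := by
  rw [← dag_rightUnitor, dag_dag]

@[simp] lemma dag_zero (x y : C) : dag (0 : x ⟶ y) = 0 := by
  have h := dag_smul (0 : ℂ) (0 : x ⟶ y)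
  simpa using h

@[simp] lemma dag_tensorHom {x y z w : C} (f : x ⟶ y) (g : z ⟶ w) :
    dag (f ⊗ₘ g) = dag f ⊗ₘ dag g := by
  rw [MonoidalCategory.tensorHom_def, dag_comp, dag_whiskerLeft, dag_whiskerRight,
    MonoidalCategory.tensorHom_def']

/-- The dagger as an additive homomorphism. -/
def dagHom (x y : C) : (x ⟶ y) →+ (y ⟶ x) :=
  AddMonoidHom.mk' dag dag_add

lemma dag_sum {ι : Type*} (s : Finset ι) {x y : C} (f : ι → (x ⟶ y)) :
    dag (∑ i ∈ s, f i) = ∑ i ∈ s, dag (f i) :=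
  map_sum (dagHom x y) f s

/-- A dual of `x` for which left and right traces agree. -/
structure SphericalDual (x : C) where
  /-- The dual object. -/
  dual : C
  [pairing : ExactPairing x dual]
  spherical : ∀ f : x ⟶ x,
    η_ x dual ≫ f ▷ dual ≫ dag (η_ x dual) = dag (ε_ x dual) ≫ dual ◁ f ≫ ε_ x dual

attribute [instance] SphericalDual.pairing

/-- The chosen dual. -/
def SphericalDual.chosen (x : C) : SphericalDual x where
  dual := xᘁ
  spherical f := UnitaryFusionCategory.spherical f

namespace SphericalDual

variable {x y : C} (D : SphericalDual x) (E : SphericalDual y)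

/-- The coevaluation `1 ⟶ x ⊗ x*`. -/
abbrev coev : 𝟙_ C ⟶ x ⊗ D.dual := η_ x D.dual
/-- The evaluation `x* ⊗ x ⟶ 1`. -/
abbrev ev : D.dual ⊗ x ⟶ 𝟙_ C := ε_ x D.dual

/-- The trace computed with the given dual. -/
def trace (f : x ⟶ x) : ℂ := scalar (D.coev ≫ f ▷ D.dual ≫ dag D.coev)

lemma trace_eq_left (f : x ⟶ x) : D.trace f = scalar (dag D.ev ≫ D.dual ◁ f ≫ D.ev) := by
  rw [trace, D.spherical]

/-- The dagger of a snake identity: the adjoint cup and cap form an exact pairing in the opposite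
order. -/
lemma ev_coev : dag D.ev ▷ D.dual ⊗≫ D.dual ◁ dag D.coev = ⊗𝟙.hom := by
  have h := congrArg dag (ExactPairing.coevaluation_evaluation x D.dual)
  simp only [dag_comp, dag_whiskerLeft, dag_whiskerRight, dag_associator_inv, dag_leftUnitor_inv,
    dag_rightUnitor, Category.assoc] at h
  simp only [monoidalComp]
  simpa using h

lemma coev_ev : x ◁ dag D.ev ⊗≫ dag D.coev ▷ x = ⊗𝟙.hom := by
  have h := congrArg dag (ExactPairing.evaluation_coevaluation x D.dual)
  simp only [dag_comp, dag_whiskerLeft, dag_whiskerRight, dag_associator, dag_leftUnitor,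
    dag_rightUnitor_inv, Category.assoc] at h
  simp only [monoidalComp]
  simpa using h

/-- The mate of `f`. -/
def mate (f : x ⟶ y) : E.dual ⟶ D.dual :=
  𝟙 _ ⊗≫ E.dual ◁ D.coev ⊗≫ E.dual ◁ f ▷ D.dual ⊗≫ E.ev ▷ D.dual ⊗≫ 𝟙 _

/-- The morphism whose mate with respect to the adjoint cups and caps is the mate of `f`. -/
def doubleMate (f : x ⟶ y) : x ⟶ y :=
  𝟙 _ ⊗≫ x ◁ dag E.ev ⊗≫ x ◁ mate D E f ▷ y ⊗≫ dag D.coev ▷ y ⊗≫ 𝟙 _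

/-- This lemma and the next three carry a morphism around one cup or cap. Together they move it once
around a circle, without presupposing that the duality is pivotal. -/
lemma coev_mate (f : x ⟶ y) : E.coev ≫ y ◁ mate D E f = D.coev ≫ f ▷ D.dual := by
  calc
    _ = 𝟙 _ ⊗≫ (E.coev ▷ 𝟙_ C ≫ (y ⊗ E.dual) ◁ (D.coev ≫ f ▷ D.dual)) ⊗≫
          y ◁ E.ev ▷ D.dual ⊗≫ 𝟙 _ := by dsimp only [mate]; monoidal
    _ = 𝟙 _ ⊗≫ (D.coev ≫ f ▷ D.dual) ⊗≫ (E.coev ▷ y ⊗≫ y ◁ E.ev) ▷ D.dual ⊗≫ 𝟙 _ := by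
        rw [← whisker_exchange]; monoidal
    _ = _ := by rw [ExactPairing.evaluation_coevaluation'']; monoidal

lemma mate_ev (f : x ⟶ y) : mate D E f ▷ x ≫ D.ev = E.dual ◁ f ≫ E.ev := by
  calc
    _ = 𝟙 _ ⊗≫ E.dual ◁ D.coev ▷ x ⊗≫ ((E.dual ◁ f ≫ E.ev) ▷ (D.dual ⊗ x) ≫ 𝟙_ C ◁ D.ev) ⊗≫
          𝟙 _ := by dsimp only [mate]; monoidal
    _ = 𝟙 _ ⊗≫ E.dual ◁ (D.coev ▷ x ⊗≫ x ◁ D.ev) ⊗≫ (E.dual ◁ f ≫ E.ev) ⊗≫ 𝟙 _ := by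
        rw [← whisker_exchange]; monoidal
    _ = _ := by rw [ExactPairing.evaluation_coevaluation'']; monoidal

lemma doubleMate_coev (f : x ⟶ y) :
    doubleMate D E f ▷ E.dual ≫ dag E.coev = x ◁ mate D E f ≫ dag D.coev := by
  calc
    _ = 𝟙 _ ⊗≫ x ◁ dag E.ev ▷ E.dual ⊗≫ ((x ◁ mate D E f ≫ dag D.coev) ▷ (y ⊗ E.dual) ≫
          𝟙_ C ◁ dag E.coev) ⊗≫ 𝟙 _ := by dsimp only [doubleMate]; monoidal
    _ = 𝟙 _ ⊗≫ x ◁ (dag E.ev ▷ E.dual ⊗≫ E.dual ◁ dag E.coev) ⊗≫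
          (x ◁ mate D E f ≫ dag D.coev) ⊗≫ 𝟙 _ := by
        rw [← whisker_exchange]; monoidal
    _ = _ := by rw [ev_coev]; monoidal

lemma ev_doubleMate (f : x ⟶ y) :
    dag D.ev ≫ D.dual ◁ doubleMate D E f = dag E.ev ≫ mate D E f ▷ y := by
  calc
    _ = 𝟙 _ ⊗≫ (dag D.ev ▷ 𝟙_ C ≫ (D.dual ⊗ x) ◁ (dag E.ev ≫ mate D E f ▷ y)) ⊗≫
          D.dual ◁ dag D.coev ▷ y ⊗≫ 𝟙 _ := by dsimp only [doubleMate]; monoidal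
    _ = 𝟙 _ ⊗≫ (dag E.ev ≫ mate D E f ▷ y) ⊗≫
          (dag D.ev ▷ D.dual ⊗≫ D.dual ◁ dag D.coev) ▷ y ⊗≫ 𝟙 _ := by
        rw [← whisker_exchange]; monoidal
    _ = _ := by rw [ev_coev]; monoidal

/-- On the right loop `f` leaves through the cup as its mate and returns through the adjoint cap as
`doubleMate D E f`, a priori a different morphism. -/
lemma trace_comp_doubleMate (f : x ⟶ y) (g : y ⟶ x) :
    D.trace (f ≫ g) = E.trace (g ≫ doubleMate D E f) := by
  rw [trace, trace]
  congr 1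
  calc
    _ = (D.coev ≫ f ▷ D.dual) ≫ g ▷ D.dual ≫ dag D.coev := by simp
    _ = E.coev ≫ (y ◁ mate D E f ≫ g ▷ D.dual) ≫ dag D.coev := by
        rw [← coev_mate D E]; simp
    _ = E.coev ≫ g ▷ E.dual ≫ x ◁ mate D E f ≫ dag D.coev := by
        rw [whisker_exchange]; simp
    _ = _ := by rw [← doubleMate_coev]; simp

/-- The same journey on the left loop, on which it is `g` that travels. Sphericality makes the two
loops comparable. -/
lemma trace_doubleMate_comp (f : x ⟶ y) (g : y ⟶ x) :
    D.trace (f ≫ g) = E.trace (doubleMate E D g ≫ f) := by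
  rw [trace_eq_left, trace_eq_left]
  congr 1
  calc
    _ = dag D.ev ≫ D.dual ◁ f ≫ (D.dual ◁ g ≫ D.ev) := by simp
    _ = (dag D.ev ≫ mate E D g ▷ x) ≫ E.dual ◁ f ≫ E.ev := by
        rw [← mate_ev E D, Category.assoc, ← whisker_exchange_assoc]
    _ = _ := by rw [← ev_doubleMate E D]; simp

lemma trace_add (f g : x ⟶ x) : D.trace (f + g) = D.trace f + D.trace g := by
  simp only [trace, MonoidalPreadditive.add_whiskerRight, Preadditive.add_comp,
    Preadditive.comp_add, scalar_add]

lemma trace_smul (c : ℂ) (f : x ⟶ x) : D.trace (c • f) = c * D.trace f := by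
  simp only [trace, MonoidalLinear.smul_whiskerRight, Linear.smul_comp, Linear.comp_smul,
    scalar_smul]

lemma trace_sub (f g : x ⟶ x) : D.trace (f - g) = D.trace f - D.trace g := by
  rw [sub_eq_add_neg, trace_add, ← neg_one_smul ℂ g, trace_smul]; ring

lemma trace_comp_dag_eq (f : x ⟶ y) :
    D.trace (f ≫ dag f) = scalar ((D.coev ≫ f ▷ D.dual) ≫ dag (D.coev ≫ f ▷ D.dual)) := by
  simp [trace]

lemma exists_trace_comp_dag (f : x ⟶ y) : ∃ c : ℂ, D.trace (f ≫ dag f) = c * conj c := by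
  rw [trace_comp_dag_eq]
  exact exists_scalar_comp_dag _

lemma trace_comp_dag_definite (f : x ⟶ y) (h : D.trace (f ≫ dag f) = 0) : f = 0 := by
  rw [trace_comp_dag_eq] at h
  have h1 : D.coev ≫ f ▷ D.dual = 0 := dag_definite _ (by rw [← scalar_spec (_ ≫ dag _), h, zero_smul])
  -- Bending is injective: the snake identity recovers `f` from its bent form.
  have h2 : f = 𝟙 _ ⊗≫ ((D.coev ≫ f ▷ D.dual) ▷ x) ⊗≫ y ◁ D.ev ⊗≫ 𝟙 _ := by
    symm
    calc
      _ = 𝟙 _ ⊗≫ D.coev ▷ x ⊗≫ (f ▷ (D.dual ⊗ x) ≫ y ◁ D.ev) ⊗≫ 𝟙 _ := by monoidal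
      _ = 𝟙 _ ⊗≫ (D.coev ▷ x ⊗≫ x ◁ D.ev) ⊗≫ f ⊗≫ 𝟙 _ := by
          rw [← whisker_exchange]; monoidal
      _ = _ := by rw [ExactPairing.evaluation_coevaluation'']; monoidal
  rw [h2, h1]
  simp [monoidalComp]

lemma doubleMate_sub (f g : x ⟶ y) :
    doubleMate D E (f - g) = doubleMate D E f - doubleMate D E g := by
  have hw : ∀ (z : C) {a b : C} (f g : a ⟶ b), z ◁ (f - g) = z ◁ f - z ◁ g := fun z a b f g =>
    map_sub ((tensorLeft z).mapAddHom) f g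
  have hw' : ∀ (z : C) {a b : C} (f g : a ⟶ b), (f - g) ▷ z = f ▷ z - g ▷ z := fun z a b f g =>
    map_sub ((tensorRight z).mapAddHom) f g
  simp only [doubleMate, mate, monoidalComp, hw, hw', Preadditive.sub_comp, Preadditive.comp_sub]

/-- Going around the right loop undoes going around the left one, so both sides have the same
pairing with every `g`; the trace pairing is nondegenerate. -/
lemma doubleMate_doubleMate (f : x ⟶ y) : doubleMate D E (doubleMate D E f) = f := by
  have h : ∀ g : y ⟶ x, E.trace (g ≫ (doubleMate D E (doubleMate D E f) - f)) = 0 := by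
    intro g
    rw [Preadditive.comp_sub, trace_sub, ← trace_comp_doubleMate,
      trace_doubleMate_comp E D, sub_self]
  have h1 := h (dag (doubleMate D E (doubleMate D E f) - f))
  have h2 := trace_comp_dag_definite E _ (by rwa [dag_dag])
  rw [← sub_eq_zero, ← dag_dag (_ - _), h2, dag_zero]

/-- A linear involution without eigenvalue `-1` is the identity. If `doubleMate` sends `g` to `-g`,
then `D.trace (g ≫ dag g) = -E.trace (dag g ≫ g)`; both traces are nonnegative, so both vanish and
`g = 0`. -/
lemma doubleMate_eq (f : x ⟶ y) : doubleMate D E f = f := by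
  rw [← sub_eq_zero]
  set g := doubleMate D E f - f with hg
  have h1 : doubleMate D E g = (-1 : ℂ) • g := by
    rw [hg, doubleMate_sub, doubleMate_doubleMate, neg_one_smul, neg_sub]
  have h2 := trace_comp_doubleMate D E g (dag g)
  obtain ⟨c, hc⟩ := exists_trace_comp_dag D g
  obtain ⟨c', hc'⟩ := exists_trace_comp_dag E (dag g)
  rw [dag_dag] at hc'
  rw [h1, Linear.comp_smul, trace_smul, hc', hc, Complex.mul_conj, Complex.mul_conj] at h2
  have h3 : Complex.normSq c = -1 * Complex.normSq c' := by exact_mod_cast h2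
  have h4 : Complex.normSq c = 0 := by
    nlinarith [Complex.normSq_nonneg c, Complex.normSq_nonneg c']
  exact trace_comp_dag_definite D g (by rw [hc, Complex.mul_conj, h4, Complex.ofReal_zero])

/-- The trace is cyclic, and does not depend on the duals. -/
lemma trace_comp (f : x ⟶ y) (g : y ⟶ x) : D.trace (f ≫ g) = E.trace (g ≫ f) := by
  rw [trace_comp_doubleMate D E, doubleMate_eq]

lemma trace_eq (f : x ⟶ x) : D.trace f = tr f := by
  have := trace_comp D (chosen x) f (𝟙 x)
  rw [Category.comp_id, Category.id_comp] at this
  exact this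

end SphericalDual

lemma tr_comp {x y : C} (f : x ⟶ y) (g : y ⟶ x) : tr (f ≫ g) = tr (g ≫ f) :=
  SphericalDual.trace_comp (.chosen x) (.chosen y) f g

end Trace

/-! ### Partial traces -/

section PartialTrace

variable {C : Type u} [Category.{v} C] [Abelian C] [Linear ℂ C] [MonoidalCategory C]
  [MonoidalPreadditive C] [MonoidalLinear ℂ C] [RightRigidCategory C] [UnitaryFusionCategory C]

variable {x y z w : C}

/-- The right partial trace. -/
def ptrR (D : SphericalDual w) (G : x ⊗ w ⟶ y ⊗ w) : x ⟶ y :=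
  𝟙 _ ⊗≫ x ◁ D.coev ⊗≫ G ▷ D.dual ⊗≫ y ◁ dag D.coev ⊗≫ 𝟙 _

/-- The left partial trace. -/
def ptrL (D : SphericalDual w) (G : w ⊗ x ⟶ w ⊗ y) : x ⟶ y :=
  𝟙 _ ⊗≫ dag D.ev ▷ x ⊗≫ D.dual ◁ G ⊗≫ D.ev ▷ y ⊗≫ 𝟙 _

lemma whiskerRight_comp_ptrR (D : SphericalDual w) (f : x ⟶ y) (G : y ⊗ w ⟶ z ⊗ w) :
    f ≫ ptrR D G = ptrR D (f ▷ w ≫ G) := by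
  calc
    _ = 𝟙 _ ⊗≫ (f ▷ 𝟙_ C ≫ y ◁ D.coev) ⊗≫ G ▷ D.dual ⊗≫ z ◁ dag D.coev ⊗≫ 𝟙 _ := by
        dsimp only [ptrR]; monoidal
    _ = _ := by rw [← whisker_exchange]; dsimp only [ptrR]; monoidal

lemma ptrR_comp_whiskerRight (D : SphericalDual w) (G : x ⊗ w ⟶ y ⊗ w) (f : y ⟶ z) :
    ptrR D G ≫ f = ptrR D (G ≫ f ▷ w) := by
  calc
    _ = 𝟙 _ ⊗≫ x ◁ D.coev ⊗≫ G ▷ D.dual ⊗≫ (y ◁ dag D.coev ≫ f ▷ 𝟙_ C) ⊗≫ 𝟙 _ := by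
        dsimp only [ptrR]; monoidal
    _ = _ := by rw [whisker_exchange]; dsimp only [ptrR]; monoidal

lemma whiskerLeft_comp_ptrL (D : SphericalDual w) (f : x ⟶ y) (G : w ⊗ y ⟶ w ⊗ z) :
    f ≫ ptrL D G = ptrL D (w ◁ f ≫ G) := by
  calc
    _ = 𝟙 _ ⊗≫ (𝟙_ C ◁ f ≫ dag D.ev ▷ y) ⊗≫ D.dual ◁ G ⊗≫ D.ev ▷ z ⊗≫ 𝟙 _ := by
        dsimp only [ptrL]; monoidal
    _ = _ := by rw [whisker_exchange]; dsimp only [ptrL]; monoidal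

lemma ptrL_comp_whiskerLeft (D : SphericalDual w) (G : w ⊗ x ⟶ w ⊗ y) (f : y ⟶ z) :
    ptrL D G ≫ f = ptrL D (G ≫ w ◁ f) := by
  calc
    _ = 𝟙 _ ⊗≫ dag D.ev ▷ x ⊗≫ D.dual ◁ G ⊗≫ (D.ev ▷ y ≫ 𝟙_ C ◁ f) ⊗≫ 𝟙 _ := by
        dsimp only [ptrL]; monoidal
    _ = _ := by rw [← whisker_exchange]; dsimp only [ptrL]; monoidal

/-- Closing `x` on the left and closing `y` on the right involve disjoint cups and caps and may be
done in either order. This makes the product of two spherical duals spherical. -/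
lemma trace_ptr_comm (D : SphericalDual x) (E : SphericalDual y) (G : x ⊗ y ⟶ x ⊗ y) :
    dag D.ev ≫ D.dual ◁ ptrR E G ≫ D.ev = E.coev ≫ ptrL D G ▷ E.dual ≫ dag E.coev := by
  calc
    _ = 𝟙 _ ⊗≫ (dag D.ev ▷ 𝟙_ C ≫ (D.dual ⊗ x) ◁ E.coev) ⊗≫ D.dual ◁ G ▷ E.dual ⊗≫
          ((D.dual ⊗ x) ◁ dag E.coev ≫ D.ev ▷ 𝟙_ C) ⊗≫ 𝟙 _ := by dsimp only [ptrR]; monoidal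
    _ = _ := by rw [← whisker_exchange, whisker_exchange D.ev (dag E.coev)]; dsimp only [ptrL]; monoidal

namespace SphericalDual

lemma coev_tensor_trace (D : SphericalDual x) (E : SphericalDual y) (G : x ⊗ y ⟶ x ⊗ y) :
    η_ (x ⊗ y) (E.dual ⊗ D.dual) ≫ G ▷ (E.dual ⊗ D.dual) ≫
      dag (η_ (x ⊗ y) (E.dual ⊗ D.dual)) = D.coev ≫ ptrR E G ▷ D.dual ≫ dag D.coev := by
  have h : dag (η_ (x ⊗ y) (E.dual ⊗ D.dual)) =
      𝟙 _ ⊗≫ x ◁ dag E.coev ▷ D.dual ⊗≫ dag D.coev := by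
    rw [ExactPairing.tensor_coevaluation]
    simp [monoidalComp]
  rw [h, ExactPairing.tensor_coevaluation]
  dsimp only [ptrR]
  monoidal

lemma ev_tensor_trace (D : SphericalDual x) (E : SphericalDual y) (G : x ⊗ y ⟶ x ⊗ y) :
    dag (ε_ (x ⊗ y) (E.dual ⊗ D.dual)) ≫ (E.dual ⊗ D.dual) ◁ G ≫
      ε_ (x ⊗ y) (E.dual ⊗ D.dual) = dag E.ev ≫ E.dual ◁ ptrL D G ≫ E.ev := by
  have h : dag (ε_ (x ⊗ y) (E.dual ⊗ D.dual)) =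
      dag E.ev ⊗≫ E.dual ◁ dag D.ev ▷ y ⊗≫ 𝟙 _ := by
    rw [ExactPairing.tensor_evaluation]
    simp [monoidalComp]
  rw [h, ExactPairing.tensor_evaluation]
  dsimp only [ptrL]
  monoidal

/-- The dual of a tensor product. -/
def tensor (D : SphericalDual x) (E : SphericalDual y) : SphericalDual (x ⊗ y) where
  dual := E.dual ⊗ D.dual
  spherical G := by
    rw [coev_tensor_trace, ev_tensor_trace, ← E.spherical, D.spherical, trace_ptr_comm]

/-- The object `x` as a dual of its dual. -/
def flip (D : SphericalDual x) : SphericalDual D.dual where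
  dual := x
  pairing :=
    { coevaluation' := dag D.ev
      evaluation' := dag D.coev
      coevaluation_evaluation' := by
        have h := congrArg dag (ExactPairing.evaluation_coevaluation x D.dual)
        simpa only [dag_comp, dag_whiskerLeft, dag_whiskerRight, dag_associator, dag_leftUnitor,
          dag_rightUnitor_inv, Category.assoc] using h
      evaluation_coevaluation' := by
        have h := congrArg dag (ExactPairing.coevaluation_evaluation x D.dual)
        simpa only [dag_comp, dag_whiskerLeft, dag_whiskerRight, dag_associator_inv,
          dag_leftUnitor_inv, dag_rightUnitor, Category.assoc] using h }
  spherical f := by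
    change dag D.ev ≫ f ▷ x ≫ dag (dag D.ev) = dag (dag D.coev) ≫ x ◁ f ≫ dag D.coev
    rw [dag_dag, dag_dag]
    -- Every endomorphism of the dual is the mate of an endomorphism of `x`, so sphericality
    -- transfers from `x`. The witness is `f` bent back by the original cup and cap.
    have hm : ∃ g : x ⟶ x, mate D D g = f := by
      refine ⟨𝟙 _ ⊗≫ D.coev ▷ x ⊗≫ x ◁ f ▷ x ⊗≫ x ◁ D.ev ⊗≫ 𝟙 _, ?_⟩
      calc
        _ = 𝟙 _ ⊗≫ D.dual ◁ (𝟙_ C ◁ D.coev ≫ D.coev ▷ (x ⊗ D.dual)) ⊗≫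
              ((D.dual ⊗ x) ◁ (f ▷ (x ⊗ D.dual) ⊗≫ D.ev ▷ D.dual ⊗≫ 𝟙 D.dual) ≫
                D.ev ▷ D.dual) ⊗≫ 𝟙 _ := by dsimp only [mate]; monoidal
        _ = 𝟙 _ ⊗≫ D.dual ◁ D.coev ⊗≫
              ((D.dual ⊗ x) ◁ (𝟙 D.dual ⊗≫ (D.dual ◁ D.coev ≫ f ▷ (x ⊗ D.dual)) ⊗≫
                D.ev ▷ D.dual ⊗≫ 𝟙 D.dual) ≫ D.ev ▷ D.dual) ⊗≫ 𝟙 _ := by rw [whisker_exchange]; monoidal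
        _ = 𝟙 _ ⊗≫ (D.dual ◁ D.coev ⊗≫ D.ev ▷ D.dual) ⊗≫
              (D.dual ◁ D.coev ≫ f ▷ (x ⊗ D.dual)) ⊗≫ D.ev ▷ D.dual ⊗≫ 𝟙 _ := by
            rw [whisker_exchange]; monoidal
        _ = 𝟙 _ ⊗≫ (D.dual ◁ D.coev ≫ f ▷ (x ⊗ D.dual)) ⊗≫ D.ev ▷ D.dual ⊗≫ 𝟙 _ := by
            rw [ExactPairing.coevaluation_evaluation'']; monoidal
        _ = 𝟙 _ ⊗≫ f ⊗≫ (D.dual ◁ D.coev ⊗≫ D.ev ▷ D.dual) ⊗≫ 𝟙 _ := by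
            rw [whisker_exchange]; monoidal
        _ = f := by rw [ExactPairing.coevaluation_evaluation'']; monoidal
    obtain ⟨g, rfl⟩ := hm
    rw [mate_ev, ← D.spherical, reassoc_of% (coev_mate D D g)]

end SphericalDual

/-- The trace may be computed with the product dual, for which it is a pair of nested loops; the
inner loop is the partial trace. -/
lemma tr_ptrR (D : SphericalDual w) (G : x ⊗ w ⟶ x ⊗ w) : tr (ptrR D G) = tr G := by
  rw [← SphericalDual.trace_eq ((SphericalDual.chosen x).tensor D) G]
  exact (congrArg scalar (SphericalDual.coev_tensor_trace (.chosen x) D G)).symm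

lemma tr_ptrL (D : SphericalDual w) (G : w ⊗ x ⟶ w ⊗ x) : tr (ptrL D G) = tr G := by
  rw [← SphericalDual.trace_eq (D.tensor (SphericalDual.chosen x)) G,
    SphericalDual.trace_eq_left, ← SphericalDual.trace_eq (SphericalDual.chosen x),
    SphericalDual.trace_eq_left]
  exact (congrArg scalar (SphericalDual.ev_tensor_trace D (.chosen x) G)).symm

end PartialTrace

/-! ### Semisimplicity -/

section Semisimple

variable {C : Type u} [Category.{v} C] [Abelian C] [Linear ℂ C] [MonoidalCategory C]
  [MonoidalPreadditive C] [MonoidalLinear ℂ C] [RightRigidCategory C] [UnitaryFusionCategory C]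

lemma Irr.exists_iso (x : C) [hx : Simple x] : ∃ k : Irr C, Nonempty (x ≅ k.obj) := by
  refine ⟨Quotient.mk _ ⟨x, hx⟩, ?_⟩
  have h := Quotient.mk_out (s := (isIsomorphicSetoid C).comap (fun x : {x : C // Simple x} => x.1))
    ⟨x, hx⟩
  exact ⟨(Classical.choice h).symm⟩

lemma Irr.hom_eq_zero {i j : Irr C} (h : i ≠ j) (f : i.obj ⟶ j.obj) : f = 0 := by
  by_contra hf
  have : IsIso f := isIso_of_hom_simple hf
  apply h
  rw [← Quotient.out_eq i, ← Quotient.out_eq j]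
  have e : i.obj ≅ j.obj := asIso f
  exact Quotient.sound ⟨e⟩

@[simp] lemma Irr.δ_self (i : Irr C) : Irr.δ i i = 𝟙 i.obj := by
  simp [Irr.δ]

lemma Irr.δ_ne {i j : Irr C} (h : i ≠ j) : Irr.δ i j = 0 := by
  simp [Irr.δ, h]

lemma tr_id (i : Irr C) : tr (𝟙 i.obj) = ((i.d : ℝ) : ℂ) := by
  obtain ⟨c, hc⟩ := exists_tr_comp_dag (𝟙 i.obj)
  rw [dag_id, Category.comp_id, Complex.mul_conj] at hc
  change _ = ((qdim i.obj : ℝ) : ℂ)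
  rw [qdim, hc, Complex.ofReal_re]

lemma Irr.d_ne_zero (i : Irr C) : ((i.d : ℝ) : ℂ) ≠ 0 :=
  Complex.ofReal_ne_zero.2 i.d.2.ne'

lemma Irr.endo_eq {i : Irr C} (f : i.obj ⟶ i.obj) : f = (tr f / (i.d : ℝ)) • 𝟙 i.obj := by
  obtain ⟨c, hc⟩ := endomorphism_simple_eq_smul_id ℂ f
  rw [← hc, tr_smul, tr_id, mul_div_cancel_right₀ _ i.d_ne_zero]

/-- For a monomorphism the positive endomorphism `f ≫ dag f` acts injectively on the finite
dimensional `End y`, hence is invertible. -/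
lemma exists_retraction {x y : C} (f : y ⟶ x) [Mono f] : ∃ s : x ⟶ y, f ≫ s = 𝟙 y := by
  have hinj : ∀ h : y ⟶ y, h ≫ f ≫ dag f = 0 → h = 0 := fun h hh => by
    have h1 : h ≫ f = 0 := by
      refine dag_definite _ ?_
      rw [dag_comp, Category.assoc, reassoc_of% hh, Limits.zero_comp]
    exact Limits.zero_of_comp_mono f h1
  have hsurj : Function.Surjective (Linear.rightComp ℂ y (f ≫ dag f)) := by
    refine LinearMap.surjective_of_injective ((injective_iff_map_eq_zero _).2 fun h hh => ?_)
    exact hinj h hh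
  obtain ⟨h, hh⟩ := hsurj (𝟙 y)
  change h ≫ f ≫ dag f = 𝟙 y at hh
  -- Surjectivity only gave `h ≫ (f ≫ dag f) = 𝟙 y`; injectivity turns `h` into an inverse on the
  -- other side too.
  refine ⟨dag f ≫ h, sub_eq_zero.1 (hinj _ ?_)⟩
  rw [Preadditive.sub_comp, Category.id_comp, Category.assoc, Category.assoc, hh,
    Category.comp_id, sub_self]

variable (C) in
/-- The endomorphisms of `x` that are sums of morphisms factoring through simple objects. -/
def simpleSpan (x y : C) : Submodule ℂ (x ⟶ y) :=
  Submodule.span ℂ {f | ∃ (k : Irr C) (p : x ⟶ k.obj) (i : k.obj ⟶ y), f = p ≫ i}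

lemma comp_mem_simpleSpan {x y z w : C} (s : x ⟶ y) (t : z ⟶ w) {f : y ⟶ z}
    (hf : f ∈ simpleSpan C y z) : s ≫ f ≫ t ∈ simpleSpan C x w := by
  induction hf using Submodule.span_induction with
  | mem f hf =>
    obtain ⟨k, p, i, rfl⟩ := hf
    exact Submodule.subset_span ⟨k, s ≫ p, i ≫ t, by simp⟩
  | zero => simp
  | add f g _ _ hf hg =>
    rw [Preadditive.add_comp, Preadditive.comp_add]
    exact add_mem hf hg
  | smul c f _ hf =>
    rw [Linear.smul_comp, Linear.comp_smul]
    exact Submodule.smul_mem _ _ hf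

/-- The map `f ↦ p ≫ f ≫ i` embeds `End y` into `End x`. If it were onto, `𝟙 x` would factor through
`i`, and `i` would be an isomorphism. -/
lemma finrank_end_lt {x y : C} (i : y ⟶ x) (p : x ⟶ y) (h : i ≫ p = 𝟙 y) (hi : ¬ IsIso i) :
    Module.finrank ℂ (y ⟶ y) < Module.finrank ℂ (x ⟶ x) := by
  let T : (y ⟶ y) →ₗ[ℂ] (x ⟶ x) := (Linear.leftComp ℂ x p) ∘ₗ (Linear.rightComp ℂ y i)
  have hT : ∀ f, T f = p ≫ f ≫ i := fun f => rfl
  have hinj : Function.Injective T := by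
    intro f g hfg
    rw [hT, hT] at hfg
    have := congrArg (fun u => i ≫ u ≫ p) hfg
    simpa [reassoc_of% h, h] using this
  rw [← LinearMap.finrank_range_of_inj hinj]
  refine Submodule.finrank_lt fun htop => hi ?_
  obtain ⟨f, hf⟩ := LinearMap.range_eq_top.1 htop (𝟙 x)
  rw [hT] at hf
  refine ⟨p ≫ f, ?_, by rw [Category.assoc, hf]⟩
  rw [← Category.assoc, h, Category.id_comp]
  have : i ≫ p ≫ f ≫ i = i := by rw [hf, Category.comp_id]
  have h2 := congrArg (· ≫ p) this
  simpa [reassoc_of% h, h] using h2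

/-- Induction on `dim End x`. A nonzero object that is not simple has a proper nonzero subobject,
which splits off with the kernel of the retraction as complement; both summands have smaller
endomorphism algebras. -/
lemma id_mem_simpleSpan (x : C) : 𝟙 x ∈ simpleSpan C x x := by
  induction hn : Module.finrank ℂ (x ⟶ x) using Nat.strong_induction_on generalizing x with
  | _ n ih =>
    by_cases h0 : 𝟙 x = 0
    · rw [h0]; exact zero_mem _
    by_cases hs : Simple x
    · obtain ⟨k, ⟨e⟩⟩ := Irr.exists_iso x
      exact Submodule.subset_span ⟨k, e.hom, e.inv, by simp⟩
    have : ∃ (y : C) (f : y ⟶ x), Mono f ∧ f ≠ 0 ∧ ¬ IsIso f := by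
      by_contra! hc
      refine hs ⟨fun {y} f hf => ⟨fun h hf0 => h0 ?_, fun hf0 => hc y f hf hf0⟩⟩
      subst hf0
      rw [← IsIso.inv_hom_id (0 : y ⟶ x), Limits.comp_zero]
    obtain ⟨y, f, hf, hf0, hfi⟩ := this
    obtain ⟨s, hs⟩ := exists_retraction f
    have hz : (𝟙 x - s ≫ f) ≫ s = 0 := by
      rw [Preadditive.sub_comp, Category.id_comp, Category.assoc, hs, Category.comp_id, sub_self]
    set i := Limits.kernel.ι s
    set π := Limits.kernel.lift s _ hz
    have hπ : π ≫ i = 𝟙 x - s ≫ f := Limits.kernel.lift_ι _ _ _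
    have his : i ≫ s = 0 := Limits.kernel.condition s
    have hi : i ≫ π = 𝟙 _ := by
      rw [← cancel_mono i, Category.assoc, hπ, Preadditive.comp_sub, reassoc_of% his]
      simp
    have hii : ¬ IsIso i := fun _ => by
      have hs0 : s = 0 := by rw [← IsIso.inv_hom_id_assoc i s, his, Limits.comp_zero]
      apply hf0
      rw [← Category.id_comp f, ← hs, hs0]
      simp
    have h1 := comp_mem_simpleSpan s f (ih _ (hn ▸ finrank_end_lt f s hs hfi) y rfl)
    have h2 := comp_mem_simpleSpan π i (ih _ (hn ▸ finrank_end_lt i π hi hii) _ rfl)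
    rw [Category.id_comp] at h1 h2
    have h3 := add_mem h1 h2
    rwa [hπ, add_sub_cancel] at h3

/-! ### Orthonormal bases of hom spaces to simple objects -/

variable {x : C} {k : Irr C} {w : {r : ℝ // 0 < r}} {ι : Type*} [Fintype ι]

/-- The weight turning the adjoint of an orthonormal basis into the dual basis. -/
def dualWeight (w : {r : ℝ // 0 < r}) (k : Irr C) : ℂ := ((k.d / √(w : ℝ) : ℝ) : ℂ)

lemma sqrt_ne_zero (w : {r : ℝ // 0 < r}) : ((√(w : ℝ) : ℝ) : ℂ) ≠ 0 :=
  Complex.ofReal_ne_zero.2 (Real.sqrt_pos.2 w.2).ne'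

lemma SkeinHom.sum_inner {y : C} (b : OrthonormalBasis ι ℂ (SkeinHom w x y)) (f : x ⟶ y) :
    f = ∑ e, (((1 / √(w : ℝ) : ℝ) : ℂ) * tr (f ≫ dag (b e).hom)) • (b e).hom := by
  exact (b.sum_repr' (f : SkeinHom w x y)).symm

/-- By Schur's lemma `dag (b e).hom ≫ f` is the scalar `tr / d_k`. The weight `d_k / √w` turns it
into the inner product `tr / √w`, so this is the expansion of `f` in the basis. -/
lemma sum_basis_comp (b : OrthonormalBasis ι ℂ (SkeinHom w x k.obj)) (f : x ⟶ k.obj) :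
    ∑ e, dualWeight w k • ((b e).hom ≫ dag (b e).hom ≫ f) = f := by
  classical
  have h1 : ∀ e, dualWeight w k • ((b e).hom ≫ dag (b e).hom ≫ f) =
      (((1 / √(w : ℝ) : ℝ) : ℂ) * tr (f ≫ dag (b e).hom)) • (b e).hom := fun e => by
    rw [Irr.endo_eq (dag (b e).hom ≫ f), Linear.comp_smul, Category.comp_id, smul_smul, tr_comp]
    congr 1
    rw [dualWeight]
    push_cast
    field_simp [k.d_ne_zero]
  rw [Finset.sum_congr rfl fun e _ => h1 e]
  exact (SkeinHom.sum_inner b f).symm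

/-- The resolution of the identity, that is, the fusion relation. The left side fixes every morphism
to a simple object, since Schur's lemma kills the other labels, and `𝟙 x` is a sum of morphisms
through simple objects. -/
lemma sum_basis_eq_id {w : Irr C → {r : ℝ // 0 < r}} {ι : Irr C → Type*} [∀ k, Fintype (ι k)]
    (b : ∀ k, OrthonormalBasis (ι k) ℂ (SkeinHom (w k) x k.obj)) :
    ∑ k, ∑ e, dualWeight (w k) k • ((b k e).hom ≫ dag (b k e).hom) = 𝟙 x := by
  set S := ∑ k, ∑ e, dualWeight (w k) k • ((b k e).hom ≫ dag (b k e).hom) with hS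
  have h1 : ∀ (j : Irr C) (p : x ⟶ j.obj), S ≫ p = p := fun j p => by
    rw [hS, Preadditive.sum_comp, Finset.sum_eq_single j]
    · conv_rhs => rw [← sum_basis_comp (b j) p]
      rw [Preadditive.sum_comp]
      exact Finset.sum_congr rfl fun e _ => by simp
    · intro i _ hij
      rw [Preadditive.sum_comp]
      refine Finset.sum_eq_zero fun e _ => ?_
      rw [Linear.smul_comp, Category.assoc, Irr.hom_eq_zero hij (dag (b i e).hom ≫ p),
        Limits.comp_zero, smul_zero]
    · simp
  have h2 : ∀ f ∈ simpleSpan C x x, S ≫ f = f := fun f hf => by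
    induction hf using Submodule.span_induction with
    | mem f hf =>
      obtain ⟨k, p, i, rfl⟩ := hf
      rw [← Category.assoc, h1]
    | zero => simp
    | add f g _ _ hf hg => rw [Preadditive.comp_add, hf, hg]
    | smul c f _ hf => rw [Linear.comp_smul, hf]
  simpa using h2 _ (id_mem_simpleSpan x)

end Semisimple

/-! ### The exchange basis of `C(i ⊗ h → m ⊗ l)` -/

section Exchange

variable {C : Type u} [Category.{v} C] [Abelian C] [Linear ℂ C] [MonoidalCategory C]
  [MonoidalPreadditive C] [MonoidalLinear ℂ C] [RightRigidCategory C] [UnitaryFusionCategory C]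

variable {r r' i h m l : C}

/-- The exchange of a string `r` between two parallel strings. -/
def exch (f : i ⊗ rᘁ ⟶ m) (q : r ⊗ h ⟶ l) : i ⊗ h ⟶ m ⊗ l :=
  𝟙 _ ⊗≫ i ◁ dag (ε_ r rᘁ) ▷ h ⊗≫ (f ⊗ₘ q)

/-- The string `r*` of `f` bent to the right. -/
def bend (f : i ⊗ rᘁ ⟶ m) : i ⟶ m ⊗ r := 𝟙 _ ⊗≫ i ◁ dag (ε_ r rᘁ) ⊗≫ f ▷ r

lemma exch_eq_bend (f : i ⊗ rᘁ ⟶ m) (q : r ⊗ h ⟶ l) :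
    exch f q = bend f ▷ h ⊗≫ m ◁ q := by
  dsimp only [exch, bend]
  rw [MonoidalCategory.tensorHom_def]
  monoidal

lemma dag_bend (f : i ⊗ rᘁ ⟶ m) : dag (bend f) = dag f ▷ r ⊗≫ i ◁ ε_ r rᘁ ⊗≫ 𝟙 _ := by
  simp [bend, monoidalComp]

lemma dag_exch_eq_bend (f : i ⊗ rᘁ ⟶ m) (q : r ⊗ h ⟶ l) :
    dag (exch f q) = m ◁ dag q ⊗≫ dag (bend f) ▷ h := by
  rw [exch_eq_bend]
  simp [monoidalComp]

lemma dag_exch (f : i ⊗ rᘁ ⟶ m) (q : r ⊗ h ⟶ l) :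
    dag (exch f q) = (dag f ⊗ₘ dag q) ⊗≫ i ◁ (ε_ r rᘁ ▷ h) ⊗≫ 𝟙 _ := by
  simp [exch, monoidalComp]

/-- The left side is the trace of the partial trace of `f ≫ dag f'` over `rᘁ`, computed with `r` as
the dual of `rᘁ`; hence the use of `flip`. -/
lemma tr_bend (f f' : i ⊗ rᘁ ⟶ m) : tr (bend f ≫ dag (bend f')) = tr (f ≫ dag f') := by
  refine Eq.trans ?_ (tr_ptrR (SphericalDual.chosen r).flip (f ≫ dag f'))
  rw [dag_bend]
  congr 1
  dsimp only [ptrR]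
  rw [show dag (SphericalDual.chosen r).flip.coev = ε_ r rᘁ from dag_dag _]
  change _ = 𝟙 _ ⊗≫ i ◁ dag (ε_ r rᘁ) ⊗≫ (f ≫ dag f') ▷ r ⊗≫ i ◁ ε_ r rᘁ ⊗≫ 𝟙 _
  dsimp only [bend]
  monoidal

/-- Closing `h` turns the right half into a morphism `r ⟶ r'` on the exchanged string, to which
Schur's lemma applies when `r` and `r'` are simple. -/
lemma ptrR_exch_comp_dag (D : SphericalDual h) (f : i ⊗ rᘁ ⟶ m) (q : r ⊗ h ⟶ l)
    (f' : i ⊗ r'ᘁ ⟶ m) (q' : r' ⊗ h ⟶ l) :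
    ptrR D (exch f q ≫ dag (exch f' q')) =
      bend f ≫ m ◁ ptrR D (q ≫ dag q') ≫ dag (bend f') := by
  rw [exch_eq_bend, dag_exch_eq_bend]
  calc
    _ = ptrR D (bend f ▷ h ≫ (𝟙 _ ⊗≫ m ◁ (q ≫ dag q') ⊗≫ 𝟙 _) ≫ dag (bend f') ▷ h) := by
        congr 1; monoidal
    _ = bend f ≫ ptrR D (𝟙 _ ⊗≫ m ◁ (q ≫ dag q') ⊗≫ 𝟙 _) ≫ dag (bend f') := by
        rw [ptrR_comp_whiskerRight, whiskerRight_comp_ptrR]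
    _ = _ := by
        congr 2
        dsimp only [ptrR]
        monoidal

lemma tr_exch_of_ne {r r' : Irr C} (hr : r ≠ r') (f : i ⊗ r.objᘁ ⟶ m) (q : r.obj ⊗ h ⟶ l)
    (f' : i ⊗ r'.objᘁ ⟶ m) (q' : r'.obj ⊗ h ⟶ l) :
    tr (exch f q ≫ dag (exch f' q')) = 0 := by
  rw [← tr_ptrR (.chosen h), ptrR_exch_comp_dag, Irr.hom_eq_zero hr (ptrR _ _)]
  -- This serves to obtain `tr 0 = 0`.
  have := tr_smul 0 (𝟙 i)
  simpa using this

lemma tr_exch {r : Irr C} (f : i ⊗ r.objᘁ ⟶ m) (q : r.obj ⊗ h ⟶ l)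
    (f' : i ⊗ r.objᘁ ⟶ m) (q' : r.obj ⊗ h ⟶ l) :
    tr (exch f q ≫ dag (exch f' q')) =
      tr (f ≫ dag f') * tr (q ≫ dag q') / ((r.d : ℝ) : ℂ) := by
  rw [← tr_ptrR (.chosen h), ptrR_exch_comp_dag, Irr.endo_eq (ptrR _ _), tr_ptrR,
    MonoidalLinear.whiskerLeft_smul, Linear.smul_comp, Linear.comp_smul, tr_smul,
    MonoidalCategory.whiskerLeft_id, Category.id_comp, tr_bend]
  ring

/-- Bending with the adjoint cup is undone by the adjoint cap, through the daggered snake identity.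
-/
lemma exists_bend_eq (A : i ⟶ m ⊗ r) : ∃ f : i ⊗ rᘁ ⟶ m, bend f = A := by
  refine ⟨𝟙 _ ⊗≫ A ▷ rᘁ ⊗≫ m ◁ dag (η_ r rᘁ) ⊗≫ 𝟙 _, ?_⟩
  have h := (SphericalDual.chosen r).coev_ev
  change r ◁ dag (ε_ r rᘁ) ⊗≫ dag (η_ r rᘁ) ▷ r = _ at h
  calc
    _ = 𝟙 _ ⊗≫ (i ◁ dag (ε_ r rᘁ) ≫ A ▷ (rᘁ ⊗ r)) ⊗≫ m ◁ dag (η_ r rᘁ) ▷ r ⊗≫ 𝟙 _ := by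
        dsimp only [bend]; monoidal
    _ = 𝟙 _ ⊗≫ A ⊗≫ m ◁ (r ◁ dag (ε_ r rᘁ) ⊗≫ dag (η_ r rᘁ) ▷ r) ⊗≫ 𝟙 _ := by
        rw [whisker_exchange]; monoidal
    _ = A := by rw [h]; monoidal

/-- Bend `h` upwards, so that a strand pair `l ⊗ hᘁ` appears to the right of `m`, and decompose the
identity of `l ⊗ hᘁ` through simple objects. Each simple `r` then runs between the two sides as an
exchanged string. -/
lemma exch_span (M : i ⊗ h ⟶ m ⊗ l) :
    M ∈ Submodule.span ℂ {g | ∃ (r : Irr C) (f : i ⊗ r.objᘁ ⟶ m) (q : r.obj ⊗ h ⟶ l),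
      g = exch f q} := by
  -- `T g` is `M` with `g` inserted on the bent pair. The snake identity gives `T (𝟙 _) = M`, and
  -- `T` of a morphism through a simple object is an exchange.
  let T : (l ⊗ hᘁ ⟶ l ⊗ hᘁ) → (i ⊗ h ⟶ m ⊗ l) := fun g =>
    𝟙 _ ⊗≫ i ◁ η_ h hᘁ ▷ h ⊗≫ M ▷ (hᘁ ⊗ h) ⊗≫ m ◁ g ▷ h ⊗≫ m ◁ l ◁ ε_ h hᘁ ⊗≫ 𝟙 _
  have hT : T (𝟙 _) = M := by
    calc
      _ = 𝟙 _ ⊗≫ i ◁ η_ h hᘁ ▷ h ⊗≫ (M ▷ (hᘁ ⊗ h) ≫ (m ⊗ l) ◁ ε_ h hᘁ) ⊗≫ 𝟙 _ := by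
          dsimp only [T]; monoidal
      _ = 𝟙 _ ⊗≫ i ◁ (η_ h hᘁ ▷ h ⊗≫ h ◁ ε_ h hᘁ) ⊗≫ M ⊗≫ 𝟙 _ := by
          rw [← whisker_exchange]; monoidal
      _ = M := by rw [ExactPairing.evaluation_coevaluation'']; monoidal
  have hmem : ∀ g ∈ simpleSpan C (l ⊗ hᘁ) (l ⊗ hᘁ), T g ∈
      Submodule.span ℂ {g | ∃ (r : Irr C) (f : i ⊗ r.objᘁ ⟶ m) (q : r.obj ⊗ h ⟶ l),
        g = exch f q} := fun g hg => by
    induction hg using Submodule.span_induction with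
    | mem g hg =>
      obtain ⟨r, p, s, rfl⟩ := hg
      obtain ⟨f, hf⟩ := exists_bend_eq
        (𝟙 _ ⊗≫ i ◁ η_ h hᘁ ⊗≫ M ▷ hᘁ ⊗≫ m ◁ p : i ⟶ m ⊗ r.obj)
      refine Submodule.subset_span ⟨r, f, 𝟙 _ ⊗≫ s ▷ h ⊗≫ l ◁ ε_ h hᘁ ⊗≫ 𝟙 _, ?_⟩
      rw [exch_eq_bend, hf]
      dsimp only [T]
      monoidal
    | zero =>
      have : T 0 = 0 := by simp [T, monoidalComp]
      rw [this]; exact zero_mem _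
    | add f g _ _ hf hg =>
      have : T (f + g) = T f + T g := by
        simp only [T, monoidalComp, MonoidalPreadditive.whiskerLeft_add,
          MonoidalPreadditive.add_whiskerRight, Preadditive.add_comp, Preadditive.comp_add]
      rw [this]; exact add_mem hf hg
    | smul c f _ hf =>
      have : T (c • f) = c • T f := by
        simp only [T, monoidalComp, MonoidalLinear.whiskerLeft_smul,
          MonoidalLinear.smul_whiskerRight, Linear.smul_comp, Linear.comp_smul]
      rw [this]; exact Submodule.smul_mem _ _ hf
  rw [← hT]
  exact hmem _ (id_mem_simpleSpan _)

/-- `exch` as a bilinear map. -/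
def exchₗ (i h m l r : C) :
    (i ⊗ rᘁ ⟶ m) →ₗ[ℂ] (r ⊗ h ⟶ l) →ₗ[ℂ] (i ⊗ h ⟶ m ⊗ l) :=
  LinearMap.mk₂ ℂ exch
    (fun f f' q => by
      simp only [exch, monoidalComp, MonoidalPreadditive.add_tensor, Preadditive.comp_add])
    (fun c f q => by
      simp only [exch, monoidalComp, MonoidalCategory.tensorHom_def,
        MonoidalLinear.smul_whiskerRight, Linear.smul_comp, Linear.comp_smul])
    (fun f q q' => by
      simp only [exch, monoidalComp, MonoidalPreadditive.tensor_add, Preadditive.comp_add])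
    (fun c f q => by
      simp only [exch, monoidalComp, MonoidalCategory.tensorHom_def,
        MonoidalLinear.whiskerLeft_smul, Linear.comp_smul])

lemma exchₗ_apply (f : i ⊗ rᘁ ⟶ m) (q : r ⊗ h ⟶ l) : exchₗ i h m l r f q = exch f q := rfl

lemma sqrt_mul_sqrt_eq (i r m h l : {x : ℝ // 0 < x}) :
    √(i * h * m * l : ℝ) * r = √(i * r * m : ℝ) * √(r * h * l : ℝ) := by
  have := i.2; have := r.2; have := m.2; have := h.2; have := l.2
  rw [← Real.sqrt_mul (by positivity),
    show (i * r * m * (r * h * l) : ℝ) = (i * h * m * l) * r ^ 2 by ring,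
    Real.sqrt_mul (x := (i * h * m * l : ℝ)) (by positivity), Real.sqrt_sq r.2.le]

end Exchange

/-! ### Expansion of `i ⊗ h ⟶ m ⊗ l` in exchanges of simple strings -/

section ExchangeBasis

variable {X : Type u₂} [Category.{v₂} X] [Abelian X] [Linear ℂ X] [MonoidalCategory X]
  [MonoidalPreadditive X] [MonoidalLinear ℂ X] [RightRigidCategory X] [UnitaryFusionCategory X]

lemma eq_sum_nodeL {r g k : Irr X} (f : r.obj ⊗ g.obj ⟶ k.obj) :
    f = ∑ e : IdxL r g k,
      (((1 / √(r.d * g.d * k.d : ℝ) : ℝ) : ℂ) * tr (f ≫ dag (nodeL e))) • nodeL e :=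
  SkeinHom.sum_inner (stdOrthonormalBasis ℂ (TriL r g k)) f

lemma eq_sum_nodeR {j r n : Irr X} (f : j.obj ⊗ (r.obj)ᘁ ⟶ n.obj) :
    f = ∑ o : IdxR j r n,
      (((1 / √(j.d * r.d * n.d : ℝ) : ℝ) : ℂ) * tr (f ≫ dag (nodeR o))) • nodeR o :=
  SkeinHom.sum_inner (stdOrthonormalBasis ℂ (TriR j r n)) f

/-- Exchanges of nodes are orthogonal by `tr_exch` and `tr_exch_of_ne`. Since a node has
unnormalized square norm `√w`, their square norm is `√(d_i d_r d_m) √(d_r d_h d_l) / d_r = √(d_i d_h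
d_m d_l)`, independent of `r`. They span by `exch_span`. -/
lemma eq_sum_exch {i h m l : Irr X} (M : i.obj ⊗ h.obj ⟶ m.obj ⊗ l.obj) :
    M = ∑ r : Irr X, ∑ q : IdxL r h l, ∑ f : IdxR i r m,
      (((1 / √(i.d * h.d * m.d * l.d : ℝ) : ℝ) : ℂ) *
        tr (M ≫ dag (exch (nodeR f) (nodeL q)))) • exch (nodeR f) (nodeL q) := by
  have key : ∀ M ∈ Submodule.span ℂ {g | ∃ (r : Irr X) (f : i.obj ⊗ r.objᘁ ⟶ m.obj)
      (q : r.obj ⊗ h.obj ⟶ l.obj), g = exch f q}, M = ∑ r : Irr X, ∑ q : IdxL r h l,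
        ∑ f : IdxR i r m, (((1 / √(i.d * h.d * m.d * l.d : ℝ) : ℝ) : ℂ) *
        tr (M ≫ dag (exch (nodeR f) (nodeL q)))) • exch (nodeR f) (nodeL q) := fun M hM => by
    induction hM using Submodule.span_induction with
    | mem M hM =>
      obtain ⟨r, f, q, rfl⟩ := hM
      rw [Finset.sum_eq_single r]
      · conv_lhs => rw [← exchₗ_apply, eq_sum_nodeR f, eq_sum_nodeL q]
        simp only [map_sum, map_smul, LinearMap.sum_apply, LinearMap.smul_apply, exchₗ_apply,
          Finset.smul_sum]
        refine Finset.sum_congr rfl fun q' _ => Finset.sum_congr rfl fun f' _ => ?_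
        rw [smul_smul, tr_exch]
        congr 1
        have h1 := sqrt_mul_sqrt_eq i.d r.d m.d h.d l.d
        have h2 : ((√(i.d * h.d * m.d * l.d : ℝ) : ℝ) : ℂ) * ((r.d : ℝ) : ℂ) =
          ((√(i.d * r.d * m.d : ℝ) : ℝ) : ℂ) * ((√(r.d * h.d * l.d : ℝ) : ℝ) : ℂ) := by
          exact_mod_cast h1
        have h3 := sqrt_ne_zero (i.d * r.d * m.d)
        have h4 := sqrt_ne_zero (r.d * h.d * l.d)
        have h5 := sqrt_ne_zero (i.d * h.d * m.d * l.d)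
        simp only [Positive.val_mul] at h3 h4 h5
        push_cast
        generalize ((√(i.d * h.d * m.d * l.d : ℝ) : ℝ) : ℂ) = a at *
        generalize ((√(i.d * r.d * m.d : ℝ) : ℝ) : ℂ) = b at *
        generalize ((√(r.d * h.d * l.d : ℝ) : ℝ) : ℂ) = c at *
        have h6 := r.d_ne_zero
        field_simp
        linear_combination (tr (q ≫ dag (nodeL q')) * tr (f ≫ dag (nodeR f'))) * h2
      · intro r' _ hr
        refine Finset.sum_eq_zero fun q' _ => Finset.sum_eq_zero fun f' _ => ?_
        rw [tr_exch_of_ne (Ne.symm hr), mul_zero, zero_smul]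
      · simp
    | zero =>
      symm
      refine Finset.sum_eq_zero fun r _ => Finset.sum_eq_zero fun q' _ =>
        Finset.sum_eq_zero fun f' _ => ?_
      have := tr_smul 0 (𝟙 (i.obj ⊗ h.obj))
      rw [Limits.zero_comp, ← zero_smul ℂ (𝟙 (i.obj ⊗ h.obj)), tr_smul]
      simp
    | add f g _ _ hf hg =>
      simp only [Preadditive.add_comp, tr_add, mul_add, add_smul, Finset.sum_add_distrib]
      rw [← hf, ← hg]
    | smul c f _ hf =>
      conv_lhs => rw [hf]
      simp only [Linear.smul_comp, tr_smul, Finset.smul_sum, smul_smul, mul_left_comm]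
  exact key M (exch_span M)

end ExchangeBasis

/-! ### Cutting an annular diagram into four pieces -/

section Annulus

variable {C : Type u} [Category.{v} C] [Abelian C] [Linear ℂ C] [MonoidalCategory C]
  [MonoidalPreadditive C] [MonoidalLinear ℂ C] [RightRigidCategory C] [UnitaryFusionCategory C]

lemma whiskers_comp_cup {P P' Q Q' z : C} (F : P ⟶ P') (G : Q ⟶ Q') (e : 𝟙_ C ⟶ z) :
    F ▷ Q ≫ P' ◁ G ≫ P' ◁ ((λ_ Q').inv ≫ e ▷ Q') =
      P ◁ ((λ_ Q).inv ≫ e ▷ Q) ≫ F ▷ (z ⊗ Q) ≫ P' ◁ z ◁ G := by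
  have h : G ≫ (λ_ Q').inv ≫ e ▷ Q' = ((λ_ Q).inv ≫ e ▷ Q) ≫ z ◁ G := by
    rw [leftUnitor_inv_naturality_assoc, whisker_exchange, Category.assoc]
  rw [← MonoidalCategory.whiskerLeft_comp, h, MonoidalCategory.whiskerLeft_comp,
    ← whisker_exchange_assoc]

lemma ptrL_whiskerRight {w a b : C} (D : SphericalDual w) (Q : w ⊗ a ⟶ w ⊗ b) (e : C) :
    ptrL D ((α_ _ _ _).inv ≫ Q ▷ e ≫ (α_ _ _ _).hom) = ptrL D Q ▷ e := by
  dsimp only [ptrL]; monoidal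

lemma ptrR_whiskerLeft {w a b : C} (D : SphericalDual w) (Q : a ⊗ w ⟶ b ⊗ w) (e : C) :
    ptrR D ((α_ _ _ _).hom ≫ e ◁ Q ≫ (α_ _ _ _).inv) = e ◁ ptrR D Q := by
  dsimp only [ptrR]; monoidal

/-- The two morphisms stand side by side, so each partial trace sees only one of them. -/
lemma ptrR_ptrL_tensor {w v a a' b b' : C} (D : SphericalDual w) (E : SphericalDual v)
    (Q : w ⊗ a ⟶ w ⊗ b) (Q' : a' ⊗ v ⟶ b' ⊗ v) :
    ptrR E (ptrL D (w ◁ (α_ a a' v).hom ≫ (α_ _ _ _).inv ≫ (Q ⊗ₘ Q') ≫ (α_ _ _ _).hom ≫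
      w ◁ (α_ b b' v).inv)) =
      ptrL D Q ⊗ₘ ptrR E Q' := by
  calc
    _ = ptrR E (ptrL D (w ◁ (α_ a a' v).hom ≫
          ((α_ _ _ _).inv ≫ Q ▷ (a' ⊗ v) ≫ (α_ _ _ _).hom) ≫
            w ◁ (b ◁ Q' ≫ (α_ b b' v).inv))) := by
        rw [MonoidalCategory.tensorHom_def]; congr 2; monoidal
    _ = ptrR E ((ptrL D Q ▷ a') ▷ v ≫ ((α_ _ _ _).hom ≫ b ◁ Q' ≫ (α_ _ _ _).inv)) := by
        rw [← whiskerLeft_comp_ptrL, ← ptrL_comp_whiskerLeft, ptrL_whiskerRight]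
        congr 1; monoidal
    _ = _ := by
        rw [← whiskerRight_comp_ptrR, ptrR_whiskerLeft, MonoidalCategory.tensorHom_def]

variable {w v' j g n k y i h vv m l : C}

/-- The part of the annular diagram between the lower left and the upper right pieces. -/
def annulusMid (F : w ⊗ j ⟶ y ⊗ i) (G : g ⊗ v' ⟶ h ⊗ vv) (F' : w ⊗ n ⟶ y ⊗ m)
    (G' : k ⊗ v' ⟶ l ⊗ vv) (M : i ⊗ h ⟶ m ⊗ l) :
    w ⊗ ((j ⊗ g) ⊗ v') ⟶ w ⊗ ((n ⊗ k) ⊗ v') :=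
  𝟙 _ ⊗≫ (F ⊗ₘ G) ⊗≫ y ◁ M ▷ vv ⊗≫ (dag F' ⊗ₘ dag G') ⊗≫ 𝟙 _

/-- The upper left piece. -/
def annulusLeft {r : C} (F : w ⊗ j ⟶ y ⊗ i) (F' : w ⊗ n ⟶ y ⊗ m) (f : i ⊗ rᘁ ⟶ m) :
    w ⊗ (j ⊗ rᘁ) ⟶ w ⊗ n :=
  (α_ _ _ _).inv ≫ F ▷ rᘁ ≫ (α_ _ _ _).hom ≫ y ◁ f ≫ dag F'

/-- The lower right piece. -/
def annulusRight {r : C} (G : g ⊗ v' ⟶ h ⊗ vv) (G' : k ⊗ v' ⟶ l ⊗ vv) (q : r ⊗ h ⟶ l) :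
    (r ⊗ g) ⊗ v' ⟶ k ⊗ v' :=
  (α_ _ _ _).hom ≫ r ◁ G ≫ (α_ _ _ _).inv ≫ q ▷ vv ≫ dag G'

/-- The cup creating the string `r` can be created before `F` and `G` are applied. After that the
left and the right piece no longer interact. -/
lemma annulusMid_exch {r : C} (F : w ⊗ j ⟶ y ⊗ i) (G : g ⊗ v' ⟶ h ⊗ vv) (F' : w ⊗ n ⟶ y ⊗ m)
    (G' : k ⊗ v' ⟶ l ⊗ vv) (f : i ⊗ rᘁ ⟶ m) (q : r ⊗ h ⟶ l) :
    annulusMid F G F' G' (exch f q) =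
      w ◁ ((𝟙 (j ⊗ g) ⊗≫ j ◁ dag (ε_ r rᘁ) ▷ g ⊗≫ 𝟙 ((j ⊗ rᘁ) ⊗ (r ⊗ g))) ▷ v') ≫
        (w ◁ (α_ _ _ _).hom ≫ (α_ _ _ _).inv ≫
          (annulusLeft F F' f ⊗ₘ annulusRight G G' q) ≫ (α_ _ _ _).hom ≫
          w ◁ (α_ _ _ _).inv) := by
  calc
    _ = 𝟙 _ ⊗≫ (F ▷ (g ⊗ v') ≫ (y ⊗ i) ◁ G ≫ (y ⊗ i) ◁ ((λ_ _).inv ≫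
          dag (ε_ r rᘁ) ▷ (h ⊗ vv))) ⊗≫ ((y ◁ f) ⊗ₘ (q ▷ vv)) ≫
          (dag F' ⊗ₘ dag G') ⊗≫ 𝟙 _ := by
        dsimp only [annulusMid, exch]
        simp only [MonoidalCategory.tensorHom_def]
        monoidal
    _ = _ := by
        have h : (annulusLeft F F' f ⊗ₘ annulusRight G G' q) =
            ((α_ _ _ _).inv ⊗ₘ (α_ _ _ _).hom) ≫ (((F ▷ rᘁ) ⊗ₘ (r ◁ G)) ≫
              ((α_ _ _ _).hom ⊗ₘ (α_ _ _ _).inv) ≫ ((y ◁ f) ⊗ₘ (q ▷ vv)) ≫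
              (dag F' ⊗ₘ dag G')) := by
          simp only [annulusLeft, annulusRight, MonoidalCategory.tensorHom_comp_tensorHom]
        rw [whiskers_comp_cup, h]
        simp only [MonoidalCategory.tensorHom_def]
        monoidal

/-- Closing the outer strings leaves once more an exchange of `r`, now between the strands `j` and
`g` at the lower left: the string has become a loop through all four sides of the annulus. -/
lemma ptr_annulusMid_exch {r : C} (D : SphericalDual w) (E : SphericalDual v')
    (F : w ⊗ j ⟶ y ⊗ i) (G : g ⊗ v' ⟶ h ⊗ vv) (F' : w ⊗ n ⟶ y ⊗ m)
    (G' : k ⊗ v' ⟶ l ⊗ vv) (f : i ⊗ rᘁ ⟶ m) (q : r ⊗ h ⟶ l) :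
    ptrR E (ptrL D (annulusMid F G F' G' (exch f q))) =
      exch (ptrL D (annulusLeft F F' f)) (ptrR E (annulusRight G G' q)) := by
  rw [annulusMid_exch, ← whiskerLeft_comp_ptrL, ← whiskerRight_comp_ptrR,
    ptrR_ptrL_tensor D E (annulusLeft F F' f) (annulusRight G G' q)]
  dsimp only [exch]
  simp only [MonoidalCategory.tensorHom_def]
  monoidal

lemma tr_annulusMid (D : SphericalDual w) (E : SphericalDual v')
    (F : w ⊗ j ⟶ y ⊗ i) (G : g ⊗ v' ⟶ h ⊗ vv) (F' : w ⊗ n ⟶ y ⊗ m)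
    (G' : k ⊗ v' ⟶ l ⊗ vv) (M : i ⊗ h ⟶ m ⊗ l) (N : n ⊗ k ⟶ j ⊗ g) :
    tr (annulusMid F G F' G' M ≫ w ◁ (N ▷ v')) =
      tr (ptrR E (ptrL D (annulusMid F G F' G' M)) ≫ N) := by
  rw [ptrR_comp_whiskerRight, tr_ptrR, ptrL_comp_whiskerLeft, tr_ptrL]

/-- `tr (annulusMid M ≫ N)` as a linear functional of `M`. -/
def annulusFunctional (F : w ⊗ j ⟶ y ⊗ i) (G : g ⊗ v' ⟶ h ⊗ vv) (F' : w ⊗ n ⟶ y ⊗ m)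
    (G' : k ⊗ v' ⟶ l ⊗ vv) (N : n ⊗ k ⟶ j ⊗ g) : (i ⊗ h ⟶ m ⊗ l) →ₗ[ℂ] ℂ where
  toFun M := tr (annulusMid F G F' G' M ≫ w ◁ (N ▷ v'))
  map_add' M M' := by
    simp only [annulusMid, monoidalComp, MonoidalPreadditive.whiskerLeft_add,
      MonoidalPreadditive.add_whiskerRight, Preadditive.add_comp, Preadditive.comp_add, tr_add]
  map_smul' c M := by
    simp only [annulusMid, monoidalComp, MonoidalLinear.whiskerLeft_smul,
      MonoidalLinear.smul_whiskerRight, Linear.smul_comp, Linear.comp_smul, tr_smul,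
      RingHom.id_apply, smul_eq_mul]

end Annulus

/-! ### The annulus as a sum of products of four closed diagrams -/

section AnnulusSum

variable {X : Type u₂} [Category.{v₂} X] [Abelian X] [Linear ℂ X] [MonoidalCategory X]
  [MonoidalPreadditive X] [MonoidalLinear ℂ X] [RightRigidCategory X] [UnitaryFusionCategory X]

variable {w v' y vv : X} {j g n k i h m l : Irr X}

lemma tr_ptr_annulusMid_exch (D : SphericalDual w) (E : SphericalDual v') {r : Irr X}
    (F : w ⊗ j.obj ⟶ y ⊗ i.obj) (G : g.obj ⊗ v' ⟶ h.obj ⊗ vv) (F' : w ⊗ n.obj ⟶ y ⊗ m.obj)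
    (G' : k.obj ⊗ v' ⟶ l.obj ⊗ vv) (N : n.obj ⊗ k.obj ⟶ j.obj ⊗ g.obj)
    (f : i.obj ⊗ r.objᘁ ⟶ m.obj) (q : r.obj ⊗ h.obj ⟶ l.obj) :
    tr (annulusMid F G F' G' (exch f q) ≫ w ◁ (N ▷ v')) =
      ∑ o : IdxR j r n, ∑ e : IdxL r g k,
        (((1 / √(j.d * r.d * n.d : ℝ) : ℝ) : ℂ) * ((1 / √(r.d * g.d * k.d : ℝ) : ℝ) : ℂ)) *
        (tr (w ◁ dag (nodeR o) ≫ annulusLeft F F' f) *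
          tr (dag (nodeL e) ▷ v' ≫ annulusRight G G' q) * tr (exch (nodeR o) (nodeL e) ≫ N)) := by
  rw [tr_annulusMid D E, ptr_annulusMid_exch, ← exchₗ_apply, eq_sum_nodeR (ptrL D _),
    eq_sum_nodeL (ptrR E _)]
  simp only [map_sum, map_smul, LinearMap.sum_apply, LinearMap.smul_apply, exchₗ_apply,
    Finset.smul_sum, smul_smul, Preadditive.sum_comp, Linear.smul_comp]
  rw [Finset.sum_comm]
  let T : (j.obj ⊗ g.obj ⟶ j.obj ⊗ g.obj) →ₗ[ℂ] ℂ :=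
    { toFun := tr, map_add' := tr_add, map_smul' := tr_smul }
  change T _ = _
  rw [map_sum]
  refine Finset.sum_congr rfl fun o _ => ?_
  rw [map_sum]
  refine Finset.sum_congr rfl fun e _ => ?_
  rw [map_smul]
  change _ * tr _ = _
  rw [ptrL_comp_whiskerLeft, tr_ptrL, ptrR_comp_whiskerRight, tr_ptrR, tr_comp _ (w ◁ _),
    tr_comp _ (dag _ ▷ v')]
  ring

/-- The exchange basis resolves the upper right piece, which introduces `r`, `q` and `f`; the two
closed halves are then expanded in nodes, which introduces `o` and `e`. Every node occurs once as
itself and once as its dagger, as in the definition of `B_p`. -/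
lemma tr_annulusMid_eq_sum (D : SphericalDual w) (E : SphericalDual v')
    (F : w ⊗ j.obj ⟶ y ⊗ i.obj) (G : g.obj ⊗ v' ⟶ h.obj ⊗ vv) (F' : w ⊗ n.obj ⟶ y ⊗ m.obj)
    (G' : k.obj ⊗ v' ⟶ l.obj ⊗ vv) (M : i.obj ⊗ h.obj ⟶ m.obj ⊗ l.obj)
    (N : n.obj ⊗ k.obj ⟶ j.obj ⊗ g.obj) :
    tr (annulusMid F G F' G' M ≫ w ◁ (N ▷ v')) =
      ∑ r : Irr X, ∑ q : IdxL r h l, ∑ f : IdxR i r m, ∑ o : IdxR j r n, ∑ e : IdxL r g k,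
        (((1 / √(i.d * h.d * m.d * l.d : ℝ) : ℝ) : ℂ) *
          ((1 / √(j.d * r.d * n.d : ℝ) : ℝ) : ℂ) * ((1 / √(r.d * g.d * k.d : ℝ) : ℝ) : ℂ)) *
        (tr (exch (nodeR o) (nodeL e) ≫ N) * tr (dag (nodeL e) ▷ v' ≫ annulusRight G G' (nodeL q)) *
          tr (w ◁ dag (nodeR o) ≫ annulusLeft F F' (nodeR f)) *
          tr (dag (exch (nodeR f) (nodeL q)) ≫ M)) := by
  change annulusFunctional F G F' G' N M = _
  conv_lhs => rw [eq_sum_exch M]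
  simp only [map_sum, map_smul]
  refine Finset.sum_congr rfl fun r _ => Finset.sum_congr rfl fun q _ =>
    Finset.sum_congr rfl fun f _ => ?_
  change _ • tr _ = _
  rw [tr_ptr_annulusMid_exch D E, Finset.smul_sum]
  refine Finset.sum_congr rfl fun o _ => ?_
  rw [Finset.smul_sum]
  refine Finset.sum_congr rfl fun e _ => ?_
  rw [smul_eq_mul, tr_comp M]
  ring

end AnnulusSum

/-! ### The four corners -/

section Corners

variable {C : Type u} [Category.{v} C] [Abelian C] [Linear ℂ C] [MonoidalCategory C]
  [MonoidalPreadditive C] [MonoidalLinear ℂ C] [RightRigidCategory C] [UnitaryFusionCategory C]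

variable {a b c d s t u v' w x y z g h i j k l m n r : C}

/-- The lower right corner, with the loop `r` fused into the edges by `E` and `q`. -/
def cor₂₁ (H : HalfBraiding b) (ψ : b ⊗ (g ⊗ u) ⟶ h ⊗ v') (E : k ⟶ r ⊗ g) (q : r ⊗ h ⟶ l) :
    b ⊗ (k ⊗ u) ⟶ l ⊗ v' :=
  b ◁ (E ▷ u) ⊗≫ (H.β r).hom ▷ (g ⊗ u) ⊗≫ r ◁ ψ ⊗≫ q ▷ v'

/-- The upper left corner, with the loop fused into the edges by `O` and `f`. -/
def cor₁₂ {r' : C} (ψ : d ⊗ (z ⊗ j) ⟶ y ⊗ i) (O : n ⟶ j ⊗ r') (f : i ⊗ r' ⟶ m) :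
    d ⊗ (z ⊗ n) ⟶ y ⊗ m :=
  d ◁ (z ◁ O) ⊗≫ ψ ▷ r' ⊗≫ y ◁ f

/-- The plaquette with given corners, drawn in the plane. -/
def planarGlue (βi : g ⊗ b ⟶ b ⊗ g) (ξ₁₁ : a ⊗ (s ⊗ t) ⟶ j ⊗ g) (ξ₂₁ : b ⊗ (g ⊗ u) ⟶ h ⊗ v')
    (ξ₁₂ : d ⊗ (z ⊗ j) ⟶ y ⊗ i) (ξ₂₂ : c ⊗ (i ⊗ h) ⟶ x ⊗ w) :
    d ⊗ (z ⊗ (a ⊗ (s ⊗ (t ⊗ (b ⊗ u))))) ⟶ y ⊗ (cᘁ ⊗ (x ⊗ (w ⊗ v'))) :=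
  𝟙 _ ⊗≫ d ◁ z ◁ ξ₁₁ ▷ (b ⊗ u) ⊗≫ d ◁ z ◁ j ◁ βi ▷ u ⊗≫
    (d ⊗ (z ⊗ j)) ◁ ξ₂₁ ⊗≫ ξ₁₂ ▷ (h ⊗ v') ⊗≫ y ◁ dag (ε_ c cᘁ) ▷ (i ⊗ (h ⊗ v')) ⊗≫ y ◁ cᘁ ◁ ξ₂₂ ▷ v' ⊗≫ 𝟙 _

/-- The upper left corner of the annular diagram. -/
def annF (ξ₁₂ : d ⊗ (z ⊗ j) ⟶ y ⊗ i) : (d ⊗ z) ⊗ j ⟶ y ⊗ i := (α_ _ _ _).hom ≫ ξ₁₂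

/-- The lower right corner of the annular diagram. -/
def annG (βi : g ⊗ b ⟶ b ⊗ g) (ξ₂₁ : b ⊗ (g ⊗ u) ⟶ h ⊗ v') : g ⊗ (b ⊗ u) ⟶ h ⊗ v' :=
  (α_ _ _ _).inv ≫ βi ▷ u ≫ (α_ _ _ _).hom ≫ ξ₂₁

lemma dag_planarGlue (βi : g ⊗ b ⟶ b ⊗ g) (ξ₁₁ : a ⊗ (s ⊗ t) ⟶ j ⊗ g)
    (ξ₂₁ : b ⊗ (g ⊗ u) ⟶ h ⊗ v') (ξ₁₂ : d ⊗ (z ⊗ j) ⟶ y ⊗ i) (ξ₂₂ : c ⊗ (i ⊗ h) ⟶ x ⊗ w) :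
    dag (planarGlue βi ξ₁₁ ξ₂₁ ξ₁₂ ξ₂₂) =
      𝟙 _ ⊗≫ y ◁ cᘁ ◁ dag ξ₂₂ ▷ v' ⊗≫ y ◁ ε_ c cᘁ ▷ (i ⊗ (h ⊗ v')) ⊗≫ dag ξ₁₂ ▷ (h ⊗ v') ⊗≫
        (d ⊗ (z ⊗ j)) ◁ dag ξ₂₁ ⊗≫ d ◁ z ◁ j ◁ dag βi ▷ u ⊗≫ d ◁ z ◁ dag ξ₁₁ ▷ (b ⊗ u) ⊗≫
        𝟙 _ := by
  simp only [planarGlue, monoidalComp, MonoidalCoherence.refl_iso,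
    MonoidalCoherence.whiskerLeft_iso, MonoidalCoherence.whiskerRight_iso,
    MonoidalCoherence.left_iso, MonoidalCoherence.left'_iso, MonoidalCoherence.assoc_iso, MonoidalCoherence.assoc'_iso,
    dag_comp, dag_whiskerLeft, dag_whiskerRight, dag_dag,
    dag_id, Iso.refl_hom, Iso.trans_hom, whiskerLeftIso_hom, whiskerRightIso_hom, Iso.symm_hom,
    dag_associator, dag_associator_inv, dag_leftUnitor_inv]
  monoidal

/-- The cup and the cap of `c` close up around the two upper right corners, giving a left partial
trace. Cyclicity moves `ξ₁₁` behind `η₁₁†`, so that the two lower left corners meet as well. -/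
lemma tr_planarGlue {g' h' i' j' : C} (βi : g ⊗ b ⟶ b ⊗ g) (ξ₁₁ : a ⊗ (s ⊗ t) ⟶ j ⊗ g)
    (ξ₂₁ : b ⊗ (g ⊗ u) ⟶ h ⊗ v') (ξ₁₂ : d ⊗ (z ⊗ j) ⟶ y ⊗ i) (ξ₂₂ : c ⊗ (i ⊗ h) ⟶ x ⊗ w)
    (βi' : g' ⊗ b ⟶ b ⊗ g') (η₁₁ : a ⊗ (s ⊗ t) ⟶ j' ⊗ g')
    (η₂₁ : b ⊗ (g' ⊗ u) ⟶ h' ⊗ v') (η₁₂ : d ⊗ (z ⊗ j') ⟶ y ⊗ i')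
    (η₂₂ : c ⊗ (i' ⊗ h') ⟶ x ⊗ w) :
    tr (planarGlue βi ξ₁₁ ξ₂₁ ξ₁₂ ξ₂₂ ≫ dag (planarGlue βi' η₁₁ η₂₁ η₁₂ η₂₂)) =
      tr (annulusMid (annF ξ₁₂) (annG βi ξ₂₁) (annF η₁₂) (annG βi' η₂₁)
        (ptrL (.chosen c) (ξ₂₂ ≫ dag η₂₂)) ≫ (d ⊗ z) ◁ ((dag η₁₁ ≫ ξ₁₁) ▷ (b ⊗ u))) := by
  have h1 : dag (annF η₁₂) = dag η₁₂ ≫ (α_ _ _ _).inv := by simp [annF]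
  have h2 : dag (annG βi' η₂₁) = dag η₂₁ ≫ (α_ _ _ _).inv ≫ dag βi' ▷ u ≫ (α_ _ _ _).hom := by
    simp [annG]
  rw [dag_planarGlue]
  trans tr ((𝟙 _ ⊗≫ d ◁ z ◁ ξ₁₁ ▷ (b ⊗ u) ⊗≫ 𝟙 ((d ⊗ z) ⊗ ((j ⊗ g) ⊗ (b ⊗ u)))) ≫
    annulusMid (annF ξ₁₂) (annG βi ξ₂₁) (annF η₁₂) (annG βi' η₂₁)
        (ptrL (.chosen c) (ξ₂₂ ≫ dag η₂₂)) ≫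
      (𝟙 ((d ⊗ z) ⊗ ((j' ⊗ g') ⊗ (b ⊗ u))) ⊗≫ d ◁ z ◁ dag η₁₁ ▷ (b ⊗ u) ⊗≫
        𝟙 (d ⊗ (z ⊗ (a ⊗ (s ⊗ (t ⊗ (b ⊗ u))))))))
  · congr 1
    dsimp only [annulusMid, planarGlue]
    rw [MonoidalCategory.tensorHom_def' (annF ξ₁₂), MonoidalCategory.tensorHom_def (dag (annF η₁₂)),
      h1, h2]
    dsimp only [annF, annG, ptrL]
    monoidal
  · rw [tr_comp, Category.assoc]
    congr 2
    monoidal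

lemma halfBraiding_comp_whiskerRight (H : HalfBraiding b) {r g k : C} (E : k ⟶ r ⊗ g) :
    (H.β k).hom ≫ E ▷ b =
      b ◁ E ≫ (α_ _ _ _).inv ≫ (H.β r).hom ▷ g ≫ (α_ _ _ _).hom ≫ r ◁ (H.β g).hom ≫
        (α_ _ _ _).inv := by
  rw [← H.naturality, H.monoidal]

/-- Cyclicity brings the crossing of `b` under `k` to the node `E : k ⟶ r ⊗ g`. Passing the node
splits it into crossings under `r` and under `g`; the second cancels the crossing drawn in `ξ`, and
the first is the one in the corner operator. -/
lemma tr_cor₂₁ (H : HalfBraiding b) {βi' : k ⊗ b ⟶ b ⊗ k} (hβ : dag βi' = (H.β k).hom)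
    (ξ : b ⊗ (g ⊗ u) ⟶ h ⊗ v') (η : b ⊗ (k ⊗ u) ⟶ l ⊗ v') (E : k ⟶ r ⊗ g) (q : r ⊗ h ⟶ l) :
    tr (E ▷ (b ⊗ u) ≫ annulusRight (annG (H.β g).inv ξ) (annG βi' η) q) =
      tr (cor₂₁ H ξ E q ≫ dag η) := by
  have h2 : dag (annG βi' η) = dag η ≫ (α_ _ _ _).inv ≫ (H.β k).hom ▷ u ≫ (α_ _ _ _).hom := by
    simp [annG, hβ]
  have h3 : cor₂₁ H ξ E q = (α_ _ _ _).inv ≫ ((H.β k).hom ≫ E ▷ b) ▷ u ≫ (α_ _ _ _).hom ≫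
      (α_ _ _ _).hom ≫ r ◁ (annG (H.β g).inv ξ) ≫ (α_ _ _ _).inv ≫ q ▷ v' := by
    rw [halfBraiding_comp_whiskerRight]
    -- Insert a crossing of `b` with `g` followed by its inverse.
    trans 𝟙 _ ⊗≫ b ◁ E ▷ u ⊗≫ (H.β r).hom ▷ (g ⊗ u) ⊗≫
      r ◁ ((H.β g).hom ≫ (H.β g).inv) ▷ u ⊗≫ r ◁ ξ ⊗≫ q ▷ v'
    · rw [Iso.hom_inv_id]
      dsimp only [cor₂₁]
      monoidal
    · dsimp only [annG]
      monoidal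
  rw [h3]
  trans tr ((E ▷ (b ⊗ u) ≫ (α_ _ _ _).hom ≫ r ◁ (annG (H.β g).inv ξ) ≫ (α_ _ _ _).inv ≫ q ▷ v' ≫
    dag η) ≫ ((α_ _ _ _).inv ≫ (H.β k).hom ▷ u ≫ (α_ _ _ _).hom))
  · dsimp only [annulusRight]
    rw [h2]
    simp only [Category.assoc]
  · rw [tr_comp]
    congr 1
    simp only [Category.assoc, comp_whiskerRight]
    monoidal

lemma tr_cor₁₂ {r : C} (ξ : d ⊗ (z ⊗ j) ⟶ y ⊗ i) (η : d ⊗ (z ⊗ n) ⟶ y ⊗ m) (O : n ⟶ j ⊗ rᘁ)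
    (f : i ⊗ rᘁ ⟶ m) :
    tr ((d ⊗ z) ◁ O ≫ annulusLeft (annF ξ) (annF η) f) = tr (cor₁₂ ξ O f ≫ dag η) := by
  have h2 : dag (annF η) = dag η ≫ (α_ _ _ _).inv := by simp [annF]
  trans tr (((d ⊗ z) ◁ O ≫ (α_ _ _ _).inv ≫ annF ξ ▷ rᘁ ≫ (α_ _ _ _).hom ≫ y ◁ f ≫ dag η) ≫
    (α_ _ _ _).inv)
  · dsimp only [annulusLeft]
    rw [h2]
    simp only [Category.assoc]
  · rw [tr_comp]
    congr 1
    dsimp only [cor₁₂, annF]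
    monoidal

lemma tr_cor₂₂ (W : m ⊗ l ⟶ i ⊗ h) (ξ : c ⊗ (i ⊗ h) ⟶ x ⊗ w) (η : c ⊗ (m ⊗ l) ⟶ x ⊗ w) :
    tr (W ≫ ptrL (.chosen c) (ξ ≫ dag η)) = tr ((c ◁ W ≫ ξ) ≫ dag η) := by
  rw [whiskerLeft_comp_ptrL, tr_ptrL, Category.assoc]

lemma tr_cor₁₁ (W : j ⊗ g ⟶ n ⊗ k) (ξ : a ⊗ (s ⊗ t) ⟶ j ⊗ g) (η : a ⊗ (s ⊗ t) ⟶ n ⊗ k) :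
    tr (W ≫ dag η ≫ ξ) = tr ((ξ ≫ W) ≫ dag η) := by
  rw [← Category.assoc, tr_comp, Category.assoc]

end Corners

/-! ### The matrix element of a plaquette operator at four corners -/

section PlanarSum

variable {X : Type u₂} [Category.{v₂} X] [Abelian X] [Linear ℂ X] [MonoidalCategory X]
  [MonoidalPreadditive X] [MonoidalLinear ℂ X] [RightRigidCategory X] [UnitaryFusionCategory X]

lemma sum_rotate {α β γ δ M : Type*} [Fintype α] [Fintype β] [Fintype γ] [Fintype δ]
    [AddCommMonoid M] (F : α → β → γ → δ → M) :
    ∑ a, ∑ b, ∑ c, ∑ d, F a b c d = ∑ d, ∑ a, ∑ b, ∑ c, F a b c d := by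
  simp only [Finset.sum_comm (γ := δ)]

/-- Collects the normalizations of the exchange basis and of the nodes `o` and `e`. Only `r` occurs
twice under the roots, so it comes out as `1 / r`. -/
lemma inv_sqrt_mul_inv_sqrt {g h i j k l m n r : ℝ} (hh : 0 < h) (hi : 0 < i)
    (hj : 0 < j) (hl : 0 < l) (hm : 0 < m) (hn : 0 < n) (hr : 0 < r) :
    1 / √(i * h * m * l) * (1 / √(j * r * n)) * (1 / √(r * g * k)) =
      1 / (r * √(g * h * i * j * (k * l * m * n))) := by
  rw [one_div_mul_one_div, one_div_mul_one_div, ← Real.sqrt_mul (by positivity),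
    ← Real.sqrt_mul (by positivity)]
  congr 1
  rw [show i * h * m * l * (j * r * n) * (r * g * k) =
    r ^ 2 * (g * h * i * j * (k * l * m * n)) by ring, Real.sqrt_mul (by positivity),
    Real.sqrt_sq hr.le]

variable {a b c d x y z w s t u v' : X} {g h i j k l m n : Irr X}

lemma tr_planarGlue_eq_sum (H : HalfBraiding b) (hH : ∀ x, dag (H.β x).inv = (H.β x).hom)
    (ξ₁₁ : a ⊗ (s ⊗ t) ⟶ j.obj ⊗ g.obj) (ξ₂₁ : b ⊗ (g.obj ⊗ u) ⟶ h.obj ⊗ v')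
    (ξ₁₂ : d ⊗ (z ⊗ j.obj) ⟶ y ⊗ i.obj) (ξ₂₂ : c ⊗ (i.obj ⊗ h.obj) ⟶ x ⊗ w)
    (η₁₁ : a ⊗ (s ⊗ t) ⟶ n.obj ⊗ k.obj) (η₂₁ : b ⊗ (k.obj ⊗ u) ⟶ l.obj ⊗ v')
    (η₁₂ : d ⊗ (z ⊗ n.obj) ⟶ y ⊗ m.obj) (η₂₂ : c ⊗ (m.obj ⊗ l.obj) ⟶ x ⊗ w) :
    tr (planarGlue (H.β g.obj).inv ξ₁₁ ξ₂₁ ξ₁₂ ξ₂₂ ≫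
      dag (planarGlue (H.β k.obj).inv η₁₁ η₂₁ η₁₂ η₂₂)) =
    ∑ r : Irr X,
      ((1 / (r.d * √(g.d * h.d * i.d * j.d * (k.d * l.d * m.d * n.d) : ℝ)) : ℝ) : ℂ) *
      ∑ e : IdxL r g k, ∑ q : IdxL r h l, ∑ f : IdxR i r m, ∑ o : IdxR j r n,
        tr ((ξ₁₁ ≫ exch (nodeR o) (nodeL e)) ≫ dag η₁₁) *
        tr (cor₂₁ H ξ₂₁ (dag (nodeL e)) (nodeL q) ≫ dag η₂₁) *
        tr (cor₁₂ ξ₁₂ (dag (nodeR o)) (nodeR f) ≫ dag η₁₂) *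
        tr ((c ◁ dag (exch (nodeR f) (nodeL q)) ≫ ξ₂₂) ≫ dag η₂₂) := by
  rw [tr_planarGlue, tr_annulusMid_eq_sum (.chosen _) (.chosen _)]
  refine Finset.sum_congr rfl fun r _ => ?_
  rw [← inv_sqrt_mul_inv_sqrt h.d.2 i.d.2 j.d.2 l.d.2 m.d.2 n.d.2 r.d.2]
  push_cast
  simp only [tr_cor₁₁, tr_cor₂₁ H (hH _), tr_cor₁₂, tr_cor₂₂, Finset.mul_sum]
  rw [sum_rotate]

end PlanarSum

/-! ### The corner operators on homogeneous vectors -/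

section CornerSingle

variable {A : Type u₁} [Category.{v₁} A] [Abelian A] [Linear ℂ A] [MonoidalCategory A]
  [MonoidalPreadditive A] [MonoidalLinear ℂ A] [RightRigidCategory A] [UnitaryFusionCategory A]
  [BraidedCategory A]
  {X : Type u₂} [Category.{v₂} X] [Abelian X] [Linear ℂ X] [MonoidalCategory X]
  [MonoidalPreadditive X] [MonoidalLinear ℂ X] [RightRigidCategory X] [UnitaryFusionCategory X]
  (Φ : Enrichment A X)

/-- The half-braiding of `Φ(a)`. -/
abbrev Enrichment.hb (a : Irr A) : HalfBraiding (Φ.obj a) := (Φ.toCenter.obj a.obj).2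

lemma Enrichment.dag_hb_inv (a : Irr A) (x : X) :
    dag ((Φ.hb a).β x).inv = ((Φ.hb a).β x).hom := by
  rw [← dag_dag ((Φ.hb a).β x).hom]
  exact congrArg dag (Φ.dag_halfBraiding a.obj x).symm

variable {Φ}

/-- The homogeneous vector with label `L` given by the morphism `f`. -/
def hvec (L : XLabel A X) (f : Φ.obj L.a ⊗ (L.x₁.obj ⊗ L.y₁.obj) ⟶ L.y₂.obj ⊗ L.x₂.obj) : HX Φ :=
  PiLp.single 2 L (show XHom Φ L from f)

/-- A component at `M'` reads the input at `σ M'`, so every `M'` with `σ M' = σ M` could receive a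
contribution. For the corner operators the factors `Irr.δ` supply `hF` and leave only the intended
target label. -/
lemma localOp_single (σ : XLabel A X → XLabel A X) (F : ∀ L, XHom Φ (σ L) →ₗ[ℂ] XHom Φ L)
    (M : XLabel A X) (ψ : XHom Φ (σ M)) (hF : ∀ M', σ M' = σ M → M' ≠ M → F M' = 0) :
    localOp Φ σ F (PiLp.single 2 (σ M) ψ) = PiLp.single 2 M (F M ψ) := by
  ext M'
  change F M' (PiLp.single 2 (σ M) ψ (σ M')) = _
  by_cases h : M' = M
  · subst h
    rw [PiLp.single_eq_same, PiLp.single_eq_same]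
  · rw [PiLp.single_eq_of_ne _ h]
    by_cases h2 : σ M' = σ M
    · rw [hF M' h2 h, LinearMap.zero_apply]
    · rw [PiLp.single_eq_of_ne _ h2, map_zero]

lemma localOp_single_of_ne (σ : XLabel A X → XLabel A X)
    (F : ∀ L, XHom Φ (σ L) →ₗ[ℂ] XHom Φ L) (L : XLabel A X) (ψ : XHom Φ L)
    (hL : ∀ M, σ M ≠ L) : localOp Φ σ F (PiLp.single 2 L ψ) = 0 := by
  ext M'
  change F M' (PiLp.single 2 L ψ (σ M')) = _
  rw [PiLp.single_eq_of_ne _ (hL M'), map_zero]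
  rfl

variable {a : Irr A} {s t x y g h i j k l m n r : Irr X}

lemma corner₁₁_hvec (o : IdxR j r n) (e : IdxL r g k)
    (ψ : Φ.obj a ⊗ (s.obj ⊗ t.obj) ⟶ j.obj ⊗ g.obj) :
    corner₁₁ Φ o e (hvec ⟨a, s, t, j, g⟩ ψ) =
      hvec ⟨a, s, t, n, k⟩ (ψ ≫ exch (nodeR o) (nodeL e)) := by
  refine (localOp_single (fun L => { L with y₂ := j, x₂ := g }) _ ⟨a, s, t, n, k⟩ ψ ?_).trans ?_
  · rintro ⟨a', s', t', n', k'⟩ h1 h2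
    simp only [ne_eq, XLabel.mk.injEq] at h1 h2
    ext ψ'
    change (_ ⊗≫ _ ⊗≫ ((nodeR o ≫ Irr.δ n n') ⊗ₘ (nodeL e ≫ Irr.δ k k'))) = 0
    by_cases hn : n = n'
    · have hk : k ≠ k' := by tauto
      simp [Irr.δ_ne hk, monoidalComp]
    · simp [Irr.δ_ne hn, monoidalComp]
  · dsimp only [hvec]
    congr 1
    change (ψ ⊗≫ _ ⊗≫ ((nodeR o ≫ Irr.δ n n) ⊗ₘ (nodeL e ≫ Irr.δ k k))) = _
    rw [Irr.δ_self, Irr.δ_self, Category.comp_id, Category.comp_id]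
    dsimp only [exch]
    simp only [MonoidalCategory.tensorHom_def]
    monoidal

lemma corner₁₁_hvec_of_ne (o : IdxR j r n) (e : IdxL r g k) (L : XLabel A X) (ψ)
    (h : ¬ (L.y₂ = j ∧ L.x₂ = g)) : corner₁₁ Φ o e (hvec L ψ) = 0 :=
  localOp_single_of_ne _ _ _ _ (by rintro M rfl; exact h ⟨rfl, rfl⟩)

lemma corner₂₁_hvec (e : IdxL r g k) (q : IdxL r h l)
    (ψ : Φ.obj a ⊗ (g.obj ⊗ t.obj) ⟶ h.obj ⊗ x.obj) :
    corner₂₁ Φ e q (hvec ⟨a, g, t, h, x⟩ ψ) =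
      hvec ⟨a, k, t, l, x⟩ (cor₂₁ (Φ.hb a) ψ (dag (nodeL e)) (nodeL q)) := by
  refine (localOp_single (fun L => { L with x₁ := g, y₂ := h }) _ ⟨a, k, t, l, x⟩ ψ ?_).trans ?_
  · rintro ⟨a', k', t', l', x'⟩ h1 h2
    simp only [ne_eq, XLabel.mk.injEq] at h1 h2
    ext ψ'
    change (_ ◁ ((Irr.δ k' k ≫ dag (nodeL e)) ▷ _) ⊗≫ _ ⊗≫ _ ⊗≫
      (nodeL q ≫ Irr.δ l l') ▷ _) = 0
    by_cases hn : k' = k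
    · have hk : l ≠ l' := by tauto
      simp [Irr.δ_ne hk, monoidalComp]
    · simp [Irr.δ_ne hn, monoidalComp]
  · dsimp only [hvec]
    congr 1
    change (_ ◁ ((Irr.δ k k ≫ dag (nodeL e)) ▷ _) ⊗≫ _ ⊗≫ _ ⊗≫
      (nodeL q ≫ Irr.δ l l) ▷ _) = _
    rw [Irr.δ_self, Irr.δ_self, Category.comp_id, Category.id_comp]
    rfl

lemma corner₂₁_hvec_of_ne (e : IdxL r g k) (q : IdxL r h l) (L : XLabel A X) (ψ)
    (hL : ¬ (L.x₁ = g ∧ L.y₂ = h)) : corner₂₁ Φ e q (hvec L ψ) = 0 :=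
  localOp_single_of_ne _ _ _ _ (by rintro M rfl; exact hL ⟨rfl, rfl⟩)

lemma corner₁₂_hvec (o : IdxR j r n) (f : IdxR i r m)
    (ψ : Φ.obj a ⊗ (s.obj ⊗ j.obj) ⟶ y.obj ⊗ i.obj) :
    corner₁₂ Φ o f (hvec ⟨a, s, j, y, i⟩ ψ) =
      hvec ⟨a, s, n, y, m⟩ (cor₁₂ ψ (dag (nodeR o)) (nodeR f)) := by
  refine (localOp_single (fun L => { L with y₁ := j, x₂ := i }) _ ⟨a, s, n, y, m⟩ ψ ?_).trans ?_
  · rintro ⟨a', s', n', y', m'⟩ h1 h2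
    simp only [ne_eq, XLabel.mk.injEq] at h1 h2
    ext ψ'
    change (_ ◁ (_ ◁ (Irr.δ n' n ≫ dag (nodeR o))) ⊗≫ _ ⊗≫ _ ◁ (nodeR f ≫ Irr.δ m m')) = 0
    by_cases hn : n' = n
    · have hk : m ≠ m' := by tauto
      simp [Irr.δ_ne hk, monoidalComp]
    · simp [Irr.δ_ne hn, monoidalComp]
  · dsimp only [hvec]
    congr 1
    change (_ ◁ (_ ◁ (Irr.δ n n ≫ dag (nodeR o))) ⊗≫ _ ⊗≫ _ ◁ (nodeR f ≫ Irr.δ m m)) = _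
    rw [Irr.δ_self, Irr.δ_self, Category.comp_id, Category.id_comp]
    rfl

lemma corner₁₂_hvec_of_ne (o : IdxR j r n) (f : IdxR i r m) (L : XLabel A X) (ψ)
    (hL : ¬ (L.y₁ = j ∧ L.x₂ = i)) : corner₁₂ Φ o f (hvec L ψ) = 0 :=
  localOp_single_of_ne _ _ _ _ (by rintro M rfl; exact hL ⟨rfl, rfl⟩)

lemma corner₂₂_hvec (f : IdxR i r m) (q : IdxL r h l)
    (ψ : Φ.obj a ⊗ (i.obj ⊗ h.obj) ⟶ y.obj ⊗ x.obj) :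
    corner₂₂ Φ f q (hvec ⟨a, i, h, y, x⟩ ψ) =
      hvec ⟨a, m, l, y, x⟩ (Φ.obj a ◁ dag (exch (nodeR f) (nodeL q)) ≫ ψ) := by
  refine (localOp_single (fun L => { L with x₁ := i, y₁ := h }) _ ⟨a, m, l, y, x⟩ ψ ?_).trans ?_
  · rintro ⟨a', m', l', y', x'⟩ h1 h2
    simp only [ne_eq, XLabel.mk.injEq] at h1 h2
    ext ψ'
    change (_ ◁ ((Irr.δ m' m ≫ dag (nodeR f)) ⊗ₘ (Irr.δ l' l ≫ dag (nodeL q))) ⊗≫ _ ⊗≫ _) = 0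
    by_cases hn : m' = m
    · have hk : l' ≠ l := by tauto
      simp [Irr.δ_ne hk, monoidalComp]
    · simp [Irr.δ_ne hn, monoidalComp]
  · dsimp only [hvec]
    congr 1
    change (_ ◁ ((Irr.δ m m ≫ dag (nodeR f)) ⊗ₘ (Irr.δ l l ≫ dag (nodeL q))) ⊗≫ _ ⊗≫ ψ) = _
    rw [Irr.δ_self, Irr.δ_self, Category.id_comp, Category.id_comp, dag_exch]
    simp only [MonoidalCategory.tensorHom_def]
    monoidal

lemma corner₂₂_hvec_of_ne (f : IdxR i r m) (q : IdxL r h l) (L : XLabel A X) (ψ)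
    (hL : ¬ (L.x₁ = i ∧ L.y₁ = h)) : corner₂₂ Φ f q (hvec L ψ) = 0 :=
  localOp_single_of_ne _ _ _ _ (by rintro M rfl; exact hL ⟨rfl, rfl⟩)

lemma inner_single (L : XLabel A X) (f : XHom Φ L) (ψ : HX Φ) :
    inner ℂ (PiLp.single 2 L f : HX Φ) ψ = inner ℂ f (ψ L) := by
  rw [PiLp.inner_apply, Finset.sum_eq_single L, PiLp.single_eq_same]
  · intro M _ hM
    rw [PiLp.single_eq_of_ne _ hM, inner_zero_left]
  · simp

lemma inner_hvec (L : XLabel A X) (f f') :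
    inner ℂ (hvec (Φ := Φ) L f) (hvec L f') =
      ((1 / √((L.a.d * L.x₁.d * L.y₁.d * L.y₂.d * L.x₂.d : {r : ℝ // 0 < r}) : ℝ) : ℝ) : ℂ) * 
        tr (f' ≫ dag f) := by
  rw [hvec, hvec, inner_single, PiLp.single_eq_same]
  rfl

lemma inner_hvec_of_ne {L L' : XLabel A X} (h : L ≠ L') (f f') :
    inner ℂ (hvec (Φ := Φ) L f) (hvec L' f') = 0 := by
  rw [hvec, hvec, inner_single, PiLp.single_eq_of_ne _ h, inner_zero_right]

end CornerSingle

/-! ### The matrix element of a plaquette operator at four corners -/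

section LocalCoeff

variable {A : Type u₁} [Category.{v₁} A] [Abelian A] [Linear ℂ A] [MonoidalCategory A]
  [MonoidalPreadditive A] [MonoidalLinear ℂ A] [RightRigidCategory A] [UnitaryFusionCategory A]
  [BraidedCategory A]
  {X : Type u₂} [Category.{v₂} X] [Abelian X] [Linear ℂ X] [MonoidalCategory X]
  [MonoidalPreadditive X] [MonoidalLinear ℂ X] [RightRigidCategory X] [UnitaryFusionCategory X]
  {Φ : Enrichment A X}

/-- The coefficient of the change of labels from `g, h, i, j` to `k, l, m, n` caused by a loop. -/
def loopCoeff (r g h i j k l m n : Irr X) : ℂ :=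
  ((√(k.d * l.d * m.d * n.d : ℝ) / (r.d * √(g.d * h.d * i.d * j.d : ℝ)) : ℝ) : ℂ)

/-- The contribution of fixed labels to a matrix element of a plaquette operator. -/
def localTerm (φ₁₁ φ₂₁ φ₁₂ φ₂₂ ψ₁₁ ψ₂₁ ψ₁₂ ψ₂₂ : HX Φ) (r g h i j k l m n : Irr X) : ℂ :=
  loopCoeff r g h i j k l m n *
    ∑ e : IdxL r g k, ∑ q : IdxL r h l, ∑ f : IdxR i r m, ∑ o : IdxR j r n,
      inner ℂ φ₁₁ (corner₁₁ Φ o e ψ₁₁) * inner ℂ φ₂₁ (corner₂₁ Φ e q ψ₂₁) *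
        inner ℂ φ₁₂ (corner₁₂ Φ o f ψ₁₂) * inner ℂ φ₂₂ (corner₂₂ Φ f q ψ₂₂)

/-- The factor of a matrix element of a plaquette operator coming from the four corners. -/
def localCoeff (φ₁₁ φ₂₁ φ₁₂ φ₂₂ ψ₁₁ ψ₂₁ ψ₁₂ ψ₂₂ : HX Φ) : ℂ :=
  ((1 / globalDim X : ℝ) : ℂ) *
    ∑ r : Irr X, ∑ g : Irr X, ∑ h : Irr X, ∑ i : Irr X, ∑ j : Irr X,
      ∑ k : Irr X, ∑ l : Irr X, ∑ m : Irr X, ∑ n : Irr X,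
        localTerm φ₁₁ φ₂₁ φ₁₂ φ₂₂ ψ₁₁ ψ₂₁ ψ₁₂ ψ₂₂ r g h i j k l m n

/-- Selection rule at a corner: the old labels of the two inner edges must be those of the nodes,
and the label of the output is then determined. -/
lemma inner_corner₁₁_ne_zero {r g j k n : Irr X} {o : IdxR j r n} {e : IdxL r g k}
    {L M : XLabel A X} {ξ η} (h : inner ℂ (hvec (Φ := Φ) M η) (corner₁₁ Φ o e (hvec L ξ)) ≠ 0) :
    L.y₂ = j ∧ L.x₂ = g ∧ M = { L with y₂ := n, x₂ := k } := by
  by_cases hL : L.y₂ = j ∧ L.x₂ = g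
  · obtain ⟨rfl, rfl⟩ := hL
    refine ⟨rfl, rfl, ?_⟩
    by_contra hM
    exact h ((congrArg _ (corner₁₁_hvec o e ξ)).trans (inner_hvec_of_ne hM _ _))
  · rw [corner₁₁_hvec_of_ne _ _ _ _ hL, inner_zero_right] at h
    exact absurd rfl h

lemma inner_corner₂₁_ne_zero {r g h k l : Irr X} {e : IdxL r g k} {q : IdxL r h l}
    {L M : XLabel A X} {ξ η} (hne : inner ℂ (hvec (Φ := Φ) M η) (corner₂₁ Φ e q (hvec L ξ)) ≠ 0) :
    L.x₁ = g ∧ L.y₂ = h ∧ M = { L with x₁ := k, y₂ := l } := by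
  by_cases hL : L.x₁ = g ∧ L.y₂ = h
  · obtain ⟨rfl, rfl⟩ := hL
    refine ⟨rfl, rfl, ?_⟩
    by_contra hM
    exact hne ((congrArg _ (corner₂₁_hvec e q ξ)).trans (inner_hvec_of_ne hM _ _))
  · rw [corner₂₁_hvec_of_ne _ _ _ _ hL, inner_zero_right] at hne
    exact absurd rfl hne

lemma inner_corner₁₂_ne_zero {r i j m n : Irr X} {o : IdxR j r n} {f : IdxR i r m}
    {L M : XLabel A X} {ξ η} (hne : inner ℂ (hvec (Φ := Φ) M η) (corner₁₂ Φ o f (hvec L ξ)) ≠ 0) :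
    L.y₁ = j ∧ L.x₂ = i ∧ M = { L with y₁ := n, x₂ := m } := by
  by_cases hL : L.y₁ = j ∧ L.x₂ = i
  · obtain ⟨rfl, rfl⟩ := hL
    refine ⟨rfl, rfl, ?_⟩
    by_contra hM
    exact hne ((congrArg _ (corner₁₂_hvec o f ξ)).trans (inner_hvec_of_ne hM _ _))
  · rw [corner₁₂_hvec_of_ne _ _ _ _ hL, inner_zero_right] at hne
    exact absurd rfl hne

lemma inner_corner₂₂_ne_zero {r h i l m : Irr X} {f : IdxR i r m} {q : IdxL r h l}
    {L M : XLabel A X} {ξ η} (hne : inner ℂ (hvec (Φ := Φ) M η) (corner₂₂ Φ f q (hvec L ξ)) ≠ 0) :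
    L.x₁ = i ∧ L.y₁ = h ∧ M = { L with x₁ := m, y₁ := l } := by
  by_cases hL : L.x₁ = i ∧ L.y₁ = h
  · obtain ⟨rfl, rfl⟩ := hL
    refine ⟨rfl, rfl, ?_⟩
    by_contra hM
    exact hne ((congrArg _ (corner₂₂_hvec f q ξ)).trans (inner_hvec_of_ne hM _ _))
  · rw [corner₂₂_hvec_of_ne _ _ _ _ hL, inner_zero_right] at hne
    exact absurd rfl hne

variable {L₁₁ L₂₁ L₁₂ L₂₂ M₁₁ M₂₁ M₁₂ M₂₂ : XLabel A X}

/-- The corners carry the labels of a plaquette whose edges change from `g, h, i, j` to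
`k, l, m, n`. -/
structure LoopLabels (L₁₁ L₂₁ L₁₂ L₂₂ M₁₁ M₂₁ M₁₂ M₂₂ : XLabel A X)
    (g h i j k l m n : Irr X) : Prop where
  g₁ : L₁₁.x₂ = g
  g₂ : L₂₁.x₁ = g
  h₁ : L₂₁.y₂ = h
  h₂ : L₂₂.y₁ = h
  i₁ : L₁₂.x₂ = i
  i₂ : L₂₂.x₁ = i
  j₁ : L₁₁.y₂ = j
  j₂ : L₁₂.y₁ = j
  M₁₁_eq : M₁₁ = { L₁₁ with y₂ := n, x₂ := k }
  M₂₁_eq : M₂₁ = { L₂₁ with x₁ := k, y₂ := l }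
  M₁₂_eq : M₁₂ = { L₁₂ with y₁ := n, x₂ := m }
  M₂₂_eq : M₂₂ = { L₂₂ with x₁ := m, y₁ := l }

lemma loopLabels_of_localTerm_ne_zero {ξ₁₁ ξ₂₁ ξ₁₂ ξ₂₂ η₁₁ η₂₁ η₁₂ η₂₂}
    {r g h i j k l m n : Irr X}
    (hne : localTerm (Φ := Φ) (hvec M₁₁ η₁₁) (hvec M₂₁ η₂₁) (hvec M₁₂ η₁₂) (hvec M₂₂ η₂₂)
      (hvec L₁₁ ξ₁₁) (hvec L₂₁ ξ₂₁) (hvec L₁₂ ξ₁₂) (hvec L₂₂ ξ₂₂) r g h i j k l m n ≠ 0) :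
    LoopLabels L₁₁ L₂₁ L₁₂ L₂₂ M₁₁ M₂₁ M₁₂ M₂₂ g h i j k l m n := by
  obtain ⟨e, -, he⟩ := Finset.exists_ne_zero_of_sum_ne_zero (right_ne_zero_of_mul hne)
  obtain ⟨q, -, hq⟩ := Finset.exists_ne_zero_of_sum_ne_zero he
  obtain ⟨f, -, hf⟩ := Finset.exists_ne_zero_of_sum_ne_zero hq
  obtain ⟨o, -, ho⟩ := Finset.exists_ne_zero_of_sum_ne_zero hf
  simp only [mul_ne_zero_iff] at ho
  obtain ⟨⟨⟨h11, h21⟩, h12⟩, h22⟩ := ho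
  obtain ⟨a1, a2, a3⟩ := inner_corner₁₁_ne_zero h11
  obtain ⟨b1, b2, b3⟩ := inner_corner₂₁_ne_zero h21
  obtain ⟨c1, c2, c3⟩ := inner_corner₁₂_ne_zero h12
  obtain ⟨d1, d2, d3⟩ := inner_corner₂₂_ne_zero h22
  exact ⟨a2, b1, b2, d2, c2, d1, a1, c1, a3, b3, c3, d3⟩

lemma loopLabels_of_localCoeff_ne_zero {ξ₁₁ ξ₂₁ ξ₁₂ ξ₂₂ η₁₁ η₂₁ η₁₂ η₂₂}
    (hne : localCoeff (Φ := Φ) (hvec M₁₁ η₁₁) (hvec M₂₁ η₂₁) (hvec M₁₂ η₁₂) (hvec M₂₂ η₂₂)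
      (hvec L₁₁ ξ₁₁) (hvec L₂₁ ξ₂₁) (hvec L₁₂ ξ₁₂) (hvec L₂₂ ξ₂₂) ≠ 0) :
    ∃ g h i j k l m n, LoopLabels L₁₁ L₂₁ L₁₂ L₂₂ M₁₁ M₂₁ M₁₂ M₂₂ g h i j k l m n := by
  obtain ⟨r, -, hr⟩ := Finset.exists_ne_zero_of_sum_ne_zero (right_ne_zero_of_mul hne)
  obtain ⟨g, -, hr⟩ := Finset.exists_ne_zero_of_sum_ne_zero hr
  obtain ⟨h, -, hr⟩ := Finset.exists_ne_zero_of_sum_ne_zero hr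
  obtain ⟨i, -, hr⟩ := Finset.exists_ne_zero_of_sum_ne_zero hr
  obtain ⟨j, -, hr⟩ := Finset.exists_ne_zero_of_sum_ne_zero hr
  obtain ⟨k, -, hr⟩ := Finset.exists_ne_zero_of_sum_ne_zero hr
  obtain ⟨l, -, hr⟩ := Finset.exists_ne_zero_of_sum_ne_zero hr
  obtain ⟨m, -, hr⟩ := Finset.exists_ne_zero_of_sum_ne_zero hr
  obtain ⟨n, -, hr⟩ := Finset.exists_ne_zero_of_sum_ne_zero hr
  exact ⟨g, h, i, j, k, l, m, n, loopLabels_of_localTerm_ne_zero hr⟩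

/-- The selection rules read all eight edge labels off the corners, so only the sum over the loop
label survives. -/
lemma localCoeff_eq_sum {ξ₁₁ ξ₂₁ ξ₁₂ ξ₂₂ η₁₁ η₂₁ η₁₂ η₂₂} {g h i j k l m n : Irr X}
    (H : LoopLabels L₁₁ L₂₁ L₁₂ L₂₂ M₁₁ M₂₁ M₁₂ M₂₂ g h i j k l m n) :
    localCoeff (Φ := Φ) (hvec M₁₁ η₁₁) (hvec M₂₁ η₂₁) (hvec M₁₂ η₁₂) (hvec M₂₂ η₂₂)
      (hvec L₁₁ ξ₁₁) (hvec L₂₁ ξ₂₁) (hvec L₁₂ ξ₁₂) (hvec L₂₂ ξ₂₂) =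
    ((1 / globalDim X : ℝ) : ℂ) * ∑ r : Irr X,
      localTerm (hvec M₁₁ η₁₁) (hvec M₂₁ η₂₁) (hvec M₁₂ η₁₂) (hvec M₂₂ η₂₂)
      (hvec L₁₁ ξ₁₁) (hvec L₂₁ ξ₂₁) (hvec L₁₂ ξ₁₂) (hvec L₂₂ ξ₂₂) r g h i j k l m n := by
  have key : ∀ r g' h' i' j' k' l' m' n', localTerm (Φ := Φ)
      (hvec M₁₁ η₁₁) (hvec M₂₁ η₂₁) (hvec M₁₂ η₁₂) (hvec M₂₂ η₂₂)
      (hvec L₁₁ ξ₁₁) (hvec L₂₁ ξ₂₁) (hvec L₁₂ ξ₁₂) (hvec L₂₂ ξ₂₂) r g' h' i' j' k' l' m' n' ≠ 0 →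
      g' = g ∧ h' = h ∧ i' = i ∧ j' = j ∧ k' = k ∧ l' = l ∧ m' = m ∧ n' = n := by
    intro r g' h' i' j' k' l' m' n' hne
    have H' := loopLabels_of_localTerm_ne_zero hne
    refine ⟨H'.g₁.symm.trans H.g₁, H'.h₁.symm.trans H.h₁, H'.i₁.symm.trans H.i₁,
      H'.j₁.symm.trans H.j₁, ?_, ?_, ?_, ?_⟩
    · simpa using congrArg XLabel.x₂ (H'.M₁₁_eq.symm.trans H.M₁₁_eq)
    · simpa using congrArg XLabel.y₂ (H'.M₂₁_eq.symm.trans H.M₂₁_eq)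
    · simpa using congrArg XLabel.x₂ (H'.M₁₂_eq.symm.trans H.M₁₂_eq)
    · simpa using congrArg XLabel.y₂ (H'.M₁₁_eq.symm.trans H.M₁₁_eq)
  rw [localCoeff]
  congr 1
  refine Finset.sum_congr rfl fun r _ => ?_
  rw [Finset.sum_eq_single g, Finset.sum_eq_single h, Finset.sum_eq_single i,
    Finset.sum_eq_single j, Finset.sum_eq_single k, Finset.sum_eq_single l,
    Finset.sum_eq_single m, Finset.sum_eq_single n]
  all_goals first
    | exact fun hn => absurd (Finset.mem_univ _) hn
    | (intro x _ hx
       repeat' refine Finset.sum_eq_zero fun _ _ => ?_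
       by_contra hne
       have := key _ _ _ _ _ _ _ _ _ hne
       tauto)

/-- Compares the loop coefficient times the normalizations of the four corner inner products with
the constant of the theorem times the constant of the cut annulus. -/
lemma localTerm_scalar {a b c d s t u v w x y z g h i j k l m n r : ℝ} (ha : 0 < a) (hb : 0 < b)
    (hc : 0 < c) (hd : 0 < d) (hs : 0 < s) (ht : 0 < t) (hu : 0 < u) (hv : 0 < v) (hw : 0 < w)
    (hx : 0 < x) (hy : 0 < y) (hz : 0 < z) (hg : 0 < g) (hh : 0 < h) (hi : 0 < i)
    (hj : 0 < j) (hk : 0 < k) (hl : 0 < l) (hm : 0 < m) (hn : 0 < n) (hr : 0 < r) :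
    √(k * l * m * n) / (r * √(g * h * i * j)) *
      (1 / √(a * s * t * n * k) * (1 / √(b * k * u * l * v)) * (1 / √(d * z * n * y * m)) *
        (1 / √(c * m * l * x * w))) =
    1 / √(a * b * c * d * s * t * u * v * w * x * y * z) *
      (1 / (r * √(g * h * i * j * (k * l * m * n)))) := by
  -- Each of the inner edges `k, l, m, n` ends at two corners, so their dimensions leave the root;
  -- each external edge ends at one.
  have e1 : √(a * s * t * n * k) * √(b * k * u * l * v) * √(d * z * n * y * m) *
      √(c * m * l * x * w) =
      √(a * b * c * d * s * t * u * v * w * x * y * z) * (√(k * l * m * n) * √(k * l * m * n)) := by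
    rw [← Real.sqrt_mul (by positivity), ← Real.sqrt_mul (by positivity),
      ← Real.sqrt_mul (by positivity), ← Real.sqrt_mul (by positivity),
      ← Real.sqrt_mul (by positivity)]
    congr 1
    ring
  rw [one_div_mul_one_div, one_div_mul_one_div, one_div_mul_one_div, e1,
    Real.sqrt_mul (by positivity : 0 ≤ g * h * i * j)]
  have : 0 < √(k * l * m * n) := Real.sqrt_pos.2 (by positivity)
  have : 0 < √(g * h * i * j) := Real.sqrt_pos.2 (by positivity)
  have : 0 < √(a * b * c * d * s * t * u * v * w * x * y * z) := Real.sqrt_pos.2 (by positivity)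
  generalize √(k * l * m * n) = K at *
  generalize √(g * h * i * j) = G at *
  generalize √(a * b * c * d * s * t * u * v * w * x * y * z) = E at *
  field_simp

variable {a b c d : Irr A} {s t u v w x y z g h i j k l m n : Irr X}

/-- The core of the theorem. Term by term in `r` and the nodes, the definition of `B_p` is the
expansion `tr_planarGlue_eq_sum` of the closed planar diagram. -/
lemma localCoeff_hvec (ξ₁₁ : Φ.obj a ⊗ (s.obj ⊗ t.obj) ⟶ j.obj ⊗ g.obj)
    (ξ₂₁ : Φ.obj b ⊗ (g.obj ⊗ u.obj) ⟶ h.obj ⊗ v.obj)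
    (ξ₁₂ : Φ.obj d ⊗ (z.obj ⊗ j.obj) ⟶ y.obj ⊗ i.obj)
    (ξ₂₂ : Φ.obj c ⊗ (i.obj ⊗ h.obj) ⟶ x.obj ⊗ w.obj)
    (η₁₁ : Φ.obj a ⊗ (s.obj ⊗ t.obj) ⟶ n.obj ⊗ k.obj)
    (η₂₁ : Φ.obj b ⊗ (k.obj ⊗ u.obj) ⟶ l.obj ⊗ v.obj)
    (η₁₂ : Φ.obj d ⊗ (z.obj ⊗ n.obj) ⟶ y.obj ⊗ m.obj)
    (η₂₂ : Φ.obj c ⊗ (m.obj ⊗ l.obj) ⟶ x.obj ⊗ w.obj) :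
    localCoeff (hvec ⟨a, s, t, n, k⟩ η₁₁) (hvec ⟨b, k, u, l, v⟩ η₂₁) (hvec ⟨d, z, n, y, m⟩ η₁₂)
      (hvec ⟨c, m, l, x, w⟩ η₂₂) (hvec ⟨a, s, t, j, g⟩ ξ₁₁) (hvec ⟨b, g, u, h, v⟩ ξ₂₁)
      (hvec ⟨d, z, j, y, i⟩ ξ₁₂) (hvec ⟨c, i, h, x, w⟩ ξ₂₂) =
    ((1 / (globalDim X * √(a.d * b.d * c.d * d.d * s.d * t.d * u.d * v.d * w.d * x.d * y.d *
      z.d : ℝ)) : ℝ) : ℂ) *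
    tr (planarGlue ((Φ.hb b).β g.obj).inv ξ₁₁ ξ₂₁ ξ₁₂ ξ₂₂ ≫
      dag (planarGlue ((Φ.hb b).β k.obj).inv η₁₁ η₂₁ η₁₂ η₂₂)) := by
  refine (localCoeff_eq_sum (g := g) (h := h) (i := i) (j := j) (k := k) (l := l) (m := m) (n := n)
    ⟨rfl, rfl, rfl, rfl, rfl, rfl, rfl, rfl, rfl, rfl, rfl, rfl⟩).trans ?_
  rw [tr_planarGlue_eq_sum (Φ.hb b) (Φ.dag_hb_inv b), ← one_div_mul_one_div, Complex.ofReal_mul,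
    mul_assoc]
  congr 1
  rw [Finset.mul_sum]
  refine Finset.sum_congr rfl fun r _ => ?_
  rw [← mul_assoc, ← Complex.ofReal_mul, ← localTerm_scalar a.d.2 b.d.2 c.d.2 d.d.2 s.d.2 t.d.2
    u.d.2 v.d.2 w.d.2 x.d.2 y.d.2 z.d.2 g.d.2 h.d.2 i.d.2 j.d.2 k.d.2 l.d.2 m.d.2 n.d.2 r.d.2,
    localTerm, loopCoeff, Complex.ofReal_mul, mul_assoc (Complex.ofReal _) (Complex.ofReal _) (∑ _, _)]
  congr 1
  dsimp only
  simp only [Finset.mul_sum, corner₁₁_hvec, corner₂₁_hvec, corner₁₂_hvec, corner₂₂_hvec,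
    inner_hvec]
  refine Finset.sum_congr rfl fun e _ => Finset.sum_congr rfl fun q _ =>
    Finset.sum_congr rfl fun f _ => Finset.sum_congr rfl fun o _ => ?_
  simp only [Positive.val_mul, Complex.ofReal_mul]
  ring

end LocalCoeff

/-! ### Fusing a loop into a plaquette does not change its evaluation -/

section Slide

variable {C : Type u} [Category.{v} C] [Abelian C] [Linear ℂ C] [MonoidalCategory C]
  [MonoidalPreadditive C] [MonoidalLinear ℂ C] [RightRigidCategory C] [UnitaryFusionCategory C]

variable {a b c d s t u v' w x y z g h i j k l m n r : C}

lemma halfBraiding_inv_naturality (H : HalfBraiding b) (e : g ⟶ k) :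
    e ▷ b ≫ (H.β k).inv = (H.β g).inv ≫ b ◁ e := by
  rw [Iso.eq_inv_comp, ← Category.assoc, ← H.naturality, Category.assoc, Iso.hom_inv_id,
    Category.comp_id]

/-- A morphism on an inner edge may be absorbed at either end of that edge; this is the first of
four such lemmas. On the bottom edge it has to pass over the string `b`. -/
lemma planarGlue_slide_g (H : HalfBraiding b) (ξ₁₁ : a ⊗ (s ⊗ t) ⟶ j ⊗ g) (e : g ⟶ k)
    (ξ₂₁ : b ⊗ (k ⊗ u) ⟶ h ⊗ v') (ξ₁₂ : d ⊗ (z ⊗ j) ⟶ y ⊗ i) (ξ₂₂ : c ⊗ (i ⊗ h) ⟶ x ⊗ w) :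
    planarGlue (H.β k).inv (ξ₁₁ ≫ j ◁ e) ξ₂₁ ξ₁₂ ξ₂₂ =
      planarGlue (H.β g).inv ξ₁₁ (b ◁ (e ▷ u) ≫ ξ₂₁) ξ₁₂ ξ₂₂ := by
  calc
    _ = 𝟙 _ ⊗≫ d ◁ z ◁ ξ₁₁ ▷ (b ⊗ u) ⊗≫ d ◁ z ◁ j ◁ (e ▷ b ≫ (H.β k).inv) ▷ u ⊗≫
        (d ⊗ (z ⊗ j)) ◁ ξ₂₁ ⊗≫ ξ₁₂ ▷ (h ⊗ v') ⊗≫ y ◁ dag (ε_ c cᘁ) ▷ (i ⊗ (h ⊗ v')) ⊗≫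
        y ◁ cᘁ ◁ ξ₂₂ ▷ v' ⊗≫ 𝟙 _ := by dsimp only [planarGlue]; monoidal
    _ = _ := by rw [halfBraiding_inv_naturality]; dsimp only [planarGlue]; monoidal

lemma planarGlue_slide_j (βi : g ⊗ b ⟶ b ⊗ g) (ξ₁₁ : a ⊗ (s ⊗ t) ⟶ j ⊗ g) (o : j ⟶ n)
    (ξ₂₁ : b ⊗ (g ⊗ u) ⟶ h ⊗ v') (ξ₁₂ : d ⊗ (z ⊗ n) ⟶ y ⊗ i) (ξ₂₂ : c ⊗ (i ⊗ h) ⟶ x ⊗ w) :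
    planarGlue βi (ξ₁₁ ≫ o ▷ g) ξ₂₁ ξ₁₂ ξ₂₂ =
      planarGlue βi ξ₁₁ ξ₂₁ (d ◁ (z ◁ o) ≫ ξ₁₂) ξ₂₂ := by
  calc
    _ = 𝟙 _ ⊗≫ d ◁ z ◁ ξ₁₁ ▷ (b ⊗ u) ⊗≫ (d ⊗ z) ◁ (o ▷ (g ⊗ (b ⊗ u)) ≫
          n ◁ ((α_ _ _ _).inv ≫ βi ▷ u ≫ (α_ _ _ _).hom ≫ ξ₂₁)) ⊗≫
        ξ₁₂ ▷ (h ⊗ v') ⊗≫ y ◁ dag (ε_ c cᘁ) ▷ (i ⊗ (h ⊗ v')) ⊗≫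
        y ◁ cᘁ ◁ ξ₂₂ ▷ v' ⊗≫ 𝟙 _ := by dsimp only [planarGlue]; monoidal
    _ = _ := by rw [← whisker_exchange]; dsimp only [planarGlue]; monoidal

lemma planarGlue_slide_i (βi : g ⊗ b ⟶ b ⊗ g) (ξ₁₁ : a ⊗ (s ⊗ t) ⟶ j ⊗ g)
    (ξ₂₁ : b ⊗ (g ⊗ u) ⟶ h ⊗ v') (ξ₁₂ : d ⊗ (z ⊗ j) ⟶ y ⊗ i) (f : i ⟶ m)
    (ξ₂₂ : c ⊗ (m ⊗ h) ⟶ x ⊗ w) :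
    planarGlue βi ξ₁₁ ξ₂₁ (ξ₁₂ ≫ y ◁ f) ξ₂₂ =
      planarGlue βi ξ₁₁ ξ₂₁ ξ₁₂ (c ◁ (f ▷ h) ≫ ξ₂₂) := by
  calc
    _ = 𝟙 _ ⊗≫ d ◁ z ◁ ξ₁₁ ▷ (b ⊗ u) ⊗≫ d ◁ z ◁ j ◁ βi ▷ u ⊗≫
        (d ⊗ (z ⊗ j)) ◁ ξ₂₁ ⊗≫ ξ₁₂ ▷ (h ⊗ v') ⊗≫
        y ◁ (𝟙_ C ◁ f ≫ dag (ε_ c cᘁ) ▷ m) ▷ (h ⊗ v') ⊗≫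
        y ◁ cᘁ ◁ ξ₂₂ ▷ v' ⊗≫ 𝟙 _ := by dsimp only [planarGlue]; monoidal
    _ = _ := by rw [whisker_exchange]; dsimp only [planarGlue]; monoidal

lemma planarGlue_slide_h (βi : g ⊗ b ⟶ b ⊗ g) (ξ₁₁ : a ⊗ (s ⊗ t) ⟶ j ⊗ g)
    (ξ₂₁ : b ⊗ (g ⊗ u) ⟶ h ⊗ v') (q : h ⟶ l) (ξ₁₂ : d ⊗ (z ⊗ j) ⟶ y ⊗ i)
    (ξ₂₂ : c ⊗ (i ⊗ l) ⟶ x ⊗ w) :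
    planarGlue βi ξ₁₁ (ξ₂₁ ≫ q ▷ v') ξ₁₂ ξ₂₂ =
      planarGlue βi ξ₁₁ ξ₂₁ ξ₁₂ (c ◁ (i ◁ q) ≫ ξ₂₂) := by
  calc
    _ = 𝟙 _ ⊗≫ d ◁ z ◁ ξ₁₁ ▷ (b ⊗ u) ⊗≫ d ◁ z ◁ j ◁ βi ▷ u ⊗≫
        (d ⊗ (z ⊗ j)) ◁ ξ₂₁ ⊗≫ ((d ⊗ (z ⊗ j)) ◁ (q ▷ v') ≫ ξ₁₂ ▷ (l ⊗ v')) ⊗≫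
        y ◁ dag (ε_ c cᘁ) ▷ (i ⊗ (l ⊗ v')) ⊗≫
        y ◁ cᘁ ◁ ξ₂₂ ▷ v' ⊗≫ 𝟙 _ := by dsimp only [planarGlue]; monoidal
    _ = 𝟙 _ ⊗≫ d ◁ z ◁ ξ₁₁ ▷ (b ⊗ u) ⊗≫ d ◁ z ◁ j ◁ βi ▷ u ⊗≫
        (d ⊗ (z ⊗ j)) ◁ ξ₂₁ ⊗≫ ξ₁₂ ▷ (h ⊗ v') ⊗≫
        y ◁ (𝟙_ C ◁ (i ◁ q) ≫ dag (ε_ c cᘁ) ▷ (i ⊗ l)) ▷ v' ⊗≫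
        y ◁ cᘁ ◁ ξ₂₂ ▷ v' ⊗≫ 𝟙 _ := by rw [whisker_exchange]; monoidal
    _ = _ := by rw [whisker_exchange]; dsimp only [planarGlue]; monoidal

/-- A cup `r* r` between two strings. -/
def insertCup (j r g : C) : j ⊗ g ⟶ (j ⊗ rᘁ) ⊗ (r ⊗ g) :=
  𝟙 _ ⊗≫ j ◁ dag (ε_ r rᘁ) ▷ g ⊗≫ 𝟙 _

/-- A cap `r* r` between two strings. -/
def insertCap (i r h : C) : (i ⊗ rᘁ) ⊗ (r ⊗ h) ⟶ i ⊗ h :=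
  𝟙 _ ⊗≫ i ◁ ε_ r rᘁ ▷ h ⊗≫ 𝟙 _

lemma exch_eq_insertCup (o : j ⊗ rᘁ ⟶ n) (e : r ⊗ g ⟶ k) :
    exch o e = (insertCup j r g ≫ o ▷ (r ⊗ g)) ≫ n ◁ e := by
  dsimp only [exch, insertCup]
  rw [MonoidalCategory.tensorHom_def]
  monoidal

lemma dag_exch_eq_insertCap (f : i ⊗ rᘁ ⟶ m) (q : r ⊗ h ⟶ l) :
    dag (exch f q) = m ◁ dag q ≫ dag f ▷ (r ⊗ h) ≫ insertCap i r h := by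
  rw [dag_exch]
  dsimp only [insertCap]
  rw [MonoidalCategory.tensorHom_def']
  monoidal

lemma cor₂₁_eq (H : HalfBraiding b) (ψ : b ⊗ (g ⊗ u) ⟶ h ⊗ v') (E : k ⟶ r ⊗ g)
    (q : r ⊗ h ⟶ l) : cor₂₁ H ψ E q = (b ◁ (E ▷ u) ≫ cor₂₁ H ψ (𝟙 _) (𝟙 _)) ≫ q ▷ v' := by
  dsimp only [cor₂₁]; monoidal

lemma cor₁₂_eq {r' : C} (ψ : d ⊗ (z ⊗ j) ⟶ y ⊗ i) (O : n ⟶ j ⊗ r') (f : i ⊗ r' ⟶ m) :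
    cor₁₂ ψ O f = (d ◁ (z ◁ O) ≫ cor₁₂ ψ (𝟙 _) (𝟙 _)) ≫ y ◁ f := by
  dsimp only [cor₁₂]; monoidal

/-- The plaquette with a loop `r` inside and endomorphisms of the four pairs of parallel
strings. -/
def loopGlue (H : HalfBraiding b) (ξ₁₁ : a ⊗ (s ⊗ t) ⟶ j ⊗ g) (ξ₂₁ : b ⊗ (g ⊗ u) ⟶ h ⊗ v')
    (ξ₁₂ : d ⊗ (z ⊗ j) ⟶ y ⊗ i) (ξ₂₂ : c ⊗ (i ⊗ h) ⟶ x ⊗ w) (r : C) (E : r ⊗ g ⟶ r ⊗ g)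
    (Q : r ⊗ h ⟶ r ⊗ h) (F : i ⊗ rᘁ ⟶ i ⊗ rᘁ) (O : j ⊗ rᘁ ⟶ j ⊗ rᘁ) :
    d ⊗ (z ⊗ (a ⊗ (s ⊗ (t ⊗ (b ⊗ u))))) ⟶ y ⊗ (cᘁ ⊗ (x ⊗ (w ⊗ v'))) :=
  planarGlue (H.β (r ⊗ g)).inv (ξ₁₁ ≫ insertCup j r g)
    (b ◁ (E ▷ u) ≫ cor₂₁ H ξ₂₁ (𝟙 _) (𝟙 _)) (d ◁ (z ◁ O) ≫ cor₁₂ ξ₁₂ (𝟙 _) (𝟙 _))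
    (c ◁ (F ▷ (r ⊗ h)) ≫ c ◁ ((i ⊗ rᘁ) ◁ Q) ≫ c ◁ insertCap i r h ≫ ξ₂₂)

/-- A fused edge carries a node at one end and its adjoint at the other. Sliding them together
replaces them by `e ≫ dag e` on the parallel pair formed by the loop and the original edge. -/
lemma planarGlue_fused (H : HalfBraiding b) (ξ₁₁ : a ⊗ (s ⊗ t) ⟶ j ⊗ g)
    (ξ₂₁ : b ⊗ (g ⊗ u) ⟶ h ⊗ v') (ξ₁₂ : d ⊗ (z ⊗ j) ⟶ y ⊗ i) (ξ₂₂ : c ⊗ (i ⊗ h) ⟶ x ⊗ w)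
    (e : r ⊗ g ⟶ k) (q : r ⊗ h ⟶ l) (f : i ⊗ rᘁ ⟶ m) (o : j ⊗ rᘁ ⟶ n) :
    planarGlue (H.β k).inv (ξ₁₁ ≫ exch o e) (cor₂₁ H ξ₂₁ (dag e) q) (cor₁₂ ξ₁₂ (dag o) f)
      (c ◁ dag (exch f q) ≫ ξ₂₂) =
    loopGlue H ξ₁₁ ξ₂₁ ξ₁₂ ξ₂₂ r (e ≫ dag e) (q ≫ dag q) (f ≫ dag f) (o ≫ dag o) := by
  rw [exch_eq_insertCup, ← Category.assoc, planarGlue_slide_g, ← Category.assoc,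
    planarGlue_slide_j, cor₂₁_eq, ← Category.assoc, planarGlue_slide_h, cor₁₂_eq,
    ← Category.assoc (d ◁ z ◁ o), planarGlue_slide_i, dag_exch_eq_insertCap, loopGlue]
  congr 1
  · simp only [MonoidalCategory.whiskerLeft_comp, comp_whiskerRight, Category.assoc]
  · simp only [MonoidalCategory.whiskerLeft_comp, Category.assoc]
  · simp only [MonoidalCategory.whiskerLeft_comp, comp_whiskerRight, Category.assoc]
    simp only [← MonoidalCategory.whiskerLeft_comp_assoc]
    rw [whisker_exchange_assoc]

lemma halfBraiding_tensor_inv (H : HalfBraiding b) (r g : C) :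
    (H.β (r ⊗ g)).inv = (α_ _ _ _).hom ≫ r ◁ (H.β g).inv ≫ (α_ _ _ _).inv ≫
      (H.β r).inv ▷ g ≫ (α_ _ _ _).hom := by
  rw [← cancel_epi (H.β (r ⊗ g)).hom, Iso.hom_inv_id, H.monoidal]
  simp

/-- The axiom `spherical` converts this left loop into the right loop by which `tr` is defined. -/
lemma circle (r : C) : dag (ε_ r rᘁ) ≫ ε_ r rᘁ = tr (𝟙 r) • 𝟙 (𝟙_ C) := by
  have h := spherical (𝟙 r)
  rw [MonoidalCategory.whiskerLeft_id, Category.id_comp] at h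
  rw [← h, tr, scalar_spec]

/-- With nothing fused the two crossings of `b` under the loop cancel. The cup of the loop then
slides past `ξ₂₁`, `ξ₁₂` and the cup of `c` until it meets its cap, and the free circle is removed.
-/
lemma loopGlue_id (H : HalfBraiding b) (ξ₁₁ : a ⊗ (s ⊗ t) ⟶ j ⊗ g)
    (ξ₂₁ : b ⊗ (g ⊗ u) ⟶ h ⊗ v') (ξ₁₂ : d ⊗ (z ⊗ j) ⟶ y ⊗ i) (ξ₂₂ : c ⊗ (i ⊗ h) ⟶ x ⊗ w) :
    loopGlue H ξ₁₁ ξ₂₁ ξ₁₂ ξ₂₂ r (𝟙 _) (𝟙 _) (𝟙 _) (𝟙 _) =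
      tr (𝟙 r) • planarGlue (H.β g).inv ξ₁₁ ξ₂₁ ξ₁₂ ξ₂₂ := by
  calc
    _ = 𝟙 _ ⊗≫ d ◁ z ◁ ξ₁₁ ▷ (b ⊗ u) ⊗≫ d ◁ z ◁ j ◁ dag (ε_ r rᘁ) ▷ (g ⊗ (b ⊗ u)) ⊗≫
        (d ⊗ z ⊗ j ⊗ rᘁ ⊗ r) ◁ (H.β g).inv ▷ u ⊗≫
        (d ⊗ z ⊗ j ⊗ rᘁ) ◁ ((H.β r).inv ≫ (H.β r).hom) ▷ (g ⊗ u) ⊗≫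
        (d ⊗ z ⊗ j ⊗ rᘁ ⊗ r) ◁ ξ₂₁ ⊗≫
        ξ₁₂ ▷ (rᘁ ⊗ (r ⊗ (h ⊗ v'))) ⊗≫ y ◁ dag (ε_ c cᘁ) ▷ (i ⊗ (rᘁ ⊗ (r ⊗ (h ⊗ v')))) ⊗≫
        y ◁ cᘁ ◁ c ◁ i ◁ ε_ r rᘁ ▷ (h ⊗ v') ⊗≫ y ◁ cᘁ ◁ ξ₂₂ ▷ v' ⊗≫ 𝟙 _ := by
      dsimp only [loopGlue, planarGlue, insertCup, insertCap, cor₂₁, cor₁₂]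
      rw [halfBraiding_tensor_inv]
      monoidal
    _ = 𝟙 _ ⊗≫ d ◁ z ◁ ξ₁₁ ▷ (b ⊗ u) ⊗≫ d ◁ z ◁ j ◁ (dag (ε_ r rᘁ) ▷ (g ⊗ (b ⊗ u)) ≫
          (rᘁ ⊗ r) ◁ ((α_ _ _ _).inv ≫ (H.β g).inv ▷ u ≫ (α_ _ _ _).hom ≫ ξ₂₁)) ⊗≫
        ξ₁₂ ▷ (rᘁ ⊗ (r ⊗ (h ⊗ v'))) ⊗≫ y ◁ dag (ε_ c cᘁ) ▷ (i ⊗ (rᘁ ⊗ (r ⊗ (h ⊗ v')))) ⊗≫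
        y ◁ cᘁ ◁ c ◁ i ◁ ε_ r rᘁ ▷ (h ⊗ v') ⊗≫ y ◁ cᘁ ◁ ξ₂₂ ▷ v' ⊗≫ 𝟙 _ := by
      rw [Iso.inv_hom_id]
      monoidal
    _ = 𝟙 _ ⊗≫ d ◁ z ◁ ξ₁₁ ▷ (b ⊗ u) ⊗≫ d ◁ z ◁ j ◁ (H.β g).inv ▷ u ⊗≫
        (d ⊗ (z ⊗ j)) ◁ ξ₂₁ ⊗≫
        ((d ⊗ (z ⊗ j)) ◁ (dag (ε_ r rᘁ) ▷ (h ⊗ v')) ≫ ξ₁₂ ▷ ((rᘁ ⊗ r) ⊗ (h ⊗ v'))) ⊗≫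
        y ◁ dag (ε_ c cᘁ) ▷ (i ⊗ (rᘁ ⊗ (r ⊗ (h ⊗ v')))) ⊗≫
        y ◁ cᘁ ◁ c ◁ i ◁ ε_ r rᘁ ▷ (h ⊗ v') ⊗≫ y ◁ cᘁ ◁ ξ₂₂ ▷ v' ⊗≫ 𝟙 _ := by
      rw [← whisker_exchange]
      monoidal
    _ = 𝟙 _ ⊗≫ d ◁ z ◁ ξ₁₁ ▷ (b ⊗ u) ⊗≫ d ◁ z ◁ j ◁ (H.β g).inv ▷ u ⊗≫
        (d ⊗ (z ⊗ j)) ◁ ξ₂₁ ⊗≫ ξ₁₂ ▷ (h ⊗ v') ⊗≫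
        y ◁ (𝟙_ C ◁ (i ◁ dag (ε_ r rᘁ)) ≫ dag (ε_ c cᘁ) ▷ (i ⊗ (rᘁ ⊗ r))) ▷ (h ⊗ v') ⊗≫
        y ◁ cᘁ ◁ c ◁ i ◁ ε_ r rᘁ ▷ (h ⊗ v') ⊗≫ y ◁ cᘁ ◁ ξ₂₂ ▷ v' ⊗≫ 𝟙 _ := by
      rw [whisker_exchange]
      monoidal
    _ = 𝟙 _ ⊗≫ d ◁ z ◁ ξ₁₁ ▷ (b ⊗ u) ⊗≫ d ◁ z ◁ j ◁ (H.β g).inv ▷ u ⊗≫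
        (d ⊗ (z ⊗ j)) ◁ ξ₂₁ ⊗≫ ξ₁₂ ▷ (h ⊗ v') ⊗≫
        y ◁ dag (ε_ c cᘁ) ▷ (i ⊗ (h ⊗ v')) ⊗≫
        y ◁ cᘁ ◁ c ◁ i ◁ (dag (ε_ r rᘁ) ≫ ε_ r rᘁ) ▷ (h ⊗ v') ⊗≫
        y ◁ cᘁ ◁ ξ₂₂ ▷ v' ⊗≫ 𝟙 _ := by
      rw [whisker_exchange]
      monoidal
    _ = tr (𝟙 r) • (𝟙 _ ⊗≫ d ◁ z ◁ ξ₁₁ ▷ (b ⊗ u) ⊗≫ d ◁ z ◁ j ◁ (H.β g).inv ▷ u ⊗≫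
        (d ⊗ (z ⊗ j)) ◁ ξ₂₁ ⊗≫ ξ₁₂ ▷ (h ⊗ v') ⊗≫
        y ◁ dag (ε_ c cᘁ) ▷ (i ⊗ (h ⊗ v')) ⊗≫
        y ◁ cᘁ ◁ c ◁ i ◁ 𝟙 (𝟙_ C) ▷ (h ⊗ v') ⊗≫
        y ◁ cᘁ ◁ ξ₂₂ ▷ v' ⊗≫ 𝟙 _) := by
      rw [circle]
      simp only [monoidalComp, MonoidalLinear.smul_whiskerRight, MonoidalLinear.whiskerLeft_smul,
        Linear.comp_smul, Linear.smul_comp]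
    _ = _ := by
      congr 1
      dsimp only [planarGlue]
      monoidal

end Slide

/-! ### Summing over the loop: the evaluation is unchanged -/

section LoopSum

variable {X : Type u₂} [Category.{v₂} X] [Abelian X] [Linear ℂ X] [MonoidalCategory X]
  [MonoidalPreadditive X] [MonoidalLinear ℂ X] [RightRigidCategory X] [UnitaryFusionCategory X]

lemma sum_linear_basis {V : Type*} [AddCommGroup V] [Module ℂ V] {x : X}
    {w : Irr X → {r : ℝ // 0 < r}} {ι : Irr X → Type*} [∀ k, Fintype (ι k)]
    (b : ∀ k, OrthonormalBasis (ι k) ℂ (SkeinHom (w k) x k.obj)) (T : (x ⟶ x) → V)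
    (hT : IsLinearMap ℂ T) :
    ∑ k, ∑ e, dualWeight (w k) k • T ((b k e).hom ≫ dag (b k e).hom) = T (𝟙 x) := by
  have h := congrArg (hT.mk' T) (sum_basis_eq_id b)
  simp only [map_sum, map_smul] at h
  exact h

variable {a b c d s t u v' w x y z : X} {g h i j r : Irr X}

/-- Up to one factor `d_r`, the coefficient in the definition of `B_p` is the product of the weights
that make each of the four node sums a resolution of the identity. -/
lemma loopCoeff_eq (r g h i j k l m n : Irr X) :
    loopCoeff r g h i j k l m n = ((r.d : ℝ) : ℂ) *
      (dualWeight (r.d * g.d * k.d) k * dualWeight (r.d * h.d * l.d) l *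
        dualWeight (i.d * r.d * m.d) m * dualWeight (j.d * r.d * n.d) n) := by
  have hr := r.d.2
  have hg := g.d.2
  have hh := h.d.2
  have hi := i.d.2
  have hj := j.d.2
  have hk := k.d.2
  have hl := l.d.2
  have hm := m.d.2
  have hn := n.d.2
  simp only [loopCoeff, dualWeight, Positive.val_mul]
  norm_cast
  have e1 : √(r.d * g.d * k.d : ℝ) * √(r.d * h.d * l.d : ℝ) * √(i.d * r.d * m.d : ℝ) *
      √(j.d * r.d * n.d : ℝ) =
      (r.d : ℝ) ^ 2 * (√(g.d * h.d * i.d * j.d : ℝ) * √(k.d * l.d * m.d * n.d : ℝ)) := by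
    rw [← Real.sqrt_mul (by positivity), ← Real.sqrt_mul (by positivity),
      ← Real.sqrt_mul (by positivity), ← Real.sqrt_mul (by positivity),
      ← Real.sqrt_sq (by positivity : (0 : ℝ) ≤ (r.d : ℝ) ^ 2), ← Real.sqrt_mul (by positivity)]
    congr 1
    ring
  have e2 : √(k.d * l.d * m.d * n.d : ℝ) * √(k.d * l.d * m.d * n.d : ℝ) =
    k.d * l.d * m.d * n.d := Real.mul_self_sqrt (by positivity)
  rw [div_mul_div_comm, div_mul_div_comm, div_mul_div_comm, e1]
  have : 0 < √(k.d * l.d * m.d * n.d : ℝ) := Real.sqrt_pos.2 (by positivity)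
  have : 0 < √(g.d * h.d * i.d * j.d : ℝ) := Real.sqrt_pos.2 (by positivity)
  field_simp
  exact (sq _).trans e2

lemma sum_loopGlue (H : HalfBraiding b) (ξ₁₁ : a ⊗ (s ⊗ t) ⟶ j.obj ⊗ g.obj)
    (ξ₂₁ : b ⊗ (g.obj ⊗ u) ⟶ h.obj ⊗ v') (ξ₁₂ : d ⊗ (z ⊗ j.obj) ⟶ y ⊗ i.obj)
    (ξ₂₂ : c ⊗ (i.obj ⊗ h.obj) ⟶ x ⊗ w) (r : Irr X) :
    ∑ k : Irr X, ∑ l : Irr X, ∑ m : Irr X, ∑ n : Irr X, loopCoeff r g h i j k l m n •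
      ∑ e : IdxL r g k, ∑ q : IdxL r h l, ∑ f : IdxR i r m, ∑ o : IdxR j r n,
      loopGlue H ξ₁₁ ξ₂₁ ξ₁₂ ξ₂₂ r.obj (nodeL e ≫ dag (nodeL e)) (nodeL q ≫ dag (nodeL q))
        (nodeR f ≫ dag (nodeR f)) (nodeR o ≫ dag (nodeR o)) =
    ((r.d : ℝ) : ℂ) ^ 2 • planarGlue (H.β g.obj).inv ξ₁₁ ξ₂₁ ξ₁₂ ξ₂₂ := by
  -- Since the coefficient factors over the edges, the sums can be nested, one edge at a time.
  trans ((r.d : ℝ) : ℂ) • ∑ k : Irr X, ∑ e : IdxL r g k, dualWeight (r.d * g.d * k.d) k •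
      ∑ l : Irr X, ∑ q : IdxL r h l, dualWeight (r.d * h.d * l.d) l •
      ∑ m : Irr X, ∑ f : IdxR i r m, dualWeight (i.d * r.d * m.d) m •
      ∑ n : Irr X, ∑ o : IdxR j r n, dualWeight (j.d * r.d * n.d) n •
      loopGlue H ξ₁₁ ξ₂₁ ξ₁₂ ξ₂₂ r.obj (nodeL e ≫ dag (nodeL e)) (nodeL q ≫ dag (nodeL q))
        (nodeR f ≫ dag (nodeR f)) (nodeR o ≫ dag (nodeR o))
  · simp only [Finset.smul_sum, smul_smul, loopCoeff_eq]
    refine Finset.sum_congr rfl fun k _ => ?_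
    refine (sum_rotate _).trans ?_
    refine Finset.sum_congr rfl fun e _ => Finset.sum_congr rfl fun l _ => ?_
    refine (Finset.sum_congr rfl fun m _ => Finset.sum_comm).trans (Finset.sum_comm.trans ?_)
    refine Finset.sum_congr rfl fun q _ => Finset.sum_congr rfl fun m _ => ?_
    refine Finset.sum_comm.trans ?_
    refine Finset.sum_congr rfl fun f _ => Finset.sum_congr rfl fun n _ => ?_
    refine Finset.sum_congr rfl fun o _ => ?_
    congr 1
    ring
  -- `loopGlue` is linear in each of the four edge endomorphisms, so each sum replaces its argument
  -- by an identity. The free circle then gives the second factor `d_r`.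
  · have hO := fun E Q F => sum_linear_basis (fun n => stdOrthonormalBasis ℂ (TriR j r n))
      (fun O => loopGlue H ξ₁₁ ξ₂₁ ξ₁₂ ξ₂₂ r.obj E Q F O)
      ⟨by intros; simp [loopGlue, planarGlue, monoidalComp],
       by intros; simp [loopGlue, planarGlue, monoidalComp]⟩
    have hF := fun E Q O => sum_linear_basis (fun m => stdOrthonormalBasis ℂ (TriR i r m))
      (fun F => loopGlue H ξ₁₁ ξ₂₁ ξ₁₂ ξ₂₂ r.obj E Q F O)
      ⟨by intros; simp [loopGlue, planarGlue, monoidalComp],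
       by intros; simp [loopGlue, planarGlue, monoidalComp]⟩
    have hQ := fun E F O => sum_linear_basis (fun l => stdOrthonormalBasis ℂ (TriL r h l))
      (fun Q => loopGlue H ξ₁₁ ξ₂₁ ξ₁₂ ξ₂₂ r.obj E Q F O)
      ⟨by intros; simp [loopGlue, planarGlue, monoidalComp],
       by intros; simp [loopGlue, planarGlue, monoidalComp]⟩
    have hE := fun Q F O => sum_linear_basis (fun k => stdOrthonormalBasis ℂ (TriL r g k))
      (fun E => loopGlue H ξ₁₁ ξ₂₁ ξ₁₂ ξ₂₂ r.obj E Q F O)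
      ⟨by intros; simp [loopGlue, planarGlue, monoidalComp],
       by intros; simp [loopGlue, planarGlue, monoidalComp]⟩
    simp only [nodeL, nodeR, hO, hF, hQ, hE]
    rw [loopGlue_id, smul_smul, tr_id, sq]

lemma globalDim_pos : 0 < globalDim X := by
  have hu : (0 : ℝ) < globalDim X := by
    obtain ⟨k, -⟩ := Irr.exists_iso (𝟙_ X)
    exact Finset.sum_pos (fun i _ => pow_pos i.d.2 2) ⟨k, Finset.mem_univ k⟩
  exact hu

/-- Every `r` contributes `d_r²` times the original evaluation, and these factors add up to
`globalDim X`. This is the source of `B_p² = B_p`. -/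
lemma sum_planarGlue_fused (H : HalfBraiding b) (ξ₁₁ : a ⊗ (s ⊗ t) ⟶ j.obj ⊗ g.obj)
    (ξ₂₁ : b ⊗ (g.obj ⊗ u) ⟶ h.obj ⊗ v') (ξ₁₂ : d ⊗ (z ⊗ j.obj) ⟶ y ⊗ i.obj)
    (ξ₂₂ : c ⊗ (i.obj ⊗ h.obj) ⟶ x ⊗ w) :
    ((1 / globalDim X : ℝ) : ℂ) • ∑ r : Irr X,
    ∑ k : Irr X, ∑ l : Irr X, ∑ m : Irr X, ∑ n : Irr X, loopCoeff r g h i j k l m n •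
      ∑ e : IdxL r g k, ∑ q : IdxL r h l, ∑ f : IdxR i r m, ∑ o : IdxR j r n,
      planarGlue (H.β k.obj).inv (ξ₁₁ ≫ exch (nodeR o) (nodeL e))
        (cor₂₁ H ξ₂₁ (dag (nodeL e)) (nodeL q)) (cor₁₂ ξ₁₂ (dag (nodeR o)) (nodeR f))
        (c ◁ dag (exch (nodeR f) (nodeL q)) ≫ ξ₂₂) =
    planarGlue (H.β g.obj).inv ξ₁₁ ξ₂₁ ξ₁₂ ξ₂₂ := by
  simp only [planarGlue_fused, sum_loopGlue]
  rw [← Finset.sum_smul, smul_smul]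
  have h1 : ∑ r : Irr X, ((r.d : ℝ) : ℂ) ^ 2 = ((globalDim X : ℝ) : ℂ) := by
    rw [globalDim]; push_cast; rfl
  rw [h1, ← Complex.ofReal_mul, one_div_mul_cancel globalDim_pos.ne', Complex.ofReal_one, one_smul]

end LoopSum

/-! ### The closed diagram of the enriched skein module is planar -/

section Drag

variable {C : Type u} [Category.{v} C] [Abelian C] [Linear ℂ C] [MonoidalCategory C]
  [MonoidalPreadditive C] [MonoidalLinear ℂ C] [RightRigidCategory C] [UnitaryFusionCategory C]

variable {a b c d s t u v' w x y z g h i j k l m n p q : C}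

lemma hom_ext_of_tr {f f' : x ⟶ y} (h : ∀ e : y ⟶ x, tr (f ≫ e) = tr (f' ≫ e)) : f = f' := by
  rw [← sub_eq_zero]
  refine tr_comp_dag_definite _ ?_
  have h1 := h (dag (f - f'))
  have h2 : f = f' + (f - f') := by abel
  conv at h1 => lhs; rw [h2]
  rw [Preadditive.add_comp, tr_add] at h1
  simpa using h1

/-- Naturality along `𝟙_ ⊗ 𝟙_ ≅ 𝟙_` combined with monoidality makes the half-braiding at the unit
idempotent up to unitors; being invertible, it is trivial. -/
lemma HalfBraiding.β_unit (H : HalfBraiding c) :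
    (H.β (𝟙_ C)).hom = (ρ_ c).hom ≫ (λ_ c).inv := by
  set B := (H.β (𝟙_ C)).hom with hB
  have h1 := H.naturality (λ_ (𝟙_ C)).hom
  rw [H.monoidal, ← hB] at h1
  have h2 : ((ρ_ c).inv ≫ B ≫ (λ_ c).hom) ≫ ((ρ_ c).inv ≫ B ≫ (λ_ c).hom) =
      (ρ_ c).inv ≫ B ≫ (λ_ c).hom := by
    trans (ρ_ c).inv ≫ c ◁ (λ_ (𝟙_ C)).inv ≫ (c ◁ (λ_ (𝟙_ C)).hom ≫ B) ≫ (λ_ c).hom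
    · rw [h1]
      monoidal
    · simp
  have : IsIso ((ρ_ c).inv ≫ B ≫ (λ_ c).hom) := by rw [hB]; infer_instance
  have h3 : (ρ_ c).inv ≫ B ≫ (λ_ c).hom = 𝟙 c := by
    rw [← cancel_epi ((ρ_ c).inv ≫ B ≫ (λ_ c).hom), h2, Category.comp_id]
  rw [Iso.inv_comp_eq, ← Iso.eq_comp_inv] at h3
  simpa using h3

/-- Conjugation by a half-braiding. -/
def conjHalf (H : HalfBraiding c) (e : y ⊗ q ⟶ y ⊗ p) : y ⊗ (c ⊗ q) ⟶ y ⊗ (c ⊗ p) :=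
  (α_ _ _ _).inv ≫ (H.β y).inv ▷ q ≫ (α_ _ _ _).hom ≫ c ◁ e ≫ (α_ _ _ _).inv ≫
    (H.β y).hom ▷ p ≫ (α_ _ _ _).hom

/-- Naturality along the cup and the cap of `y` trades the crossings of `c` with `y` for crossings
with `yᘁ`. Those commute with `e` and cancel. -/
lemma ptrL_conjHalf (H : HalfBraiding c) (e : y ⊗ q ⟶ y ⊗ p) :
    ptrL (.chosen y) (conjHalf H e) = c ◁ ptrL (.chosen y) e := by
  have h1 : dag (ε_ y yᘁ) ▷ c ≫ (α_ _ _ _).hom ≫ yᘁ ◁ (H.β y).inv =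
      (λ_ c).hom ≫ (ρ_ c).inv ≫ c ◁ dag (ε_ y yᘁ) ≫ (α_ _ _ _).inv ≫ (H.β yᘁ).hom ▷ y ≫
        (α_ _ _ _).hom := by
    have h := H.naturality (dag (ε_ y yᘁ))
    rw [H.monoidal, HalfBraiding.β_unit] at h
    rw [← cancel_mono (yᘁ ◁ (H.β y).hom), ← cancel_mono (α_ _ _ _).inv]
    simp only [Category.assoc] at h ⊢
    rw [h]
    simp
  have h2 : yᘁ ◁ (H.β y).hom ≫ (α_ _ _ _).inv ≫ ε_ y yᘁ ▷ c =
      (α_ _ _ _).inv ≫ (H.β yᘁ).inv ▷ y ≫ (α_ _ _ _).hom ≫ c ◁ ε_ y yᘁ ≫ (ρ_ c).hom ≫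
        (λ_ c).inv := by
    have h := H.naturality (ε_ y yᘁ)
    rw [H.monoidal, HalfBraiding.β_unit] at h
    rw [← cancel_epi ((α_ _ _ _).inv ≫ (H.β yᘁ).hom ▷ y ≫ (α_ _ _ _).hom)]
    simp only [Category.assoc] at h ⊢
    rw [← h]
    simp
  calc
    _ = 𝟙 _ ⊗≫ (dag (ε_ y yᘁ) ▷ c ≫ (α_ _ _ _).hom ≫ (yᘁ : C) ◁ (H.β y).inv) ▷ q ⊗≫
        (yᘁ : C) ◁ c ◁ e ⊗≫ ((yᘁ : C) ◁ (H.β y).hom ≫ (α_ _ _ _).inv ≫ ε_ y yᘁ ▷ c) ▷ p ⊗≫ 𝟙 _ := by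
      dsimp only [ptrL, conjHalf, SphericalDual.chosen, SphericalDual.ev]; monoidal
    _ = 𝟙 _ ⊗≫ c ◁ dag (ε_ y yᘁ) ▷ q ⊗≫ ((H.β yᘁ).hom ▷ (y ⊗ q) ≫
        (yᘁ ⊗ c) ◁ e) ⊗≫ (H.β yᘁ).inv ▷ (y ⊗ p) ⊗≫ c ◁ ε_ y yᘁ ▷ p ⊗≫ 𝟙 _ := by
      rw [h1, h2]; monoidal
    _ = 𝟙 _ ⊗≫ c ◁ dag (ε_ y yᘁ) ▷ q ⊗≫ (c ⊗ yᘁ) ◁ e ⊗≫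
        ((H.β yᘁ).hom ≫ (H.β yᘁ).inv) ▷ (y ⊗ p) ⊗≫ c ◁ ε_ y yᘁ ▷ p ⊗≫ 𝟙 _ := by
      rw [← whisker_exchange]; monoidal
    _ = _ := by
      rw [Iso.hom_inv_id]
      dsimp only [ptrL, SphericalDual.chosen, SphericalDual.ev]; monoidal

/-- A closed string `c` can be pulled through `y`. -/
lemma ptrL_halfBraiding (H : HalfBraiding c) (N : c ⊗ p ⟶ c ⊗ q) :
    ptrL (.chosen c) ((α_ _ _ _).inv ≫ (H.β y).hom ▷ p ≫ (α_ _ _ _).hom ≫ y ◁ N ≫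
      (α_ _ _ _).inv ≫ (H.β y).inv ▷ q ≫ (α_ _ _ _).hom) = y ◁ ptrL (.chosen c) N := by
  -- The half-braiding is natural in `y`, not in `c`, so the loop `c` cannot be moved directly.
  -- Testing against `e` closes `y` as well, and cyclicity moves the crossings from `N` to `e`,
  -- where `ptrL_conjHalf` removes them.
  refine hom_ext_of_tr fun e => ?_
  set A := (α_ c y p).inv ≫ (H.β y).hom ▷ p ≫ (α_ _ _ _).hom with hA
  set B := (α_ y c q).inv ≫ (H.β y).inv ▷ q ≫ (α_ _ _ _).hom with hB
  have h1 : (α_ c y p).inv ≫ (H.β y).hom ▷ p ≫ (α_ _ _ _).hom ≫ y ◁ N ≫ B = (A ≫ y ◁ N) ≫ B := by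
    simp [hA]
  have h2 : conjHalf H e = (B ≫ c ◁ e) ≫ A := by simp [conjHalf, hA, hB]
  rw [h1]
  trans tr (N ≫ ptrL (.chosen y) (conjHalf H e))
  · rw [ptrL_comp_whiskerLeft, tr_ptrL, whiskerLeft_comp_ptrL, tr_ptrL]
    rw [Category.assoc, Category.assoc, tr_comp, h2, Category.assoc]
  · rw [ptrL_conjHalf, tr_comp N, tr_comp _ e, ← tr_ptrL (.chosen c), ← whiskerLeft_comp_ptrL,
      ← tr_ptrL (.chosen y) (e ≫ _), ← ptrL_comp_whiskerLeft]

end Drag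

/-! ### The enriched skein pairing equals the planar diagram -/

section Skein

variable {C : Type u} [Category.{v} C] [Abelian C] [Linear ℂ C] [MonoidalCategory C]
  [MonoidalPreadditive C] [MonoidalLinear ℂ C] [RightRigidCategory C] [UnitaryFusionCategory C]

variable {a b c d s t u v' w x y z g h i j k l m n p q : C}

/-- The plaquette with given corners as an element of the enriched skein module. -/
def skeinGlue (Ha : HalfBraiding a) (Hb : HalfBraiding b) (Hc : HalfBraiding c)
    (ξ₁₁ : a ⊗ (s ⊗ t) ⟶ j ⊗ g) (ξ₂₁ : b ⊗ (g ⊗ u) ⟶ h ⊗ v')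
    (ξ₁₂ : d ⊗ (z ⊗ j) ⟶ y ⊗ i) (ξ₂₂ : c ⊗ (i ⊗ h) ⟶ x ⊗ w) :
    c ⊗ (d ⊗ (b ⊗ (a ⊗ (z ⊗ (s ⊗ (t ⊗ u)))))) ⟶ y ⊗ (x ⊗ (w ⊗ v')) :=
  𝟙 _ ⊗≫ c ◁ d ◁ b ◁ (Ha.β z).hom ▷ (s ⊗ (t ⊗ u)) ⊗≫ c ◁ d ◁ b ◁ z ◁ ξ₁₁ ▷ u ⊗≫
    c ◁ d ◁ (Hb.β (z ⊗ j)).hom ▷ (g ⊗ u) ⊗≫ c ◁ (d ⊗ (z ⊗ j)) ◁ ξ₂₁ ⊗≫ c ◁ ξ₁₂ ▷ (h ⊗ v') ⊗≫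
    (Hc.β y).hom ▷ (i ⊗ (h ⊗ v')) ⊗≫ y ◁ ξ₂₂ ▷ v' ⊗≫ 𝟙 _

/-- The plaquette without its upper right corner. -/
def lowerGlue (βi : g ⊗ b ⟶ b ⊗ g) (ξ₁₁ : a ⊗ (s ⊗ t) ⟶ j ⊗ g) (ξ₂₁ : b ⊗ (g ⊗ u) ⟶ h ⊗ v')
    (ξ₁₂ : d ⊗ (z ⊗ j) ⟶ y ⊗ i) :
    d ⊗ (z ⊗ (a ⊗ (s ⊗ (t ⊗ (b ⊗ u))))) ⟶ y ⊗ ((i ⊗ h) ⊗ v') :=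
  𝟙 _ ⊗≫ d ◁ z ◁ ξ₁₁ ▷ (b ⊗ u) ⊗≫ d ◁ z ◁ j ◁ βi ▷ u ⊗≫
    (d ⊗ (z ⊗ j)) ◁ ξ₂₁ ⊗≫ ξ₁₂ ▷ (h ⊗ v') ⊗≫ 𝟙 _

lemma tr_planarGlue_eq_lowerGlue {g' h' i' j' : C} (βi : g ⊗ b ⟶ b ⊗ g)
    (ξ₁₁ : a ⊗ (s ⊗ t) ⟶ j ⊗ g)
    (ξ₂₁ : b ⊗ (g ⊗ u) ⟶ h ⊗ v') (ξ₁₂ : d ⊗ (z ⊗ j) ⟶ y ⊗ i) (ξ₂₂ : c ⊗ (i ⊗ h) ⟶ x ⊗ w)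
    (βi' : g' ⊗ b ⟶ b ⊗ g') (η₁₁ : a ⊗ (s ⊗ t) ⟶ j' ⊗ g')
    (η₂₁ : b ⊗ (g' ⊗ u) ⟶ h' ⊗ v') (η₁₂ : d ⊗ (z ⊗ j') ⟶ y ⊗ i')
    (η₂₂ : c ⊗ (i' ⊗ h') ⟶ x ⊗ w) :
    tr (planarGlue βi ξ₁₁ ξ₂₁ ξ₁₂ ξ₂₂ ≫ dag (planarGlue βi' η₁₁ η₂₁ η₁₂ η₂₂)) =
      tr (lowerGlue βi ξ₁₁ ξ₂₁ ξ₁₂ ≫ y ◁ (ptrL (.chosen c) (ξ₂₂ ≫ dag η₂₂) ▷ v') ≫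
        dag (lowerGlue βi' η₁₁ η₂₁ η₁₂)) := by
  have h1 : dag (lowerGlue βi' η₁₁ η₂₁ η₁₂) =
      𝟙 _ ⊗≫ dag η₁₂ ▷ (h' ⊗ v') ⊗≫
        (d ⊗ (z ⊗ j')) ◁ dag η₂₁ ⊗≫ d ◁ z ◁ j' ◁ dag βi' ▷ u ⊗≫ d ◁ z ◁ dag η₁₁ ▷ (b ⊗ u) ⊗≫
        𝟙 _ := by
    simp only [lowerGlue, monoidalComp, MonoidalCoherence.refl_iso,
      MonoidalCoherence.whiskerLeft_iso, MonoidalCoherence.whiskerRight_iso,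
      MonoidalCoherence.assoc_iso, MonoidalCoherence.assoc'_iso,
      dag_comp, dag_whiskerLeft, dag_whiskerRight,
      dag_id, Iso.refl_hom, Iso.trans_hom, whiskerLeftIso_hom, whiskerRightIso_hom, Iso.symm_hom,
      dag_associator, dag_associator_inv]
    monoidal
  congr 1
  rw [dag_planarGlue, h1]
  dsimp only [planarGlue, lowerGlue, ptrL, SphericalDual.chosen, SphericalDual.ev]
  monoidal

/-- The half-braidings moving the strings `a` and `b` of the skein module into the plane. -/
def unweave (Ha : HalfBraiding a) (Hb : HalfBraiding b) (z s t u : C) :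
    b ⊗ (a ⊗ (z ⊗ (s ⊗ (t ⊗ u)))) ⟶ z ⊗ (a ⊗ (s ⊗ (t ⊗ (b ⊗ u)))) :=
  𝟙 _ ⊗≫ b ◁ (Ha.β z).hom ▷ (s ⊗ (t ⊗ u)) ⊗≫ (Hb.β (z ⊗ (a ⊗ (s ⊗ t)))).hom ▷ u ⊗≫ 𝟙 _

/-- The half-braidings are unitary, so rerouting `a` and `b` is undone by the dagger. -/
lemma dag_unweave_comp (Ha : HalfBraiding a) (Hb : HalfBraiding b)
    (ha : ∀ x, dag (Ha.β x).inv = (Ha.β x).hom) (hb : ∀ x, dag (Hb.β x).inv = (Hb.β x).hom)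
    (z s t u : C) : dag (unweave Ha Hb z s t u) ≫ unweave Ha Hb z s t u = 𝟙 _ := by
  have ha' : dag (Ha.β z).hom = (Ha.β z).inv := by rw [← ha, dag_dag]
  have hb' : dag (Hb.β (z ⊗ (a ⊗ (s ⊗ t)))).hom = (Hb.β (z ⊗ (a ⊗ (s ⊗ t)))).inv := by
    rw [← hb, dag_dag]
  have h1 : dag (unweave Ha Hb z s t u) = 𝟙 _ ⊗≫ (Hb.β (z ⊗ (a ⊗ (s ⊗ t)))).inv ▷ u ⊗≫
      b ◁ (Ha.β z).inv ▷ (s ⊗ (t ⊗ u)) ⊗≫ 𝟙 _ := by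
    simp only [unweave, monoidalComp, MonoidalCoherence.refl_iso,
      MonoidalCoherence.whiskerLeft_iso, MonoidalCoherence.whiskerRight_iso,
      MonoidalCoherence.assoc_iso, MonoidalCoherence.assoc'_iso,
      dag_comp, dag_whiskerLeft, dag_whiskerRight, ha', hb',
      dag_id, Iso.refl_hom, Iso.trans_hom, whiskerLeftIso_hom, whiskerRightIso_hom, Iso.symm_hom,
      dag_associator, dag_associator_inv]
    monoidal
  calc
    _ = 𝟙 _ ⊗≫ (Hb.β (z ⊗ (a ⊗ (s ⊗ t)))).inv ▷ u ⊗≫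
        b ◁ ((Ha.β z).inv ≫ (Ha.β z).hom) ▷ (s ⊗ (t ⊗ u)) ⊗≫
        (Hb.β (z ⊗ (a ⊗ (s ⊗ t)))).hom ▷ u ⊗≫ 𝟙 _ := by
      rw [h1]; dsimp only [unweave]; monoidal
    _ = 𝟙 _ ⊗≫ ((Hb.β (z ⊗ (a ⊗ (s ⊗ t)))).inv ≫ (Hb.β (z ⊗ (a ⊗ (s ⊗ t)))).hom) ▷ u ⊗≫ 𝟙 _ := by
      rw [Iso.inv_hom_id]; monoidal
    _ = _ := by rw [Iso.inv_hom_id]; monoidal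

/-- The upper right corner behind which the string `c` passes. -/
def upperGlue (Hc : HalfBraiding c) (y v' : C) (ξ₂₂ : c ⊗ (i ⊗ h) ⟶ x ⊗ w) :
    c ⊗ (y ⊗ ((i ⊗ h) ⊗ v')) ⟶ y ⊗ (x ⊗ (w ⊗ v')) :=
  (α_ _ _ _).inv ≫ (Hc.β y).hom ▷ ((i ⊗ h) ⊗ v') ≫ (α_ _ _ _).hom ≫
    y ◁ ((α_ _ _ _).inv ≫ ξ₂₂ ▷ v' ≫ (α_ _ _ _).hom)

/-- Extend the crossing of `b` under `z` and `j` by one under `g` and compensate with its inverse.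
The extended crossing passes the corner `ξ₁₁` by naturality and goes into `unweave`; the inverse is
the crossing of the planar picture. -/
lemma skeinGlue_eq (Ha : HalfBraiding a) (Hb : HalfBraiding b) (Hc : HalfBraiding c)
    (ξ₁₁ : a ⊗ (s ⊗ t) ⟶ j ⊗ g) (ξ₂₁ : b ⊗ (g ⊗ u) ⟶ h ⊗ v')
    (ξ₁₂ : d ⊗ (z ⊗ j) ⟶ y ⊗ i) (ξ₂₂ : c ⊗ (i ⊗ h) ⟶ x ⊗ w) :
    skeinGlue Ha Hb Hc ξ₁₁ ξ₂₁ ξ₁₂ ξ₂₂ =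
      c ◁ (d ◁ unweave Ha Hb z s t u) ≫ c ◁ lowerGlue (Hb.β g).inv ξ₁₁ ξ₂₁ ξ₁₂ ≫
        upperGlue Hc y v' ξ₂₂ := by
  have h1 : (Hb.β (z ⊗ (a ⊗ (s ⊗ t)))).hom ≫ (z ◁ ξ₁₁) ▷ b =
      b ◁ (z ◁ ξ₁₁) ≫ b ◁ (α_ _ _ _).inv ≫ (α_ _ _ _).inv ≫ (Hb.β (z ⊗ j)).hom ▷ g ≫
        (α_ _ _ _).hom ≫ (z ⊗ j) ◁ (Hb.β g).hom ≫ (α_ _ _ _).inv ≫ (α_ _ _ _).hom ▷ b := by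
    rw [← Hb.naturality]
    congr 1
    have h2 := Hb.naturality (α_ z j g).inv
    rw [Hb.monoidal (z ⊗ j) g] at h2
    rw [reassoc_of% h2]
    simp
  calc
    _ = 𝟙 _ ⊗≫ c ◁ d ◁ b ◁ (Ha.β z).hom ▷ (s ⊗ (t ⊗ u)) ⊗≫
        c ◁ d ◁ (b ◁ (z ◁ ξ₁₁) ≫ b ◁ (α_ _ _ _).inv ≫ (α_ _ _ _).inv ≫
          (Hb.β (z ⊗ j)).hom ▷ g ≫ (α_ _ _ _).hom) ▷ u ⊗≫
        c ◁ d ◁ (z ⊗ j) ◁ ((Hb.β g).hom ≫ (Hb.β g).inv) ▷ u ⊗≫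
        c ◁ (d ⊗ (z ⊗ j)) ◁ ξ₂₁ ⊗≫ c ◁ ξ₁₂ ▷ (h ⊗ v') ⊗≫
        (Hc.β y).hom ▷ (i ⊗ (h ⊗ v')) ⊗≫ y ◁ ξ₂₂ ▷ v' ⊗≫ 𝟙 _ := by
      rw [Iso.hom_inv_id]; dsimp only [skeinGlue]; monoidal
    _ = 𝟙 _ ⊗≫ c ◁ d ◁ b ◁ (Ha.β z).hom ▷ (s ⊗ (t ⊗ u)) ⊗≫
        c ◁ d ◁ (b ◁ (z ◁ ξ₁₁) ≫ b ◁ (α_ _ _ _).inv ≫ (α_ _ _ _).inv ≫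
          (Hb.β (z ⊗ j)).hom ▷ g ≫ (α_ _ _ _).hom ≫ (z ⊗ j) ◁ (Hb.β g).hom ≫
          (α_ _ _ _).inv ≫ (α_ _ _ _).hom ▷ b) ▷ u ⊗≫
        c ◁ d ◁ z ◁ j ◁ (Hb.β g).inv ▷ u ⊗≫
        c ◁ (d ⊗ (z ⊗ j)) ◁ ξ₂₁ ⊗≫ c ◁ ξ₁₂ ▷ (h ⊗ v') ⊗≫
        (Hc.β y).hom ▷ (i ⊗ (h ⊗ v')) ⊗≫ y ◁ ξ₂₂ ▷ v' ⊗≫ 𝟙 _ := by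
      monoidal
    _ = _ := by
      rw [← h1]
      dsimp only [unweave, lowerGlue, upperGlue]
      monoidal

/-- Cyclicity brings `unweave` next to its dagger, and the two cancel. The remaining closed string
`c` is pulled through `y` by `ptrL_halfBraiding`. -/
lemma tr_skeinGlue {g' h' i' j' : C} (Ha : HalfBraiding a) (Hb : HalfBraiding b)
    (Hc : HalfBraiding c) (ha : ∀ x, dag (Ha.β x).inv = (Ha.β x).hom)
    (hb : ∀ x, dag (Hb.β x).inv = (Hb.β x).hom) (hc : ∀ x, dag (Hc.β x).inv = (Hc.β x).hom)
    (ξ₁₁ : a ⊗ (s ⊗ t) ⟶ j ⊗ g) (ξ₂₁ : b ⊗ (g ⊗ u) ⟶ h ⊗ v')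
    (ξ₁₂ : d ⊗ (z ⊗ j) ⟶ y ⊗ i) (ξ₂₂ : c ⊗ (i ⊗ h) ⟶ x ⊗ w)
    (η₁₁ : a ⊗ (s ⊗ t) ⟶ j' ⊗ g')
    (η₂₁ : b ⊗ (g' ⊗ u) ⟶ h' ⊗ v') (η₁₂ : d ⊗ (z ⊗ j') ⟶ y ⊗ i')
    (η₂₂ : c ⊗ (i' ⊗ h') ⟶ x ⊗ w) :
    tr (skeinGlue Ha Hb Hc ξ₁₁ ξ₂₁ ξ₁₂ ξ₂₂ ≫ dag (skeinGlue Ha Hb Hc η₁₁ η₂₁ η₁₂ η₂₂)) =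
    tr (planarGlue (Hb.β g).inv ξ₁₁ ξ₂₁ ξ₁₂ ξ₂₂ ≫
      dag (planarGlue (Hb.β g').inv η₁₁ η₂₁ η₁₂ η₂₂)) := by
  have hU : dag (c ◁ (d ◁ unweave Ha Hb z s t u)) ≫ c ◁ (d ◁ unweave Ha Hb z s t u) = 𝟙 _ := by
    rw [dag_whiskerLeft, dag_whiskerLeft, ← MonoidalCategory.whiskerLeft_comp,
      ← MonoidalCategory.whiskerLeft_comp, dag_unweave_comp Ha Hb ha hb,
      MonoidalCategory.whiskerLeft_id, MonoidalCategory.whiskerLeft_id]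
  have hc' : dag (Hc.β y).hom = (Hc.β y).inv := by rw [← hc, dag_dag]
  rw [skeinGlue_eq, skeinGlue_eq, dag_comp, Category.assoc, tr_comp]
  simp only [Category.assoc, hU, Category.comp_id]
  have hR : upperGlue Hc y v' ξ₂₂ ≫ dag (upperGlue Hc y v' η₂₂) =
      (α_ _ _ _).inv ≫ (Hc.β y).hom ▷ _ ≫ (α_ _ _ _).hom ≫
        y ◁ ((α_ _ _ _).inv ≫ (ξ₂₂ ≫ dag η₂₂) ▷ v' ≫ (α_ _ _ _).hom) ≫
        (α_ _ _ _).inv ≫ (Hc.β y).inv ▷ _ ≫ (α_ _ _ _).hom := by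
    simp [upperGlue, hc']
  rw [dag_comp, reassoc_of% hR, tr_planarGlue_eq_lowerGlue, ← ptrL_whiskerRight,
    ← ptrL_halfBraiding Hc, ptrL_comp_whiskerLeft, whiskerLeft_comp_ptrL, tr_ptrL, dag_whiskerLeft]
  simp only [Category.assoc]

end Skein

/-! ### Identifying the diagrams of the statement when the labels match -/

section Evaluation

variable {A : Type u₁} [Category.{v₁} A] [Abelian A] [Linear ℂ A] [MonoidalCategory A]
  [MonoidalPreadditive A] [MonoidalLinear ℂ A] [RightRigidCategory A] [UnitaryFusionCategory A]
  [BraidedCategory A]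
  {X : Type u₂} [Category.{v₂} X] [Abelian X] [Linear ℂ X] [MonoidalCategory X]
  [MonoidalPreadditive X] [MonoidalLinear ℂ X] [RightRigidCategory X] [UnitaryFusionCategory X]
  {Φ : Enrichment A X}

@[simp] lemma Enrichment.δ_self (a : Irr A) : Φ.δ a a = 𝟙 (Φ.obj a) := by
  rw [Enrichment.δ, Irr.δ_self, CategoryTheory.Functor.map_id]
  rfl

variable {a b c d : Irr A} {s t u v w x y z g h i j k l m n : Irr X}

lemma planarEval_eq (ξ₁₁ : Φ.obj a ⊗ (s.obj ⊗ t.obj) ⟶ j.obj ⊗ g.obj)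
    (ξ₂₁ : Φ.obj b ⊗ (g.obj ⊗ u.obj) ⟶ h.obj ⊗ v.obj)
    (ξ₁₂ : Φ.obj d ⊗ (z.obj ⊗ j.obj) ⟶ y.obj ⊗ i.obj)
    (ξ₂₂ : Φ.obj c ⊗ (i.obj ⊗ h.obj) ⟶ x.obj ⊗ w.obj) :
    planarEval (L₁₁ := ⟨a, s, t, j, g⟩) (L₂₁ := ⟨b, g, u, h, v⟩) (L₁₂ := ⟨d, z, j, y, i⟩)
      (L₂₂ := ⟨c, i, h, x, w⟩) ξ₁₁ ξ₂₁ ξ₁₂ ξ₂₂ =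
    planarGlue ((Φ.hb b).β g.obj).inv ξ₁₁ ξ₂₁ ξ₁₂ ξ₂₂ := by
  dsimp only [planarEval, planarGlue]
  simp only [Irr.δ_self, MonoidalCategory.whiskerLeft_id, id_whiskerRight, Category.id_comp,
    MonoidalCategory.tensorHom_def']
  dsimp only [SkeinHom.hom, Enrichment.half]
  monoidal

lemma skeinEval_eq (ξ₁₁ : Φ.obj a ⊗ (s.obj ⊗ t.obj) ⟶ j.obj ⊗ g.obj)
    (ξ₂₁ : Φ.obj b ⊗ (g.obj ⊗ u.obj) ⟶ h.obj ⊗ v.obj)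
    (ξ₁₂ : Φ.obj d ⊗ (z.obj ⊗ j.obj) ⟶ y.obj ⊗ i.obj)
    (ξ₂₂ : Φ.obj c ⊗ (i.obj ⊗ h.obj) ⟶ x.obj ⊗ w.obj) :
    skeinEval (L₁₁ := ⟨a, s, t, j, g⟩) (L₂₁ := ⟨b, g, u, h, v⟩) (L₁₂ := ⟨d, z, j, y, i⟩)
      (L₂₂ := ⟨c, i, h, x, w⟩) ξ₁₁ ξ₂₁ ξ₁₂ ξ₂₂ =
    skeinGlue (Φ.hb a) (Φ.hb b) (Φ.hb c) ξ₁₁ ξ₂₁ ξ₁₂ ξ₂₂ := by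
  dsimp only [skeinEval, skeinGlue]
  simp only [Irr.δ_self, MonoidalCategory.whiskerLeft_id, id_whiskerRight, Category.id_comp,
    MonoidalCategory.tensorHom_def']
  dsimp only [SkeinHom.hom, Enrichment.half]
  monoidal

lemma planarDiagram_eq (ξ₁₁ : Φ.obj a ⊗ (s.obj ⊗ t.obj) ⟶ j.obj ⊗ g.obj)
    (ξ₂₁ : Φ.obj b ⊗ (g.obj ⊗ u.obj) ⟶ h.obj ⊗ v.obj)
    (ξ₁₂ : Φ.obj d ⊗ (z.obj ⊗ j.obj) ⟶ y.obj ⊗ i.obj)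
    (ξ₂₂ : Φ.obj c ⊗ (i.obj ⊗ h.obj) ⟶ x.obj ⊗ w.obj)
    (η₁₁ : Φ.obj a ⊗ (s.obj ⊗ t.obj) ⟶ n.obj ⊗ k.obj)
    (η₂₁ : Φ.obj b ⊗ (k.obj ⊗ u.obj) ⟶ l.obj ⊗ v.obj)
    (η₁₂ : Φ.obj d ⊗ (z.obj ⊗ n.obj) ⟶ y.obj ⊗ m.obj)
    (η₂₂ : Φ.obj c ⊗ (m.obj ⊗ l.obj) ⟶ x.obj ⊗ w.obj) :
    tr (planarEval (L₁₁ := ⟨a, s, t, j, g⟩) (L₂₁ := ⟨b, g, u, h, v⟩) (L₁₂ := ⟨d, z, j, y, i⟩)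
        (L₂₂ := ⟨c, i, h, x, w⟩) ξ₁₁ ξ₂₁ ξ₁₂ ξ₂₂ ≫
      planarCodδ Φ ⟨b, g, u, h, v⟩ ⟨d, z, j, y, i⟩ ⟨c, i, h, x, w⟩
        ⟨b, k, u, l, v⟩ ⟨d, z, n, y, m⟩ ⟨c, m, l, x, w⟩ ≫
      dag (planarEval (L₁₁ := ⟨a, s, t, n, k⟩) (L₂₁ := ⟨b, k, u, l, v⟩)
        (L₁₂ := ⟨d, z, n, y, m⟩) (L₂₂ := ⟨c, m, l, x, w⟩) η₁₁ η₂₁ η₁₂ η₂₂) ≫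
      planarDomδ Φ ⟨a, s, t, n, k⟩ ⟨b, k, u, l, v⟩ ⟨d, z, n, y, m⟩
        ⟨a, s, t, j, g⟩ ⟨b, g, u, h, v⟩ ⟨d, z, j, y, i⟩) =
    tr (planarGlue ((Φ.hb b).β g.obj).inv ξ₁₁ ξ₂₁ ξ₁₂ ξ₂₂ ≫
      dag (planarGlue ((Φ.hb b).β k.obj).inv η₁₁ η₂₁ η₁₂ η₂₂)) := by
  rw [planarEval_eq, planarEval_eq]
  have h1 : planarCodδ Φ ⟨b, g, u, h, v⟩ ⟨d, z, j, y, i⟩ ⟨c, i, h, x, w⟩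
        ⟨b, k, u, l, v⟩ ⟨d, z, n, y, m⟩ ⟨c, m, l, x, w⟩ =
      𝟙 (y.obj ⊗ ((Φ.obj c)ᘁ ⊗ (x.obj ⊗ (w.obj ⊗ v.obj)))) := by
    simp [planarCodδ]
    rfl
  have h2 : planarDomδ Φ ⟨a, s, t, n, k⟩ ⟨b, k, u, l, v⟩ ⟨d, z, n, y, m⟩
        ⟨a, s, t, j, g⟩ ⟨b, g, u, h, v⟩ ⟨d, z, j, y, i⟩ =
      𝟙 (Φ.obj d ⊗ (z.obj ⊗ (Φ.obj a ⊗ (s.obj ⊗ (t.obj ⊗ (Φ.obj b ⊗ u.obj)))))) := by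
    simp [planarDomδ]
    rfl
  rw [h1, h2]
  congr 1
  exact (congrArg _ (Category.id_comp _)).trans (congrArg _ (Category.comp_id _))

lemma skeinDiagram_eq (ξ₁₁ : Φ.obj a ⊗ (s.obj ⊗ t.obj) ⟶ j.obj ⊗ g.obj)
    (ξ₂₁ : Φ.obj b ⊗ (g.obj ⊗ u.obj) ⟶ h.obj ⊗ v.obj)
    (ξ₁₂ : Φ.obj d ⊗ (z.obj ⊗ j.obj) ⟶ y.obj ⊗ i.obj)
    (ξ₂₂ : Φ.obj c ⊗ (i.obj ⊗ h.obj) ⟶ x.obj ⊗ w.obj)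
    (η₁₁ : Φ.obj a ⊗ (s.obj ⊗ t.obj) ⟶ n.obj ⊗ k.obj)
    (η₂₁ : Φ.obj b ⊗ (k.obj ⊗ u.obj) ⟶ l.obj ⊗ v.obj)
    (η₁₂ : Φ.obj d ⊗ (z.obj ⊗ n.obj) ⟶ y.obj ⊗ m.obj)
    (η₂₂ : Φ.obj c ⊗ (m.obj ⊗ l.obj) ⟶ x.obj ⊗ w.obj) :
    tr (skeinEval (L₁₁ := ⟨a, s, t, j, g⟩) (L₂₁ := ⟨b, g, u, h, v⟩) (L₁₂ := ⟨d, z, j, y, i⟩)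
        (L₂₂ := ⟨c, i, h, x, w⟩) ξ₁₁ ξ₂₁ ξ₁₂ ξ₂₂ ≫
      skeinCodδ ⟨b, g, u, h, v⟩ ⟨d, z, j, y, i⟩ ⟨c, i, h, x, w⟩
        ⟨b, k, u, l, v⟩ ⟨d, z, n, y, m⟩ ⟨c, m, l, x, w⟩ ≫
      dag (skeinEval (L₁₁ := ⟨a, s, t, n, k⟩) (L₂₁ := ⟨b, k, u, l, v⟩)
        (L₁₂ := ⟨d, z, n, y, m⟩) (L₂₂ := ⟨c, m, l, x, w⟩) η₁₁ η₂₁ η₁₂ η₂₂) ≫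
      skeinDomδ Φ ⟨a, s, t, n, k⟩ ⟨b, k, u, l, v⟩ ⟨d, z, n, y, m⟩ ⟨c, m, l, x, w⟩
        ⟨a, s, t, j, g⟩ ⟨b, g, u, h, v⟩ ⟨d, z, j, y, i⟩ ⟨c, i, h, x, w⟩) =
    tr (planarGlue ((Φ.hb b).β g.obj).inv ξ₁₁ ξ₂₁ ξ₁₂ ξ₂₂ ≫
      dag (planarGlue ((Φ.hb b).β k.obj).inv η₁₁ η₂₁ η₁₂ η₂₂)) := by
  rw [skeinEval_eq, skeinEval_eq, ← tr_skeinGlue (Φ.hb a) (Φ.hb b) (Φ.hb c) (Φ.dag_hb_inv a)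
    (Φ.dag_hb_inv b) (Φ.dag_hb_inv c)]
  have h1 : skeinCodδ (A := A) ⟨b, g, u, h, v⟩ ⟨d, z, j, y, i⟩ ⟨c, i, h, x, w⟩
        ⟨b, k, u, l, v⟩ ⟨d, z, n, y, m⟩ ⟨c, m, l, x, w⟩ =
      𝟙 (y.obj ⊗ (x.obj ⊗ (w.obj ⊗ v.obj))) := by
    simp [skeinCodδ]
    rfl
  have h2 : skeinDomδ Φ ⟨a, s, t, n, k⟩ ⟨b, k, u, l, v⟩ ⟨d, z, n, y, m⟩ ⟨c, m, l, x, w⟩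
        ⟨a, s, t, j, g⟩ ⟨b, g, u, h, v⟩ ⟨d, z, j, y, i⟩ ⟨c, i, h, x, w⟩ =
      𝟙 (Φ.obj c ⊗ (Φ.obj d ⊗ (Φ.obj b ⊗ (Φ.obj a ⊗ (z.obj ⊗ (s.obj ⊗ (t.obj ⊗ u.obj))))))) := by
    simp [skeinDomδ]
    rfl
  rw [h1, h2]
  congr 1
  exact (congrArg _ (Category.id_comp _)).trans (congrArg _ (Category.comp_id _))

end Evaluation

/-! ### The basis of simple tensors -/

section PiHilbertBasis

variable {S : Type} [Fintype S] [DecidableEq S] {H : Type u} [NormedAddCommGroup H]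
  [InnerProductSpace ℂ H] [FiniteDimensional ℂ H] {κ : Type*} [Fintype κ]

variable (S) in
/-- The orthonormal basis of simple tensors of basis vectors. -/
def PiHilbert.onb (b : OrthonormalBasis κ ℂ H) :
    OrthonormalBasis (S → κ) ℂ (PiHilbert S H) :=
  (show Module.Basis (S → κ) ℂ (PiHilbert S H) from
    Basis.piTensorProduct fun _ : S => b.toBasis).toOrthonormalBasis (by
    classical
    have h : ∀ p : S → κ, (show Module.Basis (S → κ) ℂ (PiHilbert S H) from
        Basis.piTensorProduct fun _ : S => b.toBasis) p = PiHilbert.tprod fun s => b (p s) :=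
      fun p => (Basis.piTensorProduct_apply _ p).trans (by
        simp only [OrthonormalBasis.coe_toBasis]; rfl)
    rw [orthonormal_iff_ite]
    intro p q
    rw [h, h, PiHilbert.inner_tprod]
    simp only [orthonormal_iff_ite.1 b.orthonormal]
    rw [Fintype.prod_ite_zero]
    simp [funext_iff])

lemma PiHilbert.onb_apply (b : OrthonormalBasis κ ℂ H) (p : S → κ) :
    PiHilbert.onb S b p = PiHilbert.tprod fun s => b (p s) := by
  rw [PiHilbert.onb, Module.Basis.coe_toOrthonormalBasis]
  exact (Basis.piTensorProduct_apply _ p).trans (by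
    simp only [OrthonormalBasis.coe_toBasis]; rfl)

lemma PiHilbert.map_tprod (T : S → H →ₗ[ℂ] H) (f : S → H) :
    PiHilbert.map T (PiHilbert.tprod f) = PiHilbert.tprod fun s => T s (f s) :=
  PiTensorProduct.map_tprod _ _

lemma PiHilbert.map_update_tprod (v : S) (T : H →ₗ[ℂ] H) (f : S → H) :
    PiHilbert.map (Function.update (fun _ => LinearMap.id) v T) (PiHilbert.tprod f) =
      PiHilbert.tprod (Function.update f v (T (f v))) := by
  rw [PiHilbert.map_tprod]
  congr 1
  ext s
  by_cases h : s = v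
  · subst h; simp
  · simp [Function.update_of_ne h]

lemma PiHilbert.tprod_update_zero (v : S) (f : S → H) :
    PiHilbert.tprod (Function.update f v 0) = 0 :=
  (PiTensorProduct.tprod ℂ).map_update_zero f v

end PiHilbertBasis

/-! ### Simple tensors as an eigenbasis of the edge terms -/

section KetBasis

variable {A : Type u₁} [Category.{v₁} A] [Abelian A] [Linear ℂ A] [MonoidalCategory A]
  [MonoidalPreadditive A] [MonoidalLinear ℂ A] [RightRigidCategory A] [UnitaryFusionCategory A]
  [BraidedCategory A]
  {X : Type u₂} [Category.{v₂} X] [Abelian X] [Linear ℂ X] [MonoidalCategory X]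
  [MonoidalPreadditive X] [MonoidalLinear ℂ X] [RightRigidCategory X] [UnitaryFusionCategory X]
  {Φ : Enrichment A X} {N P Q : ℕ}
  {ιA : ALabel A → Type w₁} [∀ L, Fintype (ιA L)]
  {ιX : XLabel A X → Type w₂} [∀ L, Fintype (ιX L)]
  (bA : ∀ L, OrthonormalBasis (ιA L) ℂ (AHom L))
  (bX : ∀ L, OrthonormalBasis (ιX L) ℂ (XHom Φ L))

variable (N P Q) in
/-- The simple tensors of basis vectors form an orthonormal basis. -/
def ketBasis : OrthonormalBasis (State ιA ιX N P Q) ℂ (Htot Φ N P Q) :=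
  (PiHilbert.onb (ASite N P Q) (Pi.orthonormalBasis bA)).tensorProduct
    (PiHilbert.onb (BSite P Q) (Pi.orthonormalBasis bX))

lemma ketBasis_apply (ξ : State ιA ιX N P Q) : ketBasis N P Q bA bX ξ = ket bA bX ξ := by
  rw [ketBasis, OrthonormalBasis.tensorProduct_apply', PiHilbert.onb_apply, PiHilbert.onb_apply]
  simp only [Pi.orthonormalBasis_apply]
  rfl

lemma projX_single (q : XLabel A X → Prop) [DecidablePred q] (L : XLabel A X) (f : XHom Φ L) :
    projX Φ q (PiLp.single 2 L f) = if q L then PiLp.single 2 L f else 0 := by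
  ext M
  change (if q M then (PiLp.single 2 L f : HX Φ) M else 0) = _
  by_cases h : M = L
  · subst h; split_ifs <;> rfl
  · rw [PiLp.single_eq_of_ne _ h]
    split_ifs <;> simp [PiLp.single_eq_of_ne _ h]

lemma projA_single (q : ALabel A → Prop) [DecidablePred q] (L : ALabel A) (f : AHom L) :
    projA A q (PiLp.single 2 L f) = if q L then PiLp.single 2 L f else 0 := by
  ext M
  change (if q M then (PiLp.single 2 L f : HA A) M else 0) = _
  by_cases h : M = L
  · subst h; split_ifs <;> rfl
  · rw [PiLp.single_eq_of_ne _ h]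
    split_ifs <;> simp [PiLp.single_eq_of_ne _ h]

/-- The factor of a simple tensor in the boundary layer. -/
def ketX (ξ : BSite P Q → Σ L, ιX L) : PiHilbert (BSite P Q) (HX Φ) :=
  PiHilbert.tprod fun v => (PiLp.single 2 (ξ v).1 (bX (ξ v).1 (ξ v).2) : HX Φ)

/-- The factor of a simple tensor in the bulk. -/
def ketA (ξ : ASite N P Q → Σ L, ιA L) : PiHilbert (ASite N P Q) (HA A) :=
  PiHilbert.tprod fun v => (PiLp.single 2 (ξ v).1 (bA (ξ v).1 (ξ v).2) : HA A)

lemma ket_eq (ξ : State ιA ιX N P Q) : ket bA bX ξ = ketA bA ξ.1 ⊗ₜ[ℂ] ketX bX ξ.2 := rfl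

lemma atX_projX_ketX (v : BSite P Q) (q : XLabel A X → Prop) [DecidablePred q]
    (ξ : BSite P Q → Σ L, ιX L) :
    atX v (projX Φ q) (ketX bX ξ) = if q (ξ v).1 then ketX bX ξ else 0 := by
  rw [atX, ketX, PiHilbert.map_update_tprod, projX_single]
  split_ifs with h
  · rw [Function.update_eq_self]
  · exact PiHilbert.tprod_update_zero _ _

lemma atA_projA_ketA (v : ASite N P Q) (q : ALabel A → Prop) [DecidablePred q]
    (ξ : ASite N P Q → Σ L, ιA L) :
    atA v (projA A q) (ketA bA ξ) = if q (ξ v).1 then ketA bA ξ else 0 := by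
  rw [atA, ketA, PiHilbert.map_update_tprod, projA_single]
  split_ifs with h
  · rw [Function.update_eq_self]
  · exact PiHilbert.tprod_update_zero _ _

lemma sum_apply_eq_ite {α V : Type*} [Fintype α] [DecidableEq α] [AddCommGroup V] [Module ℂ V]
    (T : α → V →ₗ[ℂ] V) (x : V) (p q : α) [Decidable (p = q)]
    (h : ∀ a, p = a → q = a → T a x = x) (h' : ∀ a, ¬ (p = a ∧ q = a) → T a x = 0) :
    (∑ a, T a) x = if p = q then x else 0 := by
  rw [LinearMap.sum_apply]
  split_ifs with hpq
  · subst hpq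
    rw [Finset.sum_eq_single p, h p rfl rfl]
    · exact fun a _ ha => h' a fun h => ha h.1.symm
    · simp
  · exact Finset.sum_eq_zero fun a _ => h' a fun h => hpq (h.1.trans h.2.symm)

open Classical in
-- A simple tensor has one label at each half of the edge, so at most one term of the sum over
-- labels acts nontrivially on it.
lemma edgeTerm_ket (ℓ : Link N P Q) (ξ : State ιA ιX N P Q) :
    edgeTerm Φ ℓ (ket bA bX ξ) = if ℓ.Matches ξ then ket bA bX ξ else 0 := by
  have hA : ∀ (v v' : ASite N P Q) (q q' : ALabel A → Prop) [DecidablePred q] [DecidablePred q'],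
      (atA v (projA A q) ∘ₗ atA v' (projA A q')) (ketA bA ξ.1) =
        if q (ξ.1 v).1 ∧ q' (ξ.1 v').1 then ketA bA ξ.1 else 0 := by
    intro v v' q q' _ _
    rw [LinearMap.comp_apply, atA_projA_ketA]
    by_cases h : q' (ξ.1 v').1
    · rw [if_pos h, atA_projA_ketA]; simp only [h, and_true]
    · rw [if_neg h, map_zero, if_neg (fun h' => h h'.2)]
  have hX : ∀ (v v' : BSite P Q) (q q' : XLabel A X → Prop) [DecidablePred q] [DecidablePred q'],
      (atX v (projX Φ q) ∘ₗ atX v' (projX Φ q')) (ketX bX ξ.2) =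
        if q (ξ.2 v).1 ∧ q' (ξ.2 v').1 then ketX bX ξ.2 else 0 := by
    intro v v' q q' _ _
    rw [LinearMap.comp_apply, atX_projX_ketX]
    by_cases h : q' (ξ.2 v').1
    · rw [if_pos h, atX_projX_ketX]; simp only [h, and_true]
    · rw [if_neg h, map_zero, if_neg (fun h' => h h'.2)]
  rw [ket_eq]
  rcases ℓ with ⟨l, l', _, v⟩ | ⟨l, i, j⟩ | ⟨l, i, j⟩ | ⟨l, _, v⟩ | ⟨i, j⟩ | ⟨i, j⟩
  iterate 3
    refine sum_apply_eq_ite _ _ _ _ (fun a h1 h2 => ?_) (fun a h => ?_)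
    · rw [TensorProduct.map_tmul, hA, if_pos ⟨h1, h2⟩, LinearMap.id_apply]
    · rw [TensorProduct.map_tmul, hA, if_neg h, TensorProduct.zero_tmul]
  · refine sum_apply_eq_ite _ _ _ _ (fun a h1 h2 => ?_) (fun a h => ?_)
    · rw [TensorProduct.map_tmul, atA_projA_ketA, if_pos h1, atX_projX_ketX, if_pos h2]
    · rw [TensorProduct.map_tmul, atA_projA_ketA, atX_projX_ketX]
      by_cases h1 : (ξ.1 (l, v)).1.a₂ = a
      · rw [if_neg (fun h2 => h ⟨h1, h2⟩), TensorProduct.tmul_zero]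
      · rw [if_neg h1, TensorProduct.zero_tmul]
  iterate 2
    refine sum_apply_eq_ite _ _ _ _ (fun a h1 h2 => ?_) (fun a h => ?_)
    · rw [TensorProduct.map_tmul, hX, if_pos ⟨h1, h2⟩, LinearMap.id_apply]
    · rw [TensorProduct.map_tmul, hX, if_neg h, TensorProduct.tmul_zero]

lemma edgeTerm_eq_self_iff (ℓ : Link N P Q) (ψ : Htot Φ N P Q) :
    edgeTerm Φ ℓ ψ = ψ ↔
      ∀ ξ : State ιA ιX N P Q, ¬ ℓ.Matches ξ → (ketBasis N P Q bA bX).repr ψ ξ = 0 := by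
  classical
  have h : ∀ ξ, (ketBasis N P Q bA bX).repr (edgeTerm Φ ℓ ψ) ξ =
      if ℓ.Matches ξ then (ketBasis N P Q bA bX).repr ψ ξ else 0 := fun ξ => by
    conv_lhs => rw [← (ketBasis N P Q bA bX).sum_repr ψ]
    simp only [map_sum, map_smul, ketBasis_apply, edgeTerm_ket]
    simp only [← ketBasis_apply]
    have h2 : ∀ η : State ιA ιX N P Q, (ketBasis N P Q bA bX).repr
        (if ℓ.Matches η then ketBasis N P Q bA bX η else 0) ξ =
        if η = ξ then (if ℓ.Matches ξ then 1 else 0) else 0 := fun η => by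
      by_cases hη : η = ξ
      · subst hη
        by_cases hm : ℓ.Matches η <;> simp [hm]
      · by_cases hm : ℓ.Matches η <;> simp [hm, hη, Ne.symm hη]
    simp only [PiLp.smul_apply, WithLp.ofLp_sum, Finset.sum_apply, h2]
    simp
  constructor
  · intro hψ ξ hξ
    rw [← hψ, h, if_neg hξ]
  · intro hψ
    refine (ketBasis N P Q bA bX).repr.injective ?_
    ext ξ
    rw [h]
    split_ifs with hm
    · rfl
    · rw [hψ ξ hm]

/-- All edge terms are diagonal in this basis with eigenvalues `0` and `1`; a basis vector survives
when every edge matches. -/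
lemma mem_edgeGroundSpace_iff (ψ : Htot Φ N P Q) :
    ψ ∈ edgeGroundSpace Φ N P Q ↔
      ∀ ξ : State ιA ιX N P Q, ¬ ξ.Matched → (ketBasis N P Q bA bX).repr ψ ξ = 0 := by
  have h : ψ ∈ edgeGroundSpace Φ N P Q ↔ ∀ ℓ : Link N P Q, edgeTerm Φ ℓ ψ = ψ := by
    simp [edgeGroundSpace, Submodule.mem_iInf, LinearMap.mem_ker, sub_eq_zero]
  simp only [h, edgeTerm_eq_self_iff bA bX, State.Matched, not_forall]
  exact ⟨fun H ξ ⟨ℓ, hℓ⟩ => H ℓ ξ hℓ, fun H ℓ ξ hℓ => H ξ ⟨ℓ, hℓ⟩⟩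

end KetBasis

/-! ### Matrix elements of plaquette operators -/

namespace Plaq

variable {P Q : ℕ} (p : Plaq P Q)

lemma castSucc_ne_succ' {n : ℕ} (i : Fin n) : i.castSucc ≠ i.succ :=
  i.castSucc_lt_succ.ne

lemma c₁₁_ne_c₂₁ : p.c₁₁ ≠ p.c₂₁ := fun h => castSucc_ne_succ' _ (congrArg Prod.fst h)
lemma c₁₁_ne_c₁₂ : p.c₁₁ ≠ p.c₁₂ := fun h => castSucc_ne_succ' _ (congrArg Prod.snd h)
lemma c₁₁_ne_c₂₂ : p.c₁₁ ≠ p.c₂₂ := fun h => castSucc_ne_succ' _ (congrArg Prod.fst h)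
lemma c₂₁_ne_c₁₂ : p.c₂₁ ≠ p.c₁₂ := fun h => castSucc_ne_succ' _ (congrArg Prod.fst h).symm
lemma c₂₁_ne_c₂₂ : p.c₂₁ ≠ p.c₂₂ := fun h => castSucc_ne_succ' _ (congrArg Prod.snd h)
lemma c₁₂_ne_c₂₂ : p.c₁₂ ≠ p.c₂₂ := fun h => castSucc_ne_succ' _ (congrArg Prod.fst h)

/-- The corners of a plaquette. -/
def corners : Finset (BSite P Q) := {p.c₁₁, p.c₂₁, p.c₁₂, p.c₂₂}

lemma mem_corners {v : BSite P Q} : v ∈ p.corners ↔ p.IsCorner v := by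
  simp [corners, IsCorner]

lemma prod_eq {M : Type*} [CommMonoid M] (f : BSite P Q → M) :
    ∏ v, f v = (∏ v ∈ p.cornersᶜ, f v) * (f p.c₁₁ * f p.c₂₁ * f p.c₁₂ * f p.c₂₂) := by
  rw [← Finset.prod_compl_mul_prod p.corners, corners, Finset.prod_insert, Finset.prod_insert,
    Finset.prod_insert, Finset.prod_singleton, mul_assoc, mul_assoc]
  · simpa using p.c₁₂_ne_c₂₂
  · simpa using ⟨p.c₂₁_ne_c₁₂, p.c₂₁_ne_c₂₂⟩
  · simpa using ⟨p.c₁₁_ne_c₂₁, p.c₁₁_ne_c₁₂, p.c₁₁_ne_c₂₂⟩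

/-- Replace the values at the corners of a plaquette. -/
def setCorners {H : Type*} (F : BSite P Q → H) (x₁₁ x₂₁ x₁₂ x₂₂ : H) : BSite P Q → H := fun v =>
  if v = p.c₁₁ then x₁₁ else if v = p.c₂₁ then x₂₁ else
    if v = p.c₁₂ then x₁₂ else if v = p.c₂₂ then x₂₂ else F v

section SetCorners

variable {H : Type*} (F : BSite P Q → H) (x₁₁ x₂₁ x₁₂ x₂₂ : H)

@[simp] lemma setCorners_c₁₁ : p.setCorners F x₁₁ x₂₁ x₁₂ x₂₂ p.c₁₁ = x₁₁ := by simp [setCorners]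
@[simp] lemma setCorners_c₂₁ : p.setCorners F x₁₁ x₂₁ x₁₂ x₂₂ p.c₂₁ = x₂₁ := by
  simp [setCorners, p.c₁₁_ne_c₂₁.symm]
@[simp] lemma setCorners_c₁₂ : p.setCorners F x₁₁ x₂₁ x₁₂ x₂₂ p.c₁₂ = x₁₂ := by
  simp [setCorners, p.c₁₁_ne_c₁₂.symm, p.c₂₁_ne_c₁₂.symm]
@[simp] lemma setCorners_c₂₂ : p.setCorners F x₁₁ x₂₁ x₁₂ x₂₂ p.c₂₂ = x₂₂ := by
  simp [setCorners, p.c₁₁_ne_c₂₂.symm, p.c₂₁_ne_c₂₂.symm, p.c₁₂_ne_c₂₂.symm]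

lemma setCorners_of_not_mem {v : BSite P Q} (hv : v ∉ p.corners) :
    p.setCorners F x₁₁ x₂₁ x₁₂ x₂₂ v = F v := by
  simp only [mem_corners, IsCorner, not_or] at hv
  simp [setCorners, hv]

end SetCorners

end Plaq

/-! ### Plaquette operators as weighted sums of products of corner operators -/

section PlaquetteOp

variable {A : Type u₁} [Category.{v₁} A] [Abelian A] [Linear ℂ A] [MonoidalCategory A]
  [MonoidalPreadditive A] [MonoidalLinear ℂ A] [RightRigidCategory A] [UnitaryFusionCategory A]
  [BraidedCategory A]
  {X : Type u₂} [Category.{v₂} X] [Abelian X] [Linear ℂ X] [MonoidalCategory X]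
  [MonoidalPreadditive X] [MonoidalLinear ℂ X] [RightRigidCategory X] [UnitaryFusionCategory X]
  {Φ : Enrichment A X} {N P Q : ℕ} (p : Plaq P Q)

variable (X) in
/-- A basis of trivalent nodes with the loop attached from the left. -/
abbrev EdgeL (r : Irr X) : Type _ := Σ gk : Irr X × Irr X, IdxL r gk.1 gk.2

variable (X) in
/-- A basis of trivalent nodes with the loop attached from the right. -/
abbrev EdgeR (r : Irr X) : Type _ := Σ jn : Irr X × Irr X, IdxR jn.1 r jn.2

variable (X) in
/-- A loop together with basis vectors for the nodes on the bottom, right, top and left edge. -/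
abbrev LoopTerm : Type _ := Σ r : Irr X, EdgeL X r × EdgeL X r × EdgeR X r × EdgeR X r

namespace LoopTerm

/-- The weight of the change of the label of an edge. -/
def edgeWeight (g k : Irr X) : ℂ := ((√(k.d / g.d : ℝ) : ℝ) : ℂ)

/-- The weight of a loop. -/
def weight (θ : LoopTerm X) : ℂ :=
  ((1 / globalDim X * (1 / θ.1.d) : ℝ) : ℂ) * (edgeWeight θ.2.1.1.1 θ.2.1.1.2 *
    edgeWeight θ.2.2.1.1.1 θ.2.2.1.1.2 * edgeWeight θ.2.2.2.1.1.1 θ.2.2.2.1.1.2 *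
    edgeWeight θ.2.2.2.2.1.1 θ.2.2.2.2.1.2)

/-- One factor `√(new / old)` for each edge. In this form the weights of two loops acting on the
same edge telescope. -/
lemma loopCoeff_eq_edgeWeight (r g h i j k l m n : Irr X) :
    loopCoeff r g h i j k l m n = ((1 / r.d : ℝ) : ℂ) * (edgeWeight g k * edgeWeight h l *
      edgeWeight i m * edgeWeight j n) := by
  have := g.d.2; have := h.d.2; have := i.d.2; have := j.d.2; have := k.d.2; have := l.d.2
  have := m.d.2; have := n.d.2
  simp only [loopCoeff, edgeWeight, ← Complex.ofReal_mul]
  congr 1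
  rw [← Real.sqrt_mul (by positivity), ← Real.sqrt_mul (by positivity),
    ← Real.sqrt_mul (by positivity), mul_comm (r.d : ℝ), ← div_div, ← Real.sqrt_div (by positivity),
    div_eq_mul_one_div _ (r.d : ℝ), mul_comm]
  congr 2
  field_simp

lemma sum_eq {V : Type*} [AddCommGroup V] [Module ℂ V] (T : LoopTerm X → V) :
    ∑ θ : LoopTerm X, weight θ • T θ = ((1 / globalDim X : ℝ) : ℂ) •
      ∑ r : Irr X, ∑ g : Irr X, ∑ h : Irr X, ∑ i : Irr X, ∑ j : Irr X,
      ∑ k : Irr X, ∑ l : Irr X, ∑ m : Irr X, ∑ n : Irr X, loopCoeff r g h i j k l m n •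
      ∑ e : IdxL r g k, ∑ q : IdxL r h l, ∑ f : IdxR i r m, ∑ o : IdxR j r n,
        T ⟨r, ⟨(g, k), e⟩, ⟨(h, l), q⟩, ⟨(i, m), f⟩, ⟨(j, n), o⟩⟩ := by
  refine (Fintype.sum_equiv (κ := Σ (r : Irr X) (g : Irr X) (h : Irr X) (i : Irr X) (j : Irr X)
    (k : Irr X) (l : Irr X) (m : Irr X) (n : Irr X) (_ : IdxL r g k) (_ : IdxL r h l)
    (_ : IdxR i r m), IdxR j r n)
    ⟨fun ⟨r, ⟨(g, k), e⟩, ⟨(h, l), q⟩, ⟨(i, m), f⟩, ⟨(j, n), o⟩⟩ =>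
      ⟨r, g, h, i, j, k, l, m, n, e, q, f, o⟩,
     fun ⟨r, g, h, i, j, k, l, m, n, e, q, f, o⟩ =>
      ⟨r, ⟨(g, k), e⟩, ⟨(h, l), q⟩, ⟨(i, m), f⟩, ⟨(j, n), o⟩⟩, fun _ => rfl, fun _ => rfl⟩
    _ (fun ⟨r, g, h, i, j, k, l, m, n, e, q, f, o⟩ => ((1 / globalDim X : ℝ) : ℂ) •
      loopCoeff r g h i j k l m n • T ⟨r, ⟨(g, k), e⟩, ⟨(h, l), q⟩, ⟨(i, m), f⟩, ⟨(j, n), o⟩⟩)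
    ?_).trans ?_
  · rintro ⟨r, ⟨⟨g, k⟩, e⟩, ⟨⟨h, l⟩, q⟩, ⟨⟨i, m⟩, f⟩, ⟨⟨j, n⟩, o⟩⟩
    dsimp only [Equiv.coe_fn_mk]
    rw [smul_smul, loopCoeff_eq_edgeWeight, ← mul_assoc, ← Complex.ofReal_mul]
    rfl
  · iterate 9
      rw [Fintype.sum_sigma, Finset.smul_sum]
      refine Finset.sum_congr rfl fun _ _ => ?_
    rw [← smul_assoc, Fintype.sum_sigma, Finset.smul_sum]
    refine Finset.sum_congr rfl fun _ _ => ?_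
    iterate 2
      rw [Fintype.sum_sigma, Finset.smul_sum]
      refine Finset.sum_congr rfl fun _ _ => ?_
    rw [Finset.smul_sum]
    exact Finset.sum_congr rfl fun _ _ => smul_assoc _ _ _ |>.symm

variable (Φ) (θ : LoopTerm X)

/-- The operator of a loop at the lower left corner. -/
def op₁₁ : HX Φ →ₗ[ℂ] HX Φ := corner₁₁ Φ θ.2.2.2.2.2 θ.2.1.2
/-- The operator of a loop at the lower right corner. -/
def op₂₁ : HX Φ →ₗ[ℂ] HX Φ := corner₂₁ Φ θ.2.1.2 θ.2.2.1.2
/-- The operator of a loop at the upper left corner. -/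
def op₁₂ : HX Φ →ₗ[ℂ] HX Φ := corner₁₂ Φ θ.2.2.2.2.2 θ.2.2.2.1.2
/-- The operator of a loop at the upper right corner. -/
def op₂₂ : HX Φ →ₗ[ℂ] HX Φ := corner₂₂ Φ θ.2.2.2.1.2 θ.2.2.1.2

end LoopTerm

lemma localCoeff_eq_sum_loopTerm (φ₁₁ φ₂₁ φ₁₂ φ₂₂ ψ₁₁ ψ₂₁ ψ₁₂ ψ₂₂ : HX Φ) :
    localCoeff φ₁₁ φ₂₁ φ₁₂ φ₂₂ ψ₁₁ ψ₂₁ ψ₁₂ ψ₂₂ = ∑ θ : LoopTerm X, θ.weight *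
      (inner ℂ φ₁₁ (θ.op₁₁ Φ ψ₁₁) * inner ℂ φ₂₁ (θ.op₂₁ Φ ψ₂₁) *
        inner ℂ φ₁₂ (θ.op₁₂ Φ ψ₁₂) * inner ℂ φ₂₂ (θ.op₂₂ Φ ψ₂₂)) :=
  (LoopTerm.sum_eq (fun θ => inner ℂ φ₁₁ (θ.op₁₁ Φ ψ₁₁) * inner ℂ φ₂₁ (θ.op₂₁ Φ ψ₂₁) *
        inner ℂ φ₁₂ (θ.op₁₂ Φ ψ₁₂) * inner ℂ φ₂₂ (θ.op₂₂ Φ ψ₂₂))).symm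

lemma atCorners_tprod (S₁₁ S₂₁ S₁₂ S₂₂ : HX Φ →ₗ[ℂ] HX Φ) (F : BSite P Q → HX Φ) :
    p.atCorners Φ S₁₁ S₂₁ S₁₂ S₂₂ (PiHilbert.tprod F) =
      PiHilbert.tprod (p.setCorners F (S₁₁ (F p.c₁₁)) (S₂₁ (F p.c₂₁)) (S₁₂ (F p.c₁₂))
        (S₂₂ (F p.c₂₂))) := by
  rw [Plaq.atCorners, PiHilbert.map_tprod]
  congr 1
  ext1 v
  dsimp only [Plaq.setCorners]
  split_ifs with h1 h2 h3 h4
  · rw [h1]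
  · rw [h2]
  · rw [h3]
  · rw [h4]
  · rfl

variable (Φ) in
/-- The plaquette operator on the boundary layer. -/
def plaquetteX : PiHilbert (BSite P Q) (HX Φ) →ₗ[ℂ] PiHilbert (BSite P Q) (HX Φ) :=
  ∑ θ : LoopTerm X, θ.weight • p.atCorners Φ (θ.op₁₁ Φ) (θ.op₂₁ Φ) (θ.op₁₂ Φ) (θ.op₂₂ Φ)

variable (Φ N) in
lemma plaquetteOp_eq : plaquetteOp Φ N p = TensorProduct.map LinearMap.id (plaquetteX Φ p) :=
  congrArg (TensorProduct.map LinearMap.id) (LoopTerm.sum_eq fun θ : LoopTerm X =>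
    p.atCorners Φ (θ.op₁₁ Φ) (θ.op₂₁ Φ) (θ.op₁₂ Φ) (θ.op₂₂ Φ)).symm

lemma sum_smul_apply {α V W : Type*} [Fintype α] [AddCommGroup V] [Module ℂ V] [AddCommGroup W]
    [Module ℂ W] (c : α → ℂ) (T : α → V →ₗ[ℂ] W) (x : V) :
    (∑ a, c a • T a) x = ∑ a, c a • T a x := by
  rw [LinearMap.sum_apply]; rfl

lemma plaquetteX_tprod (F : BSite P Q → HX Φ) :
    plaquetteX Φ p (PiHilbert.tprod F) = ∑ θ : LoopTerm X, θ.weight •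
      PiHilbert.tprod (p.setCorners F (θ.op₁₁ Φ (F p.c₁₁)) (θ.op₂₁ Φ (F p.c₂₁))
        (θ.op₁₂ Φ (F p.c₁₂)) (θ.op₂₂ Φ (F p.c₂₂))) := by
  refine (sum_smul_apply _ _ _).trans (Finset.sum_congr rfl fun θ _ => ?_)
  rw [atCorners_tprod]

lemma inner_tprod_setCorners (F F' : BSite P Q → HX Φ) (x₁₁ x₂₁ x₁₂ x₂₂ : HX Φ) :
    inner ℂ (PiHilbert.tprod F') (PiHilbert.tprod (p.setCorners F x₁₁ x₂₁ x₁₂ x₂₂)) =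
      (∏ v ∈ p.cornersᶜ, inner ℂ (F' v) (F v)) * (inner ℂ (F' p.c₁₁) x₁₁ * inner ℂ (F' p.c₂₁) x₂₁ *
        inner ℂ (F' p.c₁₂) x₁₂ * inner ℂ (F' p.c₂₂) x₂₂) := by
  rw [PiHilbert.inner_tprod, p.prod_eq]
  simp only [Plaq.setCorners_c₁₁, Plaq.setCorners_c₂₁, Plaq.setCorners_c₁₂, Plaq.setCorners_c₂₂]
  congr 1
  refine Finset.prod_congr rfl fun v hv => ?_
  rw [p.setCorners_of_not_mem _ _ _ _ _ (by simpa using hv)]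

lemma inner_sum_smul {α V : Type*} [Fintype α] [NormedAddCommGroup V] [InnerProductSpace ℂ V]
    (c : α → ℂ) (x : α → V) (y : V) : inner ℂ y (∑ a, c a • x a) = ∑ a, c a * inner ℂ y (x a) := by
  simp only [inner_sum, inner_smul_right]

lemma inner_plaquetteX (F F' : BSite P Q → HX Φ) :
    inner ℂ (PiHilbert.tprod F') (plaquetteX Φ p (PiHilbert.tprod F)) =
      (∏ v ∈ p.cornersᶜ, inner ℂ (F' v) (F v)) *
        localCoeff (F' p.c₁₁) (F' p.c₂₁) (F' p.c₁₂) (F' p.c₂₂)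
          (F p.c₁₁) (F p.c₂₁) (F p.c₁₂) (F p.c₂₂) := by
  rw [plaquetteX_tprod, inner_sum_smul, localCoeff_eq_sum_loopTerm, Finset.mul_sum]
  refine Finset.sum_congr rfl fun θ _ => ?_
  rw [inner_tprod_setCorners]
  ring

lemma inner_plaquetteX_plaquetteX (F F' : BSite P Q → HX Φ) :
    inner ℂ (PiHilbert.tprod F') (plaquetteX Φ p (plaquetteX Φ p (PiHilbert.tprod F))) =
      (∏ v ∈ p.cornersᶜ, inner ℂ (F' v) (F v)) * ∑ θ : LoopTerm X, θ.weight *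
        localCoeff (F' p.c₁₁) (F' p.c₂₁) (F' p.c₁₂) (F' p.c₂₂)
          (θ.op₁₁ Φ (F p.c₁₁)) (θ.op₂₁ Φ (F p.c₂₁)) (θ.op₁₂ Φ (F p.c₁₂)) (θ.op₂₂ Φ (F p.c₂₂)) := by
  rw [plaquetteX_tprod, map_sum, inner_sum, Finset.mul_sum]
  refine Finset.sum_congr rfl fun θ _ => ?_
  rw [map_smul, inner_smul_right, inner_plaquetteX, Plaq.setCorners_c₁₁, Plaq.setCorners_c₂₁,
    Plaq.setCorners_c₁₂, Plaq.setCorners_c₂₂, Finset.prod_congr rfl fun v hv => by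
      rw [p.setCorners_of_not_mem _ _ _ _ _ (by simpa using hv)]]
  ring

lemma inner_plaquetteOp (ψ ψ' : PiHilbert (ASite N P Q) (HA A))
    (φ φ' : PiHilbert (BSite P Q) (HX Φ)) :
    inner ℂ (ψ' ⊗ₜ[ℂ] φ') (plaquetteOp Φ N p (ψ ⊗ₜ[ℂ] φ)) =
      inner ℂ ψ' ψ * inner ℂ φ' (plaquetteX Φ p φ) := by
  rw [plaquetteOp_eq, TensorProduct.map_tmul, TensorProduct.inner_tmul]
  rfl

end PlaquetteOp

/-! ### Symmetry, idempotence and diagrammatic form of local matrix elements -/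

section LocalCoeff

variable {A : Type u₁} [Category.{v₁} A] [Abelian A] [Linear ℂ A] [MonoidalCategory A]
  [MonoidalPreadditive A] [MonoidalLinear ℂ A] [RightRigidCategory A] [UnitaryFusionCategory A]
  [BraidedCategory A]
  {X : Type u₂} [Category.{v₂} X] [Abelian X] [Linear ℂ X] [MonoidalCategory X]
  [MonoidalPreadditive X] [MonoidalLinear ℂ X] [RightRigidCategory X] [UnitaryFusionCategory X]
  {Φ : Enrichment A X} {L₁₁ L₂₁ L₁₂ L₂₂ M₁₁ M₂₁ M₁₂ M₂₂ : XLabel A X}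
  {g h i j k l m n : Irr X}

namespace LoopLabels

/-- The types of the corner morphisms depend on the labels. After substituting this normal form all
gluings are between definitionally equal objects. -/
lemma exists_eq (H : LoopLabels L₁₁ L₂₁ L₁₂ L₂₂ M₁₁ M₂₁ M₁₂ M₂₂ g h i j k l m n) :
    ∃ a b c d s t u v w x y z, L₁₁ = ⟨a, s, t, j, g⟩ ∧ L₂₁ = ⟨b, g, u, h, v⟩ ∧
      L₁₂ = ⟨d, z, j, y, i⟩ ∧ L₂₂ = ⟨c, i, h, x, w⟩ ∧ M₁₁ = ⟨a, s, t, n, k⟩ ∧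
      M₂₁ = ⟨b, k, u, l, v⟩ ∧ M₁₂ = ⟨d, z, n, y, m⟩ ∧ M₂₂ = ⟨c, m, l, x, w⟩ := by
  obtain ⟨rfl, hg, rfl, hh, rfl, hi, rfl, hj, rfl, rfl, rfl, rfl⟩ := H
  refine ⟨L₁₁.a, L₂₁.a, L₂₂.a, L₁₂.a, L₁₁.x₁, L₁₁.y₁, L₂₁.y₁, L₂₁.x₂, L₂₂.x₂, L₂₂.y₂, L₁₂.y₂,
    L₁₂.x₁, rfl, ?_, ?_, ?_, rfl, rfl, rfl, rfl⟩
  · rw [← hg]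
  · rw [← hj]
  · rw [← hh, ← hi]

lemma symm (H : LoopLabels L₁₁ L₂₁ L₁₂ L₂₂ M₁₁ M₂₁ M₁₂ M₂₂ g h i j k l m n) :
    LoopLabels M₁₁ M₂₁ M₁₂ M₂₂ L₁₁ L₂₁ L₁₂ L₂₂ k l m n g h i j := by
  obtain ⟨a, b, c, d, s, t, u, v, w, x, y, z, rfl, rfl, rfl, rfl, rfl, rfl, rfl, rfl⟩ := H.exists_eq
  exact ⟨rfl, rfl, rfl, rfl, rfl, rfl, rfl, rfl, rfl, rfl, rfl, rfl⟩

end LoopLabels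

variable (ξ₁₁ : XHom Φ L₁₁) (ξ₂₁ : XHom Φ L₂₁) (ξ₁₂ : XHom Φ L₁₂) (ξ₂₂ : XHom Φ L₂₂)
  (η₁₁ : XHom Φ M₁₁) (η₂₁ : XHom Φ M₂₁) (η₁₂ : XHom Φ M₁₂) (η₂₂ : XHom Φ M₂₂)

lemma localCoeff_eq_skein
    (H : LoopLabels L₁₁ L₂₁ L₁₂ L₂₂ M₁₁ M₂₁ M₁₂ M₂₂ g h i j k l m n) :
    localCoeff (hvec M₁₁ η₁₁.hom) (hvec M₂₁ η₂₁.hom) (hvec M₁₂ η₁₂.hom) (hvec M₂₂ η₂₂.hom)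
      (hvec L₁₁ ξ₁₁.hom) (hvec L₂₁ ξ₂₁.hom) (hvec L₁₂ ξ₁₂.hom) (hvec L₂₂ ξ₂₂.hom) =
    ((1 / (globalDim X * √(L₁₁.a.d * L₂₁.a.d * L₂₂.a.d * L₁₂.a.d * L₁₁.x₁.d * L₁₁.y₁.d *
      L₂₁.y₁.d * L₂₁.x₂.d * L₂₂.x₂.d * L₂₂.y₂.d * L₁₂.y₂.d * L₁₂.x₁.d : ℝ)) : ℝ) : ℂ) *
    tr (skeinEval ξ₁₁ ξ₂₁ ξ₁₂ ξ₂₂ ≫ skeinCodδ L₂₁ L₁₂ L₂₂ M₂₁ M₁₂ M₂₂ ≫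
      dag (skeinEval η₁₁ η₂₁ η₁₂ η₂₂) ≫ skeinDomδ Φ M₁₁ M₂₁ M₁₂ M₂₂ L₁₁ L₂₁ L₁₂ L₂₂) := by
  obtain ⟨a, b, c, d, s, t, u, v, w, x, y, z, rfl, rfl, rfl, rfl, rfl, rfl, rfl, rfl⟩ := H.exists_eq
  exact (localCoeff_hvec _ _ _ _ _ _ _ _).trans
    (congrArg _ (skeinDiagram_eq ξ₁₁ ξ₂₁ ξ₁₂ ξ₂₂ η₁₁ η₂₁ η₁₂ η₂₂).symm)

lemma localCoeff_eq_planar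
    (H : LoopLabels L₁₁ L₂₁ L₁₂ L₂₂ M₁₁ M₂₁ M₁₂ M₂₂ g h i j k l m n) :
    localCoeff (hvec M₁₁ η₁₁.hom) (hvec M₂₁ η₂₁.hom) (hvec M₁₂ η₁₂.hom) (hvec M₂₂ η₂₂.hom)
      (hvec L₁₁ ξ₁₁.hom) (hvec L₂₁ ξ₂₁.hom) (hvec L₁₂ ξ₁₂.hom) (hvec L₂₂ ξ₂₂.hom) =
    ((1 / (globalDim X * √(L₁₁.a.d * L₂₁.a.d * L₂₂.a.d * L₁₂.a.d * L₁₁.x₁.d * L₁₁.y₁.d *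
      L₂₁.y₁.d * L₂₁.x₂.d * L₂₂.x₂.d * L₂₂.y₂.d * L₁₂.y₂.d * L₁₂.x₁.d : ℝ)) : ℝ) : ℂ) *
    tr (planarEval ξ₁₁ ξ₂₁ ξ₁₂ ξ₂₂ ≫ planarCodδ Φ L₂₁ L₁₂ L₂₂ M₂₁ M₁₂ M₂₂ ≫
      dag (planarEval η₁₁ η₂₁ η₁₂ η₂₂) ≫ planarDomδ Φ M₁₁ M₂₁ M₁₂ L₁₁ L₂₁ L₁₂) := by
  obtain ⟨a, b, c, d, s, t, u, v, w, x, y, z, rfl, rfl, rfl, rfl, rfl, rfl, rfl, rfl⟩ := H.exists_eq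
  exact (localCoeff_hvec _ _ _ _ _ _ _ _).trans
    (congrArg _ (planarDiagram_eq ξ₁₁ ξ₂₁ ξ₁₂ ξ₂₂ η₁₁ η₂₁ η₁₂ η₂₂).symm)

/-- Conjugating `tr (eval ξ ≫ dag (eval η))` exchanges `ξ` and `η`, and the constant involves only
the external labels, which the two share. If the labels do not fit, both sides vanish. -/
lemma conj_localCoeff :
    conj (localCoeff (hvec M₁₁ η₁₁.hom) (hvec M₂₁ η₂₁.hom) (hvec M₁₂ η₁₂.hom) (hvec M₂₂ η₂₂.hom)
      (hvec L₁₁ ξ₁₁.hom) (hvec L₂₁ ξ₂₁.hom) (hvec L₁₂ ξ₁₂.hom) (hvec L₂₂ ξ₂₂.hom)) =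
    localCoeff (hvec L₁₁ ξ₁₁.hom) (hvec L₂₁ ξ₂₁.hom) (hvec L₁₂ ξ₁₂.hom) (hvec L₂₂ ξ₂₂.hom)
      (hvec M₁₁ η₁₁.hom) (hvec M₂₁ η₂₁.hom) (hvec M₁₂ η₁₂.hom) (hvec M₂₂ η₂₂.hom) := by
  by_cases hL : ∃ g h i j k l m n, LoopLabels L₁₁ L₂₁ L₁₂ L₂₂ M₁₁ M₂₁ M₁₂ M₂₂ g h i j k l m n
  · obtain ⟨g, h, i, j, k, l, m, n, H⟩ := hL
    obtain ⟨a, b, c, d, s, t, u, v, w, x, y, z, rfl, rfl, rfl, rfl, rfl, rfl, rfl, rfl⟩ :=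
      H.exists_eq
    refine (congrArg conj (localCoeff_hvec _ _ _ _ _ _ _ _)).trans
      (Eq.trans ?_ (localCoeff_hvec _ _ _ _ _ _ _ _).symm)
    rw [map_mul, Complex.conj_ofReal, ← tr_dag, dag_comp, dag_dag]
  · rw [not_ne_iff.1 (mt loopLabels_of_localCoeff_ne_zero hL), map_zero]
    refine (not_ne_iff.1 (mt loopLabels_of_localCoeff_ne_zero fun H => hL ?_)).symm
    obtain ⟨g, h, i, j, k, l, m, n, H⟩ := H
    exact ⟨_, _, _, _, _, _, _, _, H.symm⟩

/-- The functional `f ↦ c tr (f ≫ y)`. -/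
def trFunctional {x y : X} (c : ℂ) (f : y ⟶ x) : (x ⟶ y) →ₗ[ℂ] ℂ where
  toFun φ := c * tr (φ ≫ f)
  map_add' φ ψ := by rw [Preadditive.add_comp, tr_add, mul_add]
  map_smul' a φ := by
    rw [Linear.smul_comp, tr_smul, RingHom.id_apply, smul_eq_mul]; ring

lemma op_hvec_eq_zero_of_ne (θ : LoopTerm X)
    (hne : ¬ (L₁₁.x₂ = θ.2.1.1.1 ∧ L₂₁.x₁ = θ.2.1.1.1 ∧ L₂₁.y₂ = θ.2.2.1.1.1 ∧
      L₂₂.y₁ = θ.2.2.1.1.1 ∧ L₁₂.x₂ = θ.2.2.2.1.1.1 ∧ L₂₂.x₁ = θ.2.2.2.1.1.1 ∧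
      L₁₁.y₂ = θ.2.2.2.2.1.1 ∧ L₁₂.y₁ = θ.2.2.2.2.1.1)) :
    θ.op₁₁ Φ (hvec L₁₁ ξ₁₁.hom) = 0 ∨ θ.op₂₁ Φ (hvec L₂₁ ξ₂₁.hom) = 0 ∨
      θ.op₁₂ Φ (hvec L₁₂ ξ₁₂.hom) = 0 ∨ θ.op₂₂ Φ (hvec L₂₂ ξ₂₂.hom) = 0 := by
  by_contra! hc
  obtain ⟨c1, c2, c3, c4⟩ := hc
  have h1 := not_not.1 (mt (corner₁₁_hvec_of_ne _ _ _ _) c1)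
  have h2 := not_not.1 (mt (corner₂₁_hvec_of_ne _ _ _ _) c2)
  have h3 := not_not.1 (mt (corner₁₂_hvec_of_ne _ _ _ _) c3)
  have h4 := not_not.1 (mt (corner₂₂_hvec_of_ne _ _ _ _) c4)
  exact hne ⟨h1.2, h2.1, h2.2, h4.2, h3.2, h4.1, h1.1, h3.1⟩

lemma localCoeff_eq_zero {φ₁₁ φ₂₁ φ₁₂ φ₂₂ ψ₁₁ ψ₂₁ ψ₁₂ ψ₂₂ : HX Φ}
    (h0 : ψ₁₁ = 0 ∨ ψ₂₁ = 0 ∨ ψ₁₂ = 0 ∨ ψ₂₂ = 0) :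
    localCoeff φ₁₁ φ₂₁ φ₁₂ φ₂₂ ψ₁₁ ψ₂₁ ψ₁₂ ψ₂₂ = 0 := by
  rw [localCoeff_eq_sum_loopTerm]
  refine Finset.sum_eq_zero fun θ _ => ?_
  rcases h0 with rfl | rfl | rfl | rfl <;> rw [map_zero, inner_zero_right] <;> ring

lemma LoopTerm.sum_eq_of_labels {V : Type*} [AddCommGroup V] [Module ℂ V] (T : LoopTerm X → V)
    (hT : ∀ θ : LoopTerm X, ¬ (θ.2.1.1.1 = g ∧ θ.2.2.1.1.1 = h ∧ θ.2.2.2.1.1.1 = i ∧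
      θ.2.2.2.2.1.1 = j) → T θ = 0) :
    ∑ θ : LoopTerm X, θ.weight • T θ = ((1 / globalDim X : ℝ) : ℂ) •
      ∑ r : Irr X, ∑ k : Irr X, ∑ l : Irr X, ∑ m : Irr X, ∑ n : Irr X,
      loopCoeff r g h i j k l m n •
      ∑ e : IdxL r g k, ∑ q : IdxL r h l, ∑ f : IdxR i r m, ∑ o : IdxR j r n,
        T ⟨r, ⟨(g, k), e⟩, ⟨(h, l), q⟩, ⟨(i, m), f⟩, ⟨(j, n), o⟩⟩ := by
  refine (LoopTerm.sum_eq T).trans (congrArg _ (Finset.sum_congr rfl fun r _ => ?_))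
  have key : ∀ {α : Type _} [Fintype α] (F : α → α → α → α → V) (g h i j : α)
      (_ : ∀ g' h' i' j', ¬ (g' = g ∧ h' = h ∧ i' = i ∧ j' = j) → F g' h' i' j' = 0),
      ∑ g', ∑ h', ∑ i', ∑ j', F g' h' i' j' = F g h i j := by
    intro α _ F g h i j hF
    rw [Fintype.sum_eq_single g, Fintype.sum_eq_single h, Fintype.sum_eq_single i,
      Fintype.sum_eq_single j]
    · exact fun x hx => hF _ _ _ _ (by tauto)
    · exact fun x hx => Finset.sum_eq_zero fun _ _ => hF _ _ _ _ (by tauto)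
    · exact fun x hx => Finset.sum_eq_zero fun _ _ => Finset.sum_eq_zero fun _ _ =>
        hF _ _ _ _ (by tauto)
    · exact fun x hx => Finset.sum_eq_zero fun _ _ => Finset.sum_eq_zero fun _ _ =>
        Finset.sum_eq_zero fun _ _ => hF _ _ _ _ (by tauto)
  refine key _ g h i j fun g' h' i' j' hne => ?_
  refine Finset.sum_eq_zero fun k _ => Finset.sum_eq_zero fun l _ => Finset.sum_eq_zero fun m _ =>
    Finset.sum_eq_zero fun n _ => (congrArg _ ?_).trans (smul_zero _)
  exact Finset.sum_eq_zero fun e _ => Finset.sum_eq_zero fun q _ => Finset.sum_eq_zero fun f _ =>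
    Finset.sum_eq_zero fun o _ => hT _ hne

/-- The local form of `B_p² = B_p`: as a function of `ξ` the coefficient is a linear functional of
the planar evaluation, which fusing a loop does not change. -/
lemma sum_localCoeff_op_of_matched {a b c d : Irr A} {s t u v w x y z : Irr X}
    (ξ₁₁ : Φ.obj a ⊗ (s.obj ⊗ t.obj) ⟶ j.obj ⊗ g.obj)
    (ξ₂₁ : Φ.obj b ⊗ (g.obj ⊗ u.obj) ⟶ h.obj ⊗ v.obj)
    (ξ₁₂ : Φ.obj d ⊗ (z.obj ⊗ j.obj) ⟶ y.obj ⊗ i.obj)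
    (ξ₂₂ : Φ.obj c ⊗ (i.obj ⊗ h.obj) ⟶ x.obj ⊗ w.obj) :
    ∑ θ : LoopTerm X, θ.weight •
      localCoeff (hvec M₁₁ η₁₁.hom) (hvec M₂₁ η₂₁.hom) (hvec M₁₂ η₁₂.hom) (hvec M₂₂ η₂₂.hom)
        (θ.op₁₁ Φ (hvec ⟨a, s, t, j, g⟩ ξ₁₁)) (θ.op₂₁ Φ (hvec ⟨b, g, u, h, v⟩ ξ₂₁))
        (θ.op₁₂ Φ (hvec ⟨d, z, j, y, i⟩ ξ₁₂)) (θ.op₂₂ Φ (hvec ⟨c, i, h, x, w⟩ ξ₂₂)) =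
    localCoeff (hvec M₁₁ η₁₁.hom) (hvec M₂₁ η₂₁.hom) (hvec M₁₂ η₁₂.hom) (hvec M₂₂ η₂₂.hom)
      (hvec ⟨a, s, t, j, g⟩ ξ₁₁) (hvec ⟨b, g, u, h, v⟩ ξ₂₁)
      (hvec ⟨d, z, j, y, i⟩ ξ₁₂) (hvec ⟨c, i, h, x, w⟩ ξ₂₂) := by
  refine (LoopTerm.sum_eq_of_labels (g := g) (h := h) (i := i) (j := j) _ fun θ hθ => ?_).trans ?_
  · refine localCoeff_eq_zero (op_hvec_eq_zero_of_ne (L₁₁ := ⟨a, s, t, j, g⟩)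
      (L₂₁ := ⟨b, g, u, h, v⟩) (L₁₂ := ⟨d, z, j, y, i⟩) (L₂₂ := ⟨c, i, h, x, w⟩) ξ₁₁ ξ₂₁ ξ₁₂ ξ₂₂ θ ?_)
    rintro ⟨h1, -, h2, -, h3, -, h4, -⟩
    exact hθ ⟨h1.symm, h2.symm, h3.symm, h4.symm⟩
  dsimp only [LoopTerm.op₁₁, LoopTerm.op₂₁, LoopTerm.op₁₂, LoopTerm.op₂₂]
  simp only [corner₁₁_hvec, corner₂₁_hvec, corner₁₂_hvec, corner₂₂_hvec]
  by_cases hL : ∃ k l m n, M₁₁ = ⟨a, s, t, n, k⟩ ∧ M₂₁ = ⟨b, k, u, l, v⟩ ∧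
    M₁₂ = ⟨d, z, n, y, m⟩ ∧ M₂₂ = ⟨c, m, l, x, w⟩
  · obtain ⟨k, l, m, n, rfl, rfl, rfl, rfl⟩ := hL
    -- The same functional serves for `ξ` and for every fused term, because a loop leaves the
    -- external labels alone and these fix the constant.
    let ℓ := trFunctional (((1 / (globalDim X * √(a.d * b.d * c.d * d.d * s.d * t.d * u.d * v.d *
      w.d * x.d * y.d * z.d : ℝ)) : ℝ) : ℂ))
      (dag (planarGlue ((Φ.hb b).β k.obj).inv η₁₁.hom η₂₁.hom η₁₂.hom η₂₂.hom))
    refine Eq.trans ?_ (localCoeff_hvec _ _ _ _ _ _ _ _).symm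
    refine Eq.trans ?_ (congrArg ℓ (sum_planarGlue_fused (Φ.hb b) ξ₁₁ ξ₂₁ ξ₁₂ ξ₂₂))
    simp only [map_smul, map_sum]
    refine congrArg _ ?_
    refine Finset.sum_congr rfl fun r _ => Finset.sum_congr rfl fun k _ =>
      Finset.sum_congr rfl fun l _ =>
        Finset.sum_congr rfl fun m _ => Finset.sum_congr rfl fun n _ => congrArg _ ?_
    refine Finset.sum_congr rfl fun e _ => Finset.sum_congr rfl fun q _ =>
        Finset.sum_congr rfl fun f _ => Finset.sum_congr rfl fun o _ => ?_
    exact localCoeff_hvec _ _ _ _ _ _ _ _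
  -- When `η` is not reachable from the external labels of `ξ`, every coefficient on either side is
  -- zero.
  · have h0 : ∀ {k l m n} ξ₁₁ ξ₂₁ ξ₁₂ ξ₂₂, localCoeff (hvec M₁₁ η₁₁.hom) (hvec M₂₁ η₂₁.hom)
        (hvec M₁₂ η₁₂.hom) (hvec M₂₂ η₂₂.hom) (hvec ⟨a, s, t, n, k⟩ ξ₁₁) (hvec ⟨b, k, u, l, v⟩ ξ₂₁)
        (hvec ⟨d, z, n, y, m⟩ ξ₁₂) (hvec ⟨c, m, l, x, w⟩ ξ₂₂) = 0 := by
      intro k l m n ξ₁₁ ξ₂₁ ξ₁₂ ξ₂₂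
      refine not_ne_iff.1 (mt loopLabels_of_localCoeff_ne_zero fun H => hL ?_)
      obtain ⟨_, _, _, _, k', l', m', n', H⟩ := H
      exact ⟨k', l', m', n', H.M₁₁_eq, H.M₂₁_eq, H.M₁₂_eq, H.M₂₂_eq⟩
    simp only [h0, Finset.sum_const_zero, smul_zero]

/-- When the inner edges of `ξ` do not match, some corner operator kills its vector in every term,
and both sides vanish. Idempotence therefore needs no restriction to matched states. -/
lemma sum_localCoeff_op :
    ∑ θ : LoopTerm X, θ.weight •
      localCoeff (hvec M₁₁ η₁₁.hom) (hvec M₂₁ η₂₁.hom) (hvec M₁₂ η₁₂.hom) (hvec M₂₂ η₂₂.hom)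
        (θ.op₁₁ Φ (hvec L₁₁ ξ₁₁.hom)) (θ.op₂₁ Φ (hvec L₂₁ ξ₂₁.hom))
        (θ.op₁₂ Φ (hvec L₁₂ ξ₁₂.hom)) (θ.op₂₂ Φ (hvec L₂₂ ξ₂₂.hom)) =
    localCoeff (hvec M₁₁ η₁₁.hom) (hvec M₂₁ η₂₁.hom) (hvec M₁₂ η₁₂.hom) (hvec M₂₂ η₂₂.hom)
      (hvec L₁₁ ξ₁₁.hom) (hvec L₂₁ ξ₂₁.hom) (hvec L₁₂ ξ₁₂.hom) (hvec L₂₂ ξ₂₂.hom) := by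
  by_cases hL : L₁₁.x₂ = L₂₁.x₁ ∧ L₂₁.y₂ = L₂₂.y₁ ∧ L₁₂.x₂ = L₂₂.x₁ ∧ L₁₁.y₂ = L₁₂.y₁
  · obtain ⟨a, s, t, j, g⟩ := L₁₁
    obtain ⟨b, g', u, h, v⟩ := L₂₁
    obtain ⟨d, z, j', y, i⟩ := L₁₂
    obtain ⟨c, i', h', x, w⟩ := L₂₂
    obtain ⟨h1, h2, h3, h4⟩ := hL
    dsimp only at h1 h2 h3 h4
    subst h1 h2 h3 h4
    exact sum_localCoeff_op_of_matched _ _ _ _ _ _ _ _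
  · have h0 := not_ne_iff.1 (mt (loopLabels_of_localCoeff_ne_zero (Φ := Φ) (η₁₁ := η₁₁.hom)
      (η₂₁ := η₂₁.hom) (η₁₂ := η₁₂.hom) (η₂₂ := η₂₂.hom) (ξ₁₁ := ξ₁₁.hom) (ξ₂₁ := ξ₂₁.hom)
      (ξ₁₂ := ξ₁₂.hom) (ξ₂₂ := ξ₂₂.hom)) fun H => hL ?_)
    · rw [h0]
      refine Finset.sum_eq_zero fun θ _ => ?_
      rw [localCoeff_eq_zero (op_hvec_eq_zero_of_ne ξ₁₁ ξ₂₁ ξ₁₂ ξ₂₂ θ ?_), smul_zero]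
      rintro ⟨h1, h2, h3, h4, h5, h6, h7, h8⟩
      exact hL ⟨h1.trans h2.symm, h3.trans h4.symm, h5.trans h6.symm, h7.trans h8.symm⟩
    · obtain ⟨_, _, _, _, _, _, _, _, H⟩ := H
      exact ⟨H.g₁.trans H.g₂.symm, H.h₁.trans H.h₂.symm, H.i₁.trans H.i₂.symm,
        H.j₁.trans H.j₂.symm⟩

end LocalCoeff

/-! ### Matrix coefficients of plaquette operators -/

section OrthonormalBasis

variable {ι E : Type*} [Fintype ι] [NormedAddCommGroup E] [InnerProductSpace ℂ E]

lemma isSymmetric_of_orthonormalBasis (b : OrthonormalBasis ι ℂ E) (T : E →ₗ[ℂ] E)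
    (h : ∀ i j, conj (inner ℂ (b i) (T (b j))) = inner ℂ (b j) (T (b i))) : T.IsSymmetric := by
  intro x y
  rw [← b.sum_repr' x, ← b.sum_repr' y]
  generalize (fun i => inner ℂ (b i) x) = c
  simp only [map_sum, map_smul, sum_inner, inner_sum, inner_smul_left, inner_smul_right]
  refine Finset.sum_congr rfl fun i _ => congrArg _ (Finset.sum_congr rfl fun j _ => ?_)
  rw [← h i j, inner_conj_symm, inner_conj_symm]

lemma linearMap_ext_of_orthonormalBasis (b : OrthonormalBasis ι ℂ E) {S T : E →ₗ[ℂ] E}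
    (h : ∀ i j, inner ℂ (b i) (S (b j)) = inner ℂ (b i) (T (b j))) : S = T := by
  refine b.toBasis.ext fun j => ?_
  rw [b.coe_toBasis]
  refine InnerProductSpace.ext_inner_left_basis b.toBasis fun i => ?_
  rw [b.coe_toBasis]
  exact h i j

lemma mem_of_repr_eq_zero (b : OrthonormalBasis ι ℂ E) (T : E →ₗ[ℂ] E) (p : ι → Prop)
    (h : ∀ i j, p j → inner ℂ (b i) (T (b j)) ≠ 0 → p i) {x : E}
    (hx : ∀ i, ¬ p i → b.repr x i = 0) (i : ι) (hi : ¬ p i) : b.repr (T x) i = 0 := by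
  rw [b.repr_apply_apply, ← b.sum_repr x, map_sum, inner_sum]
  refine Finset.sum_eq_zero fun j _ => ?_
  rw [map_smul, inner_smul_right]
  by_cases hj : p j
  · rw [not_ne_iff.1 (mt (h i j hj) hi), mul_zero]
  · rw [hx j hj, zero_mul]

end OrthonormalBasis

/-! ### Selection rules, symmetry and idempotence on the whole lattice -/

section MatrixCoeff

variable {A : Type u₁} [Category.{v₁} A] [Abelian A] [Linear ℂ A] [MonoidalCategory A]
  [MonoidalPreadditive A] [MonoidalLinear ℂ A] [RightRigidCategory A] [UnitaryFusionCategory A]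
  [BraidedCategory A]
  {X : Type u₂} [Category.{v₂} X] [Abelian X] [Linear ℂ X] [MonoidalCategory X]
  [MonoidalPreadditive X] [MonoidalLinear ℂ X] [RightRigidCategory X] [UnitaryFusionCategory X]
  {Φ : Enrichment A X} {N P Q : ℕ} (p : Plaq P Q)
  {ιA : ALabel A → Type w₁} {ιX : XLabel A X → Type w₂}

/-- The corners of `ξ` and `η` carry the labels of a plaquette whose edges change from
`g, h, i, j` to `k, l, m, n`. -/
abbrev State.LoopLabels (ξ η : State ιA ιX N P Q) (g h i j k l m n : Irr X) : Prop :=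
  EnrichedStringNet.LoopLabels (ξ.2 p.c₁₁).1 (ξ.2 p.c₂₁).1 (ξ.2 p.c₁₂).1 (ξ.2 p.c₂₂).1
    (η.2 p.c₁₁).1 (η.2 p.c₂₁).1 (η.2 p.c₁₂).1 (η.2 p.c₂₂).1 g h i j k l m n

variable {p} {ξ η : State ιA ιX N P Q} {g h i j k l m n : Irr X}

lemma State.LoopLabels.externalMatch (H : ξ.LoopLabels p η g h i j k l m n) :
    ξ.ExternalMatch p η := by
  simp only [State.ExternalMatch, H.M₁₁_eq, H.M₂₁_eq, H.M₁₂_eq, H.M₂₂_eq, and_self]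

lemma State.loopLabels_of_matched (hξ : ξ.Matched) (hη : η.Matched) (hE : ξ.ExternalMatch p η) :
    ξ.LoopLabels p η (ξ.2 p.c₁₁).1.x₂ (ξ.2 p.c₂₁).1.y₂ (ξ.2 p.c₁₂).1.x₂ (ξ.2 p.c₁₁).1.y₂
      (η.2 p.c₁₁).1.x₂ (η.2 p.c₂₁).1.y₂ (η.2 p.c₁₂).1.x₂ (η.2 p.c₁₁).1.y₂ := by
  obtain ⟨e1, e2, e3, e4, e5, e6, e7, e8, e9, e10, e11, e12⟩ := hE
  refine ⟨rfl, (hξ (.horizontal p.1 p.2.castSucc)).symm, rfl, (hξ (.vertical p.1.succ p.2)).symm,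
    rfl, (hξ (.horizontal p.1 p.2.succ)).symm, rfl, (hξ (.vertical p.1.castSucc p.2)).symm,
    ?_, ?_, ?_, ?_⟩
  · exact XLabel.ext e1.symm e5.symm e6.symm rfl rfl
  · exact XLabel.ext e2.symm (hη (.horizontal p.1 p.2.castSucc)).symm e7.symm rfl e8.symm
  · exact XLabel.ext e4.symm e12.symm (hη (.vertical p.1.castSucc p.2)).symm e11.symm rfl
  · exact XLabel.ext e3.symm (hη (.horizontal p.1 p.2.succ)).symm (hη (.vertical p.1.succ p.2)).symm
      e10.symm e9.symm

/-- Only the four edges of `p` change their labels, and both halves of each change to the same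
label. -/
lemma State.matched_of_loopLabels (H : ξ.LoopLabels p η g h i j k l m n) (hξ : ξ.Matched)
    (hoff : ξ.AgreeOff p η) : η.Matched := by
  obtain ⟨h1, h2⟩ := hoff
  have key : ∀ v, (η.2 v).1.a = (ξ.2 v).1.a ∧
      (v ≠ p.c₁₁ → v ≠ p.c₁₂ → (η.2 v).1.x₂ = (ξ.2 v).1.x₂) ∧
      (v ≠ p.c₂₁ → v ≠ p.c₂₂ → (η.2 v).1.x₁ = (ξ.2 v).1.x₁) ∧
      (v ≠ p.c₁₁ → v ≠ p.c₂₁ → (η.2 v).1.y₂ = (ξ.2 v).1.y₂) ∧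
      (v ≠ p.c₁₂ → v ≠ p.c₂₂ → (η.2 v).1.y₁ = (ξ.2 v).1.y₁) := by
    intro v
    by_cases hv : p.IsCorner v
    · rcases hv with rfl | rfl | rfl | rfl
      · rw [H.M₁₁_eq]; tauto
      · rw [H.M₂₁_eq]; tauto
      · rw [H.M₁₂_eq]; tauto
      · rw [H.M₂₂_eq]; tauto
    · rw [h2 v hv]; tauto
  have hk₁ : (η.2 p.c₁₁).1.x₂ = k := by rw [H.M₁₁_eq]
  have hk₂ : (η.2 p.c₂₁).1.x₁ = k := by rw [H.M₂₁_eq]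
  have hl₁ : (η.2 p.c₂₁).1.y₂ = l := by rw [H.M₂₁_eq]
  have hl₂ : (η.2 p.c₂₂).1.y₁ = l := by rw [H.M₂₂_eq]
  have hm₁ : (η.2 p.c₁₂).1.x₂ = m := by rw [H.M₁₂_eq]
  have hm₂ : (η.2 p.c₂₂).1.x₁ = m := by rw [H.M₂₂_eq]
  have hn₁ : (η.2 p.c₁₁).1.y₂ = n := by rw [H.M₁₁_eq]
  have hn₂ : (η.2 p.c₁₂).1.y₁ = n := by rw [H.M₁₂_eq]
  intro ℓ
  have hℓ := hξ ℓ
  rcases ℓ with ⟨l, l', _, v⟩ | ⟨l, i, j⟩ | ⟨l, i, j⟩ | ⟨l, _, v⟩ | ⟨i, j⟩ | ⟨i, j⟩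
  iterate 3 (dsimp only [Link.Matches] at hℓ ⊢; rwa [← h1])
  · dsimp only [Link.Matches] at hℓ ⊢
    rwa [← h1, (key v).1]
  · dsimp only [Link.Matches] at hℓ ⊢
    -- The bottom edge of `p` now carries `k` and the top edge `m`; no other horizontal edge is
    -- affected.
    by_cases c1 : i = p.1 ∧ j = p.2.castSucc
    · obtain ⟨rfl, rfl⟩ := c1
      exact hk₁.trans hk₂.symm
    by_cases c2 : i = p.1 ∧ j = p.2.succ
    · obtain ⟨rfl, rfl⟩ := c2
      exact hm₁.trans hm₂.symm
    rw [(key _).2.1, (key _).2.2.1, hℓ]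
    · exact fun e => c1 ⟨Fin.succ_injective _ (congrArg Prod.fst e), congrArg Prod.snd e⟩
    · exact fun e => c2 ⟨Fin.succ_injective _ (congrArg Prod.fst e), congrArg Prod.snd e⟩
    · exact fun e => c1 ⟨Fin.castSucc_injective _ (congrArg Prod.fst e), congrArg Prod.snd e⟩
    · exact fun e => c2 ⟨Fin.castSucc_injective _ (congrArg Prod.fst e), congrArg Prod.snd e⟩
  · dsimp only [Link.Matches] at hℓ ⊢
    by_cases c1 : i = p.1.castSucc ∧ j = p.2
    · obtain ⟨rfl, rfl⟩ := c1
      exact hn₁.trans hn₂.symm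
    by_cases c2 : i = p.1.succ ∧ j = p.2
    · obtain ⟨rfl, rfl⟩ := c2
      exact hl₁.trans hl₂.symm
    rw [(key _).2.2.2.1, (key _).2.2.2.2, hℓ]
    · exact fun e => c1 ⟨congrArg Prod.fst e, Fin.succ_injective _ (congrArg Prod.snd e)⟩
    · exact fun e => c2 ⟨congrArg Prod.fst e, Fin.succ_injective _ (congrArg Prod.snd e)⟩
    · exact fun e => c1 ⟨congrArg Prod.fst e, Fin.castSucc_injective _ (congrArg Prod.snd e)⟩
    · exact fun e => c2 ⟨congrArg Prod.fst e, Fin.castSucc_injective _ (congrArg Prod.snd e)⟩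

variable [∀ L, Fintype (ιA L)] [∀ L, Fintype (ιX L)]
  (bA : ∀ L, OrthonormalBasis (ιA L) ℂ (AHom L))
  (bX : ∀ L, OrthonormalBasis (ιX L) ℂ (XHom Φ L))

/-- The factor of a simple tensor at a boundary vertex. -/
abbrev siteVec (x : Σ L, ιX L) : HX Φ := hvec x.1 (bX x.1 x.2).hom

lemma ketX_eq (ξ : BSite P Q → Σ L, ιX L) :
    ketX bX ξ = PiHilbert.tprod fun v => siteVec bX (ξ v) := rfl

lemma eq_of_inner_siteVec_ne_zero {x y : Σ L, ιX L}
    (hne : inner ℂ (siteVec bX x) (siteVec bX y) ≠ 0) : x = y := by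
  by_contra hxy
  refine hne ?_
  have h := (Pi.orthonormalBasis bX).inner_eq_zero hxy
  rwa [Pi.orthonormalBasis_apply, Pi.orthonormalBasis_apply] at h

lemma eq_of_inner_ketA_ne_zero {ξ η : ASite N P Q → Σ L, ιA L}
    (hne : inner ℂ (ketA bA ξ) (ketA bA η) ≠ 0) : ξ = η := by
  by_contra hxy
  refine hne ?_
  have h := (PiHilbert.onb (ASite N P Q) (Pi.orthonormalBasis bA)).inner_eq_zero hxy
  rw [PiHilbert.onb_apply, PiHilbert.onb_apply] at h
  simp only [Pi.orthonormalBasis_apply] at h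
  exact h

variable (p) in
/-- The corner factor of the matrix coefficient between simple tensors of the boundary layer. -/
abbrev cornerCoeff (ξ η : BSite P Q → Σ L, ιX L) : ℂ :=
  localCoeff (siteVec bX (η p.c₁₁)) (siteVec bX (η p.c₂₁)) (siteVec bX (η p.c₁₂))
    (siteVec bX (η p.c₂₂)) (siteVec bX (ξ p.c₁₁)) (siteVec bX (ξ p.c₂₁)) (siteVec bX (ξ p.c₁₂))
    (siteVec bX (ξ p.c₂₂))

lemma inner_ketX_plaquetteX (ξ η : BSite P Q → Σ L, ιX L) :
    inner ℂ (ketX bX η) (plaquetteX Φ p (ketX bX ξ)) =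
      (∏ v ∈ p.cornersᶜ, inner ℂ (siteVec bX (η v)) (siteVec bX (ξ v))) * cornerCoeff p bX ξ η := by
  rw [ketX_eq, ketX_eq, inner_plaquetteX]

lemma matrixCoeff_eq (ξ η : State ιA ιX N P Q) : matrixCoeff bA bX p ξ η =
    inner ℂ (ketA bA η.1) (ketA bA ξ.1) *
      ((∏ v ∈ p.cornersᶜ, inner ℂ (siteVec bX (η.2 v)) (siteVec bX (ξ.2 v))) *
        cornerCoeff p bX ξ.2 η.2) := by
  rw [matrixCoeff, ket_eq, ket_eq, inner_plaquetteOp, inner_ketX_plaquetteX]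

/-- The coefficient is a product over the bulk, the other boundary vertices and the corners.
Orthonormality forces agreement in the first two; the corner selection rules govern the third. -/
lemma matrixCoeff_ne_zero {ξ η : State ιA ιX N P Q} (hne : matrixCoeff bA bX p ξ η ≠ 0) :
    ξ.AgreeOff p η ∧ ∃ g h i j k l m n, ξ.LoopLabels p η g h i j k l m n := by
  rw [matrixCoeff_eq, mul_ne_zero_iff, mul_ne_zero_iff, Finset.prod_ne_zero_iff] at hne
  obtain ⟨h1, h2, h3⟩ := hne
  refine ⟨⟨(eq_of_inner_ketA_ne_zero bA h1).symm, fun v hv => ?_⟩,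
    loopLabels_of_localCoeff_ne_zero h3⟩
  refine (eq_of_inner_siteVec_ne_zero bX (h2 v ?_)).symm
  rwa [Finset.mem_compl, p.mem_corners]

lemma matrixCoeff_eq_cornerCoeff {ξ η : State ιA ιX N P Q} (hoff : ξ.AgreeOff p η) :
    matrixCoeff bA bX p ξ η = cornerCoeff p bX ξ.2 η.2 := by
  have h1 : inner ℂ (ketA bA ξ.1) (ketA bA ξ.1) = 1 := by
    have h := (PiHilbert.onb (ASite N P Q) (Pi.orthonormalBasis bA)).inner_eq_one ξ.1
    rw [PiHilbert.onb_apply] at h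
    simp only [Pi.orthonormalBasis_apply] at h
    exact h
  have h2 : ∀ x : Σ L, ιX L, inner ℂ (siteVec bX x) (siteVec bX x) = 1 := fun x => by
    have h := (Pi.orthonormalBasis bX).inner_eq_one x
    rwa [Pi.orthonormalBasis_apply] at h
  rw [matrixCoeff_eq, ← hoff.1, h1, one_mul, Finset.prod_eq_one, one_mul]
  intro v hv
  rw [Finset.mem_compl, p.mem_corners] at hv
  rw [← hoff.2 v hv, h2]

lemma matched_of_matrixCoeff_ne_zero {ξ η : State ιA ιX N P Q} (hξ : ξ.Matched)
    (hne : matrixCoeff bA bX p ξ η ≠ 0) : η.Matched := by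
  obtain ⟨h1, g, h, i, j, k, l, m, n, H⟩ := matrixCoeff_ne_zero bA bX hne
  exact State.matched_of_loopLabels H hξ h1

variable (p) in
lemma plaquetteOp_ket (ξ : State ιA ιX N P Q) (hξ : ξ.Matched) :
    plaquetteOp Φ N p (ket bA bX ξ) = ∑ η : State ιA ιX N P Q with η.Matched,
      matrixCoeff bA bX p ξ η • ket bA bX η := by
  rw [← (ketBasis N P Q bA bX).sum_repr' (plaquetteOp Φ N p (ket bA bX ξ))]
  simp only [ketBasis_apply]
  refine (Finset.sum_filter_of_ne fun η _ hη => ?_).symm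
  exact matched_of_matrixCoeff_ne_zero bA bX hξ (smul_ne_zero_iff.1 hη).1

lemma plaquetteOp_mem (ψ : Htot Φ N P Q) (hψ : ψ ∈ edgeGroundSpace Φ N P Q) :
    plaquetteOp Φ N p ψ ∈ edgeGroundSpace Φ N P Q := by
  let bA := fun L : ALabel A => stdOrthonormalBasis ℂ (AHom L)
  let bX := fun L => stdOrthonormalBasis ℂ (XHom Φ L)
  rw [mem_edgeGroundSpace_iff bA bX] at hψ ⊢
  refine mem_of_repr_eq_zero (ketBasis N P Q bA bX) _ _ (fun η ξ hξ hne => ?_) hψ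
  rw [ketBasis_apply, ketBasis_apply] at hne
  exact matched_of_matrixCoeff_ne_zero bA bX hξ hne

lemma conj_matrixCoeff (ξ η : State ιA ιX N P Q) :
    conj (matrixCoeff bA bX p ξ η) = matrixCoeff bA bX p η ξ := by
  rw [matrixCoeff_eq, matrixCoeff_eq, map_mul, map_mul, inner_conj_symm, map_prod, conj_localCoeff]
  simp only [inner_conj_symm]

variable (Φ N p) in
lemma isSymmetric_plaquetteOp : (plaquetteOp Φ N p).IsSymmetric := by
  let bA := fun L : ALabel A => stdOrthonormalBasis ℂ (AHom L)
  let bX := fun L => stdOrthonormalBasis ℂ (XHom Φ L)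
  refine isSymmetric_of_orthonormalBasis (ketBasis N P Q bA bX) _ fun ξ η => ?_
  rw [ketBasis_apply, ketBasis_apply]
  exact conj_matrixCoeff bA bX η ξ

variable (Φ p) in
lemma plaquetteX_comp_self : plaquetteX Φ p ∘ₗ plaquetteX Φ p = plaquetteX Φ p := by
  let bX := fun L => stdOrthonormalBasis ℂ (XHom Φ L)
  refine linearMap_ext_of_orthonormalBasis
    (PiHilbert.onb (BSite P Q) (Pi.orthonormalBasis bX)) fun η ξ => ?_
  rw [PiHilbert.onb_apply, PiHilbert.onb_apply, LinearMap.comp_apply, inner_plaquetteX_plaquetteX,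
    inner_plaquetteX]
  congr 1
  simp only [Pi.orthonormalBasis_apply]
  exact sum_localCoeff_op _ _ _ _ _ _ _ _

variable (Φ N p) in
lemma plaquetteOp_comp_self : plaquetteOp Φ N p ∘ₗ plaquetteOp Φ N p = plaquetteOp Φ N p := by
  rw [plaquetteOp_eq, ← TensorProduct.map_comp, plaquetteX_comp_self, LinearMap.comp_id]

end MatrixCoeff

/-! ### Recoupling of two loops on a common edge -/

section Recoupling

variable {X : Type u₂} [Category.{v₂} X] [Abelian X] [Linear ℂ X] [MonoidalCategory X]
  [MonoidalPreadditive X] [MonoidalLinear ℂ X] [RightRigidCategory X] [UnitaryFusionCategory X]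

/-- The canonical element of two families that are both, up to a common normalization, dual to
their daggers. -/
lemma sum_dual_family_eq {V ι κ : Type*} [AddCommGroup V] [Module ℂ V] [Fintype ι] [Fintype κ]
    {Z t : X} (b : ι → (Z ⟶ t)) (b' : κ → (Z ⟶ t)) {c : ℝ} (hc : c ≠ 0)
    (hb : ∀ f : Z ⟶ t, ∑ i, tr (f ≫ dag (b i)) • b i = (c : ℂ) • f)
    (hb' : ∀ f : Z ⟶ t, ∑ i, tr (f ≫ dag (b' i)) • b' i = (c : ℂ) • f)
    (F : (Z ⟶ t) →ₗ[ℂ] (t ⟶ Z) →ₗ[ℂ] V) :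
    ∑ i, F (b i) (dag (b i)) = ∑ j, F (b' j) (dag (b' j)) := by
  have hc' : (c : ℂ) ≠ 0 := Complex.ofReal_ne_zero.2 hc
  have h1 : ∀ j, (c : ℂ) • F (b' j) (dag (b' j)) =
      ∑ i, tr (b' j ≫ dag (b i)) • F (b i) (dag (b' j)) := fun j => by
    rw [← LinearMap.smul_apply, ← map_smul, ← hb (b' j), map_sum, LinearMap.sum_apply]
    exact Finset.sum_congr rfl fun i _ => by rw [map_smul, LinearMap.smul_apply]
  -- Expanding the first argument in one family and the dagger in the other leads to the same double
  -- sum with coefficients `tr (b' j ≫ dag (b i))`. That `c` is real lets the dagger of an expansion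
  -- keep its constant.
  have h2 : ∀ i, (c : ℂ) • F (b i) (dag (b i)) =
      ∑ j, tr (b' j ≫ dag (b i)) • F (b i) (dag (b' j)) := fun i => by
    have h := congrArg dag (hb' (b i))
    rw [dag_smul, Complex.conj_ofReal, dag_sum] at h
    rw [← map_smul, ← h, map_sum]
    refine Finset.sum_congr rfl fun j _ => ?_
    rw [dag_smul, ← tr_dag, dag_comp, dag_dag, map_smul]
  refine smul_right_injective V hc' ?_
  dsimp only
  rw [Finset.smul_sum, Finset.smul_sum, Finset.sum_congr rfl fun i _ => h2 i,
    Finset.sum_congr rfl fun j _ => h1 j, Finset.sum_comm]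

lemma sum_tr_nodeL {r g k : Irr X} (f : r.obj ⊗ g.obj ⟶ k.obj) :
    ∑ e : IdxL r g k, tr (f ≫ dag (nodeL e)) • nodeL e =
      ((√(r.d * g.d * k.d : ℝ) : ℝ) : ℂ) • f := by
  conv_rhs => rw [SkeinHom.sum_inner (stdOrthonormalBasis ℂ (TriL r g k)) f]
  rw [Finset.smul_sum]
  refine Finset.sum_congr rfl fun e _ => ?_
  rw [smul_smul, ← mul_assoc, ← Complex.ofReal_mul]
  simp only [Positive.val_mul]
  rw [mul_one_div_cancel, Complex.ofReal_one, one_mul]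
  · rfl
  · have := r.d.2; have := g.d.2; have := k.d.2
    positivity

lemma sum_tr_nodeR {j r n : Irr X} (f : j.obj ⊗ (r.obj)ᘁ ⟶ n.obj) :
    ∑ o : IdxR j r n, tr (f ≫ dag (nodeR o)) • nodeR o =
      ((√(j.d * r.d * n.d : ℝ) : ℝ) : ℂ) • f := by
  conv_rhs => rw [SkeinHom.sum_inner (stdOrthonormalBasis ℂ (TriR j r n)) f]
  rw [Finset.smul_sum]
  refine Finset.sum_congr rfl fun e _ => ?_
  rw [smul_smul, ← mul_assoc, ← Complex.ofReal_mul]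
  simp only [Positive.val_mul]
  rw [mul_one_div_cancel, Complex.ofReal_one, one_mul]
  · rfl
  · have := r.d.2; have := j.d.2; have := n.d.2
    positivity

/-- Separates the intermediate label `s`: it enters only through the weight of the resolution of the
identity, and the prefactor `√(a b)` does not contain it. This gives both tree bases the same
normalization. -/
lemma sqrt_mul_dualWeight {a b c : ℝ} {s : Irr X} {w : {r : ℝ // 0 < r}} (hw : (w : ℝ) = a * s.d)
    (ha : 0 < a) (hb : 0 < b) (hc : c = s.d * b) :
    ((√c : ℝ) : ℂ) = ((√(a * b) : ℝ) : ℂ) * dualWeight w s := by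
  have hs := s.d.2
  rw [dualWeight, ← Complex.ofReal_mul, hc, hw, Real.sqrt_mul ha.le, Real.sqrt_mul ha.le,
    Real.sqrt_mul hs.le]
  have h1 : (s.d : ℝ) = √(s.d : ℝ) * √(s.d : ℝ) := (Real.mul_self_sqrt hs.le).symm
  have h2 : 0 < √a := Real.sqrt_pos.2 ha
  have h3 : 0 < √(s.d : ℝ) := Real.sqrt_pos.2 hs
  congr 1
  conv_rhs => enter [2, 1]; rw [h1]
  field_simp

variable {r r' h t : Irr X}

/-- Completeness of the trees that fuse `r` first: summing over the second node expands a morphism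
`s ⊗ r̄' ⟶ t`, and summing over `s` with the first node resolves the identity of `r ⊗ h`. -/
lemma sum_tr_nodeL_nodeR (f : (r.obj ⊗ h.obj) ⊗ (r'.obj)ᘁ ⟶ t.obj) :
    ∑ i : (Σ s : Irr X, IdxL r h s × IdxR s r' t),
      tr (f ≫ dag (nodeL i.2.1 ▷ (r'.obj)ᘁ ≫ nodeR i.2.2)) •
        (nodeL i.2.1 ▷ (r'.obj)ᘁ ≫ nodeR i.2.2) =
    ((√((r.d * h.d) * (r'.d * t.d) : ℝ) : ℝ) : ℂ) • f := by
  rw [Fintype.sum_sigma]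
  simp only [Fintype.sum_prod_type]
  have hT := sum_linear_basis (fun s => stdOrthonormalBasis ℂ (TriL r h s))
    (fun u => u ▷ (r'.obj)ᘁ ≫ f) ⟨by intros; simp, by intros; simp⟩
  rw [id_whiskerRight, Category.id_comp] at hT
  refine Eq.trans ?_ (congrArg (HSMul.hSMul _) hT)
  rw [Finset.smul_sum]
  refine Finset.sum_congr rfl fun s _ => ?_
  rw [Finset.smul_sum]
  refine Finset.sum_congr rfl fun q _ => ?_
  have h1 : ∀ o : IdxR s r' t, tr (f ≫ dag (nodeL q ▷ (r'.obj)ᘁ ≫ nodeR o)) =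
      tr ((dag (nodeL q) ▷ (r'.obj)ᘁ ≫ f) ≫ dag (nodeR o)) := fun o => by
    rw [dag_comp, dag_whiskerRight, ← Category.assoc, tr_comp, Category.assoc]
  simp only [h1, ← Linear.comp_smul]
  rw [← Preadditive.comp_sum, sum_tr_nodeR, Linear.comp_smul, smul_smul,
    ← sqrt_mul_dualWeight (w := r.d * h.d * s.d) (c := s.d * r'.d * t.d) (by simp [Positive.val_mul])
      (mul_pos r.d.2 h.d.2) (mul_pos r'.d.2 t.d.2) (mul_assoc _ _ _), comp_whiskerRight,
    Category.assoc]
  simp only [Linear.comp_smul]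
  rfl

/-- The trees that fuse `r'` first are complete with the same constant, as `sum_dual_family_eq`
requires. -/
lemma sum_tr_nodeR_nodeL (f : (r.obj ⊗ h.obj) ⊗ (r'.obj)ᘁ ⟶ t.obj) :
    ∑ i : (Σ s : Irr X, IdxR h r' s × IdxL r s t),
      tr (f ≫ dag ((α_ _ _ _).hom ≫ r.obj ◁ nodeR i.2.1 ≫ nodeL i.2.2)) •
        ((α_ _ _ _).hom ≫ r.obj ◁ nodeR i.2.1 ≫ nodeL i.2.2) =
    ((√((r.d * h.d) * (r'.d * t.d) : ℝ) : ℝ) : ℂ) • f := by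
  rw [Fintype.sum_sigma]
  simp only [Fintype.sum_prod_type]
  have hT := sum_linear_basis (fun s => stdOrthonormalBasis ℂ (TriR h r' s))
    (fun u => (α_ _ _ _).hom ≫ r.obj ◁ u ≫ (α_ _ _ _).inv ≫ f)
    ⟨by intros; simp, by intros; simp⟩
  rw [whiskerLeft_id, Category.id_comp, Iso.hom_inv_id_assoc] at hT
  refine Eq.trans ?_ (congrArg (HSMul.hSMul _) hT)
  rw [Finset.smul_sum]
  refine Finset.sum_congr rfl fun s _ => ?_
  rw [Finset.smul_sum]
  refine Finset.sum_congr rfl fun o _ => ?_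
  have h1 : ∀ q : IdxL r s t, tr (f ≫ dag ((α_ _ _ _).hom ≫ r.obj ◁ nodeR o ≫ nodeL q)) =
      tr ((r.obj ◁ dag (nodeR o) ≫ (α_ _ _ _).inv ≫ f) ≫ dag (nodeL q)) := fun q => by
    rw [dag_comp, dag_comp, dag_whiskerLeft, dag_associator, Category.assoc, ← Category.assoc,
      tr_comp]
    simp only [Category.assoc]
  simp only [h1, ← Linear.comp_smul]
  rw [← Preadditive.comp_sum, ← Preadditive.comp_sum, sum_tr_nodeL, Linear.comp_smul,
    Linear.comp_smul, smul_smul]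
  have e : (r.d * h.d * (r'.d * t.d) : ℝ) = (h.d * r'.d) * (r.d * t.d) := by ring
  rw [e, ← sqrt_mul_dualWeight (w := h.d * r'.d * s.d) (c := r.d * s.d * t.d)
      (by simp [Positive.val_mul])
      (mul_pos h.d.2 r'.d.2) (mul_pos r.d.2 t.d.2) (by ring), MonoidalCategory.whiskerLeft_comp,
    Category.assoc]
  simp only [Linear.comp_smul]
  rfl

/-- Fusing `r` from the left and `r'` from the right into a string: the order does not matter. -/
lemma sum_nodeL_nodeR_eq_sum_nodeR_nodeL {V : Type*} [AddCommGroup V] [Module ℂ V]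
    (F : ((r.obj ⊗ h.obj) ⊗ (r'.obj)ᘁ ⟶ t.obj) →ₗ[ℂ] (t.obj ⟶ (r.obj ⊗ h.obj) ⊗ (r'.obj)ᘁ) →ₗ[ℂ] V) :
    ∑ s : Irr X, ∑ q : IdxL r h s, ∑ o : IdxR s r' t,
      F (nodeL q ▷ (r'.obj)ᘁ ≫ nodeR o) (dag (nodeL q ▷ (r'.obj)ᘁ ≫ nodeR o)) =
    ∑ s : Irr X, ∑ o : IdxR h r' s, ∑ q : IdxL r s t,
      F ((α_ _ _ _).hom ≫ r.obj ◁ nodeR o ≫ nodeL q)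
        (dag ((α_ _ _ _).hom ≫ r.obj ◁ nodeR o ≫ nodeL q)) := by
  have := sum_dual_family_eq
    (fun i : (Σ s : Irr X, IdxL r h s × IdxR s r' t) => nodeL i.2.1 ▷ (r'.obj)ᘁ ≫ nodeR i.2.2)
    (fun i : (Σ s : Irr X, IdxR h r' s × IdxL r s t) =>
      (α_ _ _ _).hom ≫ r.obj ◁ nodeR i.2.1 ≫ nodeL i.2.2)
    (Real.sqrt_pos.2 (mul_pos (mul_pos r.d.2 h.d.2) (mul_pos r'.d.2 t.d.2))).ne'
    sum_tr_nodeL_nodeR sum_tr_nodeR_nodeL F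
  simpa only [Fintype.sum_sigma, Fintype.sum_prod_type] using this

end Recoupling

/-! ### Two loops meeting at one vertex -/

section CornerIdentities

variable {C : Type u} [Category.{v} C] [Abelian C] [Linear ℂ C] [MonoidalCategory C]
  [MonoidalPreadditive C] [MonoidalLinear ℂ C] [RightRigidCategory C] [UnitaryFusionCategory C]
  {a b c d s t u v' w x y z g h i j k l m n r p k' h' m' l' i' n' j' : C}

/-- One loop stays to the left of `ψ` and the other to its right, so the interchange law applies. -/
lemma cor₂₁_cor₁₂ (H : HalfBraiding a) (ψ : a ⊗ (g ⊗ j) ⟶ h ⊗ i) (E : k ⟶ r ⊗ g)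
    (q : r ⊗ h ⟶ l) (O : n ⟶ j ⊗ pᘁ) (f : i ⊗ pᘁ ⟶ m) :
    cor₂₁ H (cor₁₂ ψ O f) E q = cor₁₂ (cor₂₁ H ψ E q) O f := by
  dsimp only [cor₂₁, cor₁₂]
  calc _ = 𝟙 _ ⊗≫ ((a ◁ E ≫ (α_ _ _ _).inv ≫ (H.β r).hom ▷ g) ▷ n ≫ _ ◁ O) ⊗≫
        r ◁ ψ ▷ pᘁ ⊗≫ ((r ⊗ h) ◁ f ≫ q ▷ m) := by monoidal
    _ = 𝟙 _ ⊗≫ (a ⊗ k) ◁ O ⊗≫ (a ◁ E ≫ (α_ _ _ _).inv ≫ (H.β r).hom ▷ g) ▷ (j ⊗ pᘁ) ⊗≫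
        r ◁ ψ ▷ pᘁ ⊗≫ ((r ⊗ h) ◁ f ≫ q ▷ m) := by rw [← whisker_exchange]; monoidal
    _ = _ := by rw [whisker_exchange]; monoidal

/-- The lower right corner of one plaquette and the lower left corner of its right neighbour, with
loops fused into the common edge by `Q`. -/
def rightFuse₁ (H : HalfBraiding b) (ξ : b ⊗ (g ⊗ u) ⟶ h ⊗ v') (E : k ⟶ r ⊗ g) (e : p ⊗ v' ⟶ y)
    (Q : (r ⊗ h) ⊗ pᘁ ⟶ t) : b ⊗ (k ⊗ u) ⟶ t ⊗ y :=
  b ◁ (E ▷ u) ⊗≫ (H.β r).hom ▷ (g ⊗ u) ⊗≫ r ◁ ξ ⊗≫ (r ⊗ h) ◁ dag (ε_ p pᘁ) ▷ v' ⊗≫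
    Q ▷ (p ⊗ v') ⊗≫ t ◁ e

/-- Here and in `cor₂₁_exch` the order of the loops enters only through the tree on the common edge.
The vertex at the other end carries the dagger of the same tree (`comp_cor₁₂`, `cor₁₂_comp`). -/
lemma cor₂₁_comp_exch (H : HalfBraiding b) (ξ : b ⊗ (g ⊗ u) ⟶ h ⊗ v') (E : k ⟶ r ⊗ g)
    (e : p ⊗ v' ⟶ y) (q : r ⊗ h ⟶ l) (o : l ⊗ pᘁ ⟶ t) :
    cor₂₁ H ξ E q ≫ exch o e = rightFuse₁ H ξ E e (q ▷ pᘁ ≫ o) := by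
  dsimp only [cor₂₁, exch, rightFuse₁]
  rw [MonoidalCategory.tensorHom_def]
  calc _ = b ◁ (E ▷ u) ⊗≫ (H.β r).hom ▷ (g ⊗ u) ⊗≫ r ◁ ξ ⊗≫
        (q ▷ (𝟙_ C ⊗ v') ≫ l ◁ dag (ε_ p pᘁ) ▷ v') ⊗≫ o ▷ (p ⊗ v') ⊗≫ t ◁ e := by monoidal
    _ = _ := by
      rw [← whisker_exchange]
      monoidal

lemma cor₂₁_exch (H : HalfBraiding b) (ξ : b ⊗ (g ⊗ u) ⟶ h ⊗ v') (E : k ⟶ r ⊗ g)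
    (e : p ⊗ v' ⟶ y) (o : h ⊗ pᘁ ⟶ l) (q : r ⊗ l ⟶ t) :
    cor₂₁ H (ξ ≫ exch o e) E q = rightFuse₁ H ξ E e ((α_ _ _ _).hom ≫ r ◁ o ≫ q) := by
  dsimp only [cor₂₁, exch, rightFuse₁]
  rw [MonoidalCategory.tensorHom_def]
  calc _ = b ◁ (E ▷ u) ⊗≫ (H.β r).hom ▷ (g ⊗ u) ⊗≫ r ◁ ξ ⊗≫ (r ⊗ h) ◁ dag (ε_ p pᘁ) ▷ v' ⊗≫
        r ◁ o ▷ (p ⊗ v') ⊗≫ ((r ⊗ l) ◁ e ≫ q ▷ y) := by monoidal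
    _ = _ := by
      rw [whisker_exchange]
      monoidal

/-- The upper right corner of one plaquette and the upper left corner of its right neighbour, with
loops fused into the common edge by `R`. -/
def rightFuse₂ (ξ : c ⊗ (i ⊗ h) ⟶ x ⊗ w) (F : m ⟶ i ⊗ rᘁ) (f : w ⊗ pᘁ ⟶ y)
    (R : t ⟶ (r ⊗ h) ⊗ pᘁ) : c ⊗ (m ⊗ t) ⟶ x ⊗ y :=
  c ◁ (m ◁ R) ⊗≫ c ◁ (F ▷ ((r ⊗ h) ⊗ pᘁ)) ⊗≫ c ◁ (i ◁ (ε_ r rᘁ ▷ (h ⊗ pᘁ))) ⊗≫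
    ξ ▷ pᘁ ⊗≫ x ◁ f

lemma comp_cor₁₂ (ξ : c ⊗ (i ⊗ h) ⟶ x ⊗ w) (F : i ⊗ rᘁ ⟶ m) (f : w ⊗ pᘁ ⟶ y)
    (o : h ⊗ pᘁ ⟶ l) (q : r ⊗ l ⟶ t) :
    c ◁ dag (exch F q) ≫ cor₁₂ ξ (dag o) f =
      rightFuse₂ ξ (dag F) f (dag ((α_ _ _ _).hom ≫ r ◁ o ≫ q)) := by
  rw [dag_exch_eq_insertCap, dag_comp, dag_comp, dag_associator, dag_whiskerLeft]
  generalize dag F = F', dag q = Q', dag o = O'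
  dsimp only [cor₁₂, insertCap, rightFuse₂]
  calc _ = c ◁ (m ◁ Q') ⊗≫ c ◁ (F' ▷ (r ⊗ l)) ⊗≫
        c ◁ i ◁ (ε_ r rᘁ ▷ l ≫ 𝟙_ C ◁ O') ⊗≫ ξ ▷ pᘁ ⊗≫ x ◁ f := by monoidal
    _ = c ◁ (m ◁ Q') ⊗≫ c ◁ (F' ▷ (r ⊗ l) ≫ (i ⊗ rᘁ) ◁ (r ◁ O')) ⊗≫
        c ◁ i ◁ (ε_ r rᘁ ▷ (h ⊗ pᘁ)) ⊗≫ ξ ▷ pᘁ ⊗≫ x ◁ f := by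
      rw [← whisker_exchange]; monoidal
    _ = _ := by rw [← whisker_exchange]; monoidal

lemma cor₁₂_comp (ξ : c ⊗ (i ⊗ h) ⟶ x ⊗ w) (F : i ⊗ rᘁ ⟶ m) (f : w ⊗ pᘁ ⟶ y)
    (q : r ⊗ h ⟶ l) (o : l ⊗ pᘁ ⟶ t) :
    cor₁₂ (c ◁ dag (exch F q) ≫ ξ) (dag o) f =
      rightFuse₂ ξ (dag F) f (dag (q ▷ pᘁ ≫ o)) := by
  rw [dag_exch_eq_insertCap, dag_comp, dag_whiskerRight]
  generalize dag F = F', dag q = Q', dag o = O'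
  dsimp only [cor₁₂, insertCap, rightFuse₂]
  monoidal

/-- The upper left corner of one plaquette and the lower left corner of its upper neighbour, with
loops fused into the common edge by `Q`. -/
def upFuse₁ (ξ : d ⊗ (z ⊗ j) ⟶ y ⊗ i) (O : n ⟶ j ⊗ rᘁ) (o : y ⊗ pᘁ ⟶ l)
    (Q : (p ⊗ i) ⊗ rᘁ ⟶ t) : d ⊗ (z ⊗ n) ⟶ l ⊗ t :=
  d ◁ (z ◁ O) ⊗≫ ξ ▷ rᘁ ⊗≫ y ◁ dag (ε_ p pᘁ) ▷ (i ⊗ rᘁ) ⊗≫ o ▷ ((p ⊗ i) ⊗ rᘁ) ⊗≫ l ◁ Q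

lemma cor₁₂_exch (ξ : d ⊗ (z ⊗ j) ⟶ y ⊗ i) (O : n ⟶ j ⊗ rᘁ) (o : y ⊗ pᘁ ⟶ l)
    (e : p ⊗ i ⟶ k) (f : k ⊗ rᘁ ⟶ t) :
    cor₁₂ (ξ ≫ exch o e) O f = upFuse₁ ξ O o (e ▷ rᘁ ≫ f) := by
  dsimp only [cor₁₂, exch, upFuse₁]
  rw [MonoidalCategory.tensorHom_def]
  monoidal

lemma cor₁₂_comp_exch (ξ : d ⊗ (z ⊗ j) ⟶ y ⊗ i) (O : n ⟶ j ⊗ rᘁ) (o : y ⊗ pᘁ ⟶ l)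
    (f : i ⊗ rᘁ ⟶ k) (e : p ⊗ k ⟶ t) :
    cor₁₂ ξ O f ≫ exch o e = upFuse₁ ξ O o ((α_ _ _ _).hom ≫ p ◁ f ≫ e) := by
  dsimp only [cor₁₂, exch, upFuse₁]
  rw [MonoidalCategory.tensorHom_def]
  calc _ = d ◁ (z ◁ O) ⊗≫ ξ ▷ rᘁ ⊗≫ y ◁ (𝟙_ C ◁ f ≫ dag (ε_ p pᘁ) ▷ k) ⊗≫ o ▷ (p ⊗ k) ⊗≫
        l ◁ e := by monoidal
    _ = d ◁ (z ◁ O) ⊗≫ ξ ▷ rᘁ ⊗≫ y ◁ (dag (ε_ p pᘁ) ▷ (i ⊗ rᘁ)) ⊗≫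
        ((y ⊗ pᘁ) ◁ (p ◁ f) ≫ o ▷ (p ⊗ k)) ⊗≫ l ◁ e := by
      rw [whisker_exchange]; monoidal
    _ = _ := by rw [whisker_exchange]; monoidal

/-- The upper right corner of one plaquette and the lower right corner of its upper neighbour,
with loops fused into the common edge by `R`. -/
def upFuse₂ (H : HalfBraiding c) (ξ : c ⊗ (i ⊗ h) ⟶ x ⊗ w) (Q' : l ⟶ r ⊗ h) (q : p ⊗ x ⟶ y)
    (R : t ⟶ (p ⊗ i) ⊗ rᘁ) : c ⊗ (t ⊗ l) ⟶ y ⊗ w :=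
  c ◁ (t ◁ Q') ⊗≫ c ◁ (R ▷ (r ⊗ h)) ⊗≫ c ◁ ((p ⊗ i) ◁ (ε_ r rᘁ ▷ h)) ⊗≫
    (H.β p).hom ▷ (i ⊗ h) ⊗≫ p ◁ ξ ⊗≫ q ▷ w

lemma comp_cor₂₁ (H : HalfBraiding c) (ξ : c ⊗ (i ⊗ h) ⟶ x ⊗ w) (Q : r ⊗ h ⟶ l) (q : p ⊗ x ⟶ y)
    (e : p ⊗ i ⟶ k) (f : k ⊗ rᘁ ⟶ t) :
    c ◁ dag (exch f Q) ≫ cor₂₁ H ξ (dag e) q = upFuse₂ H ξ (dag Q) q (dag (e ▷ rᘁ ≫ f)) := by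
  rw [dag_exch_eq_insertCap, dag_comp, dag_whiskerRight]
  generalize dag f = F', dag Q = Q', dag e = E'
  dsimp only [cor₂₁, insertCap, upFuse₂]
  calc _ = c ◁ (t ◁ Q') ⊗≫ c ◁ (F' ▷ (r ⊗ h)) ⊗≫ c ◁ (k ◁ (ε_ r rᘁ ▷ h) ≫ E' ▷ (𝟙_ C ⊗ h)) ⊗≫
      (H.β p).hom ▷ (i ⊗ h) ⊗≫ p ◁ ξ ⊗≫ q ▷ w := by monoidal
    _ = _ := by rw [whisker_exchange]; monoidal

lemma cor₂₁_comp (H : HalfBraiding c) (ξ : c ⊗ (i ⊗ h) ⟶ x ⊗ w) (Q : r ⊗ h ⟶ l) (q : p ⊗ x ⟶ y)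
    (f : i ⊗ rᘁ ⟶ k) (e : p ⊗ k ⟶ t) :
    cor₂₁ H (c ◁ dag (exch f Q) ≫ ξ) (dag e) q =
      upFuse₂ H ξ (dag Q) q (dag ((α_ _ _ _).hom ≫ p ◁ f ≫ e)) := by
  rw [dag_exch_eq_insertCap, dag_comp, dag_comp, dag_associator, dag_whiskerLeft]
  generalize dag f = F', dag Q = Q', dag e = E'
  dsimp only [cor₂₁, insertCap, upFuse₂]
  calc _ = c ◁ (E' ▷ l) ⊗≫ ((H.β p).hom ▷ (k ⊗ l) ≫
        (p ⊗ c) ◁ (k ◁ Q' ≫ F' ▷ (r ⊗ h) ⊗≫ i ◁ (ε_ r rᘁ ▷ h))) ⊗≫ p ◁ ξ ⊗≫ q ▷ w := by monoidal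
    _ = 𝟙 _ ⊗≫ c ◁ (E' ▷ l ≫ (p ⊗ k) ◁ Q') ⊗≫ c ◁ p ◁ (F' ▷ (r ⊗ h)) ⊗≫
        c ◁ ((p ⊗ i) ◁ (ε_ r rᘁ ▷ h)) ⊗≫ (H.β p).hom ▷ (i ⊗ h) ⊗≫ p ◁ ξ ⊗≫ q ▷ w := by
      rw [← whisker_exchange]; monoidal
    _ = _ := by rw [← whisker_exchange]; monoidal

end CornerIdentities

/-! ### Corner operators of different plaquettes -/

section CornerSwap

variable {A : Type u₁} [Category.{v₁} A] [Abelian A] [Linear ℂ A] [MonoidalCategory A]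
  [MonoidalPreadditive A] [MonoidalLinear ℂ A] [RightRigidCategory A] [UnitaryFusionCategory A]
  [BraidedCategory A]
  {X : Type u₂} [Category.{v₂} X] [Abelian X] [Linear ℂ X] [MonoidalCategory X]
  [MonoidalPreadditive X] [MonoidalLinear ℂ X] [RightRigidCategory X] [UnitaryFusionCategory X]
  {Φ : Enrichment A X} {V : Type*} [AddCommGroup V] [Module ℂ V]

lemma hvec_add (L : XLabel A X) (f g : XHom Φ L) :
    hvec L (f + g).hom = hvec L f.hom + hvec L g.hom :=
  PiLp.single_add 2 L (a := f) (b := g)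

lemma hvec_smul (L : XLabel A X) (c : ℂ) (f : XHom Φ L) :
    hvec L (c • f).hom = c • hvec L f.hom :=
  congrArg (WithLp.toLp 2) (Pi.single_smul (f := fun L => XHom Φ L) L c f)

/-- The inclusion of a summand as a linear map. -/
def hvecₗ (L : XLabel A X) :
    (Φ.obj L.a ⊗ (L.x₁.obj ⊗ L.y₁.obj) ⟶ L.y₂.obj ⊗ L.x₂.obj) →ₗ[ℂ] HX Φ where
  toFun := hvec L
  map_add' f g := hvec_add L f g
  map_smul' c f := hvec_smul L c f

lemma linearMap_ext_hvec {S T : HX Φ →ₗ[ℂ] V} (h : ∀ L f, S (hvec L f) = T (hvec L f)) : S = T := by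
  refine (Pi.orthonormalBasis fun L => stdOrthonormalBasis ℂ (XHom Φ L)).toBasis.ext fun j => ?_
  rw [OrthonormalBasis.coe_toBasis, Pi.orthonormalBasis_apply]
  exact h _ _

lemma bilinearMap_ext_hvec {S T : HX Φ →ₗ[ℂ] HX Φ →ₗ[ℂ] V}
    (h : ∀ L f L' f', S (hvec L f) (hvec L' f') = T (hvec L f) (hvec L' f')) : S = T :=
  linearMap_ext_hvec fun L f => linearMap_ext_hvec fun L' f' => h L f L' f'

variable {g h i j k l m n r r' s t u v w x y z k' l' m' n' i' j' g' h' : Irr X}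

/-- Precomposition on the incoming edges commutes with postcomposition on the outgoing ones. -/
lemma corner₂₂_comp_corner₁₁ (f : IdxR i r m) (q : IdxL r h l) (o : IdxR j r' n)
    (e : IdxL r' g k) :
    corner₂₂ Φ f q ∘ₗ corner₁₁ Φ o e = corner₁₁ Φ o e ∘ₗ corner₂₂ Φ f q := by
  refine linearMap_ext_hvec fun L ψ => ?_
  rw [LinearMap.comp_apply, LinearMap.comp_apply]
  obtain ⟨a, i', h', j', g'⟩ := L
  by_cases h1 : j' = j ∧ g' = g
  · obtain ⟨rfl, rfl⟩ := h1
    by_cases h2 : i' = i ∧ h' = h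
    · obtain ⟨rfl, rfl⟩ := h2
      rw [corner₁₁_hvec, corner₂₂_hvec, corner₂₂_hvec, corner₁₁_hvec, Category.assoc]
    · rw [corner₁₁_hvec, corner₂₂_hvec_of_ne _ _ _ _ h2, corner₂₂_hvec_of_ne _ _ _ _ h2, map_zero]
  · by_cases h2 : i' = i ∧ h' = h
    · obtain ⟨rfl, rfl⟩ := h2
      rw [corner₂₂_hvec, corner₁₁_hvec_of_ne _ _ _ _ h1, corner₁₁_hvec_of_ne _ _ _ _ h1, map_zero]
    · rw [corner₁₁_hvec_of_ne _ _ _ _ h1, corner₂₂_hvec_of_ne _ _ _ _ h2, map_zero, map_zero]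

lemma corner₂₁_comp_corner₁₂ (e : IdxL r g k) (q : IdxL r h l) (o : IdxR j r' n)
    (f : IdxR i r' m) :
    corner₂₁ Φ e q ∘ₗ corner₁₂ Φ o f = corner₁₂ Φ o f ∘ₗ corner₂₁ Φ e q := by
  refine linearMap_ext_hvec fun L ψ => ?_
  rw [LinearMap.comp_apply, LinearMap.comp_apply]
  obtain ⟨a, g', j', h', i'⟩ := L
  by_cases h1 : g' = g ∧ h' = h
  · obtain ⟨rfl, rfl⟩ := h1
    by_cases h2 : j' = j ∧ i' = i
    · obtain ⟨rfl, rfl⟩ := h2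
      rw [corner₁₂_hvec, corner₂₁_hvec, corner₂₁_hvec, corner₁₂_hvec, cor₂₁_cor₁₂]
    · rw [corner₂₁_hvec, corner₁₂_hvec_of_ne _ _ _ _ h2, corner₁₂_hvec_of_ne _ _ _ _ h2, map_zero]
  · by_cases h2 : j' = j ∧ i' = i
    · obtain ⟨rfl, rfl⟩ := h2
      rw [corner₁₂_hvec, corner₂₁_hvec_of_ne _ _ _ _ h1, corner₂₁_hvec_of_ne _ _ _ _ h1, map_zero]
    · rw [corner₂₁_hvec_of_ne _ _ _ _ h1, corner₁₂_hvec_of_ne _ _ _ _ h2, map_zero, map_zero]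

section Fuse

variable {C : Type u} [Category.{v} C] [Abelian C] [Linear ℂ C] [MonoidalCategory C]
  [MonoidalPreadditive C] [MonoidalLinear ℂ C] [RightRigidCategory C] [UnitaryFusionCategory C]
  {b c d g h i j k l m n p r t u v' w x y z : C}

/-- `rightFuse₁` as a linear map. -/
def rightFuse₁ₗ (H : HalfBraiding b) (ξ : b ⊗ (g ⊗ u) ⟶ h ⊗ v') (E : k ⟶ r ⊗ g)
    (e : p ⊗ v' ⟶ y) : ((r ⊗ h) ⊗ pᘁ ⟶ t) →ₗ[ℂ] (b ⊗ (k ⊗ u) ⟶ t ⊗ y) where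
  toFun := rightFuse₁ H ξ E e
  map_add' _ _ := by simp [rightFuse₁, monoidalComp]
  map_smul' _ _ := by simp [rightFuse₁, monoidalComp]

/-- `rightFuse₂` as a linear map. -/
def rightFuse₂ₗ (ξ : c ⊗ (i ⊗ h) ⟶ x ⊗ w) (F : m ⟶ i ⊗ rᘁ) (f : w ⊗ pᘁ ⟶ y) :
    (t ⟶ (r ⊗ h) ⊗ pᘁ) →ₗ[ℂ] (c ⊗ (m ⊗ t) ⟶ x ⊗ y) where
  toFun := rightFuse₂ ξ F f
  map_add' _ _ := by simp [rightFuse₂, monoidalComp]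
  map_smul' _ _ := by simp [rightFuse₂, monoidalComp]

/-- `upFuse₁` as a linear map. -/
def upFuse₁ₗ (ξ : d ⊗ (z ⊗ j) ⟶ y ⊗ i) (O : n ⟶ j ⊗ rᘁ) (o : y ⊗ pᘁ ⟶ l) :
    ((p ⊗ i) ⊗ rᘁ ⟶ t) →ₗ[ℂ] (d ⊗ (z ⊗ n) ⟶ l ⊗ t) where
  toFun := upFuse₁ ξ O o
  map_add' _ _ := by simp [upFuse₁, monoidalComp]
  map_smul' _ _ := by simp [upFuse₁, monoidalComp]

/-- `upFuse₂` as a linear map. -/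
def upFuse₂ₗ (H : HalfBraiding c) (ξ : c ⊗ (i ⊗ h) ⟶ x ⊗ w) (Q' : l ⟶ r ⊗ h) (q : p ⊗ x ⟶ y) :
    (t ⟶ (p ⊗ i) ⊗ rᘁ) →ₗ[ℂ] (c ⊗ (t ⊗ l) ⟶ y ⊗ w) where
  toFun := upFuse₂ H ξ Q' q
  map_add' _ _ := by simp [upFuse₂, monoidalComp]
  map_smul' _ _ := by simp [upFuse₂, monoidalComp]

end Fuse

lemma sum_edgeL (G : EdgeL X r → V) (hG : ∀ q : EdgeL X r, h ≠ q.1.1 → G q = 0) :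
    ∑ q, G q = ∑ l, ∑ q : IdxL r h l, G ⟨(h, l), q⟩ := by
  rw [Fintype.sum_sigma, Fintype.sum_prod_type, Fintype.sum_eq_single h]
  exact fun x hx => Finset.sum_eq_zero fun _ _ => Finset.sum_eq_zero fun _ _ => hG _ hx.symm

lemma sum_edgeR (G : EdgeR X r → V) (hG : ∀ q : EdgeR X r, j ≠ q.1.1 → G q = 0) :
    ∑ o, G o = ∑ n, ∑ o : IdxR j r n, G ⟨(j, n), o⟩ := by
  rw [Fintype.sum_sigma, Fintype.sum_prod_type, Fintype.sum_eq_single j]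
  exact fun x hx => Finset.sum_eq_zero fun _ _ => Finset.sum_eq_zero fun _ _ => hG _ hx.symm

/-- The intermediate label drops out, so the weight of two successive fusions does not depend on
their order. -/
lemma LoopTerm.edgeWeight_mul_edgeWeight (g k l : Irr X) :
    edgeWeight g k * edgeWeight k l = edgeWeight g l := by
  have := g.d.2; have := k.d.2; have := l.d.2
  rw [edgeWeight, edgeWeight, edgeWeight, ← Complex.ofReal_mul, ← Real.sqrt_mul (by positivity)]
  congr 2
  field_simp

open LoopTerm

variable (β : HX Φ →ₗ[ℂ] HX Φ →ₗ[ℂ] V)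

/-- Horizontal neighbours: `r` is fused from the left and `r'` from the right into their common
vertical edge. The form `β` stands for the rest of the lattice. -/
lemma sum_right_swap_hvec {b c : Irr A} (e : IdxL r g k) (f : IdxR i r m) (e' : IdxL r' v k')
    (f' : IdxR w r' m') (ξ₁ : Φ.obj b ⊗ (g.obj ⊗ u.obj) ⟶ h.obj ⊗ v.obj)
    (ξ₂ : Φ.obj c ⊗ (i.obj ⊗ h.obj) ⟶ x.obj ⊗ w.obj) :
    ∑ q : EdgeL X r, ∑ o : EdgeR X r', (edgeWeight q.1.1 q.1.2 * edgeWeight o.1.1 o.1.2) •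
      β (corner₂₁ Φ e q.2 (corner₁₁ Φ o.2 e' (hvec ⟨b, g, u, h, v⟩ ξ₁)))
        (corner₂₂ Φ f q.2 (corner₁₂ Φ o.2 f' (hvec ⟨c, i, h, x, w⟩ ξ₂))) =
    ∑ q : EdgeL X r, ∑ o : EdgeR X r', (edgeWeight q.1.1 q.1.2 * edgeWeight o.1.1 o.1.2) •
      β (corner₁₁ Φ o.2 e' (corner₂₁ Φ e q.2 (hvec ⟨b, g, u, h, v⟩ ξ₁)))
        (corner₁₂ Φ o.2 f' (corner₂₂ Φ f q.2 (hvec ⟨c, i, h, x, w⟩ ξ₂))) := by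
  -- In `h1` and `h2`, `t` is the final label of the common edge and `s` the intermediate one. The
  -- telescoped weight `edgeWeight h t` leaves the sum over `s`.
  have h1 : ∑ q : EdgeL X r, ∑ o : EdgeR X r',
      (edgeWeight q.1.1 q.1.2 * edgeWeight o.1.1 o.1.2) •
      β (corner₂₁ Φ e q.2 (corner₁₁ Φ o.2 e' (hvec ⟨b, g, u, h, v⟩ ξ₁)))
        (corner₂₂ Φ f q.2 (corner₁₂ Φ o.2 f' (hvec ⟨c, i, h, x, w⟩ ξ₂))) =
      ∑ t : Irr X, edgeWeight h t • ∑ s : Irr X, ∑ o : IdxR h r' s, ∑ q : IdxL r s t,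
        β (hvec ⟨b, k, u, t, k'⟩
            (cor₂₁ (Φ.hb b) (ξ₁ ≫ exch (nodeR o) (nodeL e')) (dag (nodeL e)) (nodeL q)))
          (hvec ⟨c, m, t, x, m'⟩ (Φ.obj c ◁ dag (exch (nodeR f) (nodeL q)) ≫
            cor₁₂ ξ₂ (dag (nodeR o)) (nodeR f'))) := by
    rw [Finset.sum_comm, sum_edgeR (j := h)]
    · simp only [Finset.smul_sum]
      refine Eq.trans ?_ Finset.sum_comm
      refine Finset.sum_congr rfl fun s _ => Eq.trans ?_ Finset.sum_comm
      refine Finset.sum_congr rfl fun o _ => ?_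
      rw [corner₁₁_hvec, corner₁₂_hvec, sum_edgeL (h := s)]
      · refine Finset.sum_congr rfl fun t _ => Finset.sum_congr rfl fun q _ => ?_
        rw [corner₂₁_hvec, corner₂₂_hvec, mul_comm, edgeWeight_mul_edgeWeight]
      · intro q hq
        rw [corner₂₁_hvec_of_ne _ _ _ _ (fun hh => hq hh.2), map_zero, LinearMap.zero_apply,
          smul_zero]
    · intro o ho
      refine Finset.sum_eq_zero fun q _ => ?_
      rw [corner₁₁_hvec_of_ne _ _ _ _ (fun hh => ho hh.1), map_zero, map_zero,
        LinearMap.zero_apply, smul_zero]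
  have h2 : ∑ q : EdgeL X r, ∑ o : EdgeR X r',
      (edgeWeight q.1.1 q.1.2 * edgeWeight o.1.1 o.1.2) •
      β (corner₁₁ Φ o.2 e' (corner₂₁ Φ e q.2 (hvec ⟨b, g, u, h, v⟩ ξ₁)))
        (corner₁₂ Φ o.2 f' (corner₂₂ Φ f q.2 (hvec ⟨c, i, h, x, w⟩ ξ₂))) =
      ∑ t : Irr X, edgeWeight h t • ∑ s : Irr X, ∑ q : IdxL r h s, ∑ o : IdxR s r' t,
        β (hvec ⟨b, k, u, t, k'⟩
            (cor₂₁ (Φ.hb b) ξ₁ (dag (nodeL e)) (nodeL q) ≫ exch (nodeR o) (nodeL e')))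
          (hvec ⟨c, m, t, x, m'⟩ (cor₁₂ (Φ.obj c ◁ dag (exch (nodeR f) (nodeL q)) ≫ ξ₂)
            (dag (nodeR o)) (nodeR f'))) := by
    rw [sum_edgeL (h := h)]
    · simp only [Finset.smul_sum]
      refine Eq.trans ?_ Finset.sum_comm
      refine Finset.sum_congr rfl fun s _ => Eq.trans ?_ Finset.sum_comm
      refine Finset.sum_congr rfl fun q _ => ?_
      rw [corner₂₁_hvec, corner₂₂_hvec, sum_edgeR (j := s)]
      · refine Finset.sum_congr rfl fun t _ => Finset.sum_congr rfl fun o _ => ?_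
        rw [corner₁₁_hvec, corner₁₂_hvec, edgeWeight_mul_edgeWeight]
      · intro o ho
        rw [corner₁₁_hvec_of_ne _ _ _ _ (fun hh => ho hh.1), map_zero, LinearMap.zero_apply,
          smul_zero]
    · intro q hq
      refine Finset.sum_eq_zero fun o _ => ?_
      rw [corner₂₁_hvec_of_ne _ _ _ _ (fun hh => hq hh.2), map_zero, map_zero,
        LinearMap.zero_apply, smul_zero]
  rw [h1, h2]
  refine Finset.sum_congr rfl fun t _ => congrArg _ ?_
  -- Both sides now apply one bilinear form to a tree and its dagger, summed over one of the two
  -- tree bases.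
  simp only [cor₂₁_exch, cor₂₁_comp_exch, cor₁₂_comp, comp_cor₁₂]
  exact (sum_nodeL_nodeR_eq_sum_nodeR_nodeL
    (β.compl₁₂ (hvecₗ ⟨b, k, u, t, k'⟩ ∘ₗ rightFuse₁ₗ (Φ.hb b) ξ₁ (dag (nodeL e)) (nodeL e'))
      (hvecₗ ⟨c, m, t, x, m'⟩ ∘ₗ rightFuse₂ₗ ξ₂ (dag (nodeR f)) (nodeR f')))).symm

/-- Vertical neighbours: the upper loop `r'` attaches to the common horizontal edge from the left of
the strand, the lower loop `r` from its right. -/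
lemma sum_up_swap_hvec {c d : Irr A} (o : IdxR j r n) (q : IdxL r h l) (o' : IdxR y r' n')
    (q' : IdxL r' x l') (ξ₁ : Φ.obj d ⊗ (z.obj ⊗ j.obj) ⟶ y.obj ⊗ i.obj)
    (ξ₂ : Φ.obj c ⊗ (i.obj ⊗ h.obj) ⟶ x.obj ⊗ w.obj) :
    ∑ f : EdgeR X r, ∑ e : EdgeL X r', (edgeWeight f.1.1 f.1.2 * edgeWeight e.1.1 e.1.2) •
      β (corner₁₂ Φ o f.2 (corner₁₁ Φ o' e.2 (hvec ⟨d, z, j, y, i⟩ ξ₁)))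
        (corner₂₂ Φ f.2 q (corner₂₁ Φ e.2 q' (hvec ⟨c, i, h, x, w⟩ ξ₂))) =
    ∑ f : EdgeR X r, ∑ e : EdgeL X r', (edgeWeight f.1.1 f.1.2 * edgeWeight e.1.1 e.1.2) •
      β (corner₁₁ Φ o' e.2 (corner₁₂ Φ o f.2 (hvec ⟨d, z, j, y, i⟩ ξ₁)))
        (corner₂₁ Φ e.2 q' (corner₂₂ Φ f.2 q (hvec ⟨c, i, h, x, w⟩ ξ₂))) := by
  have h1 : ∑ f : EdgeR X r, ∑ e : EdgeL X r',
      (edgeWeight f.1.1 f.1.2 * edgeWeight e.1.1 e.1.2) •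
      β (corner₁₂ Φ o f.2 (corner₁₁ Φ o' e.2 (hvec ⟨d, z, j, y, i⟩ ξ₁)))
        (corner₂₂ Φ f.2 q (corner₂₁ Φ e.2 q' (hvec ⟨c, i, h, x, w⟩ ξ₂))) =
      ∑ t : Irr X, edgeWeight i t • ∑ s : Irr X, ∑ e : IdxL r' i s, ∑ f : IdxR s r t,
        β (hvec ⟨d, z, n, n', t⟩
            (cor₁₂ (ξ₁ ≫ exch (nodeR o') (nodeL e)) (dag (nodeR o)) (nodeR f)))
          (hvec ⟨c, t, l, l', w⟩ (Φ.obj c ◁ dag (exch (nodeR f) (nodeL q)) ≫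
            cor₂₁ (Φ.hb c) ξ₂ (dag (nodeL e)) (nodeL q'))) := by
    rw [Finset.sum_comm, sum_edgeL (h := i)]
    · simp only [Finset.smul_sum]
      refine Eq.trans ?_ Finset.sum_comm
      refine Finset.sum_congr rfl fun s _ => Eq.trans ?_ Finset.sum_comm
      refine Finset.sum_congr rfl fun e _ => ?_
      rw [corner₁₁_hvec, corner₂₁_hvec, sum_edgeR (j := s)]
      · refine Finset.sum_congr rfl fun t _ => Finset.sum_congr rfl fun f _ => ?_
        rw [corner₁₂_hvec, corner₂₂_hvec, mul_comm, edgeWeight_mul_edgeWeight]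
      · intro f hf
        rw [corner₁₂_hvec_of_ne _ _ _ _ (fun hh => hf hh.2), map_zero, LinearMap.zero_apply,
          smul_zero]
    · intro e he
      refine Finset.sum_eq_zero fun f _ => ?_
      rw [corner₁₁_hvec_of_ne _ _ _ _ (fun hh => he hh.2), map_zero, map_zero,
        LinearMap.zero_apply, smul_zero]
  have h2 : ∑ f : EdgeR X r, ∑ e : EdgeL X r',
      (edgeWeight f.1.1 f.1.2 * edgeWeight e.1.1 e.1.2) •
      β (corner₁₁ Φ o' e.2 (corner₁₂ Φ o f.2 (hvec ⟨d, z, j, y, i⟩ ξ₁)))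
        (corner₂₁ Φ e.2 q' (corner₂₂ Φ f.2 q (hvec ⟨c, i, h, x, w⟩ ξ₂))) =
      ∑ t : Irr X, edgeWeight i t • ∑ s : Irr X, ∑ f : IdxR i r s, ∑ e : IdxL r' s t,
        β (hvec ⟨d, z, n, n', t⟩
            (cor₁₂ ξ₁ (dag (nodeR o)) (nodeR f) ≫ exch (nodeR o') (nodeL e)))
          (hvec ⟨c, t, l, l', w⟩ (cor₂₁ (Φ.hb c)
            (Φ.obj c ◁ dag (exch (nodeR f) (nodeL q)) ≫ ξ₂) (dag (nodeL e)) (nodeL q'))) := by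
    rw [sum_edgeR (j := i)]
    · simp only [Finset.smul_sum]
      refine Eq.trans ?_ Finset.sum_comm
      refine Finset.sum_congr rfl fun s _ => Eq.trans ?_ Finset.sum_comm
      refine Finset.sum_congr rfl fun f _ => ?_
      rw [corner₁₂_hvec, corner₂₂_hvec, sum_edgeL (h := s)]
      · refine Finset.sum_congr rfl fun t _ => Finset.sum_congr rfl fun e _ => ?_
        rw [corner₁₁_hvec, corner₂₁_hvec, edgeWeight_mul_edgeWeight]
      · intro e he
        rw [corner₁₁_hvec_of_ne _ _ _ _ (fun hh => he hh.2), map_zero, LinearMap.zero_apply,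
          smul_zero]
    · intro f hf
      refine Finset.sum_eq_zero fun e _ => ?_
      rw [corner₁₂_hvec_of_ne _ _ _ _ (fun hh => hf hh.2), map_zero, map_zero,
        LinearMap.zero_apply, smul_zero]
  rw [h1, h2]
  refine Finset.sum_congr rfl fun t _ => congrArg _ ?_
  simp only [cor₁₂_exch, cor₁₂_comp_exch, cor₂₁_comp, comp_cor₂₁]
  exact sum_nodeL_nodeR_eq_sum_nodeR_nodeL
    (β.compl₁₂ (hvecₗ ⟨d, z, n, n', t⟩ ∘ₗ upFuse₁ₗ ξ₁ (dag (nodeR o)) (nodeR o'))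
      (hvecₗ ⟨c, t, l, l', w⟩ ∘ₗ upFuse₂ₗ (Φ.hb c) ξ₂ (dag (nodeL q)) (nodeL q')))

/-- Reduced by bilinearity to homogeneous vectors. If their labels do not fit the nodes or the
common edge does not match, both sides vanish. -/
lemma sum_right_swap (e : IdxL r g k) (f : IdxR i r m) (e' : IdxL r' v k') (f' : IdxR w r' m')
    (x₁ x₂ : HX Φ) :
    ∑ q : EdgeL X r, ∑ o : EdgeR X r', (edgeWeight q.1.1 q.1.2 * edgeWeight o.1.1 o.1.2) •
      β (corner₂₁ Φ e q.2 (corner₁₁ Φ o.2 e' x₁)) (corner₂₂ Φ f q.2 (corner₁₂ Φ o.2 f' x₂)) =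
    ∑ q : EdgeL X r, ∑ o : EdgeR X r', (edgeWeight q.1.1 q.1.2 * edgeWeight o.1.1 o.1.2) •
      β (corner₁₁ Φ o.2 e' (corner₂₁ Φ e q.2 x₁)) (corner₁₂ Φ o.2 f' (corner₂₂ Φ f q.2 x₂)) := by
  suffices h : ∑ q : EdgeL X r, ∑ o : EdgeR X r',
      (edgeWeight q.1.1 q.1.2 * edgeWeight o.1.1 o.1.2) • β.compl₁₂
        (corner₂₁ Φ e q.2 ∘ₗ corner₁₁ Φ o.2 e') (corner₂₂ Φ f q.2 ∘ₗ corner₁₂ Φ o.2 f') =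
      ∑ q : EdgeL X r, ∑ o : EdgeR X r',
      (edgeWeight q.1.1 q.1.2 * edgeWeight o.1.1 o.1.2) • β.compl₁₂
        (corner₁₁ Φ o.2 e' ∘ₗ corner₂₁ Φ e q.2) (corner₁₂ Φ o.2 f' ∘ₗ corner₂₂ Φ f q.2) by
    have := LinearMap.congr_fun₂ h x₁ x₂
    simpa only [LinearMap.sum_apply, LinearMap.smul_apply, LinearMap.compl₁₂_apply,
      LinearMap.comp_apply] using this
  refine bilinearMap_ext_hvec fun L₁ ξ₁ L₂ ξ₂ => ?_
  simp only [LinearMap.sum_apply, LinearMap.smul_apply, LinearMap.compl₁₂_apply,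
    LinearMap.comp_apply]
  obtain ⟨b, g₁, u, h₁, v₁⟩ := L₁
  obtain ⟨c, i₁, h₂, x, w₁⟩ := L₂
  by_cases hL : g₁ = g ∧ v₁ = v ∧ i₁ = i ∧ w₁ = w ∧ h₁ = h₂
  · obtain ⟨rfl, rfl, rfl, rfl, rfl⟩ := hL
    exact sum_right_swap_hvec β e f e' f' ξ₁ ξ₂
  · trans (0 : V)
    · refine Finset.sum_eq_zero fun q _ => Finset.sum_eq_zero fun o _ => ?_
      by_cases c1 : h₁ = o.1.1 ∧ v₁ = v
      · by_cases c2 : h₂ = o.1.1 ∧ w₁ = w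
        · obtain ⟨⟨j', n'⟩, o⟩ := o
          obtain ⟨rfl, rfl⟩ := c1
          obtain ⟨rfl, rfl⟩ := c2
          rw [corner₁₁_hvec, corner₁₂_hvec]
          by_cases c3 : g₁ = g
          · have c4 : i₁ ≠ i := fun hi => hL ⟨c3, rfl, hi, rfl, rfl⟩
            rw [corner₂₂_hvec_of_ne _ _ _ _ (fun hh => c4 hh.1), map_zero, smul_zero]
          · rw [corner₂₁_hvec_of_ne _ _ _ _ (fun hh => c3 hh.1), map_zero, LinearMap.zero_apply,
              smul_zero]
        · rw [corner₁₂_hvec_of_ne _ _ _ _ c2, map_zero, map_zero, smul_zero]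
      · rw [corner₁₁_hvec_of_ne _ _ _ _ c1, map_zero, map_zero, LinearMap.zero_apply, smul_zero]
    · symm
      refine Finset.sum_eq_zero fun q _ => Finset.sum_eq_zero fun o _ => ?_
      by_cases c1 : g₁ = g ∧ h₁ = q.1.1
      · by_cases c2 : i₁ = i ∧ h₂ = q.1.1
        · obtain ⟨⟨h', l'⟩, q⟩ := q
          obtain ⟨rfl, rfl⟩ := c1
          obtain ⟨rfl, rfl⟩ := c2
          rw [corner₂₁_hvec, corner₂₂_hvec]
          by_cases c3 : v₁ = v
          · have c4 : w₁ ≠ w := fun hi => hL ⟨rfl, c3, rfl, hi, rfl⟩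
            rw [corner₁₂_hvec_of_ne _ _ _ _ (fun hh => c4 hh.2), map_zero, smul_zero]
          · rw [corner₁₁_hvec_of_ne _ _ _ _ (fun hh => c3 hh.2), map_zero, LinearMap.zero_apply,
              smul_zero]
        · rw [corner₂₂_hvec_of_ne _ _ _ _ c2, map_zero, map_zero, smul_zero]
      · rw [corner₂₁_hvec_of_ne _ _ _ _ c1, map_zero, map_zero, LinearMap.zero_apply, smul_zero]

lemma sum_up_swap (o : IdxR j r n) (q : IdxL r h l) (o' : IdxR y r' n') (q' : IdxL r' x l')
    (x₁ x₂ : HX Φ) :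
    ∑ f : EdgeR X r, ∑ e : EdgeL X r', (edgeWeight f.1.1 f.1.2 * edgeWeight e.1.1 e.1.2) •
      β (corner₁₂ Φ o f.2 (corner₁₁ Φ o' e.2 x₁)) (corner₂₂ Φ f.2 q (corner₂₁ Φ e.2 q' x₂)) =
    ∑ f : EdgeR X r, ∑ e : EdgeL X r', (edgeWeight f.1.1 f.1.2 * edgeWeight e.1.1 e.1.2) •
      β (corner₁₁ Φ o' e.2 (corner₁₂ Φ o f.2 x₁)) (corner₂₁ Φ e.2 q' (corner₂₂ Φ f.2 q x₂)) := by
  suffices h : ∑ f : EdgeR X r, ∑ e : EdgeL X r',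
      (edgeWeight f.1.1 f.1.2 * edgeWeight e.1.1 e.1.2) • β.compl₁₂
        (corner₁₂ Φ o f.2 ∘ₗ corner₁₁ Φ o' e.2) (corner₂₂ Φ f.2 q ∘ₗ corner₂₁ Φ e.2 q') =
      ∑ f : EdgeR X r, ∑ e : EdgeL X r',
      (edgeWeight f.1.1 f.1.2 * edgeWeight e.1.1 e.1.2) • β.compl₁₂
        (corner₁₁ Φ o' e.2 ∘ₗ corner₁₂ Φ o f.2) (corner₂₁ Φ e.2 q' ∘ₗ corner₂₂ Φ f.2 q) by
    have := LinearMap.congr_fun₂ h x₁ x₂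
    simpa only [LinearMap.sum_apply, LinearMap.smul_apply, LinearMap.compl₁₂_apply,
      LinearMap.comp_apply] using this
  refine bilinearMap_ext_hvec fun L₁ ξ₁ L₂ ξ₂ => ?_
  simp only [LinearMap.sum_apply, LinearMap.smul_apply, LinearMap.compl₁₂_apply,
    LinearMap.comp_apply]
  obtain ⟨d, z, j₁, y₁, i₁⟩ := L₁
  obtain ⟨c, i₂, h₁, x₁, w⟩ := L₂
  by_cases hL : j₁ = j ∧ y₁ = y ∧ h₁ = h ∧ x₁ = x ∧ i₁ = i₂
  · obtain ⟨rfl, rfl, rfl, rfl, rfl⟩ := hL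
    exact sum_up_swap_hvec β o q o' q' ξ₁ ξ₂
  · trans (0 : V)
    · refine Finset.sum_eq_zero fun f _ => Finset.sum_eq_zero fun e _ => ?_
      by_cases c1 : y₁ = y ∧ i₁ = e.1.1
      · by_cases c2 : i₂ = e.1.1 ∧ x₁ = x
        · obtain ⟨⟨g', k'⟩, e⟩ := e
          obtain ⟨rfl, rfl⟩ := c1
          obtain ⟨rfl, rfl⟩ := c2
          rw [corner₁₁_hvec, corner₂₁_hvec]
          by_cases c3 : j₁ = j
          · have c4 : h₁ ≠ h := fun hi => hL ⟨c3, rfl, hi, rfl, rfl⟩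
            rw [corner₂₂_hvec_of_ne _ _ _ _ (fun hh => c4 hh.2), map_zero, smul_zero]
          · rw [corner₁₂_hvec_of_ne _ _ _ _ (fun hh => c3 hh.1), map_zero, LinearMap.zero_apply,
              smul_zero]
        · rw [corner₂₁_hvec_of_ne _ _ _ _ c2, map_zero, map_zero, smul_zero]
      · rw [corner₁₁_hvec_of_ne _ _ _ _ c1, map_zero, map_zero, LinearMap.zero_apply, smul_zero]
    · symm
      refine Finset.sum_eq_zero fun f _ => Finset.sum_eq_zero fun e _ => ?_
      by_cases c1 : j₁ = j ∧ i₁ = f.1.1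
      · by_cases c2 : i₂ = f.1.1 ∧ h₁ = h
        · obtain ⟨⟨i', m'⟩, f⟩ := f
          obtain ⟨rfl, rfl⟩ := c1
          obtain ⟨rfl, rfl⟩ := c2
          rw [corner₁₂_hvec, corner₂₂_hvec]
          by_cases c3 : y₁ = y
          · have c4 : x₁ ≠ x := fun hi => hL ⟨rfl, c3, rfl, hi, rfl⟩
            rw [corner₂₁_hvec_of_ne _ _ _ _ (fun hh => c4 hh.2), map_zero, smul_zero]
          · rw [corner₁₁_hvec_of_ne _ _ _ _ (fun hh => c3 hh.1), map_zero, LinearMap.zero_apply,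
              smul_zero]
        · rw [corner₂₂_hvec_of_ne _ _ _ _ c2, map_zero, map_zero, smul_zero]
      · rw [corner₁₂_hvec_of_ne _ _ _ _ c1, map_zero, map_zero, LinearMap.zero_apply, smul_zero]

end CornerSwap

/-! ### Plaquette operators commute -/

section Multilinear

variable {S : Type} [Fintype S] [DecidableEq S] {H : Type u} [NormedAddCommGroup H]
  [InnerProductSpace ℂ H] {W : Type*} [AddCommGroup W] [Module ℂ W]

lemma PiHilbert.linearMap_ext {T T' : PiHilbert S H →ₗ[ℂ] W}
    (h : ∀ F, T (PiHilbert.tprod F) = T' (PiHilbert.tprod F)) : T = T' :=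
  PiTensorProduct.ext (MultilinearMap.ext h)

lemma PiHilbert.map_comp_map (T T' : S → H →ₗ[ℂ] H) :
    PiHilbert.map T ∘ₗ PiHilbert.map T' = PiHilbert.map fun v => T v ∘ₗ T' v :=
  (PiTensorProduct.map_comp T T').symm

lemma PiHilbert.tprod_update_add (f : S → H) (v : S) (x y : H) :
    PiHilbert.tprod (Function.update f v (x + y)) =
      PiHilbert.tprod (Function.update f v x) + PiHilbert.tprod (Function.update f v y) :=
  (PiTensorProduct.tprod ℂ (s := fun _ : S => H)).map_update_add f v x y

lemma PiHilbert.tprod_update_smul (f : S → H) (v : S) (c : ℂ) (x : H) :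
    PiHilbert.tprod (Function.update f v (c • x)) = c • PiHilbert.tprod (Function.update f v x) :=
  (PiTensorProduct.tprod ℂ (s := fun _ : S => H)).map_update_smul f v c x

/-- The simple tensor as a bilinear function of two of its factors. -/
def PiHilbert.tprod₂ (K : S → H) {v w : S} (hvw : v ≠ w) : H →ₗ[ℂ] H →ₗ[ℂ] PiHilbert S H :=
  LinearMap.mk₂ ℂ (fun x y => PiHilbert.tprod (Function.update (Function.update K v x) w y))
    (fun x x' y => by
      rw [Function.update_comm hvw, Function.update_comm hvw, Function.update_comm hvw]
      exact PiHilbert.tprod_update_add _ v x x')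
    (fun c x y => by
      rw [Function.update_comm hvw, Function.update_comm hvw]
      exact PiHilbert.tprod_update_smul _ v c x)
    (fun x y y' => PiHilbert.tprod_update_add _ w y y')
    (fun c x y => PiHilbert.tprod_update_smul _ w c y)

lemma PiHilbert.tprod₂_apply (K : S → H) {v w : S} (hvw : v ≠ w) (x y : H) :
    PiHilbert.tprod₂ K hvw x y =
      PiHilbert.tprod (Function.update (Function.update K v x) w y) := rfl

lemma sum_smul_comp_sum_smul {α β : Type*} [Fintype α] [Fintype β] (c : α → ℂ) (d : β → ℂ)
    (T : α → W →ₗ[ℂ] W) (T' : β → W →ₗ[ℂ] W) :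
    (∑ a, c a • T a) ∘ₗ (∑ b, d b • T' b) = ∑ a, ∑ b, (c a * d b) • (T a ∘ₗ T' b) := by
  rw [← Module.End.mul_eq_comp, Finset.sum_mul]
  refine Finset.sum_congr rfl fun a _ => ?_
  rw [Finset.mul_sum]
  refine Finset.sum_congr rfl fun b _ => ?_
  exact (smul_mul_smul_comm _ _ _ _)

end Multilinear

section Commute

variable {A : Type u₁} [Category.{v₁} A] [Abelian A] [Linear ℂ A] [MonoidalCategory A]
  [MonoidalPreadditive A] [MonoidalLinear ℂ A] [RightRigidCategory A] [UnitaryFusionCategory A]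
  [BraidedCategory A]
  {X : Type u₂} [Category.{v₂} X] [Abelian X] [Linear ℂ X] [MonoidalCategory X]
  [MonoidalPreadditive X] [MonoidalLinear ℂ X] [RightRigidCategory X] [UnitaryFusionCategory X]
  {Φ : Enrichment A X} {N P Q : ℕ} {p q : Plaq P Q}
  {V : Type*} [AddCommGroup V] [Module ℂ V]

open LoopTerm

lemma LoopTerm.sum_eq_sum (G : LoopTerm X → V) : ∑ θ, G θ =
    ∑ r, ∑ e : EdgeL X r, ∑ q : EdgeL X r, ∑ f : EdgeR X r, ∑ o : EdgeR X r,
      G ⟨r, e, q, f, o⟩ :=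
  (Fintype.sum_sigma _).trans <| Finset.sum_congr rfl fun _ _ =>
    (Fintype.sum_prod_type _).trans <| Finset.sum_congr rfl fun _ _ =>
    (Fintype.sum_prod_type _).trans <| Finset.sum_congr rfl fun _ _ => Fintype.sum_prod_type _

lemma LoopTerm.sum_sum_eq_sum (G : LoopTerm X → LoopTerm X → V) : ∑ θ, ∑ θ', G θ θ' =
    ∑ r, ∑ e : EdgeL X r, ∑ q : EdgeL X r, ∑ f : EdgeR X r, ∑ o : EdgeR X r,
    ∑ r', ∑ e' : EdgeL X r', ∑ q' : EdgeL X r', ∑ f' : EdgeR X r', ∑ o' : EdgeR X r',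
      G ⟨r, e, q, f, o⟩ ⟨r', e', q', f', o'⟩ :=
  (LoopTerm.sum_eq_sum _).trans <| Finset.sum_congr rfl fun _ _ =>
    Finset.sum_congr rfl fun _ _ => Finset.sum_congr rfl fun _ _ => Finset.sum_congr rfl fun _ _ =>
    Finset.sum_congr rfl fun _ _ => LoopTerm.sum_eq_sum _

/-- The double sum is reordered so that the nodes on the shared edge, the right edge of the first
loop and the left edge of the second, are summed innermost; all other nodes are spectators. -/
lemma sum_weight_congr_right (T T' : LoopTerm X → LoopTerm X → V)
    (h : ∀ r e f o r' e' q' f', ∑ q : EdgeL X r, ∑ o' : EdgeR X r',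
        (edgeWeight q.1.1 q.1.2 * edgeWeight o'.1.1 o'.1.2) •
          T ⟨r, e, q, f, o⟩ ⟨r', e', q', f', o'⟩ =
      ∑ q : EdgeL X r, ∑ o' : EdgeR X r',
        (edgeWeight q.1.1 q.1.2 * edgeWeight o'.1.1 o'.1.2) •
          T' ⟨r, e, q, f, o⟩ ⟨r', e', q', f', o'⟩) :
    ∑ θ, ∑ θ', (θ.weight * θ'.weight) • T θ θ' = ∑ θ, ∑ θ', (θ.weight * θ'.weight) • T' θ θ' := by
  have key : ∀ T : LoopTerm X → LoopTerm X → V, ∑ θ, ∑ θ', (θ.weight * θ'.weight) • T θ θ' =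
      ∑ r, ∑ e : EdgeL X r, ∑ f : EdgeR X r, ∑ o : EdgeR X r, ∑ r', ∑ e' : EdgeL X r',
      ∑ q' : EdgeL X r', ∑ f' : EdgeR X r',
      (((1 / globalDim X * (1 / r.d) : ℝ) : ℂ) * (edgeWeight e.1.1 e.1.2 *
        edgeWeight f.1.1 f.1.2 * edgeWeight o.1.1 o.1.2) *
        (((1 / globalDim X * (1 / r'.d) : ℝ) : ℂ) * (edgeWeight e'.1.1 e'.1.2 *
        edgeWeight q'.1.1 q'.1.2 * edgeWeight f'.1.1 f'.1.2))) •
      ∑ q : EdgeL X r, ∑ o' : EdgeR X r', (edgeWeight q.1.1 q.1.2 * edgeWeight o'.1.1 o'.1.2) •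
          T ⟨r, e, q, f, o⟩ ⟨r', e', q', f', o'⟩ := by
    intro T
    refine (LoopTerm.sum_sum_eq_sum _).trans ?_
    refine Finset.sum_congr rfl fun r _ => Finset.sum_congr rfl fun e _ =>
      Finset.sum_comm.trans <| Finset.sum_congr rfl fun f _ =>
      Finset.sum_comm.trans <| Finset.sum_congr rfl fun o _ =>
      Finset.sum_comm.trans <| Finset.sum_congr rfl fun r' _ =>
      Finset.sum_comm.trans <| Finset.sum_congr rfl fun e' _ =>
      Finset.sum_comm.trans <| Finset.sum_congr rfl fun q' _ =>
      Finset.sum_comm.trans <| Finset.sum_congr rfl fun f' _ => ?_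
    rw [Finset.smul_sum]
    refine Finset.sum_congr rfl fun q _ => ?_
    rw [Finset.smul_sum]
    refine Finset.sum_congr rfl fun o' _ => ?_
    rw [smul_smul]
    congr 1
    dsimp only [weight]
    ring
  rw [key T, key T']
  exact Finset.sum_congr rfl fun r _ => Finset.sum_congr rfl fun e _ =>
    Finset.sum_congr rfl fun f _ => Finset.sum_congr rfl fun o _ =>
    Finset.sum_congr rfl fun r' _ => Finset.sum_congr rfl fun e' _ =>
    Finset.sum_congr rfl fun q' _ => Finset.sum_congr rfl fun f' _ =>
    congrArg _ (h r e f o r' e' q' f')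

lemma sum_weight_congr_up (T T' : LoopTerm X → LoopTerm X → V)
    (h : ∀ r e q o r' q' f' o', ∑ f : EdgeR X r, ∑ e' : EdgeL X r',
        (edgeWeight f.1.1 f.1.2 * edgeWeight e'.1.1 e'.1.2) •
          T ⟨r, e, q, f, o⟩ ⟨r', e', q', f', o'⟩ =
      ∑ f : EdgeR X r, ∑ e' : EdgeL X r',
        (edgeWeight f.1.1 f.1.2 * edgeWeight e'.1.1 e'.1.2) •
          T' ⟨r, e, q, f, o⟩ ⟨r', e', q', f', o'⟩) :
    ∑ θ, ∑ θ', (θ.weight * θ'.weight) • T θ θ' = ∑ θ, ∑ θ', (θ.weight * θ'.weight) • T' θ θ' := by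
  have key : ∀ T : LoopTerm X → LoopTerm X → V, ∑ θ, ∑ θ', (θ.weight * θ'.weight) • T θ θ' =
      ∑ r, ∑ e : EdgeL X r, ∑ q : EdgeL X r, ∑ o : EdgeR X r, ∑ r',
      ∑ q' : EdgeL X r', ∑ f' : EdgeR X r', ∑ o' : EdgeR X r',
      (((1 / globalDim X * (1 / r.d) : ℝ) : ℂ) * (edgeWeight e.1.1 e.1.2 *
        edgeWeight q.1.1 q.1.2 * edgeWeight o.1.1 o.1.2) *
        (((1 / globalDim X * (1 / r'.d) : ℝ) : ℂ) * (edgeWeight q'.1.1 q'.1.2 *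
        edgeWeight f'.1.1 f'.1.2 * edgeWeight o'.1.1 o'.1.2))) •
      ∑ f : EdgeR X r, ∑ e' : EdgeL X r', (edgeWeight f.1.1 f.1.2 * edgeWeight e'.1.1 e'.1.2) •
          T ⟨r, e, q, f, o⟩ ⟨r', e', q', f', o'⟩ := by
    intro T
    refine (LoopTerm.sum_sum_eq_sum _).trans ?_
    refine Finset.sum_congr rfl fun r _ => Finset.sum_congr rfl fun e _ =>
      Finset.sum_congr rfl fun q _ =>
      Finset.sum_comm.trans <| Finset.sum_congr rfl fun o _ =>
      Finset.sum_comm.trans <| Finset.sum_congr rfl fun r' _ => Eq.trans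
      (Finset.sum_congr rfl fun f _ =>
        Finset.sum_comm.trans <| Finset.sum_congr rfl fun q' _ =>
        Finset.sum_comm.trans <| Finset.sum_congr rfl fun f' _ =>
        Finset.sum_comm) <|
      Finset.sum_comm.trans <| Finset.sum_congr rfl fun q' _ =>
      Finset.sum_comm.trans <| Finset.sum_congr rfl fun f' _ =>
      Finset.sum_comm.trans <| Finset.sum_congr rfl fun o' _ => ?_
    rw [Finset.smul_sum]
    refine Finset.sum_congr rfl fun q _ => ?_
    rw [Finset.smul_sum]
    refine Finset.sum_congr rfl fun o' _ => ?_
    rw [smul_smul]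
    congr 1
    dsimp only [weight]
    ring
  rw [key T, key T']
  exact Finset.sum_congr rfl fun r _ => Finset.sum_congr rfl fun e _ =>
    Finset.sum_congr rfl fun q _ => Finset.sum_congr rfl fun o _ =>
    Finset.sum_congr rfl fun r' _ => Finset.sum_congr rfl fun q' _ =>
    Finset.sum_congr rfl fun f' _ => Finset.sum_congr rfl fun o' _ =>
    congrArg _ (h r e q o r' q' f' o')

variable (Φ p) in
/-- The operator of a loop in the plaquette `p` at the vertex `v`. -/
def cornerOp (θ : LoopTerm X) (v : BSite P Q) : HX Φ →ₗ[ℂ] HX Φ :=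
  if v = p.c₁₁ then θ.op₁₁ Φ else if v = p.c₂₁ then θ.op₂₁ Φ else
    if v = p.c₁₂ then θ.op₁₂ Φ else if v = p.c₂₂ then θ.op₂₂ Φ else LinearMap.id

section CornerOp

variable (θ : LoopTerm X)

variable (p) in
@[simp] lemma cornerOp_c₁₁ : cornerOp Φ p θ p.c₁₁ = θ.op₁₁ Φ := by simp [cornerOp]
variable (p) in
@[simp] lemma cornerOp_c₂₁ : cornerOp Φ p θ p.c₂₁ = θ.op₂₁ Φ := by
  simp [cornerOp, p.c₁₁_ne_c₂₁.symm]
variable (p) in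
@[simp] lemma cornerOp_c₁₂ : cornerOp Φ p θ p.c₁₂ = θ.op₁₂ Φ := by
  simp [cornerOp, p.c₁₁_ne_c₁₂.symm, p.c₂₁_ne_c₁₂.symm]
variable (p) in
@[simp] lemma cornerOp_c₂₂ : cornerOp Φ p θ p.c₂₂ = θ.op₂₂ Φ := by
  simp [cornerOp, p.c₁₁_ne_c₂₂.symm, p.c₂₁_ne_c₂₂.symm, p.c₁₂_ne_c₂₂.symm]

lemma cornerOp_of_not_isCorner {v : BSite P Q} (hv : ¬ p.IsCorner v) :
    cornerOp Φ p θ v = LinearMap.id := by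
  simp only [Plaq.IsCorner, not_or] at hv
  simp [cornerOp, hv]

end CornerOp

lemma plaquetteX_comp_plaquetteX : plaquetteX Φ p ∘ₗ plaquetteX Φ q =
    ∑ θ : LoopTerm X, ∑ θ' : LoopTerm X, (θ.weight * θ'.weight) •
      PiHilbert.map fun v => cornerOp Φ p θ v ∘ₗ cornerOp Φ q θ' v := by
  refine (sum_smul_comp_sum_smul _ _ _ _).trans ?_
  exact Finset.sum_congr rfl fun θ _ => Finset.sum_congr rfl fun θ' _ => congrArg _
    (PiHilbert.map_comp_map _ _)

lemma plaquetteX_comp_comm_of_pointwise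
    (h : ∀ (θ θ' : LoopTerm X) v, cornerOp Φ p θ v ∘ₗ cornerOp Φ q θ' v =
      cornerOp Φ q θ' v ∘ₗ cornerOp Φ p θ v) :
    plaquetteX Φ p ∘ₗ plaquetteX Φ q = plaquetteX Φ q ∘ₗ plaquetteX Φ p := by
  rw [plaquetteX_comp_plaquetteX, plaquetteX_comp_plaquetteX, Finset.sum_comm]
  refine Finset.sum_congr rfl fun θ' _ => Finset.sum_congr rfl fun θ _ => ?_
  rw [mul_comm]
  exact congrArg _ (congrArg _ (funext (h θ θ')))

lemma plaquetteX_comp_apply (F : BSite P Q → HX Φ) :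
    (plaquetteX Φ p ∘ₗ plaquetteX Φ q) (PiHilbert.tprod F) =
    ∑ θ : LoopTerm X, ∑ θ' : LoopTerm X, (θ.weight * θ'.weight) •
      PiHilbert.tprod fun v => cornerOp Φ p θ v (cornerOp Φ q θ' v (F v)) := by
  rw [plaquetteX_comp_plaquetteX, LinearMap.sum_apply]
  refine Finset.sum_congr rfl fun θ _ => (sum_smul_apply _ _ _).trans ?_
  exact Finset.sum_congr rfl fun θ' _ => congrArg _ (PiHilbert.map_tprod _ _)

/-- A pointwise defined function in terms of its values at two points. -/
lemma eq_update_update {S H : Type*} [DecidableEq S] {G K : S → H} {v w : S}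
    (h : ∀ x, x ≠ v → x ≠ w → G x = K x) :
    G = Function.update (Function.update K v (G v)) w (G w) := by
  ext x
  by_cases h1 : x = w
  · subst h1; rw [Function.update_self]
  · rw [Function.update_of_ne h1]
    by_cases h2 : x = v
    · subst h2; rw [Function.update_self]
    · rw [Function.update_of_ne h2, h x h2 h1]

/-- Only at the two ends of the common edge do both loops act; there the sum over the nodes on that
edge is handled by `sum_right_swap`. -/
lemma plaquetteX_comp_comm_right (h₁ : p.c₂₁ = q.c₁₁) (h₂ : p.c₂₂ = q.c₁₂) :
    plaquetteX Φ p ∘ₗ plaquetteX Φ q = plaquetteX Φ q ∘ₗ plaquetteX Φ p := by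
  have hne : ∀ v, v ≠ p.c₂₁ → v ≠ p.c₂₂ → p.IsCorner v → q.IsCorner v → False := by
    intro v hv1 hv2 hp hq
    rcases hp with rfl | rfl | rfl | rfl <;> rcases hq with hq | hq | hq | hq <;>
      simp only [Plaq.c₁₁, Plaq.c₂₁, Plaq.c₁₂, Plaq.c₂₂, ne_eq, Prod.ext_iff,
        Fin.ext_iff, Fin.val_succ, Fin.val_castSucc, not_true] at hq h₁ h₂ hv1 hv2 <;> omega
  refine PiHilbert.linearMap_ext fun F => ?_
  rw [plaquetteX_comp_apply, plaquetteX_comp_apply]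
  refine Eq.trans (sum_weight_congr_right _ (fun θ θ' => PiHilbert.tprod fun v =>
    cornerOp Φ q θ' v (cornerOp Φ p θ v (F v))) fun r e f o r' e' q' f' => ?_) ?_
  -- The factors away from the common edge. They involve at most one loop each, so they depend
  -- neither on the order nor on the two shared nodes.
  · let K : BSite P Q → HX Φ := fun v => if v = p.c₁₁ then corner₁₁ Φ o.2 e.2 (F v) else
      if v = p.c₁₂ then corner₁₂ Φ o.2 f.2 (F v) else
      if v = q.c₂₁ then corner₂₁ Φ e'.2 q'.2 (F v) else
      if v = q.c₂₂ then corner₂₂ Φ f'.2 q'.2 (F v) else F v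
    have hK : ∀ (q₀ : EdgeL X r) (o' : EdgeR X r') v, v ≠ p.c₂₁ → v ≠ p.c₂₂ →
        cornerOp Φ p ⟨r, e, q₀, f, o⟩ v (cornerOp Φ q ⟨r', e', q', f', o'⟩ v (F v)) = K v ∧
        cornerOp Φ q ⟨r', e', q', f', o'⟩ v (cornerOp Φ p ⟨r, e, q₀, f, o⟩ v (F v)) = K v := by
      intro q₀ o' v hv1 hv2
      have hv3 : v ≠ q.c₁₁ := h₁ ▸ hv1
      have hv4 : v ≠ q.c₁₂ := h₂ ▸ hv2
      by_cases hp : p.IsCorner v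
      · have hq := fun hq => hne v hv1 hv2 hp hq
        rw [cornerOp_of_not_isCorner _ hq, LinearMap.id_apply, LinearMap.id_apply, and_self]
        simp only [cornerOp, K, if_neg hv1, if_neg hv2]
        rcases hp with hp | hp | hp | hp
        · simp only [if_pos hp]; rfl
        · exact absurd hp hv1
        · have : v ≠ p.c₁₁ := hp ▸ p.c₁₁_ne_c₁₂.symm
          simp only [if_neg this, if_pos hp]; rfl
        · exact absurd hp hv2
      · rw [cornerOp_of_not_isCorner _ hp, LinearMap.id_apply, LinearMap.id_apply, and_self]
        simp only [Plaq.IsCorner, not_or] at hp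
        simp only [cornerOp, K, if_neg hv3, if_neg hv4, if_neg hp.1, if_neg hp.2.2.1]
        split_ifs <;> rfl
    have := sum_right_swap (PiHilbert.tprod₂ K p.c₂₁_ne_c₂₂) e.2 f.2 e'.2 f'.2 (F p.c₂₁) (F p.c₂₂)
    refine Eq.trans (Eq.trans ?_ this) ?_
    · refine Finset.sum_congr rfl fun q₀ _ => Finset.sum_congr rfl fun o' _ => congrArg _ ?_
      rw [eq_update_update (K := K) fun v hv1 hv2 => (hK q₀ o' v hv1 hv2).1, PiHilbert.tprod₂_apply,
        cornerOp_c₂₁, cornerOp_c₂₂]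
      rw [h₁, h₂, cornerOp_c₁₁, cornerOp_c₁₂]
      rfl
    · refine Finset.sum_congr rfl fun q₀ _ => Finset.sum_congr rfl fun o' _ => congrArg _ ?_
      rw [eq_update_update (K := K) fun v hv1 hv2 => (hK q₀ o' v hv1 hv2).2, PiHilbert.tprod₂_apply,
        cornerOp_c₂₁, cornerOp_c₂₂]
      rw [h₁, h₂, cornerOp_c₁₁, cornerOp_c₁₂]
      rfl
  · rw [Finset.sum_comm]
    exact Finset.sum_congr rfl fun θ' _ => Finset.sum_congr rfl fun θ _ => by rw [mul_comm]

lemma plaquetteX_comp_comm_up (h₁ : p.c₁₂ = q.c₁₁) (h₂ : p.c₂₂ = q.c₂₁) :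
    plaquetteX Φ p ∘ₗ plaquetteX Φ q = plaquetteX Φ q ∘ₗ plaquetteX Φ p := by
  have hne : ∀ v, v ≠ p.c₁₂ → v ≠ p.c₂₂ → p.IsCorner v → q.IsCorner v → False := by
    intro v hv1 hv2 hp hq
    rcases hp with rfl | rfl | rfl | rfl <;> rcases hq with hq | hq | hq | hq <;>
      simp only [Plaq.c₁₁, Plaq.c₂₁, Plaq.c₁₂, Plaq.c₂₂, ne_eq, Prod.ext_iff,
        Fin.ext_iff, Fin.val_succ, Fin.val_castSucc, not_true] at hq h₁ h₂ hv1 hv2 <;> omega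
  refine PiHilbert.linearMap_ext fun F => ?_
  rw [plaquetteX_comp_apply, plaquetteX_comp_apply]
  refine Eq.trans (sum_weight_congr_up _ (fun θ θ' => PiHilbert.tprod fun v =>
    cornerOp Φ q θ' v (cornerOp Φ p θ v (F v))) fun r e q₁ o r' q' f' o' => ?_) ?_
  · let K : BSite P Q → HX Φ := fun v => if v = p.c₁₁ then corner₁₁ Φ o.2 e.2 (F v) else
      if v = p.c₂₁ then corner₂₁ Φ e.2 q₁.2 (F v) else
      if v = q.c₁₂ then corner₁₂ Φ o'.2 f'.2 (F v) else
      if v = q.c₂₂ then corner₂₂ Φ f'.2 q'.2 (F v) else F v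
    have hK : ∀ (f : EdgeR X r) (e' : EdgeL X r') v, v ≠ p.c₁₂ → v ≠ p.c₂₂ →
        cornerOp Φ p ⟨r, e, q₁, f, o⟩ v (cornerOp Φ q ⟨r', e', q', f', o'⟩ v (F v)) = K v ∧
        cornerOp Φ q ⟨r', e', q', f', o'⟩ v (cornerOp Φ p ⟨r, e, q₁, f, o⟩ v (F v)) = K v := by
      intro f e' v hv1 hv2
      have hv3 : v ≠ q.c₁₁ := h₁ ▸ hv1
      have hv4 : v ≠ q.c₂₁ := h₂ ▸ hv2
      by_cases hp : p.IsCorner v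
      · have hq := fun hq => hne v hv1 hv2 hp hq
        rw [cornerOp_of_not_isCorner _ hq, LinearMap.id_apply, LinearMap.id_apply, and_self]
        simp only [cornerOp, K, if_neg hv1, if_neg hv2]
        rcases hp with hp | hp | hp | hp
        · simp only [if_pos hp]; rfl
        · have : v ≠ p.c₁₁ := hp ▸ p.c₁₁_ne_c₂₁.symm
          simp only [if_neg this, if_pos hp]; rfl
        · exact absurd hp hv1
        · exact absurd hp hv2
      · rw [cornerOp_of_not_isCorner _ hp, LinearMap.id_apply, LinearMap.id_apply, and_self]
        simp only [Plaq.IsCorner, not_or] at hp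
        simp only [cornerOp, K, if_neg hv3, if_neg hv4, if_neg hp.1, if_neg hp.2.1]
        split_ifs <;> rfl
    have := sum_up_swap (PiHilbert.tprod₂ K p.c₁₂_ne_c₂₂) o.2 q₁.2 o'.2 q'.2 (F p.c₁₂) (F p.c₂₂)
    refine Eq.trans (Eq.trans ?_ this) ?_
    · refine Finset.sum_congr rfl fun f _ => Finset.sum_congr rfl fun e' _ => congrArg _ ?_
      rw [eq_update_update (K := K) fun v hv1 hv2 => (hK f e' v hv1 hv2).1, PiHilbert.tprod₂_apply,
        cornerOp_c₁₂, cornerOp_c₂₂]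
      rw [h₁, h₂, cornerOp_c₁₁, cornerOp_c₂₁]
      rfl
    · refine Finset.sum_congr rfl fun f _ => Finset.sum_congr rfl fun e' _ => congrArg _ ?_
      rw [eq_update_update (K := K) fun v hv1 hv2 => (hK f e' v hv1 hv2).2, PiHilbert.tprod₂_apply,
        cornerOp_c₁₂, cornerOp_c₂₂]
      rw [h₁, h₂, cornerOp_c₁₁, cornerOp_c₂₁]
      rfl
  · rw [Finset.sum_comm]
    exact Finset.sum_congr rfl fun θ' _ => Finset.sum_congr rfl fun θ _ => by rw [mul_comm]

set_option maxHeartbeats 1600000 in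
-- The sixteen ways in which a vertex can be a corner of both plaquettes; each is decided by
-- comparing coordinates.
lemma Plaq.eq_or_adjacent_or_opposite {v : BSite P Q} (hp : p.IsCorner v) (hq : q.IsCorner v) :
    p = q ∨ (p.c₂₁ = q.c₁₁ ∧ p.c₂₂ = q.c₁₂) ∨ (q.c₂₁ = p.c₁₁ ∧ q.c₂₂ = p.c₁₂) ∨
      (p.c₁₂ = q.c₁₁ ∧ p.c₂₂ = q.c₂₁) ∨ (q.c₁₂ = p.c₁₁ ∧ q.c₂₂ = p.c₂₁) ∨
      (v = p.c₁₁ ∧ v = q.c₂₂) ∨ (v = p.c₂₂ ∧ v = q.c₁₁) ∨ (v = p.c₁₂ ∧ v = q.c₂₁) ∨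
      (v = p.c₂₁ ∧ v = q.c₁₂) := by
  rcases hp with rfl | rfl | rfl | rfl <;> rcases hq with hq | hq | hq | hq <;>
    simp only [Plaq.c₁₁, Plaq.c₂₁, Plaq.c₁₂, Plaq.c₂₂, Prod.ext_iff,
      Fin.ext_iff, Fin.val_succ, Fin.val_castSucc, true_and, and_true] at hq ⊢ <;> omega

variable (Φ p q) in
-- Distinct plaquettes without a common edge share at most a vertex at which they are diagonally
-- opposite, and there the corner operators commute individually. Edge neighbours need the summed
-- recoupling identity.
lemma plaquetteX_comp_comm :
    plaquetteX Φ p ∘ₗ plaquetteX Φ q = plaquetteX Φ q ∘ₗ plaquetteX Φ p := by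
  by_cases hpq : p = q
  · rw [hpq]
  by_cases hr : p.c₂₁ = q.c₁₁ ∧ p.c₂₂ = q.c₁₂
  · exact plaquetteX_comp_comm_right hr.1 hr.2
  by_cases hl : q.c₂₁ = p.c₁₁ ∧ q.c₂₂ = p.c₁₂
  · exact (plaquetteX_comp_comm_right hl.1 hl.2).symm
  by_cases hu : p.c₁₂ = q.c₁₁ ∧ p.c₂₂ = q.c₂₁
  · exact plaquetteX_comp_comm_up hu.1 hu.2
  by_cases hd : q.c₁₂ = p.c₁₁ ∧ q.c₂₂ = p.c₂₁
  · exact (plaquetteX_comp_comm_up hd.1 hd.2).symm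
  refine plaquetteX_comp_comm_of_pointwise fun θ θ' v => ?_
  by_cases hp : p.IsCorner v
  · by_cases hq : q.IsCorner v
    · have hv := ((((Plaq.eq_or_adjacent_or_opposite hp hq).resolve_left hpq).resolve_left
        hr).resolve_left hl |>.resolve_left hu).resolve_left hd
      rcases hv with ⟨h1, h2⟩ | ⟨h1, h2⟩ | ⟨h1, h2⟩ | ⟨h1, h2⟩
      · rw [show cornerOp Φ p θ v = θ.op₁₁ Φ by rw [h1, cornerOp_c₁₁],
          show cornerOp Φ q θ' v = θ'.op₂₂ Φ by rw [h2, cornerOp_c₂₂]]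
        exact (corner₂₂_comp_corner₁₁ _ _ _ _).symm
      · rw [show cornerOp Φ p θ v = θ.op₂₂ Φ by rw [h1, cornerOp_c₂₂],
          show cornerOp Φ q θ' v = θ'.op₁₁ Φ by rw [h2, cornerOp_c₁₁]]
        exact corner₂₂_comp_corner₁₁ _ _ _ _
      · rw [show cornerOp Φ p θ v = θ.op₁₂ Φ by rw [h1, cornerOp_c₁₂],
          show cornerOp Φ q θ' v = θ'.op₂₁ Φ by rw [h2, cornerOp_c₂₁]]
        exact (corner₂₁_comp_corner₁₂ _ _ _ _).symm
      · rw [show cornerOp Φ p θ v = θ.op₂₁ Φ by rw [h1, cornerOp_c₂₁],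
          show cornerOp Φ q θ' v = θ'.op₁₂ Φ by rw [h2, cornerOp_c₁₂]]
        exact corner₂₁_comp_corner₁₂ _ _ _ _
    · rw [cornerOp_of_not_isCorner _ hq, LinearMap.comp_id, LinearMap.id_comp]
  · rw [cornerOp_of_not_isCorner _ hp, LinearMap.comp_id, LinearMap.id_comp]

variable (Φ N p q) in
lemma plaquetteOp_comp_comm : plaquetteOp Φ N p ∘ₗ plaquetteOp Φ N q =
    plaquetteOp Φ N q ∘ₗ plaquetteOp Φ N p := by
  rw [plaquetteOp_eq, plaquetteOp_eq, ← TensorProduct.map_comp, ← TensorProduct.map_comp,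
    plaquetteX_comp_comm]

end Commute
end EnrichedStringNet

end

theorem mainTheorem4
    {A : Type u₁} [Category.{v₁} A] [Abelian A] [Linear ℂ A] [MonoidalCategory A]
    [MonoidalPreadditive A] [MonoidalLinear ℂ A] [RightRigidCategory A]
    [UnitaryFusionCategory A] [BraidedCategory A]
    [UnitaryBraided A]
    {X : Type u₂} [Category.{v₂} X] [Abelian X] [Linear ℂ X] [MonoidalCategory X]
    [MonoidalPreadditive X] [MonoidalLinear ℂ X] [RightRigidCategory X]
    [UnitaryFusionCategory X]
    (Φ : Enrichment A X) (N P Q : ℕ)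
    {ιA : ALabel A → Type w₁} [∀ L, Fintype (ιA L)]
    {ιX : XLabel A X → Type w₂} [∀ L, Fintype (ιX L)]
    (bA : ∀ L, OrthonormalBasis (ιA L) ℂ (AHom L))
    (bX : ∀ L, OrthonormalBasis (ιX L) ℂ (XHom Φ L)) :
    (∀ (p : Plaq P Q) (ξ : State ιA ιX N P Q), ξ.Matched →
      plaquetteOp Φ N p (ket bA bX ξ) =
        ∑ η : State ιA ιX N P Q with η.Matched,
          matrixCoeff bA bX p ξ η • ket bA bX η) ∧
    (∀ (p : Plaq P Q) (ξ η : State ιA ιX N P Q),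
      ξ.Matched → η.Matched → ξ.AgreeOff p η → ξ.ExternalMatch p η →
        matrixCoeff bA bX p ξ η =
          (coeffConst p ξ : ℂ) * skeinPairing bX p ξ η ∧
        matrixCoeff bA bX p ξ η =
          (coeffConst p ξ : ℂ) * planarDiagram bX p ξ η) ∧
    (∀ (p : Plaq P Q) (ξ η : State ιA ιX N P Q),
      ξ.Matched → η.Matched → ¬ (ξ.AgreeOff p η ∧ ξ.ExternalMatch p η) →
        matrixCoeff bA bX p ξ η = 0) ∧
    (∃ hB : ∀ p : Plaq P Q,
        ∀ ψ ∈ edgeGroundSpace Φ N P Q,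
          plaquetteOp Φ N p ψ ∈ edgeGroundSpace Φ N P Q,
      (∀ p, LinearMap.IsSymmetricProjection (𝕜 := ℂ) (E := edgeGroundSpace Φ N P Q)
        ((plaquetteOp Φ N p).restrict (hB p))) ∧
      ∀ p q, Commute ((plaquetteOp Φ N p).restrict (hB p))
        ((plaquetteOp Φ N q).restrict (hB q))) := by
  refine ⟨fun p ξ hξ => plaquetteOp_ket p bA bX ξ hξ, fun p ξ η hξ hη hoff hE => ?_,
    fun p ξ η hξ hη hne => ?_, fun p ψ hψ => plaquetteOp_mem ψ hψ, fun p => ⟨?_, ?_⟩,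
    fun p q => ?_⟩
  · rw [matrixCoeff_eq_cornerCoeff bA bX hoff]
    exact ⟨localCoeff_eq_skein _ _ _ _ _ _ _ _ (State.loopLabels_of_matched hξ hη hE),
      localCoeff_eq_planar _ _ _ _ _ _ _ _ (State.loopLabels_of_matched hξ hη hE)⟩
  · by_contra h0
    obtain ⟨hoff, g, h, i, j, k, l, m, n, H⟩ := matrixCoeff_ne_zero bA bX h0
    exact hne ⟨hoff, H.externalMatch⟩
  -- Idempotence, symmetry and commutation already hold on all of `H_tot` and pass to the invariant
  -- subspace.
  · exact LinearMap.ext fun ψ => Subtype.ext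
      (LinearMap.congr_fun (plaquetteOp_comp_self Φ N p) ψ.1)
  · exact (isSymmetric_plaquetteOp Φ N p).restrict_invariant _
  · exact LinearMap.ext fun ψ => Subtype.ext
      (LinearMap.congr_fun (plaquetteOp_comp_comm Φ N p q) ψ.1)
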